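/- A geometric graph $P=(V,E)$ is a finite simple graph with $V\neq\emptyset$ whose vertices are distinct points of $\mathbb{R}^2$ and whose edges are straight-line segments (possibly crossing), weighted by their Euclidean lengths; $n=|V|+|E|$, and $d_P$ is the shortest-path distance in $P$. For $t\ge 1$, $P$ is a $t$-spanner if $d_P(u,v)\le t\,\lVert u-v\rVert$ for all $u,v\in V$. The model of computation is the deterministic real RAM with square roots, without rounding of reals to integers, and with integers of $O(\log n)$ bits; every operation takes unit time and space is counted in memory cells. There is an algorithm (one fixed preprocessing program and one fixed query program) with the following property. Let $P=(V,E)$ be a $t$-spanner and let $0\le\varepsilon\le 1$. Given $P$ and $\varepsilon$ (but not $t$), in $O(n^2\log(n+1))$ time and using $O(n\log(n+1))$ space, one can construct a data structure that answers any sequence of the following queries within the same space: for a query square $S$ in the plane (closed, of arbitrary orientation) with side length $2r>0$, it returns a set of vertices $T\subseteq V$ such that 1. $|T|=O((t/\varepsilon)^2)$, and 2. for every $v\in V\cap S$ there is $z\in T$ with $d_P(v,z)\le\varepsilon r$, and each query takes $O(\log(n+1)+(t/\varepsilon)^2)$ time. All constants hidden in the $O$-notation are absolute: they depend on none of $P$,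 $n$, $t$, $\varepsilon$, $S$. For $\varepsilon=0$ the quantity $(t/\varepsilon)^2$ is read as $\infty$, so that property 1 and the bound on the query time are void, while all other claims remain. -/

import Mathlib

/-! ## Geometric graphs -/

/-- A geometric graph: a finite simple graph whose vertices are distinct points of the Euclidean
plane; the edges are straight-line segments, which may cross each other. -/
structure GeometricGraph where
  numVertices : ℕ
  graph : SimpleGraph (Fin numVertices)
  pos : Fin numVertices → EuclideanSpace ℝ (Fin 2)
  pos_injective : Function.Injective pos

namespace GeometricGraph

/-- The complexity `n = |V| + |E|`. -/
noncomputable def complexity (P : GeometricGraph) : ℕ :=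
  P.numVertices + P.graph.edgeSet.ncard

/-- The length of a walk: the sum of the Euclidean lengths of the edges it traverses. -/
noncomputable def walkLength (P : GeometricGraph) {u v : Fin P.numVertices}
    (w : P.graph.Walk u v) : ℝ :=
  (w.darts.map fun d => dist (P.pos d.fst) (P.pos d.snd)).sum

/-- The shortest-path distance `d_P(u, v)`; it is `∞` if `v` cannot be reached from `u`. -/
noncomputable def graphDist (P : GeometricGraph) (u v : Fin P.numVertices) : ENNReal :=
  ⨅ w : P.graph.Walk u v, ENNReal.ofReal (P.walkLength w)

/-- `P` is a `t`-spanner: `d_P(u, v) ≤ t * ‖u - v‖` for all vertices `u`, `v`. -/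
def IsSpanner (P : GeometricGraph) (t : ℝ) : Prop :=
  ∀ u v : Fin P.numVertices,
    P.graphDist u v ≤ ENNReal.ofReal (t * dist (P.pos u) (P.pos v))

/-- `es` lists every edge of `P` exactly once, in some order and in some orientation. -/
def IsEdgeList (P : GeometricGraph) (es : List (Fin P.numVertices × Fin P.numVertices)) : Prop :=
  (es.map fun e => s(e.1, e.2)).Nodup ∧
    ∀ e : Sym2 (Fin P.numVertices), e ∈ (es.map fun e => s(e.1, e.2)) ↔ e ∈ P.graph.edgeSet

end GeometricGraph

/-- A square of positive side length in the plane, of arbitrary orientation, given by its centre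
and the vector from the centre to the midpoint of one of its sides. -/
structure PlaneSquare where
  centre : EuclideanSpace ℝ (Fin 2)
  half : EuclideanSpace ℝ (Fin 2)
  half_ne_zero : half ≠ 0

namespace PlaneSquare

/-- Half the side length: the side length is `2 * q.r`. -/
noncomputable def r (q : PlaneSquare) : ℝ := ‖q.half‖

/-- The points of the closed square: the combinations `centre + a • half + b • half'`, where
`half'` is `half` rotated by a right angle and `-1 ≤ a, b ≤ 1`. -/
def region (q : PlaneSquare) : Set (EuclideanSpace ℝ (Fin 2)) :=
  {x | ∃ a b : ℝ, |a| ≤ 1 ∧ |b| ≤ 1 ∧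
    x 0 = q.centre 0 + a * q.half 0 - b * q.half 1 ∧
    x 1 = q.centre 1 + a * q.half 1 + b * q.half 0}

end PlaneSquare

/-! ## The real RAM

The machine has finitely many integer registers and real registers (those that the program
mentions), an integer memory and a real memory of `S` cells each, and a write-only output list.
Integers are natural numbers of at most `W`. Programs are finite and are the same for all inputs;
every elementary operation costs one unit of time. There is no rounding of reals to integers. An
access outside of the memory or an integer overflow aborts the computation, that is, there is
no final state. -/

namespace RealRAM

structure State where
  nreg : ℕ → ℕ
  rreg : ℕ → ℝ
  nmem : ℕ → ℕ
  rmem : ℕ → ℝ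
  out : List ℕ

/-- Integer expressions. -/
inductive NExpr where
  | const (c : ℕ)
  | reg (i : ℕ)
  | load (a : NExpr)
  | add (a b : NExpr)
  | sub (a b : NExpr)
  | mul (a b : NExpr)
  | div (a b : NExpr)

/-- Real expressions. -/
inductive RExpr where
  | reg (i : ℕ)
  | load (a : NExpr)
  | ofNat (a : NExpr)
  | add (a b : RExpr)
  | sub (a b : RExpr)
  | mul (a b : RExpr)
  | div (a b : RExpr)
  | sqrt (a : RExpr)

/-- Tests. -/
inductive BExpr where
  | ltN (a b : NExpr)
  | ltR (a b : RExpr)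
  | not (a : BExpr)
  | and (a b : BExpr)

/-- Programs. -/
inductive Cmd where
  | skip
  | setN (i : ℕ) (e : NExpr)
  | setR (i : ℕ) (e : RExpr)
  | storeN (a : NExpr) (e : NExpr)
  | storeR (a : NExpr) (e : RExpr)
  | emit (e : NExpr)
  | seq (c d : Cmd)
  | ite (b : BExpr) (c d : Cmd)
  | loop (b : BExpr) (c : Cmd)

/-- The value of an expression (subtraction of integers is truncated, division of integers is
rounded down). -/
def NExpr.val (σ : State) : NExpr → ℕ
  | const c => c
  | reg i => σ.nreg i
  | load a => σ.nmem (a.val σ)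
  | add a b => a.val σ + b.val σ
  | sub a b => a.val σ - b.val σ
  | mul a b => a.val σ * b.val σ
  | div a b => a.val σ / b.val σ

/-- No overflow and no access outside of the memory happens during the evaluation. -/
def NExpr.Safe (S W : ℕ) (σ : State) : NExpr → Prop
  | const c => c ≤ W
  | reg _ => True
  | load a => a.Safe S W σ ∧ a.val σ < S
  | add a b => a.Safe S W σ ∧ b.Safe S W σ ∧ a.val σ + b.val σ ≤ W
  | sub a b => a.Safe S W σ ∧ b.Safe S W σ
  | mul a b => a.Safe S W σ ∧ b.Safe S W σ ∧ a.val σ * b.val σ ≤ W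
  | div a b => a.Safe S W σ ∧ b.Safe S W σ

/-- The number of elementary operations of the evaluation. -/
def NExpr.cost : NExpr → ℕ
  | const _ => 1
  | reg _ => 1
  | load a => a.cost + 1
  | add a b => a.cost + b.cost + 1
  | sub a b => a.cost + b.cost + 1
  | mul a b => a.cost + b.cost + 1
  | div a b => a.cost + b.cost + 1

noncomputable def RExpr.val (σ : State) : RExpr → ℝ
  | reg i => σ.rreg i
  | load a => σ.rmem (a.val σ)
  | ofNat a => (a.val σ : ℝ)
  | add a b => a.val σ + b.val σ
  | sub a b => a.val σ - b.val σ
  | mul a b => a.val σ * b.val σ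
  | div a b => a.val σ / b.val σ
  | sqrt a => Real.sqrt (a.val σ)

def RExpr.Safe (S W : ℕ) (σ : State) : RExpr → Prop
  | reg _ => True
  | load a => a.Safe S W σ ∧ a.val σ < S
  | ofNat a => a.Safe S W σ
  | add a b => a.Safe S W σ ∧ b.Safe S W σ
  | sub a b => a.Safe S W σ ∧ b.Safe S W σ
  | mul a b => a.Safe S W σ ∧ b.Safe S W σ
  | div a b => a.Safe S W σ ∧ b.Safe S W σ
  | sqrt a => a.Safe S W σ

def RExpr.cost : RExpr → ℕ
  | reg _ => 1
  | load a => a.cost + 1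
  | ofNat a => a.cost + 1
  | add a b => a.cost + b.cost + 1
  | sub a b => a.cost + b.cost + 1
  | mul a b => a.cost + b.cost + 1
  | div a b => a.cost + b.cost + 1
  | sqrt a => a.cost + 1

def BExpr.val (σ : State) : BExpr → Prop
  | ltN a b => a.val σ < b.val σ
  | ltR a b => a.val σ < b.val σ
  | not a => ¬ a.val σ
  | and a b => a.val σ ∧ b.val σ

/-- The second part of a conjunction is evaluated only if the first part is true. -/
def BExpr.Safe (S W : ℕ) (σ : State) : BExpr → Prop
  | ltN a b => a.Safe S W σ ∧ b.Safe S W σ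
  | ltR a b => a.Safe S W σ ∧ b.Safe S W σ
  | not a => a.Safe S W σ
  | and a b => a.Safe S W σ ∧ (a.val σ → b.Safe S W σ)

def BExpr.cost : BExpr → ℕ
  | ltN a b => a.cost + b.cost + 1
  | ltR a b => a.cost + b.cost + 1
  | not a => a.cost + 1
  | and a b => a.cost + b.cost + 1

/-- `Exec S W c σ σ' k`: on a machine with `S` cells per memory and integers of at most `W`, the
program `c`, started in the state `σ`, halts in the state `σ'` after `k` units of time. -/
inductive Exec (S W : ℕ) : Cmd → State → State → ℕ → Prop where
  | skip (σ : State) : Exec S W .skip σ σ 1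
  | setN (σ : State) (i : ℕ) (e : NExpr) (he : e.Safe S W σ) :
      Exec S W (.setN i e) σ { σ with nreg := Function.update σ.nreg i (e.val σ) } (e.cost + 1)
  | setR (σ : State) (i : ℕ) (e : RExpr) (he : e.Safe S W σ) :
      Exec S W (.setR i e) σ { σ with rreg := Function.update σ.rreg i (e.val σ) } (e.cost + 1)
  | storeN (σ : State) (a e : NExpr) (ha : a.Safe S W σ) (hS : a.val σ < S)
      (he : e.Safe S W σ) :
      Exec S W (.storeN a e) σ { σ with nmem := Function.update σ.nmem (a.val σ) (e.val σ) }
        (a.cost + e.cost + 1)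
  | storeR (σ : State) (a : NExpr) (e : RExpr) (ha : a.Safe S W σ) (hS : a.val σ < S)
      (he : e.Safe S W σ) :
      Exec S W (.storeR a e) σ { σ with rmem := Function.update σ.rmem (a.val σ) (e.val σ) }
        (a.cost + e.cost + 1)
  | emit (σ : State) (e : NExpr) (he : e.Safe S W σ) :
      Exec S W (.emit e) σ { σ with out := σ.out ++ [e.val σ] } (e.cost + 1)
  | seq {σ σ' σ'' : State} {c d : Cmd} {k l : ℕ} (hc : Exec S W c σ σ' k)
      (hd : Exec S W d σ' σ'' l) : Exec S W (.seq c d) σ σ'' (k + l)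
  | iteTrue {σ σ' : State} {b : BExpr} {c d : Cmd} {k : ℕ} (hS : b.Safe S W σ) (hb : b.val σ)
      (hc : Exec S W c σ σ' k) : Exec S W (.ite b c d) σ σ' (b.cost + 1 + k)
  | iteFalse {σ σ' : State} {b : BExpr} {c d : Cmd} {k : ℕ} (hS : b.Safe S W σ) (hb : ¬ b.val σ)
      (hd : Exec S W d σ σ' k) : Exec S W (.ite b c d) σ σ' (b.cost + 1 + k)
  | loopTrue {σ σ' σ'' : State} {b : BExpr} {c : Cmd} {k l : ℕ} (hS : b.Safe S W σ)
      (hb : b.val σ) (hc : Exec S W c σ σ' k) (hl : Exec S W (.loop b c) σ' σ'' l) :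
      Exec S W (.loop b c) σ σ'' (b.cost + 1 + k + l)
  | loopFalse {σ : State} {b : BExpr} {c : Cmd} (hS : b.Safe S W σ) (hb : ¬ b.val σ) :
      Exec S W (.loop b c) σ σ (b.cost + 1)

/-- The machine is deterministic. -/
theorem Exec.unique {S W : ℕ} {c : Cmd} {σ σ₁ σ₂ : State} {k₁ k₂ : ℕ}
    (h₁ : Exec S W c σ σ₁ k₁) (h₂ : Exec S W c σ σ₂ k₂) : σ₁ = σ₂ ∧ k₁ = k₂ := by
  induction h₁ generalizing σ₂ k₂ with
  | skip => cases h₂; exact ⟨rfl, rfl⟩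
  | setN => cases h₂; exact ⟨rfl, rfl⟩
  | setR => cases h₂; exact ⟨rfl, rfl⟩
  | storeN => cases h₂; exact ⟨rfl, rfl⟩
  | storeR => cases h₂; exact ⟨rfl, rfl⟩
  | emit => cases h₂; exact ⟨rfl, rfl⟩
  | seq _ _ ihc ihd =>
    cases h₂ with
    | seq hc hd =>
      obtain ⟨rfl, rfl⟩ := ihc hc
      obtain ⟨rfl, rfl⟩ := ihd hd
      exact ⟨rfl, rfl⟩
  | iteTrue _ hb _ ih =>
    cases h₂ with
    | iteTrue _ _ hc => obtain ⟨rfl, rfl⟩ := ih hc; exact ⟨rfl, rfl⟩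
    | iteFalse _ hb' _ => exact absurd hb hb'
  | iteFalse _ hb _ ih =>
    cases h₂ with
    | iteTrue _ hb' _ => exact absurd hb' hb
    | iteFalse _ _ hc => obtain ⟨rfl, rfl⟩ := ih hc; exact ⟨rfl, rfl⟩
  | loopTrue _ hb _ _ ihc ihl =>
    cases h₂ with
    | loopTrue _ _ hc hl =>
      obtain ⟨rfl, rfl⟩ := ihc hc
      obtain ⟨rfl, rfl⟩ := ihl hl
      exact ⟨rfl, rfl⟩
    | loopFalse _ hb' => exact absurd hb hb'
  | loopFalse _ hb =>
    cases h₂ with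
    | loopTrue _ hb' => exact absurd hb' hb
    | loopFalse => exact ⟨rfl, rfl⟩

/-- The input of the preprocessing: `|V|` and `|E|` in the integer registers 0 and 1, `ε` in the
real register 0, the coordinates of vertex `i` in the cells `2 * i` and `2 * i + 1` of the real
memory, the end points of the `j`-th edge in the cells `2 * j` and `2 * j + 1` of the integer
memory, and zero everywhere else. The spanner ratio is not part of the input. -/
noncomputable def buildInput (P : GeometricGraph)
    (es : List (Fin P.numVertices × Fin P.numVertices)) (ε : ℝ) : State where
  nreg i := if i = 0 then P.numVertices else if i = 1 then es.length else 0
  rreg i := if i = 0 then ε else 0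
  nmem a :=
    if h : a / 2 < es.length then
      if a % 2 = 0 then ((es[a / 2]'h).1 : ℕ) else ((es[a / 2]'h).2 : ℕ)
    else 0
  rmem a :=
    if h : a / 2 < P.numVertices then
      if a % 2 = 0 then P.pos ⟨a / 2, h⟩ 0 else P.pos ⟨a / 2, h⟩ 1
    else 0
  out := []

/-- Presenting a query to the machine: the centre and the half-side vector of the square are put
into the real registers 0 to 3 and the output is cleared. Everything else is left as it was. -/
noncomputable def queryInput (σ : State) (q : PlaneSquare) : State :=
  { σ with
    rreg := fun i =>
      if i = 0 then q.centre 0 else if i = 1 then q.centre 1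
      else if i = 2 then q.half 0 else if i = 3 then q.half 1 else σ.rreg i
    out := [] }

/-- The states of the data structure: the state after the preprocessing, and the states after any
finite sequence of queries that follow it. -/
inductive Reachable (S W : ℕ) (build query : Cmd) (σ₀ : State) : State → Prop where
  | built {σ : State} {k : ℕ} (h : Exec S W build σ₀ σ k) : Reachable S W build query σ₀ σ
  | queried {σ σ' : State} {k : ℕ} (q : PlaneSquare) (hσ : Reachable S W build query σ₀ σ)
      (h : Exec S W query (queryInput σ q) σ' k) : Reachable S W build query σ₀ σ'

/-- The vertices listed in the output are exactly those of `T`. -/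
def Returns (σ : State) {N : ℕ} (T : Finset (Fin N)) : Prop :=
  ∀ a : ℕ, a ∈ σ.out ↔ ∃ z ∈ T, (z : ℕ) = a

/-- `K * n * log (n + 1)`, rounded down: the number of cells of each of the two memories. -/
noncomputable def memorySize (K n : ℕ) : ℕ := ⌊(K : ℝ) * n * Real.log (n + 1)⌋₊

/-- The largest integer of the machine: the integers have `O(log n)` bits. -/
def wordBound (K n : ℕ) : ℕ := (n + 1) ^ K

end RealRAM

/-! Let τ ≥ 1 be the least number for which the graph is a τ-spanner. Then τ ≤ t, and a Euclidean
cover of the vertices in the square with radius s = ε r / τ is a cover in the graph metric with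
radius ε r. So the graph enters only through τ, which all-pairs Dijkstra computes in the
preprocessing (`wp_spanningRatio`); the rest is a problem about points in the plane.

That problem is governed by one farthest-first order q 0, q 1, ... of the vertices, where `lam j` is
the distance from q j to the points before it. For each radius ρ, the prefix that ends before the
first index from 1 on with `lam` at most ρ covers all points with radius ρ, and its points are more
than ρ apart. Let i and i' be these indices for r and for s. The prefix before i' is a cover, and by
packing (`card_le_of_separated`) only O((r / s)^2) = O((τ / ε)^2) of its points lie within O(r) of
the square. It remains to list such points without searching for them.

To this end every point j ≥ 1 gets an earlier parent at distance at most 2 `lam j`, whose own scale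
is at least twice as large unless it is the point 0 (`Greedy.exists_parent`). The steps to the
ancestors form a geometric series, so the first ancestor before i lies within 4 r (`dist_top`).
Besides, each point has a list of neighbours: those at distance at most 16 times the smaller of the
two scales. A point has boundedly many earlier neighbours, hence all the lists have linear size
(`Net.rowStart_nbr_le`), and they contain all edges of the tree.

A query looks for one vertex a in the axis-parallel square of half-side 2 r with the same centre; if
there is none, the answer is empty. It climbs from a to the ancestor u before i. The ancestors
before i of all points that are needed are within 14 r of u, and therefore are u itself or in its
list (`exists_inAnswer`). These roots are bounded in number, and their descendants before i' are the
answer. All of them are within 267 r of the centre, which bounds their number (`card_answer_le`).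
Children are found by reading neighbour lists. Of the entries read, the earlier neighbours are
boundedly many for each point, and a later one is charged to itself (`sum_scanLength_le`). Binary
searches in lists are made only for the roots, so the time is O(log n + (τ / ε)^2).

The vertex a is found by ranking the points in both coordinates and descending in a wavelet table
(`wp_findLeast`); the climb uses ancestors at distances that are powers of two. Both tables take O(n
log n) cells and explain the space bound.

The machine is handled by a calculus of weakest preconditions whose postconditions also speak of the
running time. What a program leaves alone is read off from its text (`Exec.frame`). As a query
changes only scratch cells and registers, the invariant `Holds` survives every sequence of queries
(`Reachable.holds`). -/

set_option linter.unusedSimpArgs false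

/-! ## Reasoning about programs -/

namespace RealRAM

/-! ### States and columns

Both memories are divided into 32 columns: cell `i` of column `j` is the cell
`32 * (n + i) + j`, where `n` is the content of the integer register 2. -/

namespace State

def setN (σ : State) (i v : ℕ) : State := { σ with nreg := Function.update σ.nreg i v }
noncomputable def setR (σ : State) (i : ℕ) (v : ℝ) : State :=
  { σ with rreg := Function.update σ.rreg i v }
def na (σ : State) (j i : ℕ) : ℕ := σ.nmem (32 * (σ.nreg 2 + i) + j)
def ra (σ : State) (j i : ℕ) : ℝ := σ.rmem (32 * (σ.nreg 2 + i) + j)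
def setNA (σ : State) (j i v : ℕ) : State :=
  { σ with nmem := Function.update σ.nmem (32 * (σ.nreg 2 + i) + j) v }
noncomputable def setRA (σ : State) (j i : ℕ) (v : ℝ) : State :=
  { σ with rmem := Function.update σ.rmem (32 * (σ.nreg 2 + i) + j) v }
def push (σ : State) (v : ℕ) : State := { σ with out := σ.out ++ [v] }

variable (σ : State) (i j k v a : ℕ) (x : ℝ)

@[simp] theorem nreg_setN : (σ.setN i v).nreg k = if k = i then v else σ.nreg k := by
  simp [setN, Function.update_apply]
@[simp] theorem rreg_setN : (σ.setN i v).rreg = σ.rreg := rfl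
@[simp] theorem nmem_setN : (σ.setN i v).nmem = σ.nmem := rfl
@[simp] theorem rmem_setN : (σ.setN i v).rmem = σ.rmem := rfl
@[simp] theorem out_setN : (σ.setN i v).out = σ.out := rfl
@[simp] theorem nreg_setR : (σ.setR i x).nreg = σ.nreg := rfl
@[simp] theorem rreg_setR : (σ.setR i x).rreg k = if k = i then x else σ.rreg k := by
  simp [setR, Function.update_apply]
@[simp] theorem nmem_setR : (σ.setR i x).nmem = σ.nmem := rfl
@[simp] theorem rmem_setR : (σ.setR i x).rmem = σ.rmem := rfl
@[simp] theorem out_setR : (σ.setR i x).out = σ.out := rfl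
@[simp] theorem nreg_setNA : (σ.setNA j i v).nreg = σ.nreg := rfl
@[simp] theorem rreg_setNA : (σ.setNA j i v).rreg = σ.rreg := rfl
@[simp] theorem rmem_setNA : (σ.setNA j i v).rmem = σ.rmem := rfl
@[simp] theorem out_setNA : (σ.setNA j i v).out = σ.out := rfl
@[simp] theorem nreg_setRA : (σ.setRA j i x).nreg = σ.nreg := rfl
@[simp] theorem rreg_setRA : (σ.setRA j i x).rreg = σ.rreg := rfl
@[simp] theorem nmem_setRA : (σ.setRA j i x).nmem = σ.nmem := rfl
@[simp] theorem out_setRA : (σ.setRA j i x).out = σ.out := rfl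
@[simp] theorem nreg_push : (σ.push v).nreg = σ.nreg := rfl
@[simp] theorem rreg_push : (σ.push v).rreg = σ.rreg := rfl
@[simp] theorem nmem_push : (σ.push v).nmem = σ.nmem := rfl
@[simp] theorem rmem_push : (σ.push v).rmem = σ.rmem := rfl
@[simp] theorem out_push : (σ.push v).out = σ.out ++ [v] := rfl

@[simp] theorem na_setN (h : i ≠ 2) : (σ.setN i v).na j k = σ.na j k := by
  simp [na, h.symm]
@[simp] theorem ra_setN (h : i ≠ 2) : (σ.setN i v).ra j k = σ.ra j k := by
  simp [ra, h.symm]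
@[simp] theorem na_setR : (σ.setR i x).na j k = σ.na j k := rfl
@[simp] theorem ra_setR : (σ.setR i x).ra j k = σ.ra j k := rfl
@[simp] theorem na_setRA : (σ.setRA i k x).na j a = σ.na j a := rfl
@[simp] theorem ra_setNA : (σ.setNA i k v).ra j a = σ.ra j a := rfl
@[simp] theorem na_push : (σ.push v).na j k = σ.na j k := rfl
@[simp] theorem ra_push : (σ.push v).ra j k = σ.ra j k := rfl

-- An address determines its column as the residue modulo 32 and its index as the quotient, so
-- distinct columns never interfere.
@[simp] theorem na_setNA (hj : j < 32) (hi : i < 32) :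
    (σ.setNA i k v).na j a = if j = i ∧ a = k then v else σ.na j a := by
  have : 32 * (σ.nreg 2 + a) + j = 32 * (σ.nreg 2 + k) + i ↔ j = i ∧ a = k := by omega
  simp [na, setNA, Function.update_apply, this]

@[simp] theorem ra_setRA (hj : j < 32) (hi : i < 32) :
    (σ.setRA i k x).ra j a = if j = i ∧ a = k then x else σ.ra j a := by
  have : 32 * (σ.nreg 2 + a) + j = 32 * (σ.nreg 2 + k) + i ↔ j = i ∧ a = k := by omega
  simp [ra, setRA, Function.update_apply, this]

end State

/-! ### Expressions -/

instance : Add NExpr := ⟨.add⟩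
instance : Sub NExpr := ⟨.sub⟩
instance : Mul NExpr := ⟨.mul⟩
instance : Div NExpr := ⟨.div⟩
instance : Add RExpr := ⟨.add⟩
instance : Sub RExpr := ⟨.sub⟩
instance : Mul RExpr := ⟨.mul⟩
instance : Div RExpr := ⟨.div⟩

/-- The address of a cell of a column. -/
def cell (j : ℕ) (e : NExpr) : NExpr := .const 32 * (.reg 2 + e) + .const j
/-- The content of a cell of a column of the integer memory. -/
def ld (j : ℕ) (e : NExpr) : NExpr := .load (cell j e)
/-- The content of a cell of a column of the real memory. -/
def rld (j : ℕ) (e : NExpr) : RExpr := .load (cell j e)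
def st (j : ℕ) (e v : NExpr) : Cmd := .storeN (cell j e) v
def rst (j : ℕ) (e : NExpr) (v : RExpr) : Cmd := .storeR (cell j e) v

/-- The size of the memory does not exceed the largest integer. -/
class Machine (S W : ℕ) : Prop where
  le : S ≤ W
  big : 100 ≤ W

section Expr

variable (σ : State) (S W : ℕ)

@[simp] theorem NExpr.val_const (c : ℕ) : (NExpr.const c).val σ = c := rfl
@[simp] theorem NExpr.val_reg (i : ℕ) : (NExpr.reg i).val σ = σ.nreg i := rfl
@[simp] theorem NExpr.val_add (a b : NExpr) : (a + b).val σ = a.val σ + b.val σ := rfl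
@[simp] theorem NExpr.val_sub (a b : NExpr) : (a - b).val σ = a.val σ - b.val σ := rfl
@[simp] theorem NExpr.val_mul (a b : NExpr) : (a * b).val σ = a.val σ * b.val σ := rfl
@[simp] theorem NExpr.val_div (a b : NExpr) : (a / b).val σ = a.val σ / b.val σ := rfl
@[simp] theorem NExpr.val_load (a : NExpr) : (NExpr.load a).val σ = σ.nmem (a.val σ) := rfl
@[simp] theorem val_cell (j : ℕ) (e : NExpr) :
    (cell j e).val σ = 32 * (σ.nreg 2 + e.val σ) + j := rfl
@[simp] theorem val_ld (j : ℕ) (e : NExpr) : (ld j e).val σ = σ.na j (e.val σ) := rfl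

@[simp] theorem NExpr.cost_const (c : ℕ) : (NExpr.const c).cost = 1 := rfl
@[simp] theorem NExpr.cost_reg (i : ℕ) : (NExpr.reg i).cost = 1 := rfl
@[simp] theorem NExpr.cost_add (a b : NExpr) : (a + b).cost = a.cost + b.cost + 1 := rfl
@[simp] theorem NExpr.cost_sub (a b : NExpr) : (a - b).cost = a.cost + b.cost + 1 := rfl
@[simp] theorem NExpr.cost_mul (a b : NExpr) : (a * b).cost = a.cost + b.cost + 1 := rfl
@[simp] theorem NExpr.cost_div (a b : NExpr) : (a / b).cost = a.cost + b.cost + 1 := rfl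
@[simp] theorem NExpr.cost_load (a : NExpr) : (NExpr.load a).cost = a.cost + 1 := rfl
@[simp] theorem cost_cell (j : ℕ) (e : NExpr) : (cell j e).cost = e.cost + 6 := by
  change 1 + (1 + e.cost + 1) + 1 + 1 + 1 = _; ring
@[simp] theorem cost_ld (j : ℕ) (e : NExpr) : (ld j e).cost = e.cost + 7 := by
  simp [ld]

@[simp] theorem NExpr.safe_const (c : ℕ) : (NExpr.const c).Safe S W σ ↔ c ≤ W := Iff.rfl
@[simp] theorem NExpr.safe_reg (i : ℕ) : (NExpr.reg i).Safe S W σ ↔ True := Iff.rfl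
@[simp] theorem NExpr.safe_add (a b : NExpr) : (a + b).Safe S W σ ↔
    a.Safe S W σ ∧ b.Safe S W σ ∧ a.val σ + b.val σ ≤ W := Iff.rfl
@[simp] theorem NExpr.safe_sub (a b : NExpr) : (a - b).Safe S W σ ↔
    a.Safe S W σ ∧ b.Safe S W σ := Iff.rfl
@[simp] theorem NExpr.safe_mul (a b : NExpr) : (a * b).Safe S W σ ↔
    a.Safe S W σ ∧ b.Safe S W σ ∧ a.val σ * b.val σ ≤ W := Iff.rfl
@[simp] theorem NExpr.safe_div (a b : NExpr) : (a / b).Safe S W σ ↔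
    a.Safe S W σ ∧ b.Safe S W σ := Iff.rfl
@[simp] theorem NExpr.safe_load (a : NExpr) : (NExpr.load a).Safe S W σ ↔
    a.Safe S W σ ∧ a.val σ < S := Iff.rfl

/-- Every intermediate value is at most the address itself, and addresses below `S` cannot overflow
on a `Machine`. Safety thus reduces to the bound on the address. -/
theorem safe_cell [Machine S W] {j : ℕ} {e : NExpr}
    (h : 32 * (σ.nreg 2 + e.val σ) + j < S) : (cell j e).Safe S W σ ↔ e.Safe S W σ := by
  have h1 := Machine.le (S := S) (W := W)
  have h2 := Machine.big (S := S) (W := W)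
  change (32 ≤ W ∧ (True ∧ e.Safe S W σ ∧ σ.nreg 2 + e.val σ ≤ W) ∧
    32 * (σ.nreg 2 + e.val σ) ≤ W) ∧ j ≤ W ∧ 32 * (σ.nreg 2 + e.val σ) + j ≤ W ↔ _
  constructor
  · exact fun h => h.1.2.1.2.1
  · exact fun h => ⟨⟨by omega, ⟨trivial, h, by omega⟩, by omega⟩, by omega, by omega⟩

@[simp] theorem safe_ld [Machine S W] (j : ℕ) (e : NExpr) : (ld j e).Safe S W σ ↔
    e.Safe S W σ ∧ 32 * (σ.nreg 2 + e.val σ) + j < S :=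
  ⟨fun h => ⟨(safe_cell σ S W h.2).1 h.1, h.2⟩, fun h => ⟨(safe_cell σ S W h.2).2 h.1, h.2⟩⟩

@[simp] theorem RExpr.val_ofNat (e : NExpr) : (RExpr.ofNat e).val σ = e.val σ := rfl
@[simp] theorem RExpr.val_reg (i : ℕ) : (RExpr.reg i).val σ = σ.rreg i := rfl
@[simp] theorem RExpr.val_add (a b : RExpr) : (a + b).val σ = a.val σ + b.val σ := rfl
@[simp] theorem RExpr.val_sub (a b : RExpr) : (a - b).val σ = a.val σ - b.val σ := rfl
@[simp] theorem RExpr.val_mul (a b : RExpr) : (a * b).val σ = a.val σ * b.val σ := rfl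
@[simp] theorem RExpr.val_div (a b : RExpr) : (a / b).val σ = a.val σ / b.val σ := rfl
@[simp] theorem RExpr.val_sqrt (a : RExpr) : (RExpr.sqrt a).val σ = Real.sqrt (a.val σ) := rfl
@[simp] theorem RExpr.val_load (a : NExpr) : (RExpr.load a).val σ = σ.rmem (a.val σ) := rfl
@[simp] theorem val_rld (j : ℕ) (e : NExpr) : (rld j e).val σ = σ.ra j (e.val σ) := rfl

@[simp] theorem RExpr.cost_ofNat (e : NExpr) : (RExpr.ofNat e).cost = e.cost + 1 := rfl
@[simp] theorem RExpr.cost_reg (i : ℕ) : (RExpr.reg i).cost = 1 := rfl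
@[simp] theorem RExpr.cost_add (a b : RExpr) : (a + b).cost = a.cost + b.cost + 1 := rfl
@[simp] theorem RExpr.cost_sub (a b : RExpr) : (a - b).cost = a.cost + b.cost + 1 := rfl
@[simp] theorem RExpr.cost_mul (a b : RExpr) : (a * b).cost = a.cost + b.cost + 1 := rfl
@[simp] theorem RExpr.cost_div (a b : RExpr) : (a / b).cost = a.cost + b.cost + 1 := rfl
@[simp] theorem RExpr.cost_sqrt (a : RExpr) : (RExpr.sqrt a).cost = a.cost + 1 := rfl
@[simp] theorem RExpr.cost_load (a : NExpr) : (RExpr.load a).cost = a.cost + 1 := rfl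
@[simp] theorem cost_rld (j : ℕ) (e : NExpr) : (rld j e).cost = e.cost + 7 := by
  simp [rld]

@[simp] theorem RExpr.safe_ofNat (e : NExpr) : (RExpr.ofNat e).Safe S W σ ↔ e.Safe S W σ := Iff.rfl
@[simp] theorem RExpr.safe_reg (i : ℕ) : (RExpr.reg i).Safe S W σ ↔ True := Iff.rfl
@[simp] theorem RExpr.safe_add (a b : RExpr) : (a + b).Safe S W σ ↔
    a.Safe S W σ ∧ b.Safe S W σ := Iff.rfl
@[simp] theorem RExpr.safe_sub (a b : RExpr) : (a - b).Safe S W σ ↔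
    a.Safe S W σ ∧ b.Safe S W σ := Iff.rfl
@[simp] theorem RExpr.safe_mul (a b : RExpr) : (a * b).Safe S W σ ↔
    a.Safe S W σ ∧ b.Safe S W σ := Iff.rfl
@[simp] theorem RExpr.safe_div (a b : RExpr) : (a / b).Safe S W σ ↔
    a.Safe S W σ ∧ b.Safe S W σ := Iff.rfl
@[simp] theorem RExpr.safe_sqrt (a : RExpr) : (RExpr.sqrt a).Safe S W σ ↔ a.Safe S W σ := Iff.rfl
@[simp] theorem RExpr.safe_load (a : NExpr) : (RExpr.load a).Safe S W σ ↔
    a.Safe S W σ ∧ a.val σ < S := Iff.rfl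
@[simp] theorem safe_rld [Machine S W] (j : ℕ) (e : NExpr) : (rld j e).Safe S W σ ↔
    e.Safe S W σ ∧ 32 * (σ.nreg 2 + e.val σ) + j < S :=
  ⟨fun h => ⟨(safe_cell σ S W h.2).1 h.1, h.2⟩, fun h => ⟨(safe_cell σ S W h.2).2 h.1, h.2⟩⟩

@[simp] theorem BExpr.val_ltN (a b : NExpr) : (BExpr.ltN a b).val σ ↔ a.val σ < b.val σ := Iff.rfl
@[simp] theorem BExpr.val_ltR (a b : RExpr) : (BExpr.ltR a b).val σ ↔ a.val σ < b.val σ := Iff.rfl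
@[simp] theorem BExpr.val_not (a : BExpr) : (BExpr.not a).val σ ↔ ¬ a.val σ := Iff.rfl
@[simp] theorem BExpr.val_and (a b : BExpr) : (BExpr.and a b).val σ ↔ a.val σ ∧ b.val σ := Iff.rfl
@[simp] theorem BExpr.cost_ltN (a b : NExpr) : (BExpr.ltN a b).cost = a.cost + b.cost + 1 := rfl
@[simp] theorem BExpr.cost_ltR (a b : RExpr) : (BExpr.ltR a b).cost = a.cost + b.cost + 1 := rfl
@[simp] theorem BExpr.cost_not (a : BExpr) : (BExpr.not a).cost = a.cost + 1 := rfl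
@[simp] theorem BExpr.cost_and (a b : BExpr) : (BExpr.and a b).cost = a.cost + b.cost + 1 := rfl
@[simp] theorem BExpr.safe_ltN (a b : NExpr) : (BExpr.ltN a b).Safe S W σ ↔
    a.Safe S W σ ∧ b.Safe S W σ := Iff.rfl
@[simp] theorem BExpr.safe_ltR (a b : RExpr) : (BExpr.ltR a b).Safe S W σ ↔
    a.Safe S W σ ∧ b.Safe S W σ := Iff.rfl
@[simp] theorem BExpr.safe_not (a : BExpr) : (BExpr.not a).Safe S W σ ↔ a.Safe S W σ := Iff.rfl
@[simp] theorem BExpr.safe_and (a b : BExpr) : (BExpr.and a b).Safe S W σ ↔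
    a.Safe S W σ ∧ (a.val σ → b.Safe S W σ) := Iff.rfl

end Expr

/-! ### What a program leaves unchanged -/

/-- Whether the address `a` may be a cell of column `j`. -/
def NExpr.inCol : NExpr → ℕ → Bool
  | .add (.mul (.const 32) _) (.const i), j => i % 32 == j
  | _, _ => true

/-- Soundness of the syntactic test: an address of the shape of `cell` lies in the column that it
names, and any other address is allowed to lie anywhere. -/
theorem NExpr.inCol_val (σ : State) (a : NExpr) : a.inCol (a.val σ % 32) = true := by
  unfold NExpr.inCol
  split
  · rename_i e i
    have h : ((NExpr.const 32).mul e |>.add (.const i)).val σ = 32 * e.val σ + i := rfl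
    simp [h]
  · rfl

namespace Cmd

/-- Whether the program may change the integer register `i`. -/
def modN : Cmd → ℕ → Bool
  | setN i _, k => i == k
  | seq c d, k => c.modN k || d.modN k
  | ite _ c d, k => c.modN k || d.modN k
  | loop _ c, k => c.modN k
  | _, _ => false

/-- Whether the program may change the real register `i`. -/
def modR : Cmd → ℕ → Bool
  | setR i _, k => i == k
  | seq c d, k => c.modR k || d.modR k
  | ite _ c d, k => c.modR k || d.modR k
  | loop _ c, k => c.modR k
  | _, _ => false

/-- Whether the program may change column `j` of the integer memory. -/
def modNA : Cmd → ℕ → Bool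
  | storeN a _, j => a.inCol j
  | seq c d, j => c.modNA j || d.modNA j
  | ite _ c d, j => c.modNA j || d.modNA j
  | loop _ c, j => c.modNA j
  | _, _ => false

/-- Whether the program may change column `j` of the real memory. -/
def modRA : Cmd → ℕ → Bool
  | storeR a _, j => a.inCol j
  | seq c d, j => c.modRA j || d.modRA j
  | ite _ c d, j => c.modRA j || d.modRA j
  | loop _ c, j => c.modRA j
  | _, _ => false

/-- Whether the program may produce output. -/
def emits : Cmd → Bool
  | emit _ => true
  | seq c d => c.emits || d.emits
  | ite _ c d => c.emits || d.emits
  | loop _ c => c.emits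
  | _ => false

end Cmd

/-- The states `σ` and `σ'` differ only in what the program `c` may change. -/
structure Frame (c : Cmd) (σ σ' : State) : Prop where
  nreg : ∀ i, c.modN i = false → σ'.nreg i = σ.nreg i
  rreg : ∀ i, c.modR i = false → σ'.rreg i = σ.rreg i
  nmem : ∀ a, c.modNA (a % 32) = false → σ'.nmem a = σ.nmem a
  rmem : ∀ a, c.modRA (a % 32) = false → σ'.rmem a = σ.rmem a
  out : c.emits = false → σ'.out = σ.out

namespace Frame

theorem refl (c : Cmd) (σ : State) : Frame c σ σ :=
  ⟨fun _ _ => rfl, fun _ _ => rfl, fun _ _ => rfl, fun _ _ => rfl, fun _ => rfl⟩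

theorem trans {c : Cmd} {σ σ' σ'' : State} (h : Frame c σ σ') (h' : Frame c σ' σ'') :
    Frame c σ σ'' :=
  ⟨fun i hi => (h'.nreg i hi).trans (h.nreg i hi), fun i hi => (h'.rreg i hi).trans (h.rreg i hi),
    fun i hi => (h'.nmem i hi).trans (h.nmem i hi), fun i hi => (h'.rmem i hi).trans (h.rmem i hi),
    fun hi => (h'.out hi).trans (h.out hi)⟩

theorem na {c : Cmd} {σ σ' : State} (h : Frame c σ σ') (j : ℕ) (hj : c.modNA j = false)
    (h2 : c.modN 2 = false) (h32 : j < 32) (i : ℕ) : σ'.na j i = σ.na j i := by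
  unfold State.na
  rw [h.nreg 2 h2]
  apply h.nmem
  rwa [show (32 * (σ.nreg 2 + i) + j) % 32 = j by omega]

theorem ra {c : Cmd} {σ σ' : State} (h : Frame c σ σ') (j : ℕ) (hj : c.modRA j = false)
    (h2 : c.modN 2 = false) (h32 : j < 32) (i : ℕ) : σ'.ra j i = σ.ra j i := by
  unfold State.ra
  rw [h.nreg 2 h2]
  apply h.rmem
  rwa [show (32 * (σ.nreg 2 + i) + j) % 32 = j by omega]

theorem mono {c d : Cmd} {σ σ' : State} (h : Frame c σ σ')
    (hN : ∀ i, d.modN i = false → c.modN i = false) (hR : ∀ i, d.modR i = false → c.modR i = false)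
    (hNA : ∀ i, d.modNA i = false → c.modNA i = false)
    (hRA : ∀ i, d.modRA i = false → c.modRA i = false)
    (ho : d.emits = false → c.emits = false) : Frame d σ σ' :=
  ⟨fun i hi => h.nreg i (hN i hi), fun i hi => h.rreg i (hR i hi),
    fun i hi => h.nmem i (hNA _ hi), fun i hi => h.rmem i (hRA _ hi), fun hi => h.out (ho hi)⟩

theorem seq_left {c d : Cmd} {σ σ' : State} (h : Frame c σ σ') : Frame (.seq c d) σ σ' :=
  h.mono (by simp [Cmd.modN]; tauto) (by simp [Cmd.modR]; tauto) (by simp [Cmd.modNA]; tauto)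
    (by simp [Cmd.modRA]; tauto) (by simp [Cmd.emits]; tauto)

theorem seq_right {c d : Cmd} {σ σ' : State} (h : Frame d σ σ') : Frame (.seq c d) σ σ' :=
  h.mono (by simp [Cmd.modN]) (by simp [Cmd.modR]) (by simp [Cmd.modNA])
    (by simp [Cmd.modRA]) (by simp [Cmd.emits])

end Frame

/-- For a concrete program the side conditions of `Frame` are decided by computation. Everything
that a subprogram does not touch is therefore carried across it by `rfl`, without being mentioned in
its specification. -/
theorem Exec.frame {S W : ℕ} {c : Cmd} {σ σ' : State} {k : ℕ} (h : Exec S W c σ σ' k) :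
    Frame c σ σ' := by
  induction h with
  | skip σ => exact Frame.refl _ _
  | setN σ i e he =>
    refine ⟨fun j hj => ?_, fun _ _ => rfl, fun _ _ => rfl, fun _ _ => rfl, fun _ => rfl⟩
    have : j ≠ i := by rintro rfl; simp [Cmd.modN] at hj
    simp [this]
  | setR σ i e he =>
    refine ⟨fun _ _ => rfl, fun j hj => ?_, fun _ _ => rfl, fun _ _ => rfl, fun _ => rfl⟩
    have : j ≠ i := by rintro rfl; simp [Cmd.modR] at hj
    simp [this]
  | storeN σ a e ha hS he =>
    refine ⟨fun _ _ => rfl, fun _ _ => rfl, fun b hb => ?_, fun _ _ => rfl, fun _ => rfl⟩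
    have : b ≠ a.val σ := by
      rintro rfl
      simp [Cmd.modNA, NExpr.inCol_val] at hb
    simp [this]
  | storeR σ a e ha hS he =>
    refine ⟨fun _ _ => rfl, fun _ _ => rfl, fun _ _ => rfl, fun b hb => ?_, fun _ => rfl⟩
    have : b ≠ a.val σ := by
      rintro rfl
      simp [Cmd.modRA, NExpr.inCol_val] at hb
    simp [this]
  | emit σ e he =>
    exact ⟨fun _ _ => rfl, fun _ _ => rfl, fun _ _ => rfl, fun _ _ => rfl,
      fun h => by simp [Cmd.emits] at h⟩
  | seq _ _ ihc ihd => exact ihc.seq_left.trans ihd.seq_right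
  | iteTrue _ _ _ ih =>
    exact ih.mono (by simp [Cmd.modN]; tauto) (by simp [Cmd.modR]; tauto)
      (by simp [Cmd.modNA]; tauto) (by simp [Cmd.modRA]; tauto) (by simp [Cmd.emits]; tauto)
  | iteFalse _ _ _ ih =>
    exact ih.mono (by simp [Cmd.modN]) (by simp [Cmd.modR]) (by simp [Cmd.modNA])
      (by simp [Cmd.modRA]) (by simp [Cmd.emits])
  | loopTrue _ _ _ _ ihc ihl =>
    exact Frame.trans (ihc.mono (fun _ h => h) (fun _ h => h) (fun _ h => h) (fun _ h => h)
      (fun h => h)) ihl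
  | loopFalse => exact Frame.refl _ _

/-! ### Weakest preconditions -/

/-- The program `c`, started in `σ`, halts in a state that satisfies `Q` together with the
running time. -/
def wp (S W : ℕ) (c : Cmd) (σ : State) (Q : State → ℕ → Prop) : Prop :=
  ∃ σ' k, Exec S W c σ σ' k ∧ Q σ' k

/-- Sequential composition of a list of programs. -/
def block : List Cmd → Cmd
  | [] => .skip
  | c :: cs => .seq c (block cs)

section

variable {S W : ℕ} {σ : State} {Q R : State → ℕ → Prop}

/-- The rule of consequence; the frame comes for free, so postconditions need not list what is
unchanged. -/
theorem wp_mono {c : Cmd} (h : wp S W c σ Q)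
    (hQ : ∀ σ' k, Frame c σ σ' → Q σ' k → R σ' k) : wp S W c σ R := by
  obtain ⟨σ', k, he, hq⟩ := h
  exact ⟨σ', k, he, hQ σ' k he.frame hq⟩

@[simp] theorem wp_skip : wp S W .skip σ Q ↔ Q σ 1 := by
  constructor
  · rintro ⟨_, _, h, hq⟩; cases h; exact hq
  · exact fun h => ⟨_, _, .skip σ, h⟩

@[simp] theorem wp_setN {i : ℕ} {e : NExpr} : wp S W (.setN i e) σ Q ↔
    e.Safe S W σ ∧ Q (σ.setN i (e.val σ)) (e.cost + 1) := by
  constructor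
  · rintro ⟨_, _, h, hq⟩; cases h; exact ⟨by assumption, hq⟩
  · exact fun h => ⟨_, _, .setN σ i e h.1, h.2⟩

@[simp] theorem wp_setR {i : ℕ} {e : RExpr} : wp S W (.setR i e) σ Q ↔
    e.Safe S W σ ∧ Q (σ.setR i (e.val σ)) (e.cost + 1) := by
  constructor
  · rintro ⟨_, _, h, hq⟩; cases h; exact ⟨by assumption, hq⟩
  · exact fun h => ⟨_, _, .setR σ i e h.1, h.2⟩

@[simp] theorem wp_emit {e : NExpr} : wp S W (.emit e) σ Q ↔
    e.Safe S W σ ∧ Q (σ.push (e.val σ)) (e.cost + 1) := by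
  constructor
  · rintro ⟨_, _, h, hq⟩; cases h; exact ⟨by assumption, hq⟩
  · exact fun h => ⟨_, _, .emit σ e h.1, h.2⟩

@[simp] theorem wp_st [Machine S W] {j : ℕ} {e v : NExpr} : wp S W (st j e v) σ Q ↔
    e.Safe S W σ ∧ 32 * (σ.nreg 2 + e.val σ) + j < S ∧ v.Safe S W σ ∧
      Q (σ.setNA j (e.val σ) (v.val σ)) (e.cost + v.cost + 7) := by
  have hc : e.cost + v.cost + 7 = (cell j e).cost + v.cost + 1 := by simp; ring
  rw [hc]
  constructor
  · rintro ⟨_, _, h, hq⟩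
    cases h with
    | storeN _ _ _ ha hS he => exact ⟨(safe_cell σ S W hS).1 ha, hS, he, hq⟩
  · rintro ⟨he, hS, hv, hq⟩
    exact ⟨_, _, .storeN σ _ _ ((safe_cell σ S W hS).2 he) hS hv, hq⟩

@[simp] theorem wp_rst [Machine S W] {j : ℕ} {e : NExpr} {v : RExpr} : wp S W (rst j e v) σ Q ↔
    e.Safe S W σ ∧ 32 * (σ.nreg 2 + e.val σ) + j < S ∧ v.Safe S W σ ∧
      Q (σ.setRA j (e.val σ) (v.val σ)) (e.cost + v.cost + 7) := by
  have hc : e.cost + v.cost + 7 = (cell j e).cost + v.cost + 1 := by simp; ring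
  rw [hc]
  constructor
  · rintro ⟨_, _, h, hq⟩
    cases h with
    | storeR _ _ _ ha hS he => exact ⟨(safe_cell σ S W hS).1 ha, hS, he, hq⟩
  · rintro ⟨he, hS, hv, hq⟩
    exact ⟨_, _, .storeR σ _ _ ((safe_cell σ S W hS).2 he) hS hv, hq⟩

theorem wp_seq {c d : Cmd} : wp S W (.seq c d) σ Q ↔
    wp S W c σ fun σ' k => wp S W d σ' fun σ'' l => Q σ'' (k + l) := by
  constructor
  · rintro ⟨_, _, h, hq⟩
    cases h with
    | seq hc hd => exact ⟨_, _, hc, _, _, hd, hq⟩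
  · rintro ⟨_, _, hc, _, _, hd, hq⟩
    exact ⟨_, _, .seq hc hd, hq⟩

@[simp] theorem wp_block_nil : wp S W (block []) σ Q ↔ Q σ 1 := wp_skip

@[simp] theorem wp_block_cons {c : Cmd} {cs : List Cmd} : wp S W (block (c :: cs)) σ Q ↔
    wp S W c σ fun σ' k => wp S W (block cs) σ' fun σ'' l => Q σ'' (k + l) := wp_seq

@[simp] theorem wp_ite {b : BExpr} {c d : Cmd} : wp S W (.ite b c d) σ Q ↔
    b.Safe S W σ ∧ (b.val σ → wp S W c σ fun σ' k => Q σ' (b.cost + 1 + k)) ∧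
      (¬ b.val σ → wp S W d σ fun σ' k => Q σ' (b.cost + 1 + k)) := by
  constructor
  · rintro ⟨_, _, h, hq⟩
    cases h with
    | iteTrue hS hb hc => exact ⟨hS, fun _ => ⟨_, _, hc, hq⟩, fun h => absurd hb h⟩
    | iteFalse hS hb hc => exact ⟨hS, fun h => absurd h hb, fun _ => ⟨_, _, hc, hq⟩⟩
  · rintro ⟨hS, h1, h2⟩
    by_cases hb : b.val σ
    · obtain ⟨_, _, hc, hq⟩ := h1 hb
      exact ⟨_, _, .iteTrue hS hb hc, hq⟩
    · obtain ⟨_, _, hc, hq⟩ := h2 hb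
      exact ⟨_, _, .iteFalse hS hb hc, hq⟩

/-- A loop with an invariant `I` on the state and the elapsed time, and a variant `μ`. -/
theorem wp_loop {b : BExpr} {c : Cmd} (I : State → ℕ → Prop) (μ : State → ℕ) (h0 : I σ 0)
    (step : ∀ σ' k, Frame (.loop b c) σ σ' → I σ' k → b.Safe S W σ' ∧
      (b.val σ' → wp S W c σ' fun σ'' l => I σ'' (k + (b.cost + 1) + l) ∧ μ σ'' < μ σ') ∧
      (¬ b.val σ' → Q σ' (k + (b.cost + 1)))) : wp S W (.loop b c) σ Q := by
  -- Induction on a bound for the variant. The elapsed time is an argument of the invariant, hence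
  -- it is generalised together with the state.
  have key : ∀ m σ' k, μ σ' ≤ m → Frame (.loop b c) σ σ' → I σ' k →
      wp S W (.loop b c) σ' fun σ'' l => Q σ'' (k + l) := by
    intro m
    induction m with
    | zero =>
      intro σ' k hm hf hI
      obtain ⟨hs, h1, h2⟩ := step σ' k hf hI
      by_cases hb : b.val σ'
      · obtain ⟨_, _, _, _, h⟩ := h1 hb
        omega
      · exact ⟨_, _, .loopFalse hs hb, h2 hb⟩
    | succ m ih =>
      intro σ' k hm hf hI
      obtain ⟨hs, h1, h2⟩ := step σ' k hf hI
      by_cases hb : b.val σ'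
      · obtain ⟨σ'', l, hx, hI', hμ⟩ := h1 hb
        have hf' : Frame (.loop b c) σ' σ'' :=
          hx.frame.mono (fun _ h => h) (fun _ h => h) (fun _ h => h) (fun _ h => h) (fun h => h)
        obtain ⟨σ₃, l', hx', hq⟩ := ih σ'' _ (by omega) (hf.trans hf') hI'
        refine ⟨_, _, .loopTrue hs hb hx hx', ?_⟩
        change Q σ₃ (k + (b.cost + 1 + l + l'))
        rwa [show k + (b.cost + 1 + l + l') = k + (b.cost + 1) + l + l' by ring]
      · exact ⟨_, _, .loopFalse hs hb, h2 hb⟩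
  have := key _ σ 0 le_rfl (Frame.refl _ _) h0
  simpa using this

/-- `for i = 0, 1, ..., hi - 1 do c` -/
def forN (i : ℕ) (hi : NExpr) (c : Cmd) : Cmd :=
  .seq (.setN i (.const 0)) (.loop (.ltN (.reg i) hi) (.seq c (.setN i (.reg i + .const 1))))

/-- A for loop with an invariant on the counter, the state and the elapsed time. -/
theorem wp_forN_time {i : ℕ} {hi : NExpr} {c : Cmd} (M : ℕ) (I : ℕ → State → ℕ → Prop)
    (hMW : M ≤ W) (hc : c.modN i = false)
    (hhi : ∀ m σ', m ≤ M → Frame (forN i hi c) σ σ' → σ'.nreg i = m →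
      hi.Safe S W σ' ∧ hi.val σ' = M)
    (h0 : I 0 (σ.setN i 0) 0)
    (step : ∀ m σ' k, m < M → Frame (forN i hi c) σ σ' → σ'.nreg i = m → I m σ' k →
      wp S W c σ' fun σ'' l => I (m + 1) (σ''.setN i (m + 1)) (k + l + (hi.cost + 7)))
    (post : ∀ σ' k, Frame (forN i hi c) σ σ' → σ'.nreg i = M → I M σ' k →
      Q σ' (k + (hi.cost + 5))) :
    wp S W (forN i hi c) σ Q := by
  unfold forN
  rw [wp_seq, wp_setN]
  have fr0 : Frame (forN i hi c) σ (σ.setN i 0) :=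
    Frame.seq_left (Exec.setN (S := W) (W := W) σ i (.const 0) (by simp)).frame
  refine ⟨by simp, ?_⟩
  refine wp_loop (fun σ' k => σ'.nreg i ≤ M ∧ I (σ'.nreg i) σ' k) (fun σ' => M - σ'.nreg i)
    (by simpa using h0) ?_
  rintro σ' k hf ⟨hm, hI⟩
  have hf' : Frame (forN i hi c) σ σ' := fr0.trans hf.seq_right
  obtain ⟨hs, hv⟩ := hhi _ σ' hm hf' rfl
  refine ⟨by simp [hs], fun hb => ?_, fun hb => ?_⟩
  · simp only [BExpr.val_ltN, NExpr.val_reg, hv] at hb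
    rw [wp_seq]
    refine wp_mono (step _ σ' k hb hf' rfl hI) ?_
    intro σ'' l hfr h
    have e1 : σ''.nreg i = σ'.nreg i := hfr.nreg i hc
    simp only [wp_setN, NExpr.safe_add, NExpr.safe_reg, NExpr.val_reg, NExpr.safe_const,
      NExpr.val_const, NExpr.val_add, e1, NExpr.cost_add, NExpr.cost_reg, NExpr.cost_const,
      State.nreg_setN, if_true, BExpr.cost_ltN]
    refine ⟨⟨trivial, by omega, by omega⟩, ⟨by omega, ?_⟩, by omega⟩
    -- The successful test costs `hi.cost + 3` and the increment 4, whence the 7. In the final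
    -- bound, 5 is the initialisation, which costs 2, and the constant part of the failing test.
    convert h using 1
    ring
  · simp only [BExpr.val_ltN, NExpr.val_reg, hv] at hb
    have hM : σ'.nreg i = M := by omega
    rw [hM] at hI
    have := post σ' k hf' hM hI
    simp only [NExpr.cost_const, BExpr.cost_ltN, NExpr.cost_reg]
    convert this using 1
    ring

/-- A for loop with an invariant on the counter and the state, and a bound on the running time of
each iteration. -/
theorem wp_forN {i : ℕ} {hi : NExpr} {c : Cmd} (M T : ℕ) (I : ℕ → State → Prop)
    (hMW : M ≤ W) (hc : c.modN i = false)
    (hhi : ∀ m σ', m ≤ M → Frame (forN i hi c) σ σ' → σ'.nreg i = m →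
      hi.Safe S W σ' ∧ hi.val σ' = M)
    (h0 : I 0 (σ.setN i 0))
    (step : ∀ m σ', m < M → Frame (forN i hi c) σ σ' → σ'.nreg i = m → I m σ' →
      wp S W c σ' fun σ'' l => I (m + 1) (σ''.setN i (m + 1)) ∧ l ≤ T)
    (post : ∀ σ' k, Frame (forN i hi c) σ σ' → σ'.nreg i = M → I M σ' →
      k ≤ M * (T + hi.cost + 7) + hi.cost + 5 → Q σ' k) :
    wp S W (forN i hi c) σ Q := by
  refine wp_forN_time M (fun m σ' k => I m σ' ∧ k ≤ m * (T + hi.cost + 7)) hMW hc hhi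
    ⟨h0, by simp⟩ ?_ ?_
  · rintro m σ' k hm hf hr ⟨hI, hk⟩
    refine wp_mono (step m σ' hm hf hr hI) ?_
    rintro σ'' l - ⟨h1, h2⟩
    refine ⟨h1, ?_⟩
    have : (m + 1) * (T + hi.cost + 7) = m * (T + hi.cost + 7) + (T + hi.cost + 7) := by ring
    omega
  · rintro σ' k hf hr ⟨hI, hk⟩
    exact post σ' _ hf hr hI (by omega)

end

theorem Frame.setN {c : Cmd} {i : ℕ} (σ : State) (v : ℕ) (h : c.modN i = true) :
    Frame c σ (σ.setN i v) :=
  ⟨fun j hj => by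
    have : j ≠ i := by rintro rfl; simp [h] at hj
    simp [this], fun _ _ => rfl, fun _ _ => rfl, fun _ _ => rfl, fun _ => rfl⟩

theorem Frame.loop {b : BExpr} {c : Cmd} {σ σ' : State} (h : Frame c σ σ') :
    Frame (.loop b c) σ σ' :=
  h.mono (fun _ h => h) (fun _ h => h) (fun _ h => h) (fun _ h => h) (fun h => h)

theorem Frame.forN {i : ℕ} {hi : NExpr} {c : Cmd} {σ σ' : State} (h : Frame c σ σ') :
    Frame (forN i hi c) σ σ' := h.seq_left.loop.seq_right

/-! ### Binary search -/

/-- Binary search: the first index `p` with `acc p ≥ key` in the range between the integer registers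
10 and 11, where `acc` is evaluated with the index in the integer register 12, and `key` is in the
real register 6. The result is left in the integer register 10. -/
def lowerBound (acc : RExpr) : Cmd :=
  .loop (.ltN (.reg 10) (.reg 11)) (block [
    .setN 12 ((.reg 10 + .reg 11) / .const 2),
    .ite (.ltR acc (.reg 6)) (.setN 10 (.reg 12 + .const 1)) (.setN 11 (.reg 12))])

/-- The numbers before the lower end are below the key, those from the upper end on are not, and
each round halves the length of the gap. With a gap below `2 ^ m` there are at most `m` rounds. -/
theorem wp_lowerBound {S W : ℕ} [Machine S W] {σ : State} {Q : State → ℕ → Prop} {acc : RExpr}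
    (f : ℕ → ℝ) (lo hi m : ℕ) (hlo : σ.nreg 10 = lo) (hhi : σ.nreg 11 = hi) (hle : lo ≤ hi)
    (hW : 2 * hi ≤ W) (hm : hi - lo < 2 ^ m)
    (hf : ∀ i j, lo ≤ i → i ≤ j → j < hi → f i ≤ f j)
    (hacc : ∀ σ', Frame (lowerBound acc) σ σ' → lo ≤ σ'.nreg 12 → σ'.nreg 12 < hi →
      acc.Safe S W σ' ∧ acc.val σ' = f (σ'.nreg 12))
    (post : ∀ σ' k p, Frame (lowerBound acc) σ σ' → σ'.nreg 10 = p → lo ≤ p → p ≤ hi →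
      (∀ q, lo ≤ q → q < p → f q < σ.rreg 6) → (∀ q, p ≤ q → q < hi → σ.rreg 6 ≤ f q) →
      k ≤ (acc.cost + 20) * (m + 1) → Q σ' k) :
    wp S W (lowerBound acc) σ Q := by
  have hB := Machine.big (S := S) (W := W)
  -- The exponent `r` bounds the length of the gap that is left and pays for the rounds to come.
  refine wp_loop (fun σ' k => ∃ l h r, σ'.nreg 10 = l ∧ σ'.nreg 11 = h ∧ lo ≤ l ∧ l ≤ h ∧ h ≤ hi ∧
    (∀ q, lo ≤ q → q < l → f q < σ.rreg 6) ∧ (∀ q, h ≤ q → q < hi → σ.rreg 6 ≤ f q) ∧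
    h - l < 2 ^ r ∧ k + (acc.cost + 20) * r ≤ (acc.cost + 20) * m) (fun σ' => σ'.nreg 11 - σ'.nreg 10)
    ⟨lo, hi, m, hlo, hhi, le_rfl, hle, le_rfl, by intros; omega, by intros; omega, hm, by simp⟩ ?_
  rintro σ' k fr ⟨l, h, r, e1, e2, h1, h2, h3, h4, h5, h6, h7⟩
  refine ⟨by simp, fun hb => ?_, fun hb => ?_⟩
  · simp only [BExpr.val_ltN, NExpr.val_reg, e1, e2] at hb
    have hr : r ≠ 0 := by rintro rfl; simp at h6; omega
    obtain ⟨r, rfl⟩ := Nat.exists_eq_succ_of_ne_zero hr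
    have hp : 2 ^ (r + 1) = 2 * 2 ^ r := by ring
    simp only [Nat.succ_eq_add_one, hp] at h6
    have fr' : Frame (lowerBound acc) σ (σ'.setN 12 ((l + h) / 2)) :=
      fr.trans (Frame.setN _ _ rfl)
    obtain ⟨hs, hv⟩ := hacc _ fr' (by simp; omega) (by simp; omega)
    simp only [State.nreg_setN, if_true] at hv
    have hkey : σ'.rreg 6 = σ.rreg 6 := fr.rreg 6 rfl
    have hk : (acc.cost + 20) * (r + 1) = (acc.cost + 20) * r + (acc.cost + 20) := by ring
    simp only [Nat.succ_eq_add_one, hk] at h7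
    simp only [wp_block_cons, wp_block_nil, wp_setN, wp_ite, NExpr.safe_div, NExpr.safe_add,
      NExpr.safe_reg, NExpr.val_reg, NExpr.safe_const, NExpr.val_div, NExpr.val_add, e1, e2,
      NExpr.val_const, BExpr.safe_ltR, hs, RExpr.safe_reg, BExpr.val_ltR, hv, RExpr.val_reg,
      State.rreg_setN, hkey, State.nreg_setN]
    refine ⟨⟨⟨trivial, trivial, by omega⟩, by omega⟩, ⟨trivial, trivial⟩, fun hlt => ?_, fun hlt => ?_⟩
    · refine ⟨⟨trivial, by omega, by simp; omega⟩, ⟨(l + h) / 2 + 1, h, r, by simp, by simp [e2],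
        by omega, by omega, h3, fun q hq hq' => ?_, h5, by omega, by simp; omega⟩, by simp [e2]; omega⟩
      exact (hf q _ hq (by omega) (by omega)).trans_lt hlt
    · refine ⟨trivial, ⟨l, (l + h) / 2, r, by simp [e1], by simp,
        by omega, by omega, by omega, h4, fun q hq hq' => ?_, by omega, by simp; omega⟩,
        by simp [e1]; omega⟩
      exact (not_lt.1 hlt).trans (hf _ q (by omega) hq hq')
  · simp only [BExpr.val_ltN, NExpr.val_reg, e1, e2] at hb
    have : l = h := by omega
    subst this
    refine post _ _ l fr e1 h1 h3 h4 h5 ?_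
    simp
    have : (acc.cost + 20) * (m + 1) = (acc.cost + 20) * m + (acc.cost + 20) := by ring
    omega

/-! ### Listing the rows of a relation -/

open Classical in
/-- The number of pairs of the relation `C` in the first `u` rows, each of length `M`. -/
noncomputable def rowStart (C : ℕ → ℕ → Prop) (M u : ℕ) : ℕ :=
  ∑ x ∈ Finset.range u, Nat.count (C x) M

/-- For every `u < A`, list the numbers `w < M` that satisfy the test `cond`, where `u` and `w` are in
the integer registers 20 and 21. The lists go to column `oc` and their first positions to column
`sc`. -/
def listRows (A M : NExpr) (cond : BExpr) (sc oc : ℕ) : Cmd := block [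
  .setN 22 (.const 0),
  forN 20 A (block [
    st sc (.reg 20) (.reg 22),
    forN 21 M (.ite cond (block [st oc (.reg 22) (.reg 21), .setN 22 (.reg 22 + .const 1)]) .skip)]),
  st sc A (.reg 22)]

/-- The lists of the rows of the relation `C`, as they are left by `listRows`. -/
structure Rows (C : ℕ → ℕ → Prop) (A M : ℕ) (start list : ℕ → ℕ) : Prop where
  start_eq : ∀ u ≤ A, start u = rowStart C M u
  list_eq : open Classical in ∀ u < A, ∀ w < M, C u w →
    list (rowStart C M u + Nat.count (C u) w) = w

open Classical in
-- The entry for the pair `(u, w)` goes to the position `rowStart C M u + Nat.count (C u) w`, which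
-- is the number of pairs of the relation that precede it lexicographically. The counter in register
-- 22 always equals this number.
theorem wp_listRows {S W : ℕ} [Machine S W] {σ : State} {Q : State → ℕ → Prop} {A M : NExpr}
    {cond : BExpr} {sc oc : ℕ} (C : ℕ → ℕ → Prop) (a m n L : ℕ)
    (hsc : sc < 32) (hoc : oc < 32) (hne : sc ≠ oc) (hn : σ.nreg 2 = n) (hS : 32 * (n + L) ≤ S)
    (haL : a < L) (hmL : m < L) (hcap : rowStart C m a < L)
    (hA : ∀ σ', Frame (listRows A M cond sc oc) σ σ' → A.Safe S W σ' ∧ A.val σ' = a)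
    (hM : ∀ σ', Frame (listRows A M cond sc oc) σ σ' → M.Safe S W σ' ∧ M.val σ' = m)
    (hC : ∀ σ', Frame (listRows A M cond sc oc) σ σ' → σ'.nreg 20 < a → σ'.nreg 21 < m →
      cond.Safe S W σ' ∧ (cond.val σ' ↔ C (σ'.nreg 20) (σ'.nreg 21)))
    (post : ∀ σ' k, Frame (listRows A M cond sc oc) σ σ' → Rows C a m (σ'.na sc) (σ'.na oc) →
      k ≤ a * (m * (cond.cost + M.cost + 30) + M.cost + A.cost + 40) + 2 * A.cost + 40 → Q σ' k) :
    wp S W (listRows A M cond sc oc) σ Q := by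
  have hB := Machine.big (S := S) (W := W)
  have hSW := Machine.le (S := S) (W := W)
  have hmono : ∀ u, u ≤ a → rowStart C m u ≤ rowStart C m a := fun u hu =>
    Finset.sum_le_sum_of_subset (Finset.range_mono hu)
  have hsucc : ∀ u, rowStart C m (u + 1) = rowStart C m u + Nat.count (C u) m := fun u =>
    Finset.sum_range_succ _ _
  let c1 : Cmd := .ite cond (block [st oc (.reg 22) (.reg 21), .setN 22 (.reg 22 + .const 1)]) .skip
  let c2 : Cmd := block [st sc (.reg 20) (.reg 22), forN 21 M c1]
  have hmod2 : (forN 20 A c2).modN 2 = false := rfl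
  unfold listRows
  rw [wp_block_cons, wp_setN]
  refine ⟨by simp, ?_⟩
  have fr0 : Frame (listRows A M cond sc oc) σ (σ.setN 22 0) := Frame.setN _ _ rfl
  rw [wp_block_cons]
  refine wp_forN a (m * (cond.cost + M.cost + 30) + M.cost + 22) (fun u σ' => σ'.nreg 22 = rowStart C m u ∧ (∀ x < u, σ'.na sc x = rowStart C m x) ∧
      ∀ x < u, ∀ w < m, C x w → rowStart C m x + Nat.count (C x) w < rowStart C m u ∧
        σ'.na oc (rowStart C m x + Nat.count (C x) w) = w) (by omega) rfl
    (fun u σ' _ fr _ => hA σ' (fr0.trans fr.seq_left.seq_right)) (by simp [rowStart]) ?_ ?_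
  · rintro u σ' hu fr e20 ⟨e22, h1, h2⟩
    have hn' : σ'.nreg 2 = n := (fr.nreg 2 rfl).trans hn
    have fr1 : Frame (listRows A M cond sc oc) σ σ' := fr0.trans fr.seq_left.seq_right
    have hu' := hmono (u + 1) hu
    rw [hsucc] at hu'
    simp only [wp_block_cons, wp_st, NExpr.safe_reg, NExpr.val_reg, e20, e22, hn']
    refine ⟨trivial, by omega, trivial, ?_⟩
    set σ₁ := σ'.setNA sc u (rowStart C m u) with hσ₁
    have fr2 : Frame (listRows A M cond sc oc) σ σ₁ := fr1.trans
      ⟨fun _ _ => rfl, fun _ _ => rfl, fun b hb => by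
        have : b ≠ 32 * (σ'.nreg 2 + u) + sc := by
          rintro rfl
          have hh : (32 * (σ'.nreg 2 + u) + sc) % 32 = sc := by omega
          rw [hh] at hb
          have : (st sc A (.reg 22)).modNA sc = true := by
            change (sc % 32 == sc) = true
            simp; omega
          simp only [listRows, block, Cmd.modNA, this, Bool.or_eq_false_iff] at hb
          simp at hb
        simp [hσ₁, State.setNA, this], fun _ _ => rfl, fun _ => rfl⟩
    -- The pairs already listed are those before `(u, w)` in lexicographic order. Their positions
    -- are strictly below the counter, so the next entry overwrites none of them.
    refine wp_forN m (cond.cost + 20) (fun w σ' => σ'.nreg 22 = rowStart C m u + Nat.count (C u) w ∧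
      (∀ x < u + 1, σ'.na sc x = rowStart C m x) ∧
      ∀ x w', w' < m → C x w' → (x < u ∨ x = u ∧ w' < w) →
        rowStart C m x + Nat.count (C x) w' < rowStart C m u + Nat.count (C u) w ∧
        σ'.na oc (rowStart C m x + Nat.count (C x) w') = w') (by omega) rfl
      (fun w σ' _ fr' _ => hM σ' (fr2.trans
        fr'.seq_left.seq_right.forN.seq_left.seq_right)) ?_ ?_ ?_
    · refine ⟨by simp [hσ₁, e22], fun x hx => ?_, fun x w' hw' hC' hx => ?_⟩
      · by_cases hxu : x = u
        · simp [hσ₁, hsc, hxu]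
        · simp [hσ₁, hsc, hxu, h1 x (by omega)]
      · have := h2 x (by omega) w' hw' hC'
        simpa [hσ₁, hsc, hoc, hne.symm] using this
    · rintro w σ₂ hw fr' e21 ⟨f22, g1, g2⟩
      have fr3 : Frame (listRows A M cond sc oc) σ σ₂ := fr2.trans
        fr'.seq_left.seq_right.forN.seq_left.seq_right
      have f20 : σ₂.nreg 20 = u := (fr'.nreg 20 rfl).trans (by simp [hσ₁, e20])
      have hn2 : σ₂.nreg 2 = n := (fr'.nreg 2 rfl).trans (by simp [hσ₁, hn'])
      obtain ⟨hs, hv⟩ := hC σ₂ fr3 (by omega) (by omega)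
      rw [f20, e21] at hv
      have hc1 : Nat.count (C u) w ≤ Nat.count (C u) m := Nat.count_monotone _ hw.le
      simp only [wp_ite, wp_block_cons, wp_block_nil, wp_setN, wp_st, wp_skip, hs, hv, e21, f22,
        NExpr.safe_reg, NExpr.val_reg, NExpr.safe_add, NExpr.safe_const, NExpr.val_add,
        NExpr.val_const, State.nreg_setNA, hn2]
      refine ⟨trivial, fun hc => ?_, fun hc => ?_⟩
      · have hcs : Nat.count (C u) (w + 1) = Nat.count (C u) w + 1 := by
          rw [Nat.count_succ, if_pos hc]
        refine ⟨trivial, by omega, trivial, ⟨trivial, by omega, by omega⟩, ⟨by simp [hcs, add_assoc],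
          fun x hx => ?_, fun x w' hw' hC' hx => ?_⟩, by simp⟩
        · simpa [hsc, hoc, hne] using g1 x hx
        · by_cases hxw : x = u ∧ w' = w
          · obtain ⟨rfl, rfl⟩ := hxw
            simp [hoc, hcs]
          · obtain ⟨g3, g4⟩ := g2 x w' hw' hC' (by omega)
            refine ⟨by omega, ?_⟩
            simpa [hoc, g3.ne] using g4
      · have hcs : Nat.count (C u) (w + 1) = Nat.count (C u) w := by
          rw [Nat.count_succ, if_neg hc, add_zero]
        refine ⟨⟨by simp [hcs, f22], by simpa using g1, fun x w' hw' hC' hx => ?_⟩, by omega⟩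
        have : ¬ (x = u ∧ w' = w) := by rintro ⟨rfl, rfl⟩; exact hc hC'
        rw [hcs]
        simpa using g2 x w' hw' hC' (by omega)
    · rintro σ₂ k fr' - ⟨f22, g1, g2⟩ hk
      simp only [wp_block_nil]
      refine ⟨⟨by simp [f22, hsucc], by simpa using g1, fun x hx w' hw' hC' => ?_⟩, ?_⟩
      · rw [hsucc]
        have := g2 x w' hw' hC' (by omega)
        simpa using this
      · have : m * (cond.cost + 20 + M.cost + 7) ≤ m * (cond.cost + M.cost + 30) :=
          Nat.mul_le_mul_left _ (by omega)
        simp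
        omega
  · rintro σ' k fr e20 ⟨e22, h1, h2⟩ hk
    have fr1 : Frame (listRows A M cond sc oc) σ σ' := fr0.trans fr.seq_left.seq_right
    have hn' : σ'.nreg 2 = n := (fr.nreg 2 rfl).trans hn
    obtain ⟨hs, hv⟩ := hA σ' fr1
    simp only [wp_block_cons, wp_block_nil, wp_st, hs, hv, e22, hn', NExpr.val_reg, NExpr.safe_reg]
    refine ⟨trivial, by omega, trivial, post _ _ (fr1.trans ?_) ⟨fun x hx => ?_, fun x hx w hw hc => ?_⟩ ?_⟩
    · have hx : Exec S W (st sc A (.reg 22)) σ' (σ'.setNA sc a (rowStart C m a)) (A.cost + 1 + 7) := by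
        have := (wp_st (S := S) (W := W) (σ := σ') (j := sc) (e := A) (v := .reg 22)
          (Q := fun σ k => σ = σ'.setNA sc a (rowStart C m a) ∧ k = A.cost + 1 + 7)).2
          ⟨hs, by simp [hv]; omega, by simp, by simp [hv, e22]⟩
        obtain ⟨_, _, h, rfl, rfl⟩ := this
        exact h
      exact hx.frame.seq_left.seq_right.seq_right
    · by_cases hxa : x = a
      · simp [hsc, hxa]
      · simp [hsc, hxa, h1 x (by omega)]
    · simpa [hsc, hoc, hne.symm] using (h2 x hx w hw hc).2
    · have : a * (m * (cond.cost + M.cost + 30) + M.cost + 22 + A.cost + 7) ≤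
        a * (m * (cond.cost + M.cost + 30) + M.cost + A.cost + 40) := Nat.mul_le_mul_left _ (by omega)
      simp
      omega

end RealRAM

/-! ### Points and distances -/

abbrev E2 := EuclideanSpace ℝ (Fin 2)

namespace RealRAM

/-- The distance of the points with the coordinates `a, b` and `c, d`. -/
def distE (a b c d : RExpr) : RExpr := .sqrt ((a - c) * (a - c) + (b - d) * (b - d))

@[simp] theorem val_distE (σ : State) (a b c d : RExpr) : (distE a b c d).val σ =
    Real.sqrt ((a.val σ - c.val σ) * (a.val σ - c.val σ) +
      (b.val σ - d.val σ) * (b.val σ - d.val σ)) := rfl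
@[simp] theorem safe_distE (σ : State) (S W : ℕ) (a b c d : RExpr) : (distE a b c d).Safe S W σ ↔
    (a.Safe S W σ ∧ c.Safe S W σ) ∧ (b.Safe S W σ ∧ d.Safe S W σ) := by
  simp [distE]
@[simp] theorem cost_distE (a b c d : RExpr) :
    (distE a b c d).cost = 2 * (a.cost + b.cost + c.cost + d.cost) + 8 := by
  simp [distE]; ring

theorem sqrt_eq_dist (x y : E2) :
    Real.sqrt ((x 0 - y 0) * (x 0 - y 0) + (x 1 - y 1) * (x 1 - y 1)) = dist x y := by
  rw [EuclideanSpace.dist_eq, Fin.sum_univ_two, Real.dist_eq, Real.dist_eq, sq_abs, sq_abs, sq, sq]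

/-! ### Copying the input -/

/-- The memory layout is initialised and the input is copied to its columns: `ε` to the real
register 4, the end points of the edges to column 0, the coordinates to columns 0 and 1. -/
def copyInput : Cmd := block [
  .setN 2 (.reg 0 + .reg 1),
  .setR 4 (.reg 0),
  forN 5 (.reg 1 + .reg 1) (st 0 (.reg 5) (.load (.reg 5))),
  forN 5 (.reg 0) (block [
    rst 0 (.reg 5) (.load (.const 2 * .reg 5)),
    rst 1 (.reg 5) (.load (.const 2 * .reg 5 + .const 1))])]

theorem State.nmem_setNA_of_lt {σ : State} {j i v a : ℕ} (h : a < 32 * σ.nreg 2) :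
    (σ.setNA j i v).nmem a = σ.nmem a := by
  have : a ≠ 32 * (σ.nreg 2 + i) + j := by omega
  simp [setNA, this]

theorem State.rmem_setRA_of_lt {σ : State} {j i a : ℕ} {v : ℝ} (h : a < 32 * σ.nreg 2) :
    (σ.setRA j i v).rmem a = σ.rmem a := by
  have : a ≠ 32 * (σ.nreg 2 + i) + j := by omega
  simp [setRA, this]

/-- The input occupies addresses below `2 * (N + E)` and the columns start at `32 * (N + E)`. No
copy therefore destroys a part of the input that is still to be read. -/
theorem wp_copyInput {S W : ℕ} [Machine S W] {σ : State} {Q : State → ℕ → Prop} (N E L : ℕ)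
    (hN : σ.nreg 0 = N) (hE : σ.nreg 1 = E) (hL : 2 * (N + E) < L) (hS : 32 * (N + E + L) ≤ S)
    (post : ∀ σ' k, Frame copyInput σ σ' → σ'.nreg 2 = N + E → σ'.rreg 4 = σ.rreg 0 →
      (∀ a < 2 * E, σ'.na 0 a = σ.nmem a) →
      (∀ v < N, σ'.ra 0 v = σ.rmem (2 * v) ∧ σ'.ra 1 v = σ.rmem (2 * v + 1)) →
      k ≤ 100 * (N + E) + 100 → Q σ' k) : wp S W copyInput σ Q := by
  have hB := Machine.big (S := S) (W := W)
  have hSW := Machine.le (S := S) (W := W)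
  unfold copyInput
  simp only [wp_block_cons, wp_setN, wp_setR, NExpr.safe_add, NExpr.safe_reg, NExpr.val_reg, hN, hE,
    NExpr.val_add, RExpr.safe_reg, RExpr.val_reg, State.rreg_setN]
  refine ⟨⟨trivial, trivial, by omega⟩, trivial, ?_⟩
  set σ₁ := (σ.setN 2 (N + E)).setR 4 (σ.rreg 0) with hσ₁
  have fr0 : Frame copyInput σ σ₁ := by
    refine (Frame.setN σ (N + E) rfl).trans ⟨fun _ _ => rfl, fun i hi => ?_, fun _ _ => rfl,
      fun _ _ => rfl, fun _ => rfl⟩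
    have : i ≠ 4 := by rintro rfl; exact absurd hi (by decide)
    simp [hσ₁, this]
  have g2 : σ₁.nreg 2 = N + E := by simp [hσ₁]
  refine wp_forN (2 * E) 20 (fun a σ' => (∀ b < 32 * (N + E), σ'.nmem b = σ.nmem b) ∧
    ∀ b < a, σ'.na 0 b = σ.nmem b) (by omega) rfl ?_ ?_ ?_ ?_
  · intro m σ' _ fr _
    have : σ'.nreg 1 = E := (fr.nreg 1 rfl).trans (by simp [hσ₁, hE])
    simp [this]; omega
  · simp [hσ₁]
  · rintro a σ' ha fr e5 ⟨h1, h2⟩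
    have e2 : σ'.nreg 2 = N + E := (fr.nreg 2 rfl).trans g2
    simp only [wp_st, NExpr.safe_reg, NExpr.val_reg, e5, e2, NExpr.safe_load, NExpr.val_load]
    refine ⟨trivial, by omega, ⟨trivial, by omega⟩, ⟨fun b hb => ?_, fun b hb => ?_⟩, by simp⟩
    · rw [State.nmem_setN, State.nmem_setNA_of_lt (by rwa [e2]), h1 b hb]
    · by_cases hba : b = a
      · simp [hba, h1 a (by omega)]
      · simp [hba, h2 b (by omega)]
  · rintro σ₂ k fr2 - ⟨-, h0⟩ hk
    have fr2' := fr0.trans fr2.seq_left.seq_right.seq_right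
    have g2' : σ₂.nreg 2 = N + E := (fr2.nreg 2 rfl).trans g2
    have gR : σ₂.rmem = σ.rmem := by
      funext b
      rw [fr2.rmem b rfl]; simp [hσ₁]
    refine wp_forN N 40 (fun a σ' => (∀ b < 32 * (N + E), σ'.rmem b = σ.rmem b) ∧
      ∀ b < a, σ'.ra 0 b = σ.rmem (2 * b) ∧ σ'.ra 1 b = σ.rmem (2 * b + 1)) (by omega) rfl ?_ ?_ ?_ ?_
    · intro m σ' _ fr _
      have : σ'.nreg 0 = N := (fr.nreg 0 rfl).trans ((fr2'.nreg 0 rfl).trans hN)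
      simp [this]
    · simp [gR]
    · rintro a σ' ha fr e5 ⟨h1, h2⟩
      have e2 : σ'.nreg 2 = N + E := (fr.nreg 2 rfl).trans g2'
      simp only [wp_block_cons, wp_block_nil, wp_rst, NExpr.safe_reg, NExpr.val_reg, e5, e2,
        RExpr.safe_load, RExpr.val_load, NExpr.safe_mul, NExpr.val_mul, NExpr.safe_add,
        NExpr.val_add, NExpr.safe_const, NExpr.val_const, State.nreg_setRA]
      refine ⟨trivial, by omega, ⟨⟨by omega, trivial, by omega⟩, by omega⟩, trivial, by omega,
        ⟨⟨⟨by omega, trivial, by omega⟩, by omega, by omega⟩, by omega⟩,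
        ⟨fun b hb => ?_, fun b hb => ?_⟩, by simp⟩
      · rw [State.rmem_setN, State.rmem_setRA_of_lt (by simpa [e2]),
          State.rmem_setRA_of_lt (by simpa [e2]), h1 b hb]
      · have e3 : (σ'.setRA 0 a (σ'.rmem (2 * a))).rmem (2 * a + 1) = σ.rmem (2 * a + 1) := by
          rw [State.rmem_setRA_of_lt (by rw [e2]; omega), h1 _ (by omega)]
        by_cases hba : b = a
        · rw [h1 (2 * a) (by omega)] at e3
          simp [hba, h1 (2 * a) (by omega), e3]
        · simp [hba, h2 b (by omega)]
    · rintro σ₃ k' fr3 - ⟨-, h1⟩ hk'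
      have fr3' := fr2'.trans fr3.seq_left.seq_right.seq_right.seq_right
      simp only [wp_block_nil]
      have e4 : σ₃.rreg 4 = σ.rreg 0 := by
        rw [fr3.rreg 4 rfl, fr2.rreg 4 rfl]; simp [hσ₁]
      refine post _ _ fr3' ((fr3.nreg 2 rfl).trans g2') e4 (fun b hb => ?_) h1 ?_
      · rw [fr3.na 0 rfl rfl (by decide), h0 b hb]
      · simp only [NExpr.cost_add, NExpr.cost_reg, RExpr.cost_reg] at *
        omega

/-! ### The farthest-first order -/

/-- The first `m` vertices of a farthest-first order of the points `pt 0, ..., pt (N - 1)`. The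
points `pt (perm i)` with `i < j` cover all points with radius `lam j`, and the distance of
`pt (perm j)` to them is at least `lam j`. -/
structure Greedy (N m : ℕ) (pt : ℕ → E2) (perm : ℕ → ℕ) (lam : ℕ → ℝ) : Prop where
  lt : ∀ j < m, perm j < N
  sep : ∀ j < m, ∀ i < j, lam j ≤ dist (pt (perm i)) (pt (perm j))
  cover : ∀ j < m, 1 ≤ j → ∀ v < N, ∃ i < j, dist (pt v) (pt (perm i)) ≤ lam j

/-- Update the distances to the selected vertices (real column 7) when the vertex in register 7 is
selected, and find the farthest vertex. -/
def greedyInner : Cmd :=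
  forN 6 (.reg 0) (block [
    .setR 7 (distE (rld 0 (.reg 6)) (rld 1 (.reg 6)) (rld 0 (.reg 7)) (rld 1 (.reg 7))),
    .ite (.and (.not (.ltN (.reg 5) (.const 1))) (.not (.ltR (.reg 7) (rld 7 (.reg 6)))))
      .skip (rst 7 (.reg 6) (.reg 7)),
    .ite (.ltR (.reg 6) (rld 7 (.reg 6))) (block [.setN 8 (.reg 6), .setR 6 (rld 7 (.reg 6))])
      .skip])

/-- The farthest-first order starting with vertex 0: column 1 lists the vertices, the real columns 2
and 3 their coordinates, and column 4 their distances to the previous vertices. -/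
def greedy : Cmd := block [
  .setN 7 (.const 0),
  forN 5 (.reg 0) (block [
    st 1 (.reg 5) (.reg 7),
    rst 2 (.reg 5) (rld 0 (.reg 7)),
    rst 3 (.reg 5) (rld 1 (.reg 7)),
    rst 4 (.reg 5) (rld 7 (.reg 7)),
    .setR 6 (.ofNat (.const 0) - .ofNat (.const 1)),
    greedyInner,
    .setN 7 (.reg 8)])]

/-- One pass both replaces each distance by its minimum with the distance to the new vertex and
finds the largest of the new values. For `j = 0` the old values are meaningless and are not used. -/
theorem wp_greedy_inner {S W : ℕ} [Machine S W] {σ : State} {Q : State → ℕ → Prop}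
    (N n L j c : ℕ) (pt : ℕ → E2) (near : ℕ → ℝ)
    (hN : σ.nreg 0 = N) (hn : σ.nreg 2 = n) (hj : σ.nreg 5 = j) (hc : σ.nreg 7 = c) (hcN : c < N)
    (h6 : σ.rreg 6 = -1) (hL : N < L) (hS : 32 * (n + L) ≤ S)
    (hpt : ∀ v < N, σ.ra 0 v = pt v 0 ∧ σ.ra 1 v = pt v 1)
    (hnear : ∀ v < N, near v = if j = 0 then dist (pt v) (pt c)
      else min (σ.ra 7 v) (dist (pt v) (pt c))) (hpos : ∀ v < N, 0 ≤ near v)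
    (post : ∀ σ' k, (∀ v < N, σ'.ra 7 v = near v) → σ'.nreg 8 < N →
      (∀ v < N, near v ≤ near (σ'.nreg 8)) → k ≤ N * 200 + 10 → Q σ' k) :
    wp S W greedyInner σ Q := by
  unfold greedyInner
  have hB := Machine.big (S := S) (W := W)
  have hSW := Machine.le (S := S) (W := W)
  refine wp_forN N 180 (fun v σ' => (∀ w < v, σ'.ra 7 w = near w) ∧
    (∀ w, v ≤ w → σ'.ra 7 w = σ.ra 7 w) ∧ (∀ w < v, near w ≤ σ'.rreg 6) ∧
    (v = 0 ∧ σ'.rreg 6 = -1 ∨ σ'.nreg 8 < v ∧ σ'.rreg 6 = near (σ'.nreg 8))) (by omega) rfl ?_ ?_ ?_ ?_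
  · intro m σ' _ fr _
    have : σ'.nreg 0 = N := (fr.nreg 0 rfl).trans hN
    simp [this]
  · simp [h6]
  · rintro v σ' hv fr e6 ⟨h1, h2, h3, h4⟩
    have e2 : σ'.nreg 2 = n := (fr.nreg 2 rfl).trans hn
    have e5 : σ'.nreg 5 = j := (fr.nreg 5 rfl).trans hj
    have e7 : σ'.nreg 7 = c := (fr.nreg 7 rfl).trans hc
    have a0 : ∀ v, σ'.ra 0 v = σ.ra 0 v := fr.ra 0 rfl rfl (by decide)
    have a1 : ∀ v, σ'.ra 1 v = σ.ra 1 v := fr.ra 1 rfl rfl (by decide)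
    have hd : Real.sqrt ((σ'.ra 0 v - σ'.ra 0 c) * (σ'.ra 0 v - σ'.ra 0 c) +
        (σ'.ra 1 v - σ'.ra 1 c) * (σ'.ra 1 v - σ'.ra 1 c)) = dist (pt v) (pt c) := by
      rw [a0, a0, a1, a1, (hpt v hv).1, (hpt v hv).2, (hpt c hcN).1, (hpt c hcN).2, sqrt_eq_dist]
    have h7 : σ'.ra 7 v = σ.ra 7 v := h2 v le_rfl
    have hnv := hnear v hv
    -- The initial maximum -1 lies below all distances, so the first vertex always becomes a
    -- candidate and register 8 is set.
    have hneg : σ'.rreg 6 < near v ∨ v ≠ 0 := by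
      rcases h4 with h4 | h4
      · left; rw [h4.2]; linarith [hpos v hv]
      · right; omega
    -- the last conditional statement, once cell `v` has its final value
    have fin : ∀ σ₂ : State, ∀ k₀ : ℕ, k₀ ≤ 100 → σ₂.nreg 2 = n → σ₂.nreg 6 = v → σ₂.rreg 6 = σ'.rreg 6 →
        σ₂.nreg 8 = σ'.nreg 8 →
        (∀ w, σ₂.ra 7 w = if w = v then near v else σ'.ra 7 w) →
        wp S W (block [.ite (.ltR (.reg 6) (rld 7 (.reg 6)))
          (block [.setN 8 (.reg 6), .setR 6 (rld 7 (.reg 6))]) .skip]) σ₂ fun σ'' l =>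
        ((∀ w < v + 1, (σ''.setN 6 (v + 1)).ra 7 w = near w) ∧
        (∀ w, v + 1 ≤ w → (σ''.setN 6 (v + 1)).ra 7 w = σ.ra 7 w) ∧
        (∀ w < v + 1, near w ≤ (σ''.setN 6 (v + 1)).rreg 6) ∧
        (v + 1 = 0 ∧ (σ''.setN 6 (v + 1)).rreg 6 = -1 ∨ (σ''.setN 6 (v + 1)).nreg 8 < v + 1 ∧
          (σ''.setN 6 (v + 1)).rreg 6 = near ((σ''.setN 6 (v + 1)).nreg 8))) ∧ k₀ + l ≤ 180 := by
      intro σ₂ k₀ hk₀ b2 b6 r6 b8 b7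
      have g1 : ∀ w < v + 1, σ₂.ra 7 w = near w := by
        intro w hw
        rw [b7]
        split_ifs with hwv
        · rw [hwv]
        · exact h1 w (by omega)
      have g2 : ∀ w, v + 1 ≤ w → σ₂.ra 7 w = σ.ra 7 w := by
        intro w hw
        rw [b7, if_neg (by omega), h2 w (by omega)]
      have b7v : σ₂.ra 7 v = near v := g1 v (by omega)
      simp only [wp_block_cons, wp_block_nil, wp_ite, wp_setN, wp_setR, wp_skip, BExpr.safe_ltR,
        safe_rld, BExpr.val_ltR, RExpr.val_reg, val_rld, NExpr.val_reg, NExpr.safe_reg, RExpr.safe_reg,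
        b2, b6, r6, b7v, State.nreg_setN, State.ra_setN, State.ra_setR]
      refine ⟨⟨trivial, trivial, by omega⟩, fun hlt => ?_, fun hlt => ?_⟩
      · refine ⟨trivial, ⟨trivial, by simp [b2]; omega⟩, ⟨by simpa using g1, by simpa using g2, ?_, ?_⟩, by simp; omega⟩
        · intro w hw
          simp [b6, b7v]
          by_cases hwv : w = v
          · rw [hwv]
          · exact (h3 w (by omega)).trans hlt.le
        · right; simp [b6, b7v]
      · refine ⟨⟨by simpa using g1, by simpa using g2, ?_, ?_⟩, by simp; omega⟩
        · intro w hw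
          simp [r6]
          by_cases hwv : w = v
          · rw [hwv]; exact not_lt.1 hlt
          · exact h3 w (by omega)
        · right
          simp [b8, r6]
          rcases h4 with h4 | h4
          · rcases hneg with h | h
            · exact absurd h hlt
            · exact absurd h4.1 h
          · exact ⟨by omega, h4.2⟩
    rw [wp_block_cons, wp_setR]
    refine ⟨by simp [e2, e6, e7]; omega, ?_⟩
    rw [wp_block_cons, wp_ite]
    simp only [val_distE, val_rld, NExpr.val_reg, e6, e7, hd]
    refine ⟨by simp [e2, e6]; omega, fun hb => ?_, fun hb => ?_⟩
    · rw [wp_skip]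
      simp [e5, e6, h7] at hb
      rw [if_neg (by omega), min_eq_left hb.2] at hnv
      refine wp_mono (fin _ 100 le_rfl (by simp [e2]) (by simp [e6]) (by simp) (by simp) ?_) ?_
      · intro w
        split_ifs with hwv
        · simp [hwv, h7, hnv]
        · simp
      · intro σ'' l _ h
        exact ⟨h.1, by simp; omega⟩
    · simp [e5, e6, h7] at hb
      simp only [wp_rst, NExpr.safe_reg, RExpr.safe_reg, NExpr.val_reg, State.nreg_setR, e2, e6,
        RExpr.val_reg, State.rreg_setR, if_true]
      refine ⟨trivial, by omega, trivial, ?_⟩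
      refine wp_mono (fin _ 100 le_rfl (by simp [e2]) (by simp [e6]) (by simp) (by simp) ?_) ?_
      · intro w
        split_ifs with hwv
        · subst hwv
          simp
          split_ifs at hnv with hj0
          · exact hnv.symm
          · rw [min_eq_right (hb (by omega)).le] at hnv
            exact hnv.symm
        · simp [hwv]
      · intro σ'' l _ h
        exact ⟨h.1, by simp; omega⟩
  · rintro σ' k fr - ⟨h1, -, h3, h4⟩ hk
    have h5 : σ'.nreg 8 < N ∧ σ'.rreg 6 = near (σ'.nreg 8) := by
      rcases h4 with h4 | h4
      · omega
      · exact h4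
    refine post σ' k h1 h5.1 (fun v hv => h5.2 ▸ h3 v hv) ?_
    simp at hk
    omega

theorem Greedy.congr {N m : ℕ} {pt : ℕ → E2} {perm perm' : ℕ → ℕ} {lam lam' : ℕ → ℝ}
    (h : Greedy N m pt perm lam) (hp : ∀ i < m, perm' i = perm i) (hl : ∀ i < m, lam' i = lam i) :
    Greedy N m pt perm' lam' := by
  refine ⟨fun j hj => ?_, fun j hj i hi => ?_, fun j hj h1 v hv => ?_⟩
  · rw [hp j hj]; exact h.lt j hj
  · rw [hp j hj, hl j hj, hp i (hi.trans hj)]; exact h.sep j hj i hi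
  · obtain ⟨i, hi, hd⟩ := h.cover j hj h1 v hv
    exact ⟨i, hi, by rwa [hp i (hi.trans hj), hl j hj]⟩

theorem Greedy.snoc {N j : ℕ} {pt : ℕ → E2} {perm : ℕ → ℕ} {lam : ℕ → ℝ}
    (h : Greedy N j pt perm lam) (hlt : perm j < N)
    (hsep : ∀ i < j, lam j ≤ dist (pt (perm i)) (pt (perm j)))
    (hcov : 1 ≤ j → ∀ v < N, ∃ i < j, dist (pt v) (pt (perm i)) ≤ lam j) :
    Greedy N (j + 1) pt perm lam := by
  refine ⟨fun m hm => ?_, fun m hm => ?_, fun m hm => ?_⟩ <;>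
    rcases Nat.lt_succ_iff_lt_or_eq.1 hm with hm | rfl
  · exact h.lt m hm
  · exact hlt
  · exact h.sep m hm
  · exact hsep
  · exact h.cover m hm
  · exact hcov

/-- The vertex selected next is farthest from the selected ones. Its distance to them is thus a
separation for the new vertex and a covering radius for all vertices. -/
theorem wp_greedy {S W : ℕ} [Machine S W] {σ : State} {Q : State → ℕ → Prop}
    (N n L : ℕ) (pt : ℕ → E2) (hN : σ.nreg 0 = N) (hn : σ.nreg 2 = n) (hpos : 0 < N)
    (hL : N < L) (hS : 32 * (n + L) ≤ S)
    (hpt : ∀ v < N, σ.ra 0 v = pt v 0 ∧ σ.ra 1 v = pt v 1)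
    (post : ∀ σ' k, Frame greedy σ σ' → Greedy N N pt (σ'.na 1) (σ'.ra 4) →
      (∀ j < N, σ'.ra 2 j = pt (σ'.na 1 j) 0 ∧ σ'.ra 3 j = pt (σ'.na 1 j) 1) →
      k ≤ N * (N * 200 + 200) + 20 → Q σ' k) : wp S W greedy σ Q := by
  have hB := Machine.big (S := S) (W := W)
  have hSW := Machine.le (S := S) (W := W)
  unfold greedy
  rw [wp_block_cons, wp_setN]
  refine ⟨by simp, ?_⟩
  have fr0 : Frame greedy σ (σ.setN 7 0) := Frame.setN _ _ rfl
  rw [wp_block_cons]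
  refine wp_forN N (N * 200 + 150) (fun j σ' => σ'.nreg 7 < N ∧ Greedy N j pt (σ'.na 1) (σ'.ra 4) ∧
    (∀ i < j, σ'.ra 2 i = pt (σ'.na 1 i) 0 ∧ σ'.ra 3 i = pt (σ'.na 1 i) 1) ∧
    ∀ v < N, (1 ≤ j → σ'.ra 7 v ≤ σ'.ra 7 (σ'.nreg 7)) ∧
      (∀ i < j, σ'.ra 7 v ≤ dist (pt v) (pt (σ'.na 1 i))) ∧
      (1 ≤ j → ∃ i < j, σ'.ra 7 v = dist (pt v) (pt (σ'.na 1 i)))) (by omega) rfl ?_ ?_ ?_ ?_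
  · intro m σ' _ fr _
    have : σ'.nreg 0 = N := (fr.nreg 0 rfl).trans ((fr0.nreg 0 rfl).trans hN)
    simp [this]
  · exact ⟨by simpa using hpos, ⟨by simp, by simp, by simp⟩, by simp, by simp⟩
  · rintro j σ' hj fr e5 ⟨hc, hG, hco, hnear⟩
    obtain ⟨c, e7⟩ : ∃ c, σ'.nreg 7 = c := ⟨_, rfl⟩
    rw [e7] at hc hnear
    have e0 : σ'.nreg 0 = N := (fr.nreg 0 rfl).trans ((fr0.nreg 0 rfl).trans hN)
    have e2 : σ'.nreg 2 = n := (fr.nreg 2 rfl).trans hn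
    have p0 : ∀ v, σ'.ra 0 v = σ.ra 0 v := fun v => (fr.ra 0 rfl rfl (by decide) v).trans
      (fr0.ra 0 rfl rfl (by decide) v)
    have p1 : ∀ v, σ'.ra 1 v = σ.ra 1 v := fun v => (fr.ra 1 rfl rfl (by decide) v).trans
      (fr0.ra 1 rfl rfl (by decide) v)
    simp only [wp_block_cons, wp_block_nil, wp_st, wp_rst, wp_setR, NExpr.safe_reg, NExpr.val_reg,
      safe_rld, val_rld, State.nreg_setNA, State.nreg_setRA, e5, e7, e2, RExpr.safe_sub,
      RExpr.safe_ofNat, NExpr.safe_const, RExpr.val_sub, RExpr.val_ofNat, NExpr.val_const]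
    refine ⟨trivial, by omega, trivial, trivial, by omega, ⟨trivial, by omega⟩, trivial, by omega,
      ⟨trivial, by omega⟩, trivial, by omega, ⟨trivial, by omega⟩, ⟨by omega, by omega⟩, ?_⟩
    obtain ⟨σ₁, hσ₁⟩ : ∃ σ₁, σ₁ = State.setR (State.setRA (State.setRA (State.setRA (σ'.setNA 1 j c) 2 j
      ((σ'.setNA 1 j c).ra 0 c)) 3 j ((State.setRA (σ'.setNA 1 j c) 2 j
      ((σ'.setNA 1 j c).ra 0 c)).ra 1 c)) 4 j ((State.setRA (State.setRA (σ'.setNA 1 j c) 2 j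
      ((σ'.setNA 1 j c).ra 0 c)) 3 j ((State.setRA (σ'.setNA 1 j c) 2 j
      ((σ'.setNA 1 j c).ra 0 c)).ra 1 c)).ra 7 c)) 6 (((0 : ℕ) : ℝ) - ((1 : ℕ) : ℝ)) := ⟨_, rfl⟩
    rw [← hσ₁]
    have q1 : ∀ i, σ₁.na 1 i = if i = j then c else σ'.na 1 i := by intro i; simp [hσ₁]
    have q2 : ∀ i, σ₁.ra 2 i = if i = j then pt c 0 else σ'.ra 2 i := by
      intro i; simp [hσ₁, p0, (hpt c hc).1]
    have q3 : ∀ i, σ₁.ra 3 i = if i = j then pt c 1 else σ'.ra 3 i := by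
      intro i; simp [hσ₁, p1, (hpt c hc).2]
    have q4 : ∀ i, σ₁.ra 4 i = if i = j then σ'.ra 7 c else σ'.ra 4 i := by intro i; simp [hσ₁]
    have q7 : ∀ i, σ₁.ra 7 i = σ'.ra 7 i := by intro i; simp [hσ₁]
    have q0 : ∀ i, σ₁.ra 0 i = σ.ra 0 i := by intro i; simp [hσ₁, p0]
    have q0' : ∀ i, σ₁.ra 1 i = σ.ra 1 i := by intro i; simp [hσ₁, p1]
    -- The distances to the selected vertices after `c` has joined them.
    let near : ℕ → ℝ := fun v => if j = 0 then dist (pt v) (pt c)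
      else min (σ'.ra 7 v) (dist (pt v) (pt c))
    refine wp_mono (wp_greedy_inner (Q := fun σ' k => (∀ v < N, σ'.ra 7 v = near v) ∧ σ'.nreg 8 < N ∧
      (∀ v < N, near v ≤ near (σ'.nreg 8)) ∧ k ≤ N * 200 + 10) N n L j c pt near (by simp [hσ₁, e0])
      (by simp [hσ₁, e2]) (by simp [hσ₁, e5]) (by simp [hσ₁, e7]) hc (by simp [hσ₁]) hL hS
      (fun v hv => by rw [q0, q0']; exact hpt v hv) (fun v _ => by simp only [near, q7])
      (fun v hv => ?_) (fun σ' k h1 h2 h3 h4 => ⟨h1, h2, h3, h4⟩)) ?_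
    · simp only [near]
      split_ifs with h
      · exact dist_nonneg
      · obtain ⟨i, -, hi⟩ := (hnear v hv).2.2 (by omega)
        rw [hi]
        exact le_min dist_nonneg dist_nonneg
    · rintro σ₂ k fr2 ⟨g7, g8, gmax, hk⟩
      have r1 : ∀ i, σ₂.na 1 i = if i = j then c else σ'.na 1 i := fun i =>
        (fr2.na 1 rfl rfl (by decide) i).trans (q1 i)
      have r2 : ∀ i, σ₂.ra 2 i = if i = j then pt c 0 else σ'.ra 2 i := fun i =>
        (fr2.ra 2 rfl rfl (by decide) i).trans (q2 i)
      have r3 : ∀ i, σ₂.ra 3 i = if i = j then pt c 1 else σ'.ra 3 i := fun i =>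
        (fr2.ra 3 rfl rfl (by decide) i).trans (q3 i)
      have r4 : ∀ i, σ₂.ra 4 i = if i = j then σ'.ra 7 c else σ'.ra 4 i := fun i =>
        (fr2.ra 4 rfl rfl (by decide) i).trans (q4 i)
      simp only [wp_setN, NExpr.safe_reg, NExpr.val_reg]
      refine ⟨trivial, ⟨by simpa using g8, ?_, ?_, ?_⟩, by simp; omega⟩
      · have : Greedy N (j + 1) pt (σ₂.na 1) (σ₂.ra 4) := by
          refine Greedy.snoc (hG.congr (fun i hi => by rw [r1, if_neg hi.ne])
            (fun i hi => by rw [r4, if_neg hi.ne])) (by rw [r1, if_pos rfl]; exact hc) ?_ ?_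
          · intro i hi
            rw [r4, r1, r1, if_pos rfl, if_pos rfl, if_neg hi.ne, dist_comm]
            exact (hnear c hc).2.1 i hi
          · intro h1 v hv
            obtain ⟨i, hi, hd⟩ := (hnear v hv).2.2 h1
            refine ⟨i, hi, ?_⟩
            rw [r4, if_pos rfl, r1, if_neg hi.ne, ← hd]
            exact (hnear v hv).1 h1
        exact this.congr (by simp) (by simp)
      · intro i hi
        simp only [State.ra_setN, State.na_setN, ne_eq, not_false_eq_true,
          Nat.reduceEqDiff, r1, r2, r3]
        split_ifs with hij
        · exact ⟨rfl, rfl⟩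
        · exact hco i (by omega)
      · intro v hv
        simp only [State.ra_setN, State.na_setN, ne_eq, not_false_eq_true,
          Nat.reduceEqDiff, State.nreg_setN, if_true, if_false, r1, g7 v hv, g7 _ g8]
        refine ⟨fun _ => gmax v hv, fun i hi => ?_, fun _ => ?_⟩
        · simp only [near]
          split_ifs with h0 hij hij
          · exact le_rfl
          · omega
          · exact min_le_right _ _
          · exact (min_le_left _ _).trans ((hnear v hv).2.1 i (by omega))
        · simp only [near]
          split_ifs with h0
          · exact ⟨j, by omega, by simp⟩
          · rcases min_choice (σ'.ra 7 v) (dist (pt v) (pt c)) with h | h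
            · obtain ⟨i, hi, hd⟩ := (hnear v hv).2.2 (by omega)
              exact ⟨i, by omega, by rw [h, if_neg hi.ne, hd]⟩
            · exact ⟨j, by omega, by rw [h, if_pos rfl]⟩
  · rintro σ' k fr - ⟨-, hG, hco, -⟩ hk
    rw [wp_block_nil]
    refine post _ _ (fr0.trans fr.seq_left.seq_right) hG hco ?_
    simp at hk ⊢
    have : N * (N * 200 + 150 + 1 + 7) ≤ N * (N * 200 + 200) := Nat.mul_le_mul_left _ (by omega)
    omega

section Greedy

variable {N : ℕ} {pt : ℕ → E2} {perm : ℕ → ℕ} {lam : ℕ → ℝ}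

/-- If the covering radius of the first `j` points were not positive, all `N` points would coincide
with some of these `j < N` points, against injectivity. -/
theorem Greedy.lam_pos (h : Greedy N N pt perm lam)
    (hinj : ∀ u < N, ∀ v < N, pt u = pt v → u = v) {j : ℕ} (hj : j < N) (h1 : 1 ≤ j) :
    0 < lam j := by
  by_contra hneg
  have : ∀ v : Fin N, ∃ i : Fin j, pt v = pt (perm i) := by
    intro v
    obtain ⟨i, hi, hd⟩ := h.cover j hj h1 v v.2
    exact ⟨⟨i, hi⟩, dist_le_zero.1 (hd.trans (not_lt.1 hneg))⟩
  choose f hf using this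
  have hfi : Function.Injective f := by
    intro u v huv
    have : pt u = pt v := by rw [hf u, hf v, huv]
    exact Fin.ext (hinj u u.2 v v.2 this)
  have := Fintype.card_le_of_injective f hfi
  simp at this
  omega

/-- Take the first index m ≥ 1 with `lam m < 2 * lam j`. The points before m cover the point j with
radius `lam m`, which gives the distance, and by minimality each of them except the point 0 has
scale at least `2 * lam j`. -/
theorem Greedy.exists_parent (h : Greedy N N pt perm lam)
    (hinj : ∀ u < N, ∀ v < N, pt u = pt v → u = v) {j : ℕ} (hj : j < N) (h1 : 1 ≤ j) :
    ∃ i < j, (i = 0 ∨ 2 * lam j ≤ lam i) ∧ dist (pt (perm i)) (pt (perm j)) ≤ 2 * lam j := by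
  classical
  have hp := h.lam_pos hinj hj h1
  have hex : ∃ m, 1 ≤ m ∧ m ≤ j ∧ lam m < 2 * lam j := ⟨j, h1, le_rfl, by linarith⟩
  obtain ⟨m1, m2, m3⟩ := Nat.find_spec hex
  obtain ⟨i, hi, hd⟩ := h.cover _ (by omega) m1 (perm j) (h.lt j hj)
  refine ⟨i, by omega, ?_, by rw [dist_comm]; linarith⟩
  by_contra hc
  push Not at hc
  exact Nat.find_min hex hi ⟨by omega, by omega, hc.2⟩

end Greedy

/-! ### The tree -/

/-- A tree on the vertices of a farthest-first order. -/
structure Parents (N : ℕ) (q : ℕ → E2) (lam : ℕ → ℝ) (par : ℕ → ℕ) : Prop where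
  zero : par 0 = 0
  lt : ∀ j < N, 1 ≤ j → par j < j
  scale : ∀ j < N, 1 ≤ j → par j = 0 ∨ 2 * lam j ≤ lam (par j)
  dist_le : ∀ j < N, 1 ≤ j → dist (q (par j)) (q j) ≤ 2 * lam j

/-- The parents are computed in the first `N` cells of column 2. -/
def parents : Cmd :=
  forN 5 (.reg 0) (block [
    st 2 (.reg 5) (.const 0),
    forN 6 (.reg 5) (.ite (.and (.ltN (.const 0) (.reg 6)) (.and
        (.not (.ltR (rld 4 (.reg 6)) (.ofNat (.const 2) * rld 4 (.reg 5))))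
        (.not (.ltR (.ofNat (.const 2) * rld 4 (.reg 5))
          (distE (rld 2 (.reg 6)) (rld 3 (.reg 6)) (rld 2 (.reg 5)) (rld 3 (.reg 5)))))))
      (st 2 (.reg 5) (.reg 6)) .skip)])

/-- The program searches only among the indices from 1 on, since `lam 0` carries no information. If
it finds nothing, the parent that is known to exist must be 0, the default value. -/
theorem wp_parents {S W : ℕ} [Machine S W] {σ : State} {Q : State → ℕ → Prop}
    (N n L : ℕ) (q : ℕ → E2) (lam : ℕ → ℝ) (hN : σ.nreg 0 = N) (hpos : 0 < N)
    (hn : σ.nreg 2 = n) (hL : N < L) (hS : 32 * (n + L) ≤ S)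
    (hq : ∀ j < N, σ.ra 2 j = q j 0 ∧ σ.ra 3 j = q j 1) (hlam : ∀ j < N, σ.ra 4 j = lam j)
    (hex : ∀ j < N, 1 ≤ j →
      ∃ i < j, (i = 0 ∨ 2 * lam j ≤ lam i) ∧ dist (q i) (q j) ≤ 2 * lam j)
    (post : ∀ σ' k, Frame parents σ σ' → Parents N q lam (σ'.na 2) →
      k ≤ N * (N * 200 + 50) + 20 → Q σ' k) : wp S W parents σ Q := by
  have hB := Machine.big (S := S) (W := W)
  have hSW := Machine.le (S := S) (W := W)
  refine wp_forN N (N * 200 + 40) (fun j σ' => ∀ i < j, (i = 0 → σ'.na 2 i = 0) ∧ (1 ≤ i → σ'.na 2 i < i ∧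
    (σ'.na 2 i = 0 ∨ 2 * lam i ≤ lam (σ'.na 2 i)) ∧ dist (q (σ'.na 2 i)) (q i) ≤ 2 * lam i))
    (by omega) rfl ?_ ?_ ?_ ?_
  · intro m σ' _ fr _
    have : σ'.nreg 0 = N := (fr.nreg 0 rfl).trans hN
    simp [this]
  · simp
  · intro j σ' hj fr e5 hI
    have e2 : σ'.nreg 2 = n := (fr.nreg 2 rfl).trans hn
    have r2 : ∀ v, σ'.ra 2 v = σ.ra 2 v := fr.ra 2 rfl rfl (by decide)
    have r3 : ∀ v, σ'.ra 3 v = σ.ra 3 v := fr.ra 3 rfl rfl (by decide)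
    have r4 : ∀ v, σ'.ra 4 v = σ.ra 4 v := fr.ra 4 rfl rfl (by decide)
    simp only [wp_block_cons, wp_st, NExpr.safe_reg, NExpr.val_reg, NExpr.safe_const, NExpr.val_const,
      e5, e2]
    refine ⟨trivial, by omega, by omega, ?_⟩
    let P : ℕ → Prop := fun i => 0 < i ∧ 2 * lam j ≤ lam i ∧ dist (q i) (q j) ≤ 2 * lam j
    refine wp_forN j 150 (fun i σ₂ => (∀ x < j, σ₂.na 2 x = σ'.na 2 x) ∧
      (σ₂.na 2 j = 0 ∧ (∀ x < i, ¬ P x) ∨ P (σ₂.na 2 j) ∧ σ₂.na 2 j < i)) (by omega) rfl ?_ ?_ ?_ ?_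
    · intro m σ₂ _ fr2 _
      have : σ₂.nreg 5 = j := (fr2.nreg 5 rfl).trans e5
      simp [this]
    · refine ⟨fun x hx => by simp [hx.ne], Or.inl (by simp)⟩
    · rintro i σ₂ hi fr2 e6 ⟨h1, h2⟩
      have f2 : σ₂.nreg 2 = n := (fr2.nreg 2 rfl).trans e2
      have f5 : σ₂.nreg 5 = j := (fr2.nreg 5 rfl).trans e5
      have s2 : ∀ v, σ₂.ra 2 v = σ.ra 2 v := fun v => (fr2.ra 2 rfl rfl (by decide) v).trans (r2 v)
      have s3 : ∀ v, σ₂.ra 3 v = σ.ra 3 v := fun v => (fr2.ra 3 rfl rfl (by decide) v).trans (r3 v)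
      have s4 : ∀ v, σ₂.ra 4 v = σ.ra 4 v := fun v => (fr2.ra 4 rfl rfl (by decide) v).trans (r4 v)
      have hi' := hq i (hi.trans hj)
      have hj' := hq j hj
      have hd : Real.sqrt ((σ₂.ra 2 i - σ₂.ra 2 j) * (σ₂.ra 2 i - σ₂.ra 2 j) +
        (σ₂.ra 3 i - σ₂.ra 3 j) * (σ₂.ra 3 i - σ₂.ra 3 j)) = dist (q i) (q j) := by
        rw [s2, s2, s3, s3, hi'.1, hi'.2, hj'.1, hj'.2, sqrt_eq_dist]
      simp only [wp_ite, wp_st, wp_skip, BExpr.safe_and, BExpr.safe_ltN, BExpr.safe_not, BExpr.safe_ltR,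
        safe_rld, safe_distE, NExpr.safe_reg, NExpr.safe_const, NExpr.val_reg, NExpr.val_const, e6, f5,
        f2, RExpr.safe_mul, RExpr.safe_ofNat, BExpr.val_and, BExpr.val_ltN, BExpr.val_not,
        BExpr.val_ltR, RExpr.val_mul, RExpr.val_ofNat, val_rld, val_distE, hd, s4, hlam j hj,
        hlam i (hi.trans hj), not_lt, Nat.cast_ofNat]
      refine ⟨⟨⟨by omega, trivial⟩, fun _ => ⟨⟨⟨trivial, by omega⟩, by omega, trivial, by omega⟩,
        fun _ => ⟨⟨by omega, trivial, by omega⟩, ⟨⟨trivial, by omega⟩, trivial, by omega⟩,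
        ⟨trivial, by omega⟩, trivial, by omega⟩⟩⟩, fun hP => ?_, fun hP => ?_⟩
      · refine ⟨trivial, by omega, trivial, ⟨fun x hx => by simp [hx.ne, h1 x hx], Or.inr ?_⟩, by simp⟩
        simpa using hP
      · refine ⟨⟨by simpa using h1, ?_⟩, by simp⟩
        rcases h2 with ⟨h3, h4⟩ | ⟨h3, h4⟩
        · left
          refine ⟨by simpa using h3, fun x hx => ?_⟩
          by_cases hxi : x = i
          · rw [hxi]; exact hP
          · exact h4 x (by omega)
        · right
          simpa using ⟨h3, by omega⟩
    · rintro σ₂ k fr2 - ⟨h1, h2⟩ hk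
      rw [wp_block_nil]
      have : j * (150 + 1 + 7) ≤ N * 200 := Nat.mul_le_mul (by omega) (by omega)
      refine ⟨fun i hi => ?_, by simp at hk ⊢; omega⟩
      simp only [State.na_setN, ne_eq, not_false_eq_true, Nat.reduceEqDiff]
      rcases Nat.lt_succ_iff_lt_or_eq.1 hi with hi | rfl
      · rw [h1 i hi]; exact hI i hi
      · refine ⟨fun h0 => ?_, fun h1 => ?_⟩
        · rcases h2 with h2 | h2
          · exact h2.1
          · omega
        · rcases h2 with ⟨h2, h3⟩ | ⟨h2, h3⟩
          · obtain ⟨a, ha, hb, hc⟩ := hex i hj h1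
            have : a = 0 := by
              by_contra h0
              exact h3 a ha ⟨by omega, hb.resolve_left h0, hc⟩
            rw [h2]
            rw [this] at hc
            exact ⟨by omega, Or.inl rfl, hc⟩
          · exact ⟨h3, Or.inr h2.2.1, h2.2.2⟩
  · intro σ' k fr _ hI hk
    have fr' : Frame parents σ σ' := by unfold parents; exact fr
    have hP : Parents N q lam (σ'.na 2) := ⟨(hI 0 hpos).1 rfl, fun j hj h1 => ((hI j hj).2 h1).1,
      fun j hj h1 => ((hI j hj).2 h1).2.1, fun j hj h1 => ((hI j hj).2 h1).2.2⟩
    refine post _ _ fr' hP ?_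
    have : N * (N * 200 + 40 + 1 + 7) ≤ N * (N * 200 + 50) := Nat.mul_le_mul_left _ (by omega)
    simp only [NExpr.cost_reg] at hk
    exact hk.trans (by linarith)

/-! ### Powers of the parent map for binary lifting -/

/-- The number of bits of `N` goes to the integer register 3, and the corresponding power of two to
the integer register 4. -/
def bitLength : Cmd := block [
  .setN 3 (.const 0), .setN 4 (.const 1),
  .loop (.not (.ltN (.reg 0) (.reg 4))) (block [
    .setN 3 (.reg 3 + .const 1), .setN 4 (.reg 4 * .const 2)])]

theorem wp_bitLength {S W : ℕ} [Machine S W] {σ : State} {Q : State → ℕ → Prop} (N : ℕ)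
    (hN : σ.nreg 0 = N) (hpos : 0 < N) (hW : 2 * N ≤ W)
    (post : ∀ σ' k l, Frame bitLength σ σ' → σ'.nreg 3 = l → σ'.nreg 4 = 2 ^ l → N < 2 ^ l →
      2 ^ l ≤ 2 * N → k ≤ 20 * l + 20 → Q σ' k) : wp S W bitLength σ Q := by
  have hB := Machine.big (S := S) (W := W)
  unfold bitLength
  simp only [wp_block_cons, wp_setN, NExpr.safe_const, NExpr.val_const, wp_block_nil]
  refine ⟨by omega, by omega, ?_⟩
  set σ₁ := (σ.setN 3 0).setN 4 1
  have fr0 : Frame bitLength σ σ₁ := (Frame.setN _ _ rfl).trans (Frame.setN _ _ rfl)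
  refine wp_loop (fun σ' k => ∃ l, σ'.nreg 3 = l ∧ σ'.nreg 4 = 2 ^ l ∧ 2 ^ l ≤ 2 * N ∧ k ≤ 20 * l)
    (fun σ' => 2 * N - σ'.nreg 4) ⟨0, by simp [σ₁]; omega⟩ ?_
  rintro σ' k fr ⟨l, e3, e4, h1, h2⟩
  have e0 : σ'.nreg 0 = N := (fr.nreg 0 rfl).trans ((fr0.nreg 0 rfl).trans hN)
  have hl : l < 2 ^ l := Nat.lt_two_pow_self
  have hp : 2 ^ (l + 1) = 2 ^ l * 2 := pow_succ _ _
  simp only [wp_block_cons, wp_setN, wp_block_nil, BExpr.safe_not, BExpr.safe_ltN, NExpr.safe_reg,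
    BExpr.val_not, BExpr.val_ltN, NExpr.val_reg, e0, e4, e3, NExpr.safe_add, NExpr.safe_const,
    NExpr.val_add, NExpr.val_const, NExpr.safe_mul, NExpr.val_mul, State.nreg_setN, not_not]
  refine ⟨by simp, fun hb => ?_, fun hb => ?_⟩
  · refine ⟨by simp; omega, by simp; omega, ⟨l + 1, by simp, by simp [hp], by omega, by simp; omega⟩, ?_⟩
    simp
    omega
  · exact post _ _ l (fr0.trans fr.seq_left.seq_right.seq_right) e3 e4 hb h1 (by simp; omega)

/-- The ancestors of the vertices at the distances `1, 2, 4, ...` are computed in column 2. -/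
def jumps : Cmd :=
  forN 5 (.reg 3) (forN 6 (.reg 0)
    (st 2 ((.reg 5 + .const 1) * .reg 0 + .reg 6) (ld 2 (.reg 5 * .reg 0 + ld 2 (.reg 5 * .reg 0 + .reg 6)))))

/-- The iterate of order `2 ^ (i + 1)` is the iterate of order `2 ^ i` applied twice; row `i + 1` is
computed from row `i` alone. -/
theorem wp_jumps {S W : ℕ} [Machine S W] {σ : State} {Q : State → ℕ → Prop}
    (N n L l : ℕ) (par : ℕ → ℕ) (hN : σ.nreg 0 = N) (hn : σ.nreg 2 = n) (hl : σ.nreg 3 = l)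
    (hL : (l + 1) * N + l < L) (hS : 32 * (n + L) ≤ S) (hlt : ∀ v < N, par v < N)
    (hpar : ∀ v < N, σ.na 2 v = par v)
    (post : ∀ σ' k, Frame jumps σ σ' → (∀ i ≤ l, ∀ v < N, σ'.na 2 (i * N + v) = par^[2 ^ i] v) →
      k ≤ l * (N * 100 + 50) + 20 → Q σ' k) : wp S W jumps σ Q := by
  have hB := Machine.big (S := S) (W := W)
  have hSW := Machine.le (S := S) (W := W)
  have hlt' : ∀ m, ∀ v < N, par^[m] v < N := by
    intro m
    induction m with
    | zero => simp
    | succ m ih => intro v hv; rw [Function.iterate_succ_apply]; exact ih _ (hlt v hv)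
  -- Rows up to `b` end before row `b + 1` begins, so writing a row keeps the earlier ones.
  have hrow : ∀ a b v, a ≤ b → v < N → a * N + v < (b + 1) * N := by
    intro a b v hab hv
    have : (a + 1) * N ≤ (b + 1) * N := Nat.mul_le_mul_right _ (by omega)
    rw [add_mul, one_mul] at this
    omega
  refine wp_forN l (N * 60 + 20) (fun i σ' => ∀ a ≤ i, ∀ v < N, σ'.na 2 (a * N + v) = par^[2 ^ a] v)
    (by omega) rfl ?_ ?_ ?_ ?_
  · intro m σ' _ fr _
    have : σ'.nreg 3 = l := (fr.nreg 3 rfl).trans hl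
    simp [this]
  · intro a ha v hv
    obtain rfl : a = 0 := by omega
    simpa using hpar v hv
  · intro i σ' hi fr e5 hI
    have e0 : σ'.nreg 0 = N := (fr.nreg 0 rfl).trans hN
    have e2 : σ'.nreg 2 = n := (fr.nreg 2 rfl).trans hn
    have hb : (i + 1 + 1) * N ≤ (l + 1) * N := Nat.mul_le_mul_right _ (by omega)
    have hb' : (i + 1 + 1) * N = (i + 1) * N + N := by ring
    have hb2 : (i + 1) * N = i * N + N := by ring
    refine wp_forN N 40 (fun w σ₂ => (∀ a ≤ i, ∀ v < N, σ₂.na 2 (a * N + v) = par^[2 ^ a] v) ∧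
      ∀ v < w, σ₂.na 2 ((i + 1) * N + v) = par^[2 ^ (i + 1)] v) (by omega) rfl ?_ ?_ ?_ ?_
    · intro m σ₂ _ fr2 _
      have : σ₂.nreg 0 = N := (fr2.nreg 0 rfl).trans e0
      simp [this]
    · exact ⟨by simpa using hI, by simp⟩
    · rintro w σ₂ hw fr2 e6 ⟨h1, h2⟩
      have f0 : σ₂.nreg 0 = N := (fr2.nreg 0 rfl).trans e0
      have f2 : σ₂.nreg 2 = n := (fr2.nreg 2 rfl).trans e2
      have f5 : σ₂.nreg 5 = i := (fr2.nreg 5 rfl).trans e5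
      have hw2 := hlt' (2 ^ i) w hw
      simp only [wp_st, NExpr.safe_add, NExpr.safe_mul, NExpr.safe_reg, NExpr.safe_const, safe_ld,
        NExpr.val_add, NExpr.val_mul, NExpr.val_reg, NExpr.val_const, val_ld, f0, f2, f5, e6,
        h1 i le_rfl w hw, h1 i le_rfl _ hw2, ← Function.iterate_add_apply]
      refine ⟨by simp; omega, by omega, by simp; omega, ⟨fun a ha v hv => ?_, fun v hv => ?_⟩, by simp⟩
      · have := hrow a i v ha hv
        simp [show a * N + v ≠ (i + 1) * N + w by omega, h1 a ha v hv]
      · by_cases hvw : v = w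
        · simp [hvw, pow_succ, mul_two]
        · simp [hvw, h2 v (by omega)]
    · rintro σ₂ k fr2 - ⟨h1, h2⟩ hk
      refine ⟨fun a ha v hv => ?_, by simp at hk; omega⟩
      simp only [State.na_setN, ne_eq, not_false_eq_true, Nat.reduceEqDiff]
      rcases Nat.le_succ_iff.1 ha with ha | rfl
      · exact h1 a ha v hv
      · exact h2 v hv
  · intro σ' k fr _ hI hk
    refine post _ _ fr hI ?_
    have : l * (N * 60 + 20 + 1 + 7) ≤ l * (N * 100 + 50) := Nat.mul_le_mul_left _ (by omega)
    simp at hk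
    omega

/-! ### Sorting by a coordinate -/

/-- The numbers `x 0, ..., x (N - 1)` are sorted: `rk` gives the position in the sorted order, `inv`
is its inverse, and `sorted` lists the numbers in this order. -/
structure Ranking (N : ℕ) (x : ℕ → ℝ) (rk inv : ℕ → ℕ) (sorted : ℕ → ℝ) : Prop where
  rk_lt : ∀ j < N, rk j < N
  inv_rk : ∀ j < N, inv (rk j) = j
  inv_lt : ∀ p < N, inv p < N
  rk_inv : ∀ p < N, rk (inv p) = p
  sorted_eq : ∀ p < N, sorted p = x (inv p)
  mono : ∀ p p', p ≤ p' → p' < N → x (inv p) ≤ x (inv p')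

/-- The order of the numbers by their values of `x`, with ties broken. -/
def Before (x : ℕ → ℝ) (i j : ℕ) : Prop := x i < x j ∨ (¬ x j < x i ∧ i < j)

open Classical in
/-- The position of `x j` in the sorted order. -/
noncomputable def rankOf (N : ℕ) (x : ℕ → ℝ) (j : ℕ) : ℕ := Nat.count (fun i => Before x i j) N

/-- `Before` is transitive and irreflexive. What precedes `i` also precedes `j`, and `i` itself
precedes only `j`. -/
theorem rankOf_lt_rankOf {N : ℕ} {x : ℕ → ℝ} {i j : ℕ} (hi : i < N) (h : Before x i j) :
    rankOf N x i < rankOf N x j := by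
  classical
  simp only [rankOf, Nat.count_eq_card_filter_range]
  refine Finset.card_lt_card (Finset.ssubset_iff_subset_ne.2 ⟨fun a ha => ?_, fun heq => ?_⟩)
  · rw [Finset.mem_filter] at ha ⊢
    simp only [Before] at ha h ⊢
    refine ⟨ha.1, ?_⟩
    rcases ha.2 with h1 | ⟨h1, h2⟩ <;> rcases h with h3 | ⟨h3, h4⟩
    · exact Or.inl (h1.trans h3)
    · exact Or.inl (h1.trans_le (not_lt.1 h3))
    · exact Or.inl ((not_lt.1 h1).trans_lt h3)
    · exact Or.inr ⟨not_lt.2 ((not_lt.1 h1).trans (not_lt.1 h3)), h2.trans h4⟩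
  · have : i ∈ (Finset.range N).filter fun a => Before x a j := by simp [hi, h]
    rw [← heq] at this
    simp [Before] at this

theorem before_or_before {x : ℕ → ℝ} {i j : ℕ} (h : i ≠ j) : Before x i j ∨ Before x j i := by
  unfold Before
  rcases lt_trichotomy (x i) (x j) with h1 | h1 | h1
  · exact Or.inl (Or.inl h1)
  · rcases lt_or_gt_of_ne h with h2 | h2
    · exact Or.inl (Or.inr ⟨h1.le.not_gt, h2⟩)
    · exact Or.inr (Or.inr ⟨h1.ge.not_gt, h2⟩)
  · exact Or.inr (Or.inl h1)

theorem rankOf_inj {N : ℕ} {x : ℕ → ℝ} {i j : ℕ} (hi : i < N) (hj : j < N)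
    (h : rankOf N x i = rankOf N x j) : i = j := by
  by_contra hne
  rcases before_or_before (x := x) hne with hb | hb
  · exact (rankOf_lt_rankOf hi hb).ne h
  · exact (rankOf_lt_rankOf hj hb).ne' h

theorem rankOf_lt {N : ℕ} {x : ℕ → ℝ} {j : ℕ} (hj : j < N) : rankOf N x j < N := by
  classical
  rw [rankOf, Nat.count_eq_card_filter_range]
  calc _ < (Finset.range N).card := Finset.card_lt_card
        ((Finset.filter_ssubset).2 ⟨j, by simpa using hj, by simp [Before]⟩)
    _ = N := Finset.card_range N

/-- Ranks are injective because ties are broken by index, and an injective self-map of a finite set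
is surjective. -/
theorem exists_rankOf_eq {N : ℕ} (x : ℕ → ℝ) {p : ℕ} (hp : p < N) :
    ∃ j < N, rankOf N x j = p := by
  let f : Fin N → Fin N := fun j => ⟨rankOf N x j, rankOf_lt j.2⟩
  have hf : Function.Injective f := fun i j h =>
    Fin.ext (rankOf_inj (x := x) i.2 j.2 (congrArg Fin.val h))
  obtain ⟨j, hj⟩ := Finite.injective_iff_surjective.1 hf ⟨p, hp⟩
  exact ⟨j, j.2, congrArg Fin.val hj⟩

theorem Ranking.of_rankOf {N : ℕ} {x : ℕ → ℝ} {rk inv : ℕ → ℕ} {sorted : ℕ → ℝ}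
    (h1 : ∀ j < N, rk j = rankOf N x j) (h2 : ∀ j < N, inv (rankOf N x j) = j)
    (h3 : ∀ j < N, sorted (rankOf N x j) = x j) : Ranking N x rk inv sorted := by
  refine ⟨fun j hj => h1 j hj ▸ rankOf_lt hj, fun j hj => by rw [h1 j hj, h2 j hj], fun p hp => ?_,
    fun p hp => ?_, fun p hp => ?_, fun p p' hpp hp' => ?_⟩
  · obtain ⟨j, hj, rfl⟩ := exists_rankOf_eq x hp
    rwa [h2 j hj]
  · obtain ⟨j, hj, rfl⟩ := exists_rankOf_eq x hp
    rw [h2 j hj, h1 j hj]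
  · obtain ⟨j, hj, rfl⟩ := exists_rankOf_eq x hp
    rw [h2 j hj, h3 j hj]
  · obtain ⟨j, hj, rfl⟩ := exists_rankOf_eq x (hpp.trans_lt hp')
    obtain ⟨j', hj', rfl⟩ := exists_rankOf_eq x hp'
    rw [h2 j hj, h2 j' hj']
    by_contra hc
    exact absurd (rankOf_lt_rankOf (x := x) hj' (Or.inl (not_le.1 hc))) (not_lt.2 hpp)

/-- Sort the numbers in the real column `c`. The positions go to column `rc`, their inverse to column
`ic`, and the sorted numbers to the real column `sc`. -/
def rank (c rc ic sc : ℕ) : Cmd :=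
  forN 5 (.reg 0) (block [
    .setN 7 (.const 0),
    forN 6 (.reg 0) (.ite (.and (.not (.ltR (rld c (.reg 6)) (rld c (.reg 5))))
        (.not (.and (.not (.ltR (rld c (.reg 5)) (rld c (.reg 6)))) (.ltN (.reg 6) (.reg 5)))))
      .skip (.setN 7 (.reg 7 + .const 1))),
    st rc (.reg 5) (.reg 7),
    st ic (.reg 7) (.reg 5),
    rst sc (.reg 7) (rld c (.reg 5))])

/-- Sorting by counting: the rank of each number is the number of its predecessors. Quadratic time
suffices here. -/
theorem wp_rank {S W : ℕ} [Machine S W] {σ : State} {Q : State → ℕ → Prop} {c rc ic sc : ℕ}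
    (N n L : ℕ) (x : ℕ → ℝ) (hc : c < 32) (hrc : rc < 32) (hic : ic < 32) (hsc : sc < 32)
    (hne : rc ≠ ic) (hmod : (rank c rc ic sc).modRA c = false)
    (hN : σ.nreg 0 = N) (hn : σ.nreg 2 = n) (hL : N < L) (hS : 32 * (n + L) ≤ S)
    (hx : ∀ j < N, σ.ra c j = x j)
    (post : ∀ σ' k, Frame (rank c rc ic sc) σ σ' →
      Ranking N x (σ'.na rc) (σ'.na ic) (σ'.ra sc) → k ≤ N * (N * 200 + 100) + 20 → Q σ' k) :
    wp S W (rank c rc ic sc) σ Q := by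
  classical
  have hB := Machine.big (S := S) (W := W)
  have hSW := Machine.le (S := S) (W := W)
  refine wp_forN N (N * 200 + 80) (fun j σ' => ∀ i < j, σ'.na rc i = rankOf N x i ∧
    σ'.na ic (rankOf N x i) = i ∧ σ'.ra sc (rankOf N x i) = x i) (by omega) rfl ?_ ?_ ?_ ?_
  · intro m σ' _ fr _
    have : σ'.nreg 0 = N := (fr.nreg 0 rfl).trans hN
    simp [this]
  · simp
  · intro j σ' hj fr e5 hI
    have e0 : σ'.nreg 0 = N := (fr.nreg 0 rfl).trans hN
    have e2 : σ'.nreg 2 = n := (fr.nreg 2 rfl).trans hn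
    have rc' : ∀ v, σ'.ra c v = σ.ra c v := fr.ra c hmod rfl hc
    simp only [wp_block_cons, wp_setN, NExpr.safe_const, NExpr.val_const]
    refine ⟨by omega, ?_⟩
    refine wp_forN N 100 (fun i σ₂ => σ₂.nreg 7 = Nat.count (fun a => Before x a j) i) (by omega) rfl
      ?_ ?_ ?_ ?_
    · intro m σ₂ _ fr2 _
      have : σ₂.nreg 0 = N := (fr2.nreg 0 rfl).trans e0
      simp [this]
    · simp
    · intro i σ₂ hi fr2 e6 h1
      have f2 : σ₂.nreg 2 = n := (fr2.nreg 2 rfl).trans e2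
      have f5 : σ₂.nreg 5 = j := (fr2.nreg 5 rfl).trans e5
      have s : ∀ v < N, σ₂.ra c v = x v := fun v hv =>
        (fr2.ra c rfl rfl hc v).trans ((rc' v).trans (hx v hv))
      have hcl : Nat.count (fun a => Before x a j) i ≤ i := Nat.count_le _
      simp only [wp_ite, wp_skip, wp_setN, BExpr.safe_and, BExpr.safe_not, BExpr.safe_ltR,
        BExpr.safe_ltN, safe_rld, NExpr.safe_reg, NExpr.val_reg, f2, f5, e6, BExpr.val_and,
        BExpr.val_not, BExpr.val_ltR, BExpr.val_ltN, val_rld, s i hi, s j hj, NExpr.safe_add,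
        NExpr.safe_const, NExpr.val_add, NExpr.val_const, h1]
      refine ⟨⟨⟨⟨trivial, by omega⟩, trivial, by omega⟩, fun _ => ⟨⟨⟨trivial, by omega⟩, trivial,
        by omega⟩, fun _ => ⟨trivial, trivial⟩⟩⟩, fun hb => ?_, fun hb => ?_⟩
      · have : ¬ Before x i j := by unfold Before; tauto
        refine ⟨?_, by simp⟩
        rw [Nat.count_succ, if_neg this]
        simpa using h1
      · have : Before x i j := by unfold Before; tauto
        refine ⟨⟨trivial, by omega, by omega⟩, ?_, by simp⟩
        rw [Nat.count_succ, if_pos this]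
        simp
    · intro σ₂ k fr2 _ h1 hk
      have f2 : σ₂.nreg 2 = n := (fr2.nreg 2 rfl).trans e2
      have f5 : σ₂.nreg 5 = j := (fr2.nreg 5 rfl).trans e5
      have hr : rankOf N x j < N := rankOf_lt hj
      have h7 : σ₂.nreg 7 = rankOf N x j := h1
      have s : σ₂.ra c j = x j := (fr2.ra c rfl rfl hc j).trans ((rc' j).trans (hx j hj))
      simp only [wp_st, wp_rst, wp_block_nil, NExpr.safe_reg, NExpr.val_reg, f5, f2, h7,
        State.nreg_setNA, safe_rld, val_rld, State.ra_setNA, s]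
      refine ⟨trivial, by omega, trivial, trivial, by omega, trivial, trivial, by omega,
        ⟨trivial, by omega⟩, fun i hi => ?_, by simp at hk ⊢; omega⟩
      have m1 : ∀ v, σ₂.na rc v = σ'.na rc v := fun v => fr2.na rc rfl rfl hrc v
      have m2 : ∀ v, σ₂.na ic v = σ'.na ic v := fun v => fr2.na ic rfl rfl hic v
      have m3 : ∀ v, σ₂.ra sc v = σ'.ra sc v := fun v => fr2.ra sc rfl rfl hsc v
      by_cases hij : i = j
      · simp [hij, hrc, hic, hsc, hne]
      · have hr : rankOf N x i ≠ rankOf N x j := fun h => hij (rankOf_inj (by omega) hj h)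
        simpa [hij, hrc, hic, hsc, hne, hne.symm, hr, m1, m2, m3] using hI i (by omega)
  · intro σ' k fr _ hI hk
    refine post _ _ fr (Ranking.of_rankOf (fun j hj => (hI j hj).1) (fun j hj => (hI j hj).2.1)
      fun j hj => (hI j hj).2.2) ?_
    simp only [NExpr.cost_reg] at hk
    exact hk.trans (by linarith)

/-! ### Counting points in rectangles -/

/-- The number of `i < y` with `s ≤ f i < e`. -/
def cnt (f : ℕ → ℕ) (s e y : ℕ) : ℕ := Nat.count (fun i => s ≤ f i ∧ f i < e) y

theorem cnt_succ (f : ℕ → ℕ) (s e y : ℕ) :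
    cnt f s e (y + 1) = cnt f s e y + if s ≤ f y ∧ f y < e then 1 else 0 := Nat.count_succ _ _

theorem cnt_add {f : ℕ → ℕ} {s m e : ℕ} (hsm : s ≤ m) (hme : m ≤ e) (y : ℕ) :
    cnt f s m y + cnt f m e y = cnt f s e y := by
  induction y with
  | zero => simp [cnt]
  | succ y ih =>
    simp only [cnt_succ]
    split_ifs <;> omega

theorem cnt_mono (f : ℕ → ℕ) (s e : ℕ) {y y' : ℕ} (h : y ≤ y') : cnt f s e y ≤ cnt f s e y' :=
  Nat.count_monotone _ h

/-- By injectivity of `f`, a block of values is hit at most as often as it is long. This bounds the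
space of a block in the table. -/
theorem cnt_le {f : ℕ → ℕ} {N : ℕ} (hf : ∀ i < N, ∀ j < N, f i = f j → i = j) (s e : ℕ) {y : ℕ}
    (hy : y ≤ N) : cnt f s e y ≤ e - s := by
  rw [cnt, Nat.count_eq_card_filter_range, ← Nat.card_Ico]
  refine Finset.card_le_card_of_injOn f (fun i hi => ?_) (fun i hi j hj h => ?_)
  · simp at hi
    simpa using hi.2
  · simp at hi hj
    exact hf i (by omega) j (by omega) h

/-- The first cell of the table of the block of level `k` that starts at `x`. -/
def tableBase (l k x : ℕ) : ℕ := 2 * (k * 2 ^ l + x)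

/-- A table for counting in the blocks of length `2 ^ k` for `k ≤ l`. -/
def WaveletTable (f : ℕ → ℕ) (N l : ℕ) (T : ℕ → ℕ) : Prop :=
  ∀ k < l, ∀ b, (b + 1) * 2 ^ (k + 1) ≤ 2 ^ l → ∀ y ≤ N,
    T (tableBase l (k + 1) (b * 2 ^ (k + 1)) + cnt f (b * 2 ^ (k + 1)) ((b + 1) * 2 ^ (k + 1)) y) =
      cnt f (b * 2 ^ (k + 1)) (b * 2 ^ (k + 1) + 2 ^ k) y

/-- A block of length `2 ^ k` needs the `2 ^ k + 1` cells for the counts from 0 to `2 ^ k`. The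
factor 2 in `tableBase` gives it `2 * 2 ^ k` cells, so the blocks of all levels are disjoint. -/
theorem tableBase_inj {l k k' b b' p p' : ℕ} (hb : (b + 1) * 2 ^ k ≤ 2 ^ l)
    (hb' : (b' + 1) * 2 ^ k' ≤ 2 ^ l) (hp : p ≤ 2 ^ k) (hp' : p' ≤ 2 ^ k')
    (h : tableBase l k (b * 2 ^ k) + p = tableBase l k' (b' * 2 ^ k') + p') :
    k = k' ∧ b = b' ∧ p = p' := by
  have h1 : 0 < 2 ^ k := by positivity
  have h2 : 0 < 2 ^ k' := by positivity
  rw [add_mul, one_mul] at hb hb'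
  unfold tableBase at h
  have hk : k = k' := by
    by_contra hne
    rcases lt_or_gt_of_ne hne with hlt | hlt
    · have := Nat.mul_le_mul_right (2 ^ l) (show k + 1 ≤ k' from hlt)
      rw [add_mul, one_mul] at this
      omega
    · have := Nat.mul_le_mul_right (2 ^ l) (show k' + 1 ≤ k from hlt)
      rw [add_mul, one_mul] at this
      omega
  subst hk
  have hbb : b = b' := by
    by_contra hne
    rcases lt_or_gt_of_ne hne with hlt | hlt
    · have := Nat.mul_le_mul_right (2 ^ k) (show b + 1 ≤ b' from hlt)
      rw [add_mul, one_mul] at this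
      omega
    · have := Nat.mul_le_mul_right (2 ^ k) (show b' + 1 ≤ b from hlt)
      rw [add_mul, one_mul] at this
      omega
  subst hbb
  exact ⟨rfl, rfl, by omega⟩

/-- The positions by the first coordinate, in the order of the second coordinate, go to column 9. -/
def compose : Cmd := forN 5 (.reg 0) (st 9 (.reg 5) (ld 5 (ld 8 (.reg 5))))

theorem wp_compose {S W : ℕ} [Machine S W] {σ : State} {Q : State → ℕ → Prop} (N n L : ℕ)
    (hN : σ.nreg 0 = N) (hn : σ.nreg 2 = n) (hL : N < L) (hS : 32 * (n + L) ≤ S)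
    (h8 : ∀ y < N, σ.na 8 y < N)
    (post : ∀ σ' k, Frame compose σ σ' → (∀ y < N, σ'.na 9 y = σ.na 5 (σ.na 8 y)) →
      k ≤ N * 50 + 20 → Q σ' k) : wp S W compose σ Q := by
  have hB := Machine.big (S := S) (W := W)
  have hSW := Machine.le (S := S) (W := W)
  refine wp_forN N 30 (fun m σ' => ∀ y < m, σ'.na 9 y = σ.na 5 (σ.na 8 y)) (by omega) rfl ?_ ?_ ?_ ?_
  · intro m σ' _ fr _
    have : σ'.nreg 0 = N := (fr.nreg 0 rfl).trans hN
    simp [this]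
  · simp
  · intro m σ' hm fr e5 hI
    have e2 : σ'.nreg 2 = n := (fr.nreg 2 rfl).trans hn
    have a8 : ∀ v, σ'.na 8 v = σ.na 8 v := fr.na 8 rfl rfl (by decide)
    have a5 : ∀ v, σ'.na 5 v = σ.na 5 v := fr.na 5 rfl rfl (by decide)
    have := h8 m hm
    simp only [wp_st, NExpr.safe_reg, safe_ld, val_ld, NExpr.val_reg, e5, e2, a8, a5]
    refine ⟨trivial, by omega, ⟨⟨trivial, by omega⟩, by omega⟩, fun y hy => ?_, by simp⟩
    by_cases hym : y = m
    · simp [hym]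
    · simp [hym, hI y (by omega)]
  · intro σ' k fr _ hI hk
    refine post _ _ fr hI ?_
    simp only [NExpr.cost_reg] at hk
    exact hk.trans (by linarith)

/-- Count the numbers in column 9, before the position in register 6, that lie in the block that
starts at the number in register 14, and those in its left half. -/
def countBlock : Cmd := block [
  .setN 8 (.const 0), .setN 9 (.const 0),
  forN 7 (.reg 6) (block [
    .ite (.and (.not (.ltN (ld 9 (.reg 7)) (.reg 14))) (.ltN (ld 9 (.reg 7)) (.reg 14 + .reg 13 * .const 2)))
      (.setN 8 (.reg 8 + .const 1)) .skip,
    .ite (.and (.not (.ltN (ld 9 (.reg 7)) (.reg 14))) (.ltN (ld 9 (.reg 7)) (.reg 14 + .reg 13)))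
      (.setN 9 (.reg 9 + .const 1)) .skip])]

theorem wp_countBlock {S W : ℕ} [Machine S W] {σ : State} {Q : State → ℕ → Prop} (n L y h x : ℕ)
    (f : ℕ → ℕ) (hn : σ.nreg 2 = n) (hy : σ.nreg 6 = y) (hh : σ.nreg 13 = h) (hx : σ.nreg 14 = x)
    (hL : y < L) (hxL : x + h * 2 < L) (hS : 32 * (n + L) ≤ S) (hf : ∀ i < y, σ.na 9 i = f i)
    (post : ∀ σ' k, Frame countBlock σ σ' → σ'.nreg 8 = cnt f x (x + h * 2) y →
      σ'.nreg 9 = cnt f x (x + h) y → k ≤ y * 100 + 20 → Q σ' k) : wp S W countBlock σ Q := by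
  have hB := Machine.big (S := S) (W := W)
  have hSW := Machine.le (S := S) (W := W)
  unfold countBlock
  simp only [wp_block_cons, wp_setN, NExpr.safe_const, NExpr.val_const]
  refine ⟨by omega, by omega, ?_⟩
  set σ₁ := (σ.setN 8 0).setN 9 0 with hσ₁
  have fr0 : Frame countBlock σ σ₁ := (Frame.setN _ _ rfl).trans (Frame.setN _ _ rfl)
  refine wp_forN y 80 (fun m σ' => σ'.nreg 8 = cnt f x (x + h * 2) m ∧ σ'.nreg 9 = cnt f x (x + h) m)
    (by omega) rfl ?_ ?_ ?_ ?_
  · intro m σ' _ fr _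
    have : σ'.nreg 6 = y := (fr.nreg 6 rfl).trans hy
    simp [this]
  · simp [hσ₁, cnt]
  · rintro m σ' hm fr e7 ⟨h1, h2⟩
    have e2 : σ'.nreg 2 = n := (fr.nreg 2 rfl).trans hn
    have e13 : σ'.nreg 13 = h := (fr.nreg 13 rfl).trans hh
    have e14 : σ'.nreg 14 = x := (fr.nreg 14 rfl).trans hx
    have a9 : σ'.na 9 m = f m := (fr.na 9 rfl rfl (by decide) m).trans (by simpa [hσ₁] using hf m hm)
    have c1 : cnt f x (x + h * 2) m ≤ m := Nat.count_le _
    have c2 : cnt f x (x + h) m ≤ m := Nat.count_le _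
    simp only [wp_block_cons, wp_block_nil, wp_ite, wp_setN, wp_skip, BExpr.safe_and, BExpr.safe_not,
      BExpr.safe_ltN, safe_ld, NExpr.safe_reg, NExpr.val_reg, NExpr.safe_add, NExpr.safe_mul,
      NExpr.safe_const, val_ld, NExpr.val_add, NExpr.val_mul, NExpr.val_const, BExpr.val_and,
      BExpr.val_not, BExpr.val_ltN, e2, e7, e13, e14, a9, h1, h2, State.nreg_setN, State.na_setN,
      ne_eq, not_false_eq_true, Nat.reduceEqDiff, if_true, if_false, not_lt, cnt_succ]
    have s1 : 32 * (n + m) + 9 < S := by omega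
    have s2 : x + h * 2 ≤ W := by omega
    have s3 : x + h ≤ W := by omega
    have s4 : h * 2 ≤ W := by omega
    have s5 : 1 ≤ W := by omega
    have s6 : 2 ≤ W := by omega
    have s7 : m + 1 ≤ W := by omega
    have s8 : cnt f x (x + h * 2) m + 1 ≤ W := by omega
    have s9 : cnt f x (x + h) m + 1 ≤ W := by omega
    by_cases b1 : x ≤ f m ∧ f m < x + h * 2 <;> by_cases b2 : x ≤ f m ∧ f m < x + h <;>
      simp [b1, b2, s1, s2, s3, s4, s5, s6, s7, s8, s9, e7, e2, h1, h2]
  · rintro σ' k fr _ ⟨h1, h2⟩ hk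
    rw [wp_block_nil]
    refine post _ _ (fr0.trans fr.seq_left.seq_right.seq_right) h1 h2 ?_
    simp only [NExpr.cost_reg, NExpr.cost_const] at hk ⊢
    omega

/-- The table for counting the numbers in column 9 goes to column 10. -/
def wavelet : Cmd := block [
  .setN 13 (.const 1),
  forN 5 (.reg 3) (block [
    forN 6 (.reg 0) (block [
      .setN 14 (ld 9 (.reg 6) / (.reg 13 * .const 2) * (.reg 13 * .const 2)),
      countBlock,
      .ite (.ltN (ld 9 (.reg 6)) (.reg 14 + .reg 13)) (.setN 9 (.reg 9 + .const 1)) .skip,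
      st 10 (.const 2 * ((.reg 5 + .const 1) * .reg 4 + .reg 14) + (.reg 8 + .const 1)) (.reg 9)]),
    .setN 13 (.reg 13 * .const 2)])]

/-- At each level, a position `y` changes the counts of only the one block that contains `f y`. The
program counts afresh for this block and stores a single entry. Entries with count 0 are never
written, which is why column 10 has to be zero at the start. -/
theorem wp_wavelet {S W : ℕ} [Machine S W] {σ : State} {Q : State → ℕ → Prop} (N n L l : ℕ)
    (f : ℕ → ℕ) (hN : σ.nreg 0 = N) (hn : σ.nreg 2 = n) (hl : σ.nreg 3 = l) (hP : σ.nreg 4 = 2 ^ l)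
    (hL : 2 * ((l + 2) * 2 ^ l) + N < L) (hS : 32 * (n + L) ≤ S) (hf : ∀ i < N, σ.na 9 i = f i)
    (hlt : ∀ i < N, f i < 2 ^ l) (hinj : ∀ i < N, ∀ j < N, f i = f j → i = j)
    (h0 : ∀ i, σ.na 10 i = 0)
    (post : ∀ σ' k, Frame wavelet σ σ' → WaveletTable f N l (σ'.na 10) →
      k ≤ l * (N * (N * 100 + 200) + 50) + 20 → Q σ' k) : wp S W wavelet σ Q := by
  have hB := Machine.big (S := S) (W := W)
  have hSW := Machine.le (S := S) (W := W)
  have hll : l < 2 ^ l := Nat.lt_two_pow_self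
  have hl2 : (l + 2) * 2 ^ l = l * 2 ^ l + 2 * 2 ^ l := by ring
  unfold wavelet
  rw [wp_block_cons, wp_setN]
  refine ⟨by simp; omega, ?_⟩
  have fr0 : Frame wavelet σ (σ.setN 13 1) := Frame.setN _ _ rfl
  rw [wp_block_cons]
  -- the table is correct for the positions up to `y` at level `m + 1` and for all positions below
  let I : ℕ → ℕ → (ℕ → ℕ) → Prop := fun m y T =>
    ∀ k < l, ∀ b, (b + 1) * 2 ^ (k + 1) ≤ 2 ^ l →
      ∀ y' ≤ (if k < m then N else if k = m then y else 0),
      T (tableBase l (k + 1) (b * 2 ^ (k + 1)) + cnt f (b * 2 ^ (k + 1)) ((b + 1) * 2 ^ (k + 1)) y') =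
        cnt f (b * 2 ^ (k + 1)) (b * 2 ^ (k + 1) + 2 ^ k) y'
  refine wp_forN l (N * (N * 100 + 200) + 30) (fun m σ' => σ'.nreg 13 = 2 ^ m ∧ I m 0 (σ'.na 10)) (by omega) rfl ?_ ?_ ?_ ?_
  · intro m σ' _ fr _
    have : σ'.nreg 3 = l := (fr.nreg 3 rfl).trans hl
    simp [this]
  · refine ⟨by simp, fun k _ b _ y hy => ?_⟩
    simp at hy
    subst hy
    simp [cnt, h0]
  · rintro m σ' hm fr e5 ⟨e13, hI⟩
    have e0 : σ'.nreg 0 = N := (fr.nreg 0 rfl).trans hN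
    have hm2 : 2 ^ (m + 1) ≤ 2 ^ l := Nat.pow_le_pow_right (by omega) hm
    have hms : 2 ^ (m + 1) = 2 ^ m * 2 := pow_succ _ _
    have hmp : 0 < 2 ^ m := by positivity
    rw [wp_block_cons]
    refine wp_forN N (N * 100 + 150) (fun y σ₂ => I m y (σ₂.na 10)) (by omega) rfl ?_ ?_ ?_ ?_
    · intro m σ₂ _ fr2 _
      have : σ₂.nreg 0 = N := (fr2.nreg 0 rfl).trans e0
      simp [this]
    · simpa [I] using hI
    · intro y σ₂ hy fr2 e6 hI2
      have f2 : σ₂.nreg 2 = n := (fr2.nreg 2 rfl).trans ((fr.nreg 2 rfl).trans hn)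
      have f4 : σ₂.nreg 4 = 2 ^ l := (fr2.nreg 4 rfl).trans ((fr.nreg 4 rfl).trans hP)
      have f5 : σ₂.nreg 5 = m := (fr2.nreg 5 rfl).trans e5
      have f13 : σ₂.nreg 13 = 2 ^ m := (fr2.nreg 13 rfl).trans e13
      have a9 : ∀ i < N, σ₂.na 9 i = f i := fun i hi => by
        rw [fr2.na 9 rfl rfl (by decide), fr.na 9 rfl rfl (by decide), State.na_setN _ _ _ _ _ (by decide), hf i hi]
      obtain ⟨b, hb⟩ : ∃ b, b = f y / 2 ^ (m + 1) := ⟨_, rfl⟩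
      have hb1 : b * 2 ^ (m + 1) ≤ f y := by rw [hb]; exact Nat.div_mul_le_self _ _
      have hb2 : f y < (b + 1) * 2 ^ (m + 1) := by
        rw [hb, add_mul, one_mul]; exact Nat.lt_div_mul_add (by positivity)
      have hfy := hlt y hy
      have hb3 : (b + 1) * 2 ^ (m + 1) ≤ 2 ^ l := by
        -- The whole range is a multiple of the block length, so a block that begins inside it also
        -- ends inside it.
        rw [show 2 ^ l = 2 ^ (l - (m + 1)) * 2 ^ (m + 1) by
          rw [← pow_add]; congr 1; omega]
        refine Nat.mul_le_mul_right _ (Nat.lt_of_mul_lt_mul_right (a := 2 ^ (m + 1)) ?_)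
        calc b * 2 ^ (m + 1) ≤ f y := hb1
          _ < 2 ^ l := hfy
          _ = _ := by rw [← pow_add]; congr 1; omega
      have hb4 : (b + 1) * 2 ^ (m + 1) = b * 2 ^ (m + 1) + 2 ^ (m + 1) := by ring
      have hml : (m + 1) * 2 ^ l ≤ l * 2 ^ l := Nat.mul_le_mul_right _ hm
      rw [wp_block_cons, wp_setN]
      simp only [NExpr.safe_mul, NExpr.safe_div, safe_ld, NExpr.safe_reg, NExpr.val_reg,
        NExpr.safe_const, NExpr.val_mul, NExpr.val_const, NExpr.val_div, val_ld, e6, f2, f13, a9 y hy,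
        ← hms, ← hb]
      refine ⟨⟨⟨⟨trivial, by omega⟩, trivial, by omega, by omega⟩, ⟨trivial, by omega, by omega⟩,
        by omega⟩, ?_⟩
      rw [wp_block_cons]
      refine wp_countBlock n L y (2 ^ m) (b * 2 ^ (m + 1)) f (by simp [f2]) (by simp [e6])
        (by simp [f13]) (by simp) (by omega) (by omega) hS (fun i hi => by simp [a9 i (by omega)]) ?_
      intro σ₃ k fr3 c8 c9 hk
      rw [← hms, ← hb4] at c8
      have g2 : σ₃.nreg 2 = n := (fr3.nreg 2 rfl).trans (by simp [f2])
      have g4 : σ₃.nreg 4 = 2 ^ l := (fr3.nreg 4 rfl).trans (by simp [f4])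
      have g5 : σ₃.nreg 5 = m := (fr3.nreg 5 rfl).trans (by simp [f5])
      have g6 : σ₃.nreg 6 = y := (fr3.nreg 6 rfl).trans (by simp [e6])
      have g13 : σ₃.nreg 13 = 2 ^ m := (fr3.nreg 13 rfl).trans (by simp [f13])
      have g14 : σ₃.nreg 14 = b * 2 ^ (m + 1) := (fr3.nreg 14 rfl).trans (by simp)
      have g9 : σ₃.na 9 y = f y := (fr3.na 9 rfl rfl (by decide) y).trans (by simp [a9 y hy])
      have g10 : ∀ i, σ₃.na 10 i = σ₂.na 10 i := fun i =>
        (fr3.na 10 rfl rfl (by decide) i).trans (by simp)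
      have hc : cnt f (b * 2 ^ (m + 1)) ((b + 1) * 2 ^ (m + 1)) y ≤ 2 ^ (m + 1) :=
        (cnt_le hinj _ _ hy.le).trans (by rw [hb4, Nat.add_sub_cancel_left])
      have hc' : cnt f (b * 2 ^ (m + 1)) (b * 2 ^ (m + 1) + 2 ^ m) y ≤ y := Nat.count_le _
      have hcs : cnt f (b * 2 ^ (m + 1)) ((b + 1) * 2 ^ (m + 1)) (y + 1) =
          cnt f (b * 2 ^ (m + 1)) ((b + 1) * 2 ^ (m + 1)) y + 1 := by
        rw [cnt_succ, if_pos ⟨hb1, hb2⟩]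
      -- the effect of the last two statements
      have fin : ∀ v, v = cnt f (b * 2 ^ (m + 1)) (b * 2 ^ (m + 1) + 2 ^ m) (y + 1) → ∀ T : ℕ → ℕ,
          (∀ i, T i = if i = tableBase l (m + 1) (b * 2 ^ (m + 1)) +
            cnt f (b * 2 ^ (m + 1)) ((b + 1) * 2 ^ (m + 1)) (y + 1) then v else σ₂.na 10 i) →
          I m (y + 1) T := by
        intro v hv T hT k hk b' hb' y' hy'
        rw [hT]
        have hy'N : y' ≤ N := by split_ifs at hy' <;> omega
        have hb5 : (b' + 1) * 2 ^ (k + 1) = b' * 2 ^ (k + 1) + 2 ^ (k + 1) := by ring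
        have hcy : cnt f (b' * 2 ^ (k + 1)) ((b' + 1) * 2 ^ (k + 1)) y' ≤ 2 ^ (k + 1) :=
          (cnt_le hinj _ _ hy'N).trans (by rw [hb5, Nat.add_sub_cancel_left])
        have hcy2 : cnt f (b * 2 ^ (m + 1)) ((b + 1) * 2 ^ (m + 1)) (y + 1) ≤ 2 ^ (m + 1) :=
          (cnt_le hinj _ _ (show y + 1 ≤ N from hy)).trans (by rw [hb4, Nat.add_sub_cancel_left])
        split_ifs with heq
        -- The new cell can only belong to a position of the same block with the same count. The
        -- count has just risen to this value at `y + 1`, so that is the only such position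
        -- processed so far.
        · obtain ⟨h1, h2, h3⟩ := tableBase_inj hb' hb3 hcy hcy2 heq
          have h1 : k = m := by omega
          subst h1
          subst h2
          rw [hv]
          simp only [lt_irrefl, if_false, if_true] at hy'
          by_contra hne
          have hy'' : y' ≤ y := by
            by_contra hc
            have : y' = y + 1 := by omega
            rw [this] at hne
            exact hne rfl
          have := cnt_mono f (b' * 2 ^ (k + 1)) ((b' + 1) * 2 ^ (k + 1)) hy''
          omega
        · by_cases hyy : k = m ∧ y' = y + 1
          · obtain ⟨rfl, rfl⟩ := hyy
            -- Another block of the same level does not contain `f y`. Its counts at `y + 1` are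
            -- those at `y`, and the old entry serves again.
            have hbb : b' ≠ b := by
              rintro rfl
              exact heq rfl
            have hout : ¬ (b' * 2 ^ (k + 1) ≤ f y ∧ f y < (b' + 1) * 2 ^ (k + 1)) := by
              rintro ⟨h1, h2⟩
              rcases lt_or_gt_of_ne hbb with hlt | hlt
              · have := Nat.mul_le_mul_right (2 ^ (k + 1)) (show b' + 1 ≤ b from hlt)
                omega
              · have := Nat.mul_le_mul_right (2 ^ (k + 1)) (show b + 1 ≤ b' from hlt)
                omega
            rw [cnt_succ, if_neg hout, cnt_succ, if_neg (fun h => hout ⟨h.1, by omega⟩)]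
            exact hI2 k hk b' hb' y (by simp)
          · refine hI2 k hk b' hb' y' ?_
            split_ifs at hy' ⊢ <;> omega
      have hbase : 2 * ((m + 1) * 2 ^ l + b * 2 ^ (m + 1)) = tableBase l (m + 1) (b * 2 ^ (m + 1)) := rfl
      have hbl : tableBase l (m + 1) (b * 2 ^ (m + 1)) ≤ 2 * (l * 2 ^ l + 2 ^ l) := by
        unfold tableBase; omega
      simp only [wp_block_cons, wp_block_nil, wp_ite, wp_setN, wp_skip, wp_st, BExpr.safe_ltN,
        BExpr.val_ltN, safe_ld, val_ld, NExpr.safe_add, NExpr.val_add, NExpr.safe_mul, NExpr.val_mul,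
        NExpr.safe_reg, NExpr.val_reg, NExpr.safe_const, NExpr.val_const, g2, g4, g5, g6, g13, g14, g9,
        c8, c9, State.nreg_setN, State.na_setN, ne_eq, not_false_eq_true, Nat.reduceEqDiff, if_true,
        if_false, hbase]
      have q1 : (m + 1) * 2 ^ l + b * 2 ^ (m + 1) ≤ W := by omega
      refine ⟨⟨⟨trivial, by omega⟩, trivial, trivial, by omega⟩, fun hb => ?_, fun hb => ?_⟩
      · refine ⟨⟨trivial, by omega, by omega⟩, ⟨⟨by omega, ⟨⟨⟨trivial, by omega, by omega⟩, trivial,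
          by omega⟩, trivial, q1⟩, by omega⟩, ⟨trivial, by omega, by omega⟩, by omega⟩, by omega, trivial,
          fin _ ?_ _ (fun i => by simp [g10, hcs]; rfl), by simp; omega⟩
        rw [cnt_succ, if_pos ⟨hb1, hb⟩]
      · refine ⟨⟨⟨by omega, ⟨⟨⟨trivial, by omega, by omega⟩, trivial,
          by omega⟩, trivial, q1⟩, by omega⟩, ⟨trivial, by omega, by omega⟩, by omega⟩, by omega, trivial,
          fin _ ?_ _ (fun i => by simp [g10, hcs]; rfl), by simp; omega⟩
        rw [cnt_succ, if_neg (fun h => hb h.2)]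
        rfl
    · intro σ₂ k fr2 _ hI2 hk
      have f13 : σ₂.nreg 13 = 2 ^ m := (fr2.nreg 13 rfl).trans e13
      simp only [wp_block_cons, wp_block_nil, wp_setN, NExpr.safe_mul, NExpr.safe_reg,
        NExpr.safe_const, NExpr.val_mul, NExpr.val_reg, NExpr.val_const, f13, ← hms]
      refine ⟨⟨trivial, by omega, by omega⟩, ⟨by simp, ?_⟩, ?_⟩
      · intro k hk b hb y' hy'
        simp only [State.na_setN, ne_eq, not_false_eq_true, Nat.reduceEqDiff]
        refine hI2 k hk b hb y' ?_
        split_ifs at hy' ⊢ <;> omega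
      · simp only [NExpr.cost_reg, NExpr.cost_const, NExpr.cost_mul] at hk ⊢
        have : N * (N * 100 + 150 + 1 + 7) ≤ N * (N * 100 + 200) := Nat.mul_le_mul_left _ (by omega)
        linarith
  · rintro σ' k fr _ ⟨-, hI⟩ hk
    rw [wp_block_nil]
    refine post _ _ (fr0.trans fr.seq_left.seq_right) (fun k hk b hb y hy => hI k hk b hb y ?_) ?_
    · rwa [if_pos hk]
    · simp only [NExpr.cost_reg, NExpr.cost_const] at hk ⊢
      linarith

theorem Frame.ite_left {b : BExpr} {c d : Cmd} {σ σ' : State} (h : Frame c σ σ') :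
    Frame (.ite b c d) σ σ' :=
  h.mono (by simp [Cmd.modN]; tauto) (by simp [Cmd.modR]; tauto)
    (by simp [Cmd.modNA]; tauto) (by simp [Cmd.modRA]; tauto) (by simp [Cmd.emits]; tauto)

/-- The number of `i` with `a ≤ i < b` and `s ≤ f i < e`. -/
def cntRect (f : ℕ → ℕ) (a b s e : ℕ) : ℕ := cnt f s e b - cnt f s e a

theorem cntRect_add {f : ℕ → ℕ} {a b s m e : ℕ} (hab : a ≤ b) (hsm : s ≤ m) (hme : m ≤ e) :
    cntRect f a b s m + cntRect f a b m e = cntRect f a b s e := by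
  have h1 := cnt_add (f := f) hsm hme a
  have h2 := cnt_add (f := f) hsm hme b
  have h3 := cnt_mono f s m hab
  have h4 := cnt_mono f m e hab
  unfold cntRect
  omega

theorem cntRect_le (f : ℕ → ℕ) (a b s e : ℕ) : cntRect f a b s e ≤ b :=
  (Nat.sub_le _ _).trans (Nat.count_le _)

theorem cntRect_pos {f : ℕ → ℕ} {a b s e i : ℕ} (h1 : a ≤ i) (h2 : i < b) (h3 : s ≤ f i)
    (h4 : f i < e) : 0 < cntRect f a b s e := by
  have h5 := cnt_mono f s e h1
  have h6 := cnt_mono f s e (show i + 1 ≤ b from h2)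
  rw [cnt_succ, if_pos ⟨h3, h4⟩] at h6
  unfold cntRect
  omega

theorem exists_of_cntRect_pos {f : ℕ → ℕ} {a b s e : ℕ} (h : 0 < cntRect f a b s e) :
    ∃ i, a ≤ i ∧ i < b ∧ s ≤ f i ∧ f i < e := by
  by_contra hne
  push Not at hne
  have : ∀ b', a ≤ b' → b' ≤ b → cnt f s e b' = cnt f s e a := by
    intro b' hb'
    induction b', hb' using Nat.le_induction with
    | base => simp
    | succ c hc ih =>
      intro hcb
      rw [cnt_succ, if_neg (fun hh => absurd hh.2 (not_lt.2 (hne c hc hcb hh.1))), ih (by omega), add_zero]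
  unfold cntRect at h
  rcases le_total a b with hab | hab
  · rw [this b hab le_rfl] at h
    omega
  · have := cnt_mono f s e hab
    omega

/-! ### Searching in the counting table -/

/-- Descend in the counting table, with the positions in the registers 41 and 42, to the right if the
test `cond` holds. -/
def descend (cond : BExpr) : Cmd := block [
  .setN 30 (.reg 3), .setN 31 (.const 0), .setN 34 (.const 0), .setN 38 (.reg 4),
  .setN 32 (.reg 41), .setN 33 (.reg 42),
  .loop (.ltN (.const 0) (.reg 30)) (block [
    .setN 38 (.reg 38 / .const 2),
    .setN 37 (.const 2 * (.reg 30 * .reg 4 + .reg 31)),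
    .setN 35 (ld 10 (.reg 37 + .reg 32)),
    .setN 36 (ld 10 (.reg 37 + .reg 33)),
    .ite cond (block [
        .setN 34 (.reg 34 + (.reg 36 - .reg 35)),
        .setN 32 (.reg 32 - .reg 35),
        .setN 33 (.reg 33 - .reg 36),
        .setN 31 (.reg 31 + .reg 38)])
      (block [.setN 32 (.reg 35), .setN 33 (.reg 36)]),
    .setN 30 (.reg 30 - .const 1)])]

/-- The bounds `a` and `b` are replaced by the numbers of block elements before them, so that the
table can be used at the next level. Register 34 counts the elements of the window to the left of
the current block. `J` is an abstract invariant, since the descent is used both for a given value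
and for a given rank. -/
theorem wp_descend {S W : ℕ} [Machine S W] {σ : State} {Q : State → ℕ → Prop} {cond : BExpr}
    (N n L l a b : ℕ) (f : ℕ → ℕ) (c J : ℕ → ℕ → Prop) (hn : σ.nreg 2 = n) (hl : σ.nreg 3 = l)
    (hP : σ.nreg 4 = 2 ^ l) (h41 : σ.nreg 41 = a) (h42 : σ.nreg 42 = b) (hab : a ≤ b) (hbN : b ≤ N)
    (hL : 2 * ((l + 2) * 2 ^ l) + N < L) (hS : 32 * (n + L) ≤ S) (hlt : ∀ i < N, f i < 2 ^ l)
    (hT : WaveletTable f N l (σ.na 10))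
    (hJ : J l 0) (hJr : ∀ k x, J (k + 1) x → c k x → J k (x + 2 ^ k))
    (hJl : ∀ k x, J (k + 1) x → ¬ c k x → J k x)
    (hc : ∀ σ' k x, Frame (descend cond) σ σ' → σ'.nreg 31 = x → σ'.nreg 38 = 2 ^ k →
      σ'.nreg 34 = cntRect f a b 0 x → σ'.nreg 36 - σ'.nreg 35 = cntRect f a b x (x + 2 ^ k) →
      x + 2 ^ k ≤ 2 ^ l → cond.Safe S W σ' ∧ (cond.val σ' ↔ c k x))
    (post : ∀ σ' k x, Frame (descend cond) σ σ' → σ'.nreg 31 = x → σ'.nreg 34 = cntRect f a b 0 x →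
      J 0 x → x < 2 ^ l → k ≤ (cond.cost + 100) * (l + 1) → Q σ' k) : wp S W (descend cond) σ Q := by
  have hB := Machine.big (S := S) (W := W)
  have hSW := Machine.le (S := S) (W := W)
  have hl2 : (l + 2) * 2 ^ l = l * 2 ^ l + 2 * 2 ^ l := by ring
  unfold descend
  simp only [wp_block_cons, wp_setN, NExpr.safe_reg, NExpr.val_reg, NExpr.safe_const, NExpr.val_const,
    State.nreg_setN, Nat.reduceEqDiff, if_true, if_false, hl, hP, h41, h42]
  refine ⟨trivial, by omega, by omega, trivial, trivial, trivial, ?_⟩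
  set σ₁ := (((((σ.setN 30 l).setN 31 0).setN 34 0).setN 38 (2 ^ l)).setN 32 a).setN 33 b with hσ₁
  have fr0 : Frame (descend cond) σ σ₁ :=
    (((((Frame.setN _ _ rfl).trans (Frame.setN _ _ rfl)).trans (Frame.setN _ _ rfl)).trans
      (Frame.setN _ _ rfl)).trans (Frame.setN _ _ rfl)).trans (Frame.setN _ _ rfl)
  -- The block of the top level contains all values, so there the two positions are `a` and `b`
  -- themselves.
  have full : ∀ y ≤ N, cnt f 0 (2 ^ l) y = y := by
    intro y hy
    rw [cnt, Nat.count_iff_forall.2]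
    exact fun i hi => ⟨Nat.zero_le _, hlt i (by omega)⟩
  refine wp_loop (fun σ' t => ∃ k d, k ≤ l ∧ σ'.nreg 30 = k ∧ σ'.nreg 31 = d * 2 ^ k ∧
      (d + 1) * 2 ^ k ≤ 2 ^ l ∧ σ'.nreg 32 = cnt f (d * 2 ^ k) ((d + 1) * 2 ^ k) a ∧
      σ'.nreg 33 = cnt f (d * 2 ^ k) ((d + 1) * 2 ^ k) b ∧ σ'.nreg 34 = cntRect f a b 0 (d * 2 ^ k) ∧
      σ'.nreg 38 = 2 ^ k ∧ J k (d * 2 ^ k) ∧ t + (cond.cost + 80) * k ≤ (cond.cost + 80) * l)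
    (fun σ' => σ'.nreg 30) ?_ ?_
  · refine ⟨l, 0, le_rfl, by simp [hσ₁], by simp [hσ₁], by simp, ?_, ?_, ?_, by simp [hσ₁],
      by simpa using hJ, by simp⟩
    · simp [hσ₁, full a (by omega)]
    · simp [hσ₁, full b hbN]
    · have : ∀ y, cnt f 0 0 y = 0 := fun y => by simp [cnt, Nat.count_eq_card_filter_range]
      simp [hσ₁, cntRect, this]
  · rintro σ' t fr ⟨k, d, hk, e30, e31, hd, e32, e33, e34, e38, hJk, ht⟩
    have e2 : σ'.nreg 2 = n := (fr.nreg 2 rfl).trans (by simp [hσ₁, hn])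
    have e4 : σ'.nreg 4 = 2 ^ l := (fr.nreg 4 rfl).trans (by simp [hσ₁, hP])
    have a10 : ∀ i, σ'.na 10 i = σ.na 10 i := fun i =>
      (fr.na 10 rfl rfl (by decide) i).trans (by simp [hσ₁])
    refine ⟨by simp, fun hb => ?_, fun hb => ?_⟩
    · simp only [BExpr.val_ltN, NExpr.val_const, NExpr.val_reg, e30] at hb
      obtain ⟨k, rfl⟩ : ∃ k', k = k' + 1 := ⟨k - 1, by omega⟩
      have hks : 2 ^ (k + 1) = 2 ^ k * 2 := pow_succ _ _
      have hd2 : (d + 1) * 2 ^ (k + 1) = d * 2 ^ (k + 1) + 2 ^ (k + 1) := by ring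
      have hdl : d * 2 ^ (k + 1) = (2 * d) * 2 ^ k := by ring
      have hdm : d * 2 ^ (k + 1) + 2 ^ k = (2 * d + 1) * 2 ^ k := by ring
      have hdr : (d + 1) * 2 ^ (k + 1) = (2 * d + 1 + 1) * 2 ^ k := by ring
      have hk2 : 0 < 2 ^ k := by positivity
      have hml : (k + 1) * 2 ^ l ≤ l * 2 ^ l := Nat.mul_le_mul_right _ hk
      have hkt : (cond.cost + 80) * (k + 1) = (cond.cost + 80) * k + (cond.cost + 80) := by ring
      have hTk := hT k hk d hd
      unfold tableBase at hTk
      have hpa : cnt f (d * 2 ^ (k + 1)) ((d + 1) * 2 ^ (k + 1)) a ≤ a := Nat.count_le _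
      have hpb : cnt f (d * 2 ^ (k + 1)) ((d + 1) * 2 ^ (k + 1)) b ≤ b := Nat.count_le _
      have hdiv : 2 ^ (k + 1) / 2 = 2 ^ k := by omega
      have hsplit : ∀ y, cnt f (d * 2 ^ (k + 1)) (d * 2 ^ (k + 1) + 2 ^ k) y +
          cnt f (d * 2 ^ (k + 1) + 2 ^ k) ((d + 1) * 2 ^ (k + 1)) y =
          cnt f (d * 2 ^ (k + 1)) ((d + 1) * 2 ^ (k + 1)) y := fun y =>
        cnt_add (by omega) (by omega) y
      have ha := hsplit a
      have hbb := hsplit b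
      have hR : cntRect f a b 0 (d * 2 ^ (k + 1)) +
          (cnt f (d * 2 ^ (k + 1)) (d * 2 ^ (k + 1) + 2 ^ k) b -
            cnt f (d * 2 ^ (k + 1)) (d * 2 ^ (k + 1) + 2 ^ k) a) =
          cntRect f a b 0 (d * 2 ^ (k + 1) + 2 ^ k) := cntRect_add hab (by omega) (by omega)
      have hRle := cntRect_le f a b 0 (d * 2 ^ (k + 1) + 2 ^ k)
      simp only [wp_block_cons, wp_setN, NExpr.safe_div, NExpr.safe_reg, NExpr.safe_const,
        NExpr.val_div, NExpr.val_reg, NExpr.val_const, NExpr.safe_mul, NExpr.safe_add, NExpr.val_mul,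
        NExpr.val_add, State.nreg_setN, Nat.reduceEqDiff, if_true, if_false, safe_ld, val_ld,
        State.na_setN, ne_eq, not_false_eq_true, e30, e31, e32, e33, e38, e4, e2, hdiv, a10, hTk a (by omega),
        hTk b hbN, true_and, and_true]
      refine ⟨by omega, by omega, by omega, by omega, ?_⟩
      set σ₂ := ((((σ'.setN 38 (2 ^ k)).setN 37 (2 * ((k + 1) * 2 ^ l + d * 2 ^ (k + 1)))).setN 35
        (cnt f (d * 2 ^ (k + 1)) (d * 2 ^ (k + 1) + 2 ^ k) a)).setN 36
        (cnt f (d * 2 ^ (k + 1)) (d * 2 ^ (k + 1) + 2 ^ k) b)) with hσ₂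
      have fr2 : Frame (descend cond) σ σ₂ := (fr0.trans
        fr.seq_left.seq_right.seq_right.seq_right.seq_right.seq_right.seq_right).trans
          ((((Frame.setN _ _ rfl).trans (Frame.setN _ _ rfl)).trans (Frame.setN _ _ rfl)).trans
            (Frame.setN _ _ rfl))
      obtain ⟨hs, hv⟩ := hc σ₂ k (d * 2 ^ (k + 1)) fr2 (by simp [hσ₂, e31]) (by simp [hσ₂])
        (by simp [hσ₂, e34]) (by simp [hσ₂, cntRect]) (by omega)
      rw [wp_ite]
      refine ⟨hs, fun hcv => ?_, fun hcv => ?_⟩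
      · rw [hv] at hcv
        have g30 : σ₂.nreg 30 = k + 1 := by simp [hσ₂, e30]
        have g31 : σ₂.nreg 31 = d * 2 ^ (k + 1) := by simp [hσ₂, e31]
        have g32 : σ₂.nreg 32 = cnt f (d * 2 ^ (k + 1)) ((d + 1) * 2 ^ (k + 1)) a := by simp [hσ₂, e32]
        have g33 : σ₂.nreg 33 = cnt f (d * 2 ^ (k + 1)) ((d + 1) * 2 ^ (k + 1)) b := by simp [hσ₂, e33]
        have g34 : σ₂.nreg 34 = cntRect f a b 0 (d * 2 ^ (k + 1)) := by simp [hσ₂, e34]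
        have g35 : σ₂.nreg 35 = cnt f (d * 2 ^ (k + 1)) (d * 2 ^ (k + 1) + 2 ^ k) a := by simp [hσ₂]
        have g36 : σ₂.nreg 36 = cnt f (d * 2 ^ (k + 1)) (d * 2 ^ (k + 1) + 2 ^ k) b := by simp [hσ₂]
        have g38 : σ₂.nreg 38 = 2 ^ k := by simp [hσ₂]
        have c1 : cnt f (d * 2 ^ (k + 1)) ((d + 1) * 2 ^ (k + 1)) a -
            cnt f (d * 2 ^ (k + 1)) (d * 2 ^ (k + 1) + 2 ^ k) a =
            cnt f (d * 2 ^ (k + 1) + 2 ^ k) ((d + 1) * 2 ^ (k + 1)) a := by omega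
        have c2 : cnt f (d * 2 ^ (k + 1)) ((d + 1) * 2 ^ (k + 1)) b -
            cnt f (d * 2 ^ (k + 1)) (d * 2 ^ (k + 1) + 2 ^ k) b =
            cnt f (d * 2 ^ (k + 1) + 2 ^ k) ((d + 1) * 2 ^ (k + 1)) b := by omega
        simp only [wp_block_cons, wp_block_nil, wp_setN, NExpr.safe_sub, NExpr.safe_add, NExpr.safe_reg,
          NExpr.safe_const, NExpr.val_sub, NExpr.val_add, NExpr.val_reg, NExpr.val_const,
          State.nreg_setN, Nat.reduceEqDiff, if_true, if_false, g30, g31, g32, g33, g34, g35, g36, g38,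
          c1, c2, true_and, and_true, hR]
        refine ⟨by omega, by omega, by omega, ⟨k, 2 * d + 1, by omega, by simp, by simp [hdm], by omega,
          ?_, ?_, ?_, by simp [hσ₂], ?_, ?_⟩, by simp⟩
        · simp [← hdm, ← hdr]
        · simp [← hdm, ← hdr]
        · simp [← hdm]
        · rw [← hdm]; exact hJr k _ hJk hcv
        · simp; omega
      · rw [hv] at hcv
        have g30 : σ₂.nreg 30 = k + 1 := by simp [hσ₂, e30]
        have g31 : σ₂.nreg 31 = d * 2 ^ (k + 1) := by simp [hσ₂, e31]
        have g34 : σ₂.nreg 34 = cntRect f a b 0 (d * 2 ^ (k + 1)) := by simp [hσ₂, e34]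
        have g35 : σ₂.nreg 35 = cnt f (d * 2 ^ (k + 1)) (d * 2 ^ (k + 1) + 2 ^ k) a := by simp [hσ₂]
        have g36 : σ₂.nreg 36 = cnt f (d * 2 ^ (k + 1)) (d * 2 ^ (k + 1) + 2 ^ k) b := by simp [hσ₂]
        have g38 : σ₂.nreg 38 = 2 ^ k := by simp [hσ₂]
        simp only [wp_block_cons, wp_block_nil, wp_setN, NExpr.safe_sub, NExpr.safe_add, NExpr.safe_reg,
          NExpr.safe_const, NExpr.val_sub, NExpr.val_add, NExpr.val_reg, NExpr.val_const,
          State.nreg_setN, Nat.reduceEqDiff, if_true, if_false, g30, g35, g36, true_and, and_true]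
        refine ⟨by omega, ⟨k, 2 * d, by omega, by simp, by simp [g31, hdl], by omega, ?_, ?_, ?_,
          by simp [g38], ?_, ?_⟩, by simp⟩
        · simp [← hdm, ← hdl]
        · simp [← hdm, ← hdl]
        · simp [← hdl, g34]
        · rw [← hdl]; exact hJl k _ hJk hcv
        · simp; omega
    · simp only [BExpr.val_ltN, NExpr.val_const, NExpr.val_reg, e30] at hb
      obtain rfl : k = 0 := by omega
      rw [wp_block_nil]
      simp only [pow_zero, mul_one] at *
      refine post _ _ d (fr0.trans
        fr.seq_left.seq_right.seq_right.seq_right.seq_right.seq_right.seq_right) e31 e34 hJk (by omega) ?_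
      simp
      have : (cond.cost + 100) * (l + 1) = (cond.cost + 80) * l + 20 * l + (cond.cost + 100) := by ring
      omega

/-- Among the positions between the registers 41 and 42, find one with the least number in column 9
that is not less than the number in register 39. The number goes to register 31, and register 43
tells whether there is one. -/
def findLeast : Cmd := block [
  descend (.not (.ltN (.reg 39) (.reg 31 + .reg 38))),
  .setN 40 (.reg 34),
  .setN 43 (.const 0),
  .ite (.ltN (.reg 40) (.reg 42 - .reg 41)) (block [
    descend (.not (.ltN (.reg 40) (.reg 34 + (.reg 36 - .reg 35)))),
    .setN 43 (.const 1)]) .skip]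

/-- The first descent goes to the value `s` and thereby counts the window elements below `s`. If
some element is left, the second descent goes to the element whose rank in the window is this count,
counted from 0; it is the least one that is at least `s`. -/
theorem wp_findLeast {S W : ℕ} [Machine S W] {σ : State} {Q : State → ℕ → Prop}
    (N n L l a b s : ℕ) (f : ℕ → ℕ) (hn : σ.nreg 2 = n) (hl : σ.nreg 3 = l)
    (hP : σ.nreg 4 = 2 ^ l) (h39 : σ.nreg 39 = s) (h41 : σ.nreg 41 = a) (h42 : σ.nreg 42 = b)
    (hab : a ≤ b) (hbN : b ≤ N) (hs : s < 2 ^ l)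
    (hL : 2 * ((l + 2) * 2 ^ l) + N < L) (hS : 32 * (n + L) ≤ S) (hlt : ∀ i < N, f i < 2 ^ l)
    (hT : WaveletTable f N l (σ.na 10))
    (post : ∀ σ' k, Frame findLeast σ σ' →
      (σ'.nreg 43 = 0 ∧ (∀ y, a ≤ y → y < b → f y < s) ∨ σ'.nreg 43 = 1 ∧ ∃ y, a ≤ y ∧ y < b ∧
        f y = σ'.nreg 31 ∧ s ≤ σ'.nreg 31 ∧ ∀ y', a ≤ y' → y' < b → s ≤ f y' → σ'.nreg 31 ≤ f y') →
      k ≤ 300 * (l + 1) → Q σ' k) : wp S W findLeast σ Q := by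
  have hB := Machine.big (S := S) (W := W)
  have hSW := Machine.le (S := S) (W := W)
  have hl2 : (l + 2) * 2 ^ l = l * 2 ^ l + 2 * 2 ^ l := by ring
  unfold findLeast
  rw [wp_block_cons]
  refine wp_descend N n L l a b f (fun k x => x + 2 ^ k ≤ s) (fun k x => x ≤ s ∧ s < x + 2 ^ k) hn hl hP
    h41 h42 hab hbN hL hS hlt hT (by simpa using hs) (fun k x h hc => ⟨hc, by
      have : 2 ^ (k + 1) = 2 ^ k * 2 := pow_succ _ _
      omega⟩) (fun k x h hc => ⟨h.1, by omega⟩) ?_ ?_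
  · intro σ' k x fr h31 h38 _ _ hx
    have e39 : σ'.nreg 39 = s := (fr.nreg 39 rfl).trans h39
    simp only [BExpr.safe_not, BExpr.safe_ltN, NExpr.safe_reg, NExpr.safe_add, NExpr.val_reg, h31, h38,
      BExpr.val_not, BExpr.val_ltN, NExpr.val_add, e39]
    exact ⟨⟨trivial, trivial, trivial, by omega⟩, by omega⟩
  · rintro σ₁ k x fr h31 h34 hJ hx hk
    simp only [pow_zero] at hJ
    obtain rfl : x = s := by omega
    have e41 : σ₁.nreg 41 = a := (fr.nreg 41 rfl).trans h41
    have e42 : σ₁.nreg 42 = b := (fr.nreg 42 rfl).trans h42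
    have hRl := cntRect_le f a b 0 x
    have hRt : cntRect f a b 0 x + cntRect f a b x (2 ^ l) = b - a := by
      rw [cntRect_add hab (by omega) (by omega)]
      have : ∀ y ≤ N, cnt f 0 (2 ^ l) y = y := by
        intro y hy
        rw [cnt, Nat.count_iff_forall.2]
        exact fun i hi => ⟨Nat.zero_le _, hlt i (by omega)⟩
      rw [cntRect, this b hbN, this a (by omega)]
    simp only [wp_block_cons, wp_setN, NExpr.safe_reg, NExpr.val_reg, NExpr.safe_const, NExpr.val_const,
      wp_ite, BExpr.safe_ltN, NExpr.safe_sub, BExpr.val_ltN, NExpr.val_sub, State.nreg_setN,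
      Nat.reduceEqDiff, if_true, if_false, h34, e41, e42, wp_skip, true_and, and_true]
    set σ₂ := (σ₁.setN 40 (cntRect f a b 0 x)).setN 43 0 with hσ₂
    have fr2 : Frame findLeast σ σ₂ :=
      (fr.seq_left.trans (Frame.setN _ _ rfl)).trans (Frame.setN _ _ rfl)
    refine ⟨by omega, fun hb => ?_, fun hb => ?_⟩
    -- Go right as long as at most the sought number of window elements lies to the left of the new
    -- block.
    · refine wp_descend N n L l a b f (fun k x' => cntRect f a b 0 (x' + 2 ^ k) ≤ cntRect f a b 0 x)
        (fun k x' => cntRect f a b 0 x' ≤ cntRect f a b 0 x ∧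
          cntRect f a b 0 x < cntRect f a b 0 (x' + 2 ^ k)) ((fr2.nreg 2 rfl).trans hn)
        ((fr2.nreg 3 rfl).trans hl) ((fr2.nreg 4 rfl).trans hP) ((fr2.nreg 41 rfl).trans h41)
        ((fr2.nreg 42 rfl).trans h42) hab hbN hL hS hlt ?_ ?_ (fun k x' h hc => ⟨hc, by
          rw [show x' + 2 ^ k + 2 ^ k = x' + 2 ^ (k + 1) by ring]; exact h.2⟩)
        (fun k x' h hc => ⟨h.1, not_le.1 hc⟩) ?_ ?_
      · have : σ₂.na 10 = σ.na 10 := funext (fr2.na 10 rfl rfl (by decide))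
        rwa [this]
      · have h00 : cntRect f a b 0 0 = 0 := by
          have := cntRect_add (f := f) hab (le_refl 0) (le_refl 0)
          omega
        have := cntRect_add (f := f) hab (Nat.zero_le x) hx.le
        exact ⟨by omega, by rw [zero_add]; omega⟩
      · intro σ' k x' fr3 h31 h38 h34' h36 hx'
        have e40 : σ'.nreg 40 = cntRect f a b 0 x := (fr3.nreg 40 rfl).trans (by simp [hσ₂])
        have hadd := cntRect_add (f := f) hab (Nat.zero_le x') (Nat.le_add_right x' (2 ^ k))
        have := cntRect_le f a b 0 (x' + 2 ^ k)
        simp only [BExpr.safe_not, BExpr.safe_ltN, NExpr.safe_reg, NExpr.safe_add, NExpr.safe_sub,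
          NExpr.val_reg, BExpr.val_not, BExpr.val_ltN, NExpr.val_add, NExpr.val_sub, h34', h36, e40, hadd]
        exact ⟨⟨trivial, trivial, ⟨trivial, trivial⟩, by omega⟩, by omega⟩
      · rintro σ₃ k' x' fr3 h31' h34' ⟨hJ1, hJ2⟩ hx' hk'
        simp only [wp_block_nil, wp_setN, NExpr.safe_const, NExpr.val_const]
        refine ⟨by omega, post _ _ ((fr2.trans ?_).trans (Frame.setN _ _ rfl)) (Or.inr ⟨by simp, ?_⟩) ?_⟩
        · exact fr3.seq_left.ite_left.seq_left.seq_right.seq_right.seq_right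
        · simp only [pow_zero] at hJ2
          simp only [State.nreg_setN, Nat.reduceEqDiff, if_false, h31']
          have hadd := cntRect_add (f := f) hab (Nat.zero_le x') (Nat.le_add_right x' 1)
          -- The count strictly increases from `x'` to `x' + 1`, so the value `x'` does occur in the
          -- window.
          obtain ⟨y, hy1, hy2, hy3, hy4⟩ := exists_of_cntRect_pos
            (f := f) (a := a) (b := b) (s := x') (e := x' + 1) (by omega)
          refine ⟨y, hy1, hy2, by omega, ?_, fun y' h1 h2 h3 => ?_⟩
          · by_contra hc
            have := cntRect_add (f := f) hab (Nat.zero_le (x' + 1)) (by omega : x' + 1 ≤ x)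
            omega
          by_contra hc
          push Not at hc
          have r1 := cntRect_pos h1 h2 h3 hc
          have r2 := cntRect_add (f := f) hab (Nat.zero_le x) (by omega : x ≤ x')
          omega
        · simp at hk hk' ⊢
          omega
    · rw [wp_block_nil]
      refine post _ _ fr2 (Or.inl ⟨by simp [hσ₂], fun y h1 h2 => ?_⟩) ?_
      · by_contra hc
        have := cntRect_pos h1 h2 (not_lt.1 hc) (hlt y (by omega))
        omega
      · simp at hk ⊢
        omega

/-! ### Tournament trees

Nodes `1, ..., N - 1` are inner nodes and `N, ..., 2 * N - 1` are leaves. A node holds the least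
candidate (a number less than `N`) of its children and the key of that candidate. -/

/-- The right child of node `i` holds the better candidate. -/
def RightBetter (N : ℕ) (T : ℕ → ℕ) (D : ℕ → ℝ) (i : ℕ) : Prop :=
  T (2 * i + 1) < N ∧ ¬ (T (2 * i) < N ∧ ¬ D (2 * i + 1) < D (2 * i))

/-- Node `i` agrees with its children. -/
structure Agrees (N : ℕ) (T : ℕ → ℕ) (D : ℕ → ℝ) (i : ℕ) : Prop where
  right : RightBetter N T D i → T i = T (2 * i + 1) ∧ D i = D (2 * i + 1)
  left : ¬ RightBetter N T D i → T i = T (2 * i) ∧ D i = D (2 * i)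

section

variable {N : ℕ} {T : ℕ → ℕ} {D : ℕ → ℝ}

theorem Agrees.congr {T' : ℕ → ℕ} {D' : ℕ → ℝ} {i : ℕ} (h : Agrees N T D i)
    (h0 : T' i = T i ∧ D' i = D i) (h1 : T' (2 * i) = T (2 * i) ∧ D' (2 * i) = D (2 * i))
    (h2 : T' (2 * i + 1) = T (2 * i + 1) ∧ D' (2 * i + 1) = D (2 * i + 1)) : Agrees N T' D' i := by
  have e : RightBetter N T' D' i ↔ RightBetter N T D i := by
    unfold RightBetter
    rw [h1.1, h1.2, h2.1, h2.2]
  refine ⟨fun hr => ?_, fun hr => ?_⟩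
  · rw [h0.1, h0.2, h2.1, h2.2]; exact h.right (e.1 hr)
  · rw [h0.1, h0.2, h1.1, h1.2]; exact h.left (fun hh => hr (e.2 hh))

/-- One step from a node to its parent: candidates are not lost on the way up, and keys do not grow.
-/
theorem Agrees.min {i j : ℕ} (h : Agrees N T D i) (hj : j = 2 * i ∨ j = 2 * i + 1) (ht : T j < N) :
    T i < N ∧ D i ≤ D j := by
  by_cases hr : RightBetter N T D i
  · obtain ⟨e1, e2⟩ := h.right hr
    rw [e1, e2]
    refine ⟨hr.1, ?_⟩
    rcases hj with rfl | rfl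
    · by_contra hc
      exact hr.2 ⟨ht, fun h => hc h.le⟩
    · exact le_rfl
  · obtain ⟨e1, e2⟩ := h.left hr
    rw [e1, e2]
    rcases hj with rfl | rfl
    · exact ⟨ht, le_rfl⟩
    · by_contra hc
      refine hr ⟨ht, fun h => hc ⟨h.1, not_lt.1 h.2⟩⟩

/-- The root of a tournament tree holds the least candidate. -/
theorem root_min (h : ∀ i, 1 ≤ i → i < N → Agrees N T D i) {j : ℕ} (h1 : 1 ≤ j) (hj : j < 2 * N)
    (ht : T j < N) : T 1 < N ∧ D 1 ≤ D j := by
  induction j using Nat.strong_induction_on with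
  | _ j ih =>
    rcases Nat.lt_or_ge 1 j with h2 | h2
    · obtain ⟨h3, h4⟩ := (h (j / 2) (by omega) (by omega)).min (j := j) (by omega) ht
      obtain ⟨h5, h6⟩ := ih (j / 2) (by omega) (by omega) (by omega) h3
      exact ⟨h5, h6.trans h4⟩
    · obtain rfl : j = 1 := by omega
      exact ⟨ht, le_rfl⟩

/-- Every node of a tournament tree holds the number and the key of some leaf. -/
theorem exists_leaf (h : ∀ i, 1 ≤ i → i < N → Agrees N T D i) {i : ℕ} (h1 : 1 ≤ i)
    (hi : i < 2 * N) : ∃ v < N, T i = T (N + v) ∧ D i = D (N + v) := by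
  induction hm : 2 * N - i using Nat.strong_induction_on generalizing i with
  | _ m ih =>
    rcases Nat.lt_or_ge i N with h2 | h2
    · by_cases hr : RightBetter N T D i
      · obtain ⟨e1, e2⟩ := (h i h1 h2).right hr
        rw [e1, e2]
        exact ih (2 * N - (2 * i + 1)) (by omega) (by omega) (by omega) rfl
      · obtain ⟨e1, e2⟩ := (h i h1 h2).left hr
        rw [e1, e2]
        exact ih (2 * N - (2 * i)) (by omega) (by omega) (by omega) rfl
    · exact ⟨i - N, by omega, by rw [Nat.add_sub_cancel' h2], by rw [Nat.add_sub_cancel' h2]⟩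

end

/-- Repair the ancestors of the node in the register 30 of the tournament tree whose candidates are in
column 13 and whose keys are in the real column 9. -/
def repair : Cmd := block [
  .setN 30 (.reg 30 / .const 2),
  .loop (.ltN (.const 0) (.reg 30)) (block [
    .ite (.and (.ltN (ld 13 (.const 2 * .reg 30 + .const 1)) (.reg 0))
      (.not (.and (.ltN (ld 13 (.const 2 * .reg 30)) (.reg 0))
        (.not (.ltR (rld 9 (.const 2 * .reg 30 + .const 1)) (rld 9 (.const 2 * .reg 30)))))))
      (block [
        st 13 (.reg 30) (ld 13 (.const 2 * .reg 30 + .const 1)),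
        rst 9 (.reg 30) (rld 9 (.const 2 * .reg 30 + .const 1))])
      (block [
        st 13 (.reg 30) (ld 13 (.const 2 * .reg 30)),
        rst 9 (.reg 30) (rld 9 (.const 2 * .reg 30))]),
    .setN 30 (.reg 30 / .const 2)])]

/-- At any time a single inner node may disagree with its children. Repairing it moves the possible
disagreement to its parent, and above the root there is nothing to repair. -/
theorem wp_repair {S W : ℕ} [Machine S W] {σ : State} {Q : State → ℕ → Prop} (N n L l c : ℕ)
    (hN : σ.nreg 0 = N) (hn : σ.nreg 2 = n) (h30 : σ.nreg 30 = c) (hc : c < 2 * N)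
    (hl : N < 2 ^ l) (hL : 2 * N < L) (hS : 32 * (n + L) ≤ S)
    (hT : ∀ i, 1 ≤ i → i < N → i ≠ c / 2 → Agrees N (σ.na 13) (σ.ra 9) i)
    (post : ∀ σ' k, Frame repair σ σ' → (∀ i, 1 ≤ i → i < N → Agrees N (σ'.na 13) (σ'.ra 9) i) →
      (∀ i, N ≤ i → σ'.na 13 i = σ.na 13 i ∧ σ'.ra 9 i = σ.ra 9 i) →
      k ≤ 200 * (l + 1) → Q σ' k) : wp S W repair σ Q := by
  have hB := Machine.big (S := S) (W := W)
  have hSW := Machine.le (S := S) (W := W)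
  unfold repair
  simp only [wp_block_cons, wp_setN, NExpr.safe_div, NExpr.safe_reg, NExpr.safe_const, NExpr.val_div,
    NExpr.val_reg, NExpr.val_const, h30, true_and]
  refine ⟨by omega, ?_⟩
  have fr0 : Frame repair σ (σ.setN 30 (c / 2)) := Frame.setN _ _ rfl
  refine wp_loop (fun σ' t => ∃ c r, σ'.nreg 30 = c ∧ c < N ∧ c < 2 ^ r ∧
      (∀ i, 1 ≤ i → i < N → i ≠ c → Agrees N (σ'.na 13) (σ'.ra 9) i) ∧
      (∀ i, N ≤ i → σ'.na 13 i = σ.na 13 i ∧ σ'.ra 9 i = σ.ra 9 i) ∧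
      t + 150 * r ≤ 150 * l) (fun σ' => σ'.nreg 30) ?_ ?_
  · refine ⟨c / 2, l, by simp, by omega, by omega, ?_, by simp, by simp⟩
    intro i h1 h2 h3
    exact (hT i h1 h2 h3).congr (by simp) (by simp) (by simp)
  · rintro σ' t fr ⟨c, r, e30, hcN, hcr, hA, hleaf, ht⟩
    have e0 : σ'.nreg 0 = N := (fr.nreg 0 rfl).trans (by simp [hN])
    have e2 : σ'.nreg 2 = n := (fr.nreg 2 rfl).trans (by simp [hn])
    refine ⟨by simp, fun hb => ?_, fun hb => ?_⟩
    · simp only [BExpr.val_ltN, NExpr.val_const, NExpr.val_reg, e30] at hb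
      have hr : r ≠ 0 := by rintro rfl; simp at hcr; omega
      obtain ⟨r, rfl⟩ := Nat.exists_eq_succ_of_ne_zero hr
      have hp : 2 ^ (r + 1) = 2 ^ r * 2 := pow_succ _ _
      simp only [Nat.succ_eq_add_one, hp] at hcr
      -- Node `c` now copies its better child `b`. The only other node that looks at `c` is its
      -- parent `c / 2`.
      have key : ∀ (b : ℕ), (b = 2 * c ∨ b = 2 * c + 1) → (b = 2 * c + 1 ↔ RightBetter N (σ'.na 13) (σ'.ra 9) c) →
          ∀ i, 1 ≤ i → i < N → i ≠ c / 2 → Agrees N (((σ'.setNA 13 c (σ'.na 13 b)).setRA 9 c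
            (σ'.ra 9 b)).setN 30 (c / 2) |>.na 13) (((σ'.setNA 13 c (σ'.na 13 b)).setRA 9 c
            (σ'.ra 9 b)).setN 30 (c / 2) |>.ra 9) i := by
        intro b hb1 hb2 i h1 h2 h3
        by_cases hic : i = c
        · subst hic
          have n1 : 2 * i ≠ i := by omega
          have n2 : 2 * i + 1 ≠ i := by omega
          have e : RightBetter N (((σ'.setNA 13 i (σ'.na 13 b)).setRA 9 i
            (σ'.ra 9 b)).setN 30 (i / 2) |>.na 13) (((σ'.setNA 13 i (σ'.na 13 b)).setRA 9 i
            (σ'.ra 9 b)).setN 30 (i / 2) |>.ra 9) i ↔ b = 2 * i + 1 := by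
            rw [hb2]; simp [RightBetter, n1, n2]
          refine ⟨fun hr => ?_, fun hr => ?_⟩
          · rw [e] at hr; simp [n2, hr]
          · rw [e] at hr
            have : b = 2 * i := by omega
            simp [n1, this]
        · have n1 : 2 * i ≠ c := by omega
          have n2 : 2 * i + 1 ≠ c := by omega
          exact (hA i h1 h2 hic).congr (by simp [hic]) (by simp [n1]) (by simp [n2])
      have lf : ∀ b i, N ≤ i → (((σ'.setNA 13 c (σ'.na 13 b)).setRA 9 c
            (σ'.ra 9 b)).setN 30 (c / 2) |>.na 13) i = σ.na 13 i ∧ (((σ'.setNA 13 c (σ'.na 13 b)).setRA 9 c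
            (σ'.ra 9 b)).setN 30 (c / 2) |>.ra 9) i = σ.ra 9 i := by
        intro b i hi
        have : i ≠ c := by omega
        simpa [this] using hleaf i hi
      simp only [wp_block_cons, wp_block_nil, wp_setN, wp_ite, wp_st, wp_rst, BExpr.safe_and,
        BExpr.safe_ltN, BExpr.safe_not, BExpr.safe_ltR, BExpr.val_and, BExpr.val_ltN, BExpr.val_not,
        BExpr.val_ltR, safe_ld, safe_rld, val_ld, val_rld, NExpr.safe_add, NExpr.safe_mul, NExpr.safe_div,
        NExpr.safe_reg, NExpr.safe_const, NExpr.val_add, NExpr.val_mul, NExpr.val_div, NExpr.val_reg, NExpr.val_const,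
        State.nreg_setNA, State.nreg_setRA, State.ra_setNA, e30, e0, e2, true_and, and_true]
      refine ⟨⟨by omega, fun _ => ⟨by omega, fun _ => by omega⟩⟩, fun hr => ?_, fun hr => ?_⟩
      · refine ⟨by omega, by omega, by omega, by omega, by omega,
          ⟨c / 2, r, by simp, by omega, by omega, key _ (Or.inr rfl) (by simpa [RightBetter] using hr),
            lf _, by simp; omega⟩, by simp; omega⟩
      · refine ⟨by omega, by omega, by omega, by omega, by omega,
          ⟨c / 2, r, by simp, by omega, by omega, key _ (Or.inl rfl) ?_,
            lf _, by simp; omega⟩, by simp; omega⟩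
        constructor
        · intro h; omega
        · intro h; exact absurd h hr
    · simp only [BExpr.val_ltN, NExpr.val_const, NExpr.val_reg, e30] at hb
      rw [wp_block_nil]
      refine post _ _ (fr0.trans fr.seq_left.seq_right)
        (fun i h1 h2 => hA i h1 h2 (by omega)) hleaf ?_
      simp
      omega

/-- This allows a program to be unfolded while the frame of the whole program stays available for
the final postcondition. -/
theorem wp_frame {S W : ℕ} {c : Cmd} {σ : State} {Q : State → ℕ → Prop}
    (h : wp S W c σ fun σ' k => Frame c σ σ' → Q σ' k) : wp S W c σ Q :=
  wp_mono h fun _ _ hf hq => hq hf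

namespace State

variable (σ : State) (i j k v : ℕ) (x : ℝ)

theorem na_setN' (h : i ≠ 2) : (σ.setN i v).na j = σ.na j := funext fun _ => na_setN _ _ _ _ _ h
theorem ra_setN' (h : i ≠ 2) : (σ.setN i v).ra j = σ.ra j := funext fun _ => ra_setN _ _ _ _ _ h
theorem na_setR' : (σ.setR i x).na j = σ.na j := rfl
theorem ra_setR' : (σ.setR i x).ra j = σ.ra j := rfl

end State

open Classical in
theorem rowStart_succ (C : ℕ → ℕ → Prop) (M u : ℕ) :
    rowStart C M (u + 1) = rowStart C M u + Nat.count (C u) M := Finset.sum_range_succ _ _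

open Classical in
-- A position within row `u` determines the element of the row with the corresponding count, by
-- `Nat.nth`, and this is the element that the list holds there.
theorem Rows.exists_eq {C : ℕ → ℕ → Prop} {A M : ℕ} {start list : ℕ → ℕ} (h : Rows C A M start list)
    {u p : ℕ} (hu : u < A) (h1 : rowStart C M u ≤ p) (h2 : p < rowStart C M (u + 1)) :
    list p < M ∧ C u (list p) ∧ rowStart C M u + Nat.count (C u) (list p) = p := by
  rw [rowStart_succ] at h2
  have hj : p - rowStart C M u < Nat.count (C u) M := by omega
  have hw : Nat.nth (C u) (p - rowStart C M u) < M := Nat.nth_lt_of_lt_count hj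
  have hc : Nat.count (C u) (Nat.nth (C u) (p - rowStart C M u)) = p - rowStart C M u := by
    refine Nat.count_nth fun hf => ?_
    refine hj.trans_le ?_
    rw [Nat.count_eq_card_filter_range]
    exact Finset.card_le_card fun x hx => by simpa using (Finset.mem_filter.1 hx).2
  have hm : C u (Nat.nth (C u) (p - rowStart C M u)) := by
    refine Nat.nth_mem _ fun hf => ?_
    refine hj.trans_le ?_
    rw [Nat.count_eq_card_filter_range]
    exact Finset.card_le_card fun x hx => by simpa using (Finset.mem_filter.1 hx).2
  have := h.list_eq u hu _ hw hm
  rw [hc, Nat.add_sub_cancel' h1] at this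
  rw [this]
  exact ⟨hw, hm, by omega⟩

open Classical in
/-- Rows of the fibres of a function have at most as many entries as the function has arguments. -/
theorem rowStart_fibre_le (f : ℕ → ℕ) (M u : ℕ) : rowStart (fun x a => f a = x) M u ≤ M := by
  unfold rowStart
  simp only [Nat.count_eq_card_filter_range, Finset.card_filter]
  rw [Finset.sum_comm]
  calc _ ≤ ∑ a ∈ Finset.range M, 1 := Finset.sum_le_sum fun a _ => by

        -- Every argument belongs to exactly one fibre. The inequality only exchanges the classical
        -- decision of equality for the one of the natural numbers.
        refine (Finset.sum_le_sum (g := fun x => @ite ℕ (f a = x) (instDecidableEqNat _ _) 1 0)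
          fun x _ => by split <;> rfl).trans ?_
        rw [Finset.sum_ite_eq]
        split <;> simp
    _ = M := by simp

/-! ### Shortest paths -/

/-- There is a walk of length `x` from `s` to a vertex along the arcs `0, ..., M - 1`. -/
inductive ArcWalk (M : ℕ) (src tgt : ℕ → ℕ) (len : ℕ → ℝ) (s : ℕ) : ℕ → ℝ → Prop
  | nil : ArcWalk M src tgt len s s 0
  | snoc {u a : ℕ} {x : ℝ} (h : ArcWalk M src tgt len s u x) (ha : a < M) (hu : src a = u) :
      ArcWalk M src tgt len s (tgt a) (x + len a)

/-- The state of Dijkstra's algorithm: `t v` is `v` if the vertex is active, `N` if it is settled, and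
`N + 1` if it is not reached yet; `d` are the tentative distances, and `ok` are the arcs that were
relaxed if their source is settled. -/
structure Search (N M : ℕ) (src tgt : ℕ → ℕ) (len : ℕ → ℝ) (s : ℕ) (ok : ℕ → Prop) (t : ℕ → ℕ)
    (d : ℕ → ℝ) : Prop where
  leaf : ∀ v < N, t v = v ∨ t v = N ∨ t v = N + 1
  walk : ∀ v < N, t v ≤ N → ArcWalk M src tgt len s v (d v)
  order : ∀ u < N, t u = N → ∀ v < N, t v = v → d u ≤ d v
  edges : ∀ a < M, t (src a) = N → ok a → t (tgt a) ≤ N ∧ d (tgt a) ≤ d (src a) + len a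
  source : t s ≤ N ∧ d s ≤ 0

namespace Search

variable {N M : ℕ} {src tgt : ℕ → ℕ} {len : ℕ → ℝ} {s : ℕ} {ok ok' : ℕ → Prop} {t t' : ℕ → ℕ}
  {d d' : ℕ → ℝ}

theorem congr (h : Search N M src tgt len s ok t d) (hs : s < N) (hsrc : ∀ a < M, src a < N)
    (htgt : ∀ a < M, tgt a < N) (hok : ∀ a < M, ok' a → ok a)
    (ht : ∀ v < N, t' v = t v) (hd : ∀ v < N, d' v = d v) : Search N M src tgt len s ok' t' d' := by
  refine ⟨fun v hv => ?_, fun v hv => ?_, fun u hu h1 v hv h2 => ?_, fun a ha h1 h2 => ?_, ?_⟩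
  · rw [ht v hv]; exact h.leaf v hv
  · rw [ht v hv, hd v hv]; exact h.walk v hv
  · rw [ht u hu] at h1
    rw [ht v hv] at h2
    rw [hd u hu, hd v hv]
    exact h.order u hu h1 v hv h2
  · rw [ht _ (hsrc a ha)] at h1
    rw [ht _ (htgt a ha), hd _ (htgt a ha), hd _ (hsrc a ha)]
    exact h.edges a ha h1 (hok a ha h2)
  · rw [ht s hs, hd s hs]; exact h.source

/-- At the start only the source is active and nothing is settled, so that the conditions on settled
vertices are void. -/
theorem init (hs : s < N) (ht : ∀ v < N, v ≠ s → t v = N + 1) (hts : t s = s) (hd : d s = 0)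
    (hsrc : ∀ a < M, src a < N) : Search N M src tgt len s ok t d := by
  have hsettled : ∀ v < N, t v ≠ N := by
    intro v hv
    by_cases h : v = s
    · subst h; omega
    · rw [ht v hv h]; omega
  refine ⟨fun v hv => ?_, fun v hv h => ?_, fun u hu h => absurd h (hsettled u hu),
    fun a ha h => absurd h (hsettled _ (hsrc a ha)), ⟨by omega, hd.le⟩⟩
  · by_cases h : v = s
    · subst h; exact Or.inl hts
    · exact Or.inr (Or.inr (ht v hv h))
  · by_cases hv' : v = s
    · subst hv'; rw [hd]; exact .nil
    · rw [ht v hv hv'] at h; omega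

/-- Settle the active vertex `u`. -/
theorem settle (h : Search N M src tgt len s ok t d) (hok : ∀ a, ok a) {u : ℕ} (hu : u < N)
    (htu : t u = u) (hmin : ∀ v < N, t v = v → d u ≤ d v) :
    Search N M src tgt len s (fun a => src a ≠ u) (Function.update t u N) d := by
  refine ⟨fun v hv => ?_, fun v hv => ?_, fun u' hu' h1 v hv h2 => ?_, fun a ha h1 h2 => ?_, ?_⟩
  · by_cases hvu : v = u
    · simp [hvu]
    · simpa [hvu] using h.leaf v hv
  · by_cases hvu : v = u
    · subst hvu; intro _; exact h.walk v hv (by omega)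
    · simpa [hvu] using h.walk v hv
  · have hvu : v ≠ u := by rintro rfl; simp at h2; omega
    simp [hvu] at h2
    by_cases hu'u : u' = u
    · subst hu'u; exact hmin v hv h2
    · simp [hu'u] at h1; exact h.order u' hu' h1 v hv h2
  · simp [h2] at h1
    obtain ⟨h3, h4⟩ := h.edges a ha h1 (hok a)
    refine ⟨?_, h4⟩
    by_cases hvu : tgt a = u
    · simp [hvu]
    · simpa [hvu] using h3
  · refine ⟨?_, h.source.2⟩
    by_cases hvu : s = u
    · simp [hvu]
    · simpa [hvu] using h.source.1

/-- The arc already satisfies its inequality and only joins the set of the relaxed arcs. -/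
theorem relax_no (h : Search N M src tgt len s ok t d) {a : ℕ}
    (hok : ∀ b, ok' b → ok b ∨ b = a) (h1 : t (tgt a) ≤ N) (h2 : d (tgt a) ≤ d (src a) + len a) :
    Search N M src tgt len s ok' t d := by
  refine ⟨h.leaf, h.walk, h.order, fun b hb h3 h4 => ?_, h.source⟩
  rcases hok b h4 with h5 | rfl
  · exact h.edges b hb h3 h5
  · exact ⟨h1, h2⟩

/-- The target is not settled, so no settled distance changes. Its new distance is not below that of
the source of the arc, which is the largest among the settled ones; this preserves `order`.
Distances of reached vertices only decrease, which preserves the inequalities of the arcs relaxed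
before. -/
theorem relax_yes (h : Search N M src tgt len s ok t d) {a : ℕ} (ha : a < M) (hsrc : src a < N)
    (hok : ∀ b, ok' b → ok b ∨ b = a) (hw : tgt a < N) (hset : t (tgt a) ≠ N)
    (hlen : 0 ≤ len a) (htop : ∀ v < N, t v = N → d v ≤ d (src a)) (hu : t (src a) = N)
    (h1 : N < t (tgt a) ∨ d (src a) + len a < d (tgt a)) :
    Search N M src tgt len s ok' (Function.update t (tgt a) (tgt a))
      (Function.update d (tgt a) (d (src a) + len a)) := by
  have hne : ∀ v, t v = N → v ≠ tgt a := fun v hv h => hset (h ▸ hv)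
  have hsrc' : ∀ b, Function.update t (tgt a) (tgt a) b = N → b ≠ tgt a := by
    rintro b h rfl; simp at h; omega
  have hle : ∀ v, t v ≤ N → Function.update d (tgt a) (d (src a) + len a) v ≤ d v := by
    intro v hv
    by_cases hvw : v = tgt a
    · subst hvw
      rcases h1 with h1 | h1
      · omega
      · simpa using h1.le
    · simp [hvw]
  have hle' : ∀ v, t v ≤ N → Function.update t (tgt a) (tgt a) v ≤ N := by
    intro v hv
    by_cases hvw : v = tgt a
    · simp [hvw, hw.le]
    · simpa [hvw] using hv
  refine ⟨fun v hv => ?_, fun v hv => ?_, fun u hu' h2 v hv h3 => ?_, fun b hb h2 h3 => ?_, ?_⟩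
  · by_cases hvw : v = tgt a
    · simp [hvw]
    · simpa [hvw] using h.leaf v hv
  · by_cases hvw : v = tgt a
    · subst hvw
      intro _
      simpa using (h.walk _ hsrc hu.le).snoc ha rfl
    · simpa [hvw] using h.walk v hv
  · have hu2 := hsrc' u h2
    simp only [ne_eq, hu2, not_false_eq_true, Function.update_of_ne] at h2 ⊢
    by_cases hvw : v = tgt a
    · subst hvw
      have := htop u hu' h2
      simp
      linarith
    · simp [hvw] at h3 ⊢
      exact h.order u hu' h2 v hv h3
  · have hb2 := hsrc' _ h2
    have h2' : t (src b) = N := by simpa [hb2] using h2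
    rw [Function.update_of_ne hb2]
    rcases hok b h3 with h5 | rfl
    · obtain ⟨h6, h7⟩ := h.edges b hb h2' h5
      exact ⟨hle' _ h6, (hle _ h6).trans h7⟩
    · simp [hw.le]
  · exact ⟨hle' _ h.source.1, (hle _ h.source.1).trans h.source.2⟩

/-- When no vertex is active, the distances are final. -/
theorem finish (h : Search N M src tgt len s ok t d) (hok : ∀ a, ok a) (hs : s < N)
    (htgt : ∀ a < M, tgt a < N) (hact : ∀ v < N, t v ≠ v) {v : ℕ} {x : ℝ}
    (hw : ArcWalk M src tgt len s v x) : v < N ∧ IsLeast {x | ArcWalk M src tgt len s v x} (d v) := by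
  -- Along any walk from the source all vertices are settled, and adding up the arc inequalities
  -- shows that the distance is at most the length of the walk.
  have key : ∀ {v x}, ArcWalk M src tgt len s v x → v < N ∧ t v = N ∧ d v ≤ x := by
    have hfin : ∀ v < N, t v ≤ N → t v = N := by
      intro v hv h1
      rcases h.leaf v hv with h2 | h2 | h2
      · exact absurd h2 (hact v hv)
      · exact h2
      · omega
    intro v x hw
    induction hw with
    | nil => exact ⟨hs, hfin s hs h.source.1, h.source.2⟩
    | snoc _ ha hu ih =>
      subst hu
      obtain ⟨h1, h2, h3⟩ := ih
      obtain ⟨h4, h5⟩ := h.edges _ ha h2 (hok _)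
      exact ⟨htgt _ ha, hfin _ (htgt _ ha) h4, by linarith⟩
  obtain ⟨h1, h2, h3⟩ := key hw
  exact ⟨h1, h.walk v h1 h2.le, fun y hy => (key hy).2.2⟩

end Search

/-- The other direction of an arc. -/
def revArc (a : ℕ) : ℕ := a / 2 * 4 + 1 - a

/-- The arcs `2 * j` and `2 * j + 1` are the two directions of the edge `j`; the numbers of their
sources are in column 0, and columns 11 and 12 list the arcs that leave each vertex. -/
structure ArcMemory (N E n : ℕ) (pt : ℕ → E2) (src : ℕ → ℕ) (σ : State) : Prop where
  n0 : σ.nreg 0 = N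
  n2 : σ.nreg 2 = n
  src_eq : ∀ a < 2 * E, σ.na 0 a = src a
  src_lt : ∀ a < 2 * E, src a < N
  pt_eq : ∀ v < N, σ.ra 0 v = pt v 0 ∧ σ.ra 1 v = pt v 1
  rows : Rows (fun u a => src a = u) N (2 * E) (σ.na 11) (σ.na 12)

theorem ArcMemory.frame {N E n : ℕ} {pt : ℕ → E2} {src : ℕ → ℕ} {σ σ' : State} {c : Cmd}
    (h : ArcMemory N E n pt src σ) (hf : Frame c σ σ')
    (hc : (c.modN 0 = false ∧ c.modN 2 = false) ∧ (c.modNA 0 = false ∧ c.modNA 11 = false ∧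
      c.modNA 12 = false) ∧ c.modRA 0 = false ∧ c.modRA 1 = false) : ArcMemory N E n pt src σ' := by
  obtain ⟨⟨h0, h2⟩, ⟨a0, a11, a12⟩, r0, r1⟩ := hc
  refine ⟨(hf.nreg 0 h0).trans h.n0, (hf.nreg 2 h2).trans h.n2, fun a ha => ?_, h.src_lt,
    fun v hv => ?_, ?_⟩
  · rw [hf.na 0 a0 h2 (by decide)]; exact h.src_eq a ha
  · rw [hf.ra 0 r0 h2 (by decide), hf.ra 1 r1 h2 (by decide)]; exact h.pt_eq v hv
  · rw [funext (hf.na 11 a11 h2 (by decide)), funext (hf.na 12 a12 h2 (by decide))]; exact h.rows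

theorem revArc_lt {a E : ℕ} (h : a < 2 * E) : revArc a < 2 * E := by
  unfold revArc; omega

open Classical in
/-- The arcs of `u` are relaxed up to the position `p` of the list of arcs. -/
structure Relaxing (N E : ℕ) (pt : ℕ → E2) (src : ℕ → ℕ) (s u p : ℕ) (t : ℕ → ℕ) (d : ℕ → ℝ) :
    Prop where
  search : Search N (2 * E) src (fun a => src (revArc a))
    (fun a => dist (pt (src a)) (pt (src (revArc a)))) s
    (fun a => src a = u → rowStart (fun u a => src a = u) (2 * E) u + Nat.count (fun a => src a = u) a < p) t d
  top : ∀ v < N, t v = N → d v ≤ d u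
  settled : t u = N

/-- Relax the arc at the position in register 26 of the list of arcs; its source is in register 25. -/
def relax : Cmd := block [
  .setN 29 (ld 12 (.reg 26)),
  .setN 28 (ld 0 (.reg 29 / .const 2 * .const 4 + .const 1 - .reg 29)),
  .setR 7 (rld 9 (.reg 0 + .reg 25) +
    distE (rld 0 (.reg 25)) (rld 1 (.reg 25)) (rld 0 (.reg 28)) (rld 1 (.reg 28))),
  .ite (.and (.not (.ltN (.reg 0) (ld 13 (.reg 0 + .reg 28))))
      (.not (.ltR (.reg 7) (rld 9 (.reg 0 + .reg 28)))))
    .skip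
    (block [st 13 (.reg 0 + .reg 28) (.reg 28), rst 9 (.reg 0 + .reg 28) (.reg 7),
      .setN 30 (.reg 0 + .reg 28), repair]),
  .setN 26 (.reg 26 + .const 1)]

/-- Either the arc satisfies its inequality already, or the leaf of its target gets a new candidate
and key and the path to the root is repaired. -/
theorem wp_relax {S W : ℕ} [Machine S W] {σ : State} {Q : State → ℕ → Prop} (N E n L l s u p : ℕ)
    (pt : ℕ → E2) (src : ℕ → ℕ) (h : ArcMemory N E n pt src σ)
    (hu : u < N) (h25 : σ.nreg 25 = u) (h26 : σ.nreg 26 = p)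
    (hp : rowStart (fun u a => src a = u) (2 * E) u ≤ p)
    (hp' : p < rowStart (fun u a => src a = u) (2 * E) (u + 1))
    (hl : N < 2 ^ l) (hL : 2 * N < L) (hL' : 2 * E < L) (hS : 32 * (n + L) ≤ S)
    (hT : ∀ i, 1 ≤ i → i < N → Agrees N (σ.na 13) (σ.ra 9) i)
    (hR : Relaxing N E pt src s u p (fun v => σ.na 13 (N + v)) (fun v => σ.ra 9 (N + v)))
    (post : ∀ σ' k, Frame relax σ σ' → σ'.nreg 26 = p + 1 →
      (∀ i, 1 ≤ i → i < N → Agrees N (σ'.na 13) (σ'.ra 9) i) →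
      Relaxing N E pt src s u (p + 1) (fun v => σ'.na 13 (N + v)) (fun v => σ'.ra 9 (N + v)) →
      (∀ v < N, σ'.na 13 (N + v) = N ↔ σ.na 13 (N + v) = N) →
      k ≤ 200 * (l + 1) + 200 → Q σ' k) : wp S W relax σ Q := by
  classical
  have hB := Machine.big (S := S) (W := W)
  have hSW := Machine.le (S := S) (W := W)
  obtain ⟨ha, hau, hac⟩ := h.rows.exists_eq hu hp hp'
  set a := σ.na 12 p with haeq
  have hpL : p < 2 * E := hp'.trans_le (rowStart_fibre_le _ _ _)
  have hrev : revArc a = a / 2 * 4 + 1 - a := rfl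
  have hra := revArc_lt ha
  set w := src (revArc a) with hw
  have hwN : w < N := h.src_lt _ hra
  -- Advancing the position in the list by one adds exactly the arc `a` to the relaxed arcs of `u`,
  -- since arcs of the same row are distinguished by their counts.
  have hold : ∀ b, (src b = u → rowStart (fun u a => src a = u) (2 * E) u +
      Nat.count (fun a => src a = u) b < p + 1) → (src b = u → rowStart (fun u a => src a = u) (2 * E) u +
      Nat.count (fun a => src a = u) b < p) ∨ b = a := by
    intro b hb
    by_cases hbu : src b = u
    · have := hb hbu
      by_cases hba : b = a
      · exact Or.inr hba
      · refine Or.inl fun _ => ?_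
        have hne : Nat.count (fun a => src a = u) b ≠ Nat.count (fun a => src a = u) a :=
          fun e => hba (Nat.count_injective hbu hau e)
        have : rowStart (fun u a => src a = u) (2 * E) u + Nat.count (fun a => src a = u) a = p := by
          convert hac
        omega
    · exact Or.inl fun h => absurd h hbu
  have hdist : ∀ σ' : State, (∀ i, σ'.ra 0 i = σ.ra 0 i) → (∀ i, σ'.ra 1 i = σ.ra 1 i) →
    Real.sqrt ((σ'.ra 0 u - σ'.ra 0 w) * (σ'.ra 0 u - σ'.ra 0 w) +
      (σ'.ra 1 u - σ'.ra 1 w) * (σ'.ra 1 u - σ'.ra 1 w)) = dist (pt (src a)) (pt w) := by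
    intro σ' e0 e1
    rw [e0, e0, e1, e1, (h.pt_eq u hu).1, (h.pt_eq u hu).2, (h.pt_eq w hwN).1, (h.pt_eq w hwN).2,
      sqrt_eq_dist, hau]
  have hdist0 := hdist σ (fun _ => rfl) (fun _ => rfl)
  have hset : ¬ (N < σ.na 13 (N + w)) → ¬ (σ.ra 9 (N + u) + dist (pt (src a)) (pt w) < σ.ra 9 (N + w)) →
      Relaxing N E pt src s u (p + 1) (fun v => σ.na 13 (N + v)) (fun v => σ.ra 9 (N + v)) := by
    intro h1 h2
    refine ⟨hR.search.relax_no (a := a) hold (not_lt.1 h1) ?_, hR.top, hR.settled⟩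
    have : src a = u := hau
    simp only [this] at h2 ⊢
    exact not_lt.1 h2
  refine wp_frame ?_
  unfold relax
  simp only [wp_block_cons, wp_block_nil, wp_setN, wp_setR, wp_ite, wp_skip, wp_st, wp_rst,
    BExpr.safe_and, BExpr.safe_ltN, BExpr.safe_not, BExpr.safe_ltR, BExpr.val_and, BExpr.val_ltN,
    BExpr.val_not, BExpr.val_ltR, safe_ld, safe_rld, val_ld, val_rld, safe_distE, val_distE,
    NExpr.safe_add, NExpr.safe_sub, NExpr.safe_mul, NExpr.safe_div, NExpr.safe_reg, NExpr.safe_const,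
    NExpr.val_add, NExpr.val_sub, NExpr.val_mul, NExpr.val_div, NExpr.val_reg, NExpr.val_const,
    RExpr.safe_add, RExpr.val_add, RExpr.safe_reg, RExpr.val_reg,
    State.nreg_setN, State.nreg_setNA, State.nreg_setRA, State.nreg_setR, State.rreg_setR, State.na_setN,
    State.ra_setN, State.na_setR, State.ra_setR, State.rreg_setN, State.rreg_setNA,
    ne_eq, not_false_eq_true, Nat.reduceEqDiff, if_true, if_false,
    h25, h26, h.n0, h.n2, ← haeq, ← hrev, h.src_eq _ hra, ← hw, hdist0, true_and, and_true]
  refine ⟨by omega, ⟨by omega, by omega⟩, by omega, by omega, fun hc => ?_, fun hc => ?_⟩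
  · obtain ⟨h1, h2⟩ := hc
    have h3 := hset h1 h2
    refine ⟨by omega, fun hfr => post _ _ hfr (by simp) (by simpa [State.na_setN', State.ra_setN', State.na_setR', State.ra_setR'] using hT) (by simpa using h3) (by simp) ?_⟩
    simp
  · refine ⟨by omega, by omega, by omega, by omega, by omega, ?_⟩
    -- A settled target has distance at most that of `u`, so the test would have found nothing to
    -- improve.
    have hsetw : σ.na 13 (N + w) ≠ N := by
      intro he
      refine hc ⟨by omega, not_lt.2 ?_⟩
      refine (hR.top w hwN he).trans ?_
      have : 0 ≤ dist (pt (src a)) (pt w) := dist_nonneg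
      show σ.ra 9 (N + u) ≤ _
      linarith
    have hrel : N < σ.na 13 (N + w) ∨ σ.ra 9 (N + u) + dist (pt (src a)) (pt w) < σ.ra 9 (N + w) := by
      tauto
    set nd := σ.ra 9 (N + u) + dist (pt (src a)) (pt w) with hnd
    set σ₁ := ((((σ.setN 29 a).setN 28 w).setR 7 nd).setNA 13 (N + w) w).setRA 9 (N + w) nd with hσ₁
    refine wp_mono (wp_repair (Q := fun σ' k => (∀ i, 1 ≤ i → i < N → Agrees N (σ'.na 13) (σ'.ra 9) i) ∧
      (∀ i, N ≤ i → σ'.na 13 i = σ₁.na 13 i ∧ σ'.ra 9 i = σ₁.ra 9 i) ∧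
      k ≤ 200 * (l + 1)) N n L l (N + w) (by simp [hσ₁, h.n0]) (by simp [hσ₁, h.n2]) (by simp)
      (by omega) hl hL hS ?_ (fun _ _ _ h1 h2 h3 => ⟨h1, h2, h3⟩)) ?_
    · intro i h1 h2 h3
      refine (hT i h1 h2).congr ?_ ?_ ?_
      · have : i ≠ N + w := by omega
        simp [hσ₁, this]
      · have : 2 * i ≠ N + w := by omega
        simp [hσ₁, this]
      · have : 2 * i + 1 ≠ N + w := by omega
        simp [hσ₁, this]
    · rintro σ' k fr ⟨g1, g2, g3⟩
      have e26 : σ'.nreg 26 = p := (fr.nreg 26 rfl).trans (by simp [hσ₁, h26])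
      have hnaN : ∀ v, σ'.na 13 (N + v) = Function.update (fun v => σ.na 13 (N + v)) w w v := by
        intro v
        rw [(g2 (N + v) (by omega)).1]
        by_cases hvw : v = w
        · simp [hσ₁, hvw]
        · simp [hσ₁, hvw]
      have hraN : ∀ v, σ'.ra 9 (N + v) = Function.update (fun v => σ.ra 9 (N + v)) w nd v := by
        intro v
        rw [(g2 (N + v) (by omega)).2]
        by_cases hvw : v = w
        · simp [hσ₁, hvw]
        · simp [hσ₁, hvw]
      have huw : u ≠ w := by
        rintro e
        exact hsetw (e ▸ hR.settled)
      have hS' : src a = u := hau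
      simp only [e26]
      refine ⟨by omega, fun hfr => post _ _ hfr (by simp) (by simpa [State.na_setN', State.ra_setN'] using g1) ?_ ?_ ?_⟩
      · simp only [ne_eq, Nat.reduceEqDiff, not_false_eq_true, State.na_setN, State.ra_setN]
        rw [funext hnaN, funext hraN]
        refine ⟨?_, fun v hv hv' => ?_, by simpa [huw] using hR.settled⟩
        · have := hR.search.relax_yes (a := a) ha (h.src_lt a ha) hold hwN hsetw dist_nonneg
            (by rw [hS']; exact hR.top) (by rw [hS']; exact hR.settled) (by simpa [hS', hnd] using hrel)
          simpa [hS', hnd] using this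
        · have hvw : v ≠ w := by rintro rfl; simp at hv'; omega
          simp [hvw] at hv'
          simpa [hvw, huw] using hR.top v hv hv'
      · intro v hv
        rw [State.na_setN _ _ _ _ _ (by decide), hnaN]
        by_cases hvw : v = w
        · subst hvw; simp [hsetw]; omega
        · simp [hvw]
      · simp; omega

/-- Relax the arcs at the positions between the registers 26 and 27. -/
def relaxAll : Cmd := .loop (.ltN (.reg 26) (.reg 27)) relax

theorem wp_relaxAll {S W : ℕ} [Machine S W] {σ : State} {Q : State → ℕ → Prop} (N E n L l s u : ℕ)
    (pt : ℕ → E2) (src : ℕ → ℕ) (h : ArcMemory N E n pt src σ)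
    (hu : u < N) (h25 : σ.nreg 25 = u)
    (h26 : σ.nreg 26 = rowStart (fun u a => src a = u) (2 * E) u)
    (h27 : σ.nreg 27 = rowStart (fun u a => src a = u) (2 * E) (u + 1))
    (hl : N < 2 ^ l) (hL : 2 * N < L) (hL' : 2 * E < L) (hS : 32 * (n + L) ≤ S)
    (hT : ∀ i, 1 ≤ i → i < N → Agrees N (σ.na 13) (σ.ra 9) i)
    (hR : Relaxing N E pt src s u (rowStart (fun u a => src a = u) (2 * E) u)
      (fun v => σ.na 13 (N + v)) (fun v => σ.ra 9 (N + v)))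
    (post : ∀ σ' k, Frame relaxAll σ σ' →
      (∀ i, 1 ≤ i → i < N → Agrees N (σ'.na 13) (σ'.ra 9) i) →
      Relaxing N E pt src s u (rowStart (fun u a => src a = u) (2 * E) (u + 1))
        (fun v => σ'.na 13 (N + v)) (fun v => σ'.ra 9 (N + v)) →
      (∀ v < N, σ'.na 13 (N + v) = N ↔ σ.na 13 (N + v) = N) →
      k ≤ (200 * (l + 1) + 210) * (rowStart (fun u a => src a = u) (2 * E) (u + 1) -
        rowStart (fun u a => src a = u) (2 * E) u) + 10 → Q σ' k) : wp S W relaxAll σ Q := by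
  set p₀ := rowStart (fun u a => src a = u) (2 * E) u with hp₀
  set p₁ := rowStart (fun u a => src a = u) (2 * E) (u + 1) with hp₁
  have hle : p₀ ≤ p₁ := by rw [hp₁, rowStart_succ]; exact Nat.le_add_right _ _
  refine wp_loop (fun σ' t => ∃ p, σ'.nreg 26 = p ∧ p₀ ≤ p ∧ p ≤ p₁ ∧
      (∀ i, 1 ≤ i → i < N → Agrees N (σ'.na 13) (σ'.ra 9) i) ∧
      Relaxing N E pt src s u p (fun v => σ'.na 13 (N + v)) (fun v => σ'.ra 9 (N + v)) ∧
      (∀ v < N, σ'.na 13 (N + v) = N ↔ σ.na 13 (N + v) = N) ∧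
      t ≤ (200 * (l + 1) + 210) * (p - p₀)) (fun σ' => p₁ - σ'.nreg 26)
    ⟨p₀, h26, le_rfl, hle, hT, hR, fun _ _ => Iff.rfl, Nat.zero_le _⟩ ?_
  rintro σ' t fr ⟨p, e26, h1, h2, hT', hR', hset, ht⟩
  have e27 : σ'.nreg 27 = p₁ := (fr.nreg 27 rfl).trans h27
  refine ⟨by simp, fun hb => ?_, fun hb => ?_⟩
  · simp only [BExpr.val_ltN, NExpr.val_reg, e26, e27] at hb
    refine wp_relax N E n L l s u p pt src (h.frame fr ⟨⟨rfl, rfl⟩, ⟨rfl, rfl, rfl⟩, rfl, rfl⟩) hu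
      ((fr.nreg 25 rfl).trans h25) e26 h1 hb hl hL hL' hS hT' hR' ?_
    intro σ'' k _ g26 g1 g2 g3 g4
    refine ⟨⟨p + 1, g26, by omega, by omega, g1, g2, fun v hv => (g3 v hv).trans (hset v hv), ?_⟩, ?_⟩
    · rw [show p + 1 - p₀ = (p - p₀) + 1 by omega, Nat.mul_add_one]
      simp
      omega
    · simp only [e26, g26]
      omega
  · simp only [BExpr.val_ltN, NExpr.val_reg, e26, e27] at hb
    obtain rfl : p = p₁ := by omega
    refine post _ _ fr hT' hR' hset ?_
    simp
    omega

/-- Settle the nearest active vertex. -/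
def extract : Cmd := block [
  .setN 25 (ld 13 (.const 1)),
  st 13 (.reg 0 + .reg 25) (.reg 0),
  .setN 30 (.reg 0 + .reg 25),
  repair,
  .setN 26 (ld 11 (.reg 25)),
  .setN 27 (ld 11 (.reg 25 + .const 1)),
  relaxAll]

/-- The root of the tournament tree gives an active vertex `u` of least distance. Settling it only
clears the inequalities of its own arcs, and `relaxAll` restores these. -/
theorem wp_extract {S W : ℕ} [Machine S W] {σ : State} {Q : State → ℕ → Prop} (N E n L l s : ℕ)
    (pt : ℕ → E2) (src : ℕ → ℕ) (h : ArcMemory N E n pt src σ) (hs : s < N)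
    (hl : N < 2 ^ l) (hL : 2 * N < L) (hL' : 2 * E < L) (hS : 32 * (n + L) ≤ S)
    (h1 : σ.na 13 1 < N)
    (hT : ∀ i, 1 ≤ i → i < N → Agrees N (σ.na 13) (σ.ra 9) i)
    (hR : Search N (2 * E) src (fun a => src (revArc a))
      (fun a => dist (pt (src a)) (pt (src (revArc a)))) s (fun _ => True)
      (fun v => σ.na 13 (N + v)) (fun v => σ.ra 9 (N + v)))
    (post : ∀ σ' k u, Frame extract σ σ' → u < N → σ.na 13 (N + u) ≠ N →
      (∀ i, 1 ≤ i → i < N → Agrees N (σ'.na 13) (σ'.ra 9) i) →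
      Search N (2 * E) src (fun a => src (revArc a))
        (fun a => dist (pt (src a)) (pt (src (revArc a)))) s (fun _ => True)
        (fun v => σ'.na 13 (N + v)) (fun v => σ'.ra 9 (N + v)) →
      (∀ v < N, σ'.na 13 (N + v) = N ↔ σ.na 13 (N + v) = N ∨ v = u) →
      k ≤ 600 * (l + 1) * (1 + (rowStart (fun u a => src a = u) (2 * E) (u + 1) -
        rowStart (fun u a => src a = u) (2 * E) u)) → Q σ' k) : wp S W extract σ Q := by
  have hB := Machine.big (S := S) (W := W)
  have hSW := Machine.le (S := S) (W := W)
  obtain ⟨u, hu, htu, hdu⟩ := exists_leaf hT (i := 1) le_rfl (by omega)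
  -- The leaf holds a number below `N`, so its vertex is active and the number is the vertex itself.
  have htu' : σ.na 13 (N + u) = u := by
    rcases hR.leaf u hu with h | h | h
    · exact h
    · omega
    · omega
  rw [htu'] at htu
  have hmin : ∀ v < N, σ.na 13 (N + v) = v → σ.ra 9 (N + u) ≤ σ.ra 9 (N + v) := by
    intro v hv hv'
    rw [← hdu]
    exact (root_min hT (j := N + v) (by omega) (by omega) (by omega)).2
  have hset := hR.settle (fun _ => trivial) hu htu' hmin
  refine wp_frame ?_
  unfold extract
  simp only [wp_block_cons, wp_setN, wp_st, safe_ld, val_ld, NExpr.safe_add, NExpr.safe_reg,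
    NExpr.safe_const, NExpr.val_add, NExpr.val_reg, NExpr.val_const, State.nreg_setN,
    State.nreg_setNA, Nat.reduceEqDiff, if_true, if_false, h.n0, h.n2, htu, true_and, and_true]
  refine ⟨by omega, by omega, by omega, by omega, ?_⟩
  set σ₁ := ((σ.setN 25 u).setNA 13 (N + u) N).setN 30 (N + u) with hσ₁
  have na1 : ∀ i, σ₁.na 13 i = if i = N + u then N else σ.na 13 i := by intro i; simp [hσ₁]
  have ra1 : ∀ i, σ₁.ra 9 i = σ.ra 9 i := by intro i; simp [hσ₁]
  have hA1 : ArcMemory N E n pt src σ₁ := by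
    refine ⟨by simp [hσ₁, h.n0], by simp [hσ₁, h.n2], fun a ha => by simpa [hσ₁] using h.src_eq a ha,
      h.src_lt, fun v hv => by simpa [hσ₁] using h.pt_eq v hv, ?_⟩
    convert h.rows using 1
    · funext i; simp [hσ₁]
    · funext i; simp [hσ₁]
  refine wp_repair N n L l (N + u) hA1.n0 hA1.n2 (by simp [hσ₁]) (by omega) hl hL hS ?_ ?_
  · intro i h1 h2 h3
    refine (hT i h1 h2).congr ?_ ?_ ?_
    · rw [na1, ra1, if_neg (by omega)]; simp
    · rw [na1, ra1, if_neg (by omega)]; simp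
    · rw [na1, ra1, if_neg (by omega)]; simp
  intro σ₂ k₂ fr2 hT2 hleaf hk2
  have hA2 := hA1.frame fr2 ⟨⟨rfl, rfl⟩, ⟨rfl, rfl, rfl⟩, rfl, rfl⟩
  have e25 : σ₂.nreg 25 = u := (fr2.nreg 25 rfl).trans (by simp [hσ₁])
  have hle : rowStart (fun u a => src a = u) (2 * E) u ≤ rowStart (fun u a => src a = u) (2 * E) (u + 1) := by
    rw [rowStart_succ]; exact Nat.le_add_right _ _
  have hst := hA2.rows.start_eq u hu.le
  have hst' := hA2.rows.start_eq (u + 1) hu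
  simp only [State.nreg_setN, Nat.reduceEqDiff, if_true, if_false, State.na_setN, ne_eq,
    not_false_eq_true, e25, hA2.n2, hst, hst']
  refine ⟨by omega, by omega, ?_⟩
  have hna2 : ∀ v, σ₂.na 13 (N + v) = Function.update (fun v => σ.na 13 (N + v)) u N v := by
    intro v
    rw [(hleaf (N + v) (by omega)).1, na1]
    by_cases hvu : v = u
    · simp [hvu]
    · simp [hvu]
  have hra2 : ∀ v, σ₂.ra 9 (N + v) = σ.ra 9 (N + v) := fun v => by
    rw [(hleaf (N + v) (by omega)).2, ra1]
  have hA3 : ∀ p q, ArcMemory N E n pt src ((σ₂.setN 26 p).setN 27 q) := fun p q =>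
    ⟨by simp [hA2.n0], by simp [hA2.n2], fun a ha => by simpa using hA2.src_eq a ha,
      h.src_lt, fun v hv => by simpa using hA2.pt_eq v hv, by simpa [State.na_setN'] using hA2.rows⟩
  refine wp_relaxAll N E n L l s u pt src (hA3 (rowStart (fun u a => src a = u) (2 * E) u)
    (rowStart (fun u a => src a = u) (2 * E) (u + 1))) hu (by simp [e25]) (by simp) (by simp) hl hL hL' hS
    (by simpa [State.na_setN', State.ra_setN'] using hT2) ?_ ?_
  · refine ⟨?_, ?_, ?_⟩
    · simp only [ne_eq, Nat.reduceEqDiff, not_false_eq_true, State.na_setN, State.ra_setN, hna2, hra2]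
      exact hset.congr hs h.src_lt (fun a ha => h.src_lt _ (revArc_lt ha))
        (fun a _ h1 h2 => by have := h1 h2; omega) (fun _ _ => rfl) (fun _ _ => rfl)
    · intro v hv hv'
      simp only [ne_eq, Nat.reduceEqDiff, not_false_eq_true, State.na_setN, State.ra_setN, hna2, hra2] at hv' ⊢
      by_cases hvu : v = u
      · rw [hvu]
      · rw [Function.update_of_ne hvu] at hv'
        exact hR.order v hv hv' u hu htu'
    · simp [hna2]
  · intro σ₃ k₃ fr3 hT3 hR3 hset3 hk3
    rw [wp_block_nil]
    intro fr
    refine post _ _ u fr hu (by omega) hT3 ?_ ?_ ?_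
    · refine hR3.search.congr hs h.src_lt (fun a ha => h.src_lt _ (revArc_lt ha)) ?_
        (fun _ _ => rfl) (fun _ _ => rfl)
      intro a ha _ hau
      rw [rowStart_succ]
      convert Nat.add_lt_add_left (Nat.count_strict_mono (p := fun a => src a = u) hau ha) _
    · intro v hv
      rw [hset3 v hv]
      simp only [ne_eq, Nat.reduceEqDiff, not_false_eq_true, State.na_setN, hna2]
      by_cases hvu : v = u
      · simp [hvu]
      · simp [hvu]
    · set D := rowStart (fun u a => src a = u) (2 * E) (u + 1) - rowStart (fun u a => src a = u) (2 * E) u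
      have : 600 * (l + 1) * (1 + D) = 600 * (l + 1) + (200 * (l + 1) + 210) * D +
        (400 * l + 190) * D := by ring
      simp
      omega

/-- Dijkstra's algorithm from the vertex in register 23: the distance to vertex `v` is left in the
cell `N + v` of the real column 9. -/
def dijkstra : Cmd := block [
  forN 24 (.reg 0 + .reg 0) (block [
    st 13 (.reg 24) (.reg 0 + .const 1),
    rst 9 (.reg 24) (.ofNat (.const 0))]),
  st 13 (.reg 0 + .reg 23) (.reg 23),
  .setN 30 (.reg 0 + .reg 23),
  repair,
  .loop (.ltN (ld 13 (.const 1)) (.reg 0)) extract]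

/-- Each vertex is settled at most once and its arcs are then read once, each at the cost of one
repair; in total that is O((N + E) log N). -/
theorem wp_dijkstra {S W : ℕ} [Machine S W] {σ : State} {Q : State → ℕ → Prop} (N E n L l s : ℕ)
    (pt : ℕ → E2) (src : ℕ → ℕ) (h : ArcMemory N E n pt src σ) (hs : s < N) (h23 : σ.nreg 23 = s)
    (hl : N < 2 ^ l) (hL : 2 * N < L) (hL' : 2 * E < L) (hS : 32 * (n + L) ≤ S)
    (post : ∀ σ' k, Frame dijkstra σ σ' →
      (∀ v x, ArcWalk (2 * E) src (fun a => src (revArc a))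
        (fun a => dist (pt (src a)) (pt (src (revArc a)))) s v x →
        IsLeast {x | ArcWalk (2 * E) src (fun a => src (revArc a))
          (fun a => dist (pt (src a)) (pt (src (revArc a)))) s v x} (σ'.ra 9 (N + v))) →
      k ≤ 1000 * (l + 1) * (N + 2 * E + 1) → Q σ' k) : wp S W dijkstra σ Q := by
  have hB := Machine.big (S := S) (W := W)
  have hSW := Machine.le (S := S) (W := W)
  refine wp_frame ?_
  unfold dijkstra
  rw [wp_block_cons]
  refine wp_forN (2 * N) 30 (fun i σ' => ∀ j < i, σ'.na 13 j = N + 1 ∧ σ'.ra 9 j = 0) (by omega) rfl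
    (fun _ σ' _ fr _ => ?_) (by simp) ?_ ?_
  · simp [(fr.nreg 0 rfl).trans h.n0]; omega
  · intro i σ' hi fr e24 hI
    simp only [wp_block_cons, wp_block_nil, wp_st, wp_rst, NExpr.safe_reg, NExpr.safe_add,
      NExpr.safe_const, RExpr.safe_ofNat, NExpr.val_reg, NExpr.val_add, NExpr.val_const, RExpr.val_ofNat,
      State.nreg_setNA, (fr.nreg 0 rfl).trans h.n0, (fr.nreg 2 rfl).trans h.n2, e24, true_and, and_true]
    refine ⟨by omega, ⟨by omega, by omega⟩, by omega, by omega, fun j hj => ?_, by simp⟩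
    by_cases hji : j = i
    · simp [hji]
    · simpa [hji] using hI j (by omega)
  intro σ₁ k₁ fr1 _ hI hk1
  have hA1 := h.frame fr1 ⟨⟨rfl, rfl⟩, ⟨rfl, rfl, rfl⟩, rfl, rfl⟩
  have e23 : σ₁.nreg 23 = s := (fr1.nreg 23 rfl).trans h23
  simp only [wp_block_cons, wp_block_nil, wp_setN, wp_st, NExpr.safe_reg, NExpr.safe_add,
    NExpr.val_reg, NExpr.val_add, State.nreg_setNA, hA1.n0, hA1.n2, e23, true_and, and_true]
  refine ⟨by omega, by omega, by omega, ?_⟩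
  set σ₂ := (σ₁.setNA 13 (N + s) s).setN 30 (N + s) with hσ₂
  have na2 : ∀ i, σ₂.na 13 i = if i = N + s then s else σ₁.na 13 i := by intro i; simp [hσ₂]
  have ra2 : ∀ i, σ₂.ra 9 i = σ₁.ra 9 i := by intro i; simp [hσ₂]
  have hA2 : ArcMemory N E n pt src σ₂ := by
    refine ⟨by simp [hσ₂, hA1.n0], by simp [hσ₂, hA1.n2], fun a ha => by simpa [hσ₂] using hA1.src_eq a ha,
      h.src_lt, fun v hv => by simpa [hσ₂] using hA1.pt_eq v hv, ?_⟩
    convert hA1.rows using 1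
    · funext i; simp [hσ₂]
    · funext i; simp [hσ₂]
  refine wp_repair N n L l (N + s) hA2.n0 hA2.n2 (by simp [hσ₂]) (by omega) hl hL hS ?_ ?_
  · intro i h1 h2 h3
    have c1 : 2 * i ≠ N + s := by omega
    have c2 : 2 * i + 1 ≠ N + s := by omega
    have c3 : i ≠ N + s := by omega
    -- Away from the leaf of the source all nodes hold the dummy candidate `N + 1` with key 0, and
    -- equal nodes agree.
    refine ⟨fun hr => ?_, fun _ => ?_⟩
    · have := hr.1
      rw [na2, if_neg c2, (hI (2 * i + 1) (by omega)).1] at this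
      omega
    · rw [na2, na2, ra2, ra2, if_neg c1, if_neg c3, (hI i (by omega)).1, (hI i (by omega)).2,
        (hI (2 * i) (by omega)).1, (hI (2 * i) (by omega)).2]
      simp
  intro σ₃ k₃ fr3 hT3 hleaf hk3
  have hA3 := hA2.frame fr3 ⟨⟨rfl, rfl⟩, ⟨rfl, rfl, rfl⟩, rfl, rfl⟩
  have na3 : ∀ v, v < N → σ₃.na 13 (N + v) = if v = s then s else N + 1 := by
    intro v hv
    rw [(hleaf (N + v) (by omega)).1, na2]
    by_cases hvs : v = s
    · simp [hvs]
    · rw [if_neg (by omega), if_neg hvs, (hI (N + v) (by omega)).1]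
  have hR3 : Search N (2 * E) src (fun a => src (revArc a))
      (fun a => dist (pt (src a)) (pt (src (revArc a)))) s (fun _ => True)
      (fun v => σ₃.na 13 (N + v)) (fun v => σ₃.ra 9 (N + v)) := by
    refine Search.init hs (fun v hv hvs => ?_) ?_ ?_ h.src_lt
    · rw [na3 v hv, if_neg hvs]
    · rw [na3 s hs, if_pos rfl]
    · rw [(hleaf (N + s) (by omega)).2, ra2, (hI (N + s) (by omega)).2]
  classical
  let deg : ℕ → ℕ := fun u =>
    1 + (rowStart (fun u a => src a = u) (2 * E) (u + 1) - rowStart (fun u a => src a = u) (2 * E) u)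
  -- The work already done: each settled vertex counts one plus its number of arcs. It is at most `N
  -- + 2 * E` and grows with every extraction, so it serves as the variant of the loop and as the
  -- measure of time.
  let Ψ : State → ℕ := fun σ => ∑ u ∈ Finset.range N, if σ.na 13 (N + u) = N then deg u else 0
  have hdeg : ∀ m, ∑ u ∈ Finset.range m, deg u = m + rowStart (fun u a => src a = u) (2 * E) m := by
    intro m
    induction m with
    | zero => simp [rowStart]
    | succ m ih =>
      rw [Finset.sum_range_succ, ih]
      simp only [deg, rowStart_succ]
      omega
  have hΨ : ∀ σ, Ψ σ ≤ N + 2 * E := by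
    intro σ
    refine (Finset.sum_le_sum (g := deg) fun u _ => by split <;> simp).trans ?_
    rw [hdeg]
    exact Nat.add_le_add_left (rowStart_fibre_le _ _ _) _
  refine wp_loop (fun σ' t => (∀ i, 1 ≤ i → i < N → Agrees N (σ'.na 13) (σ'.ra 9) i) ∧
      Search N (2 * E) src (fun a => src (revArc a))
        (fun a => dist (pt (src a)) (pt (src (revArc a)))) s (fun _ => True)
        (fun v => σ'.na 13 (N + v)) (fun v => σ'.ra 9 (N + v)) ∧ t ≤ 620 * (l + 1) * Ψ σ')
      (fun σ' => N + 2 * E - Ψ σ') ⟨hT3, hR3, by simp⟩ ?_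
  rintro σ' t fr ⟨hT, hR, ht⟩
  have hA := hA3.frame fr ⟨⟨rfl, rfl⟩, ⟨rfl, rfl, rfl⟩, rfl, rfl⟩
  refine ⟨by simp [hA.n2]; omega, fun hb => ?_, fun hb => ?_⟩
  · simp only [BExpr.val_ltN, val_ld, NExpr.val_const, NExpr.val_reg, hA.n0] at hb
    refine wp_extract N E n L l s pt src hA hs hl hL hL' hS hb hT hR ?_
    intro σ'' k u _ hu hun hT' hR' hset hk
    have hΨ' : Ψ σ'' = Ψ σ' + deg u := by
      have : ∀ v ∈ Finset.range N, (if σ''.na 13 (N + v) = N then deg v else 0) =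
          (if σ'.na 13 (N + v) = N then deg v else 0) + if u = v then deg v else 0 := by
        intro v hv
        rw [Finset.mem_range] at hv
        simp only [hset v hv]
        by_cases hvu : v = u
        · subst hvu; simp [hun]
        · simp [hvu, Ne.symm hvu]
      simp only [Ψ]
      rw [Finset.sum_congr rfl this, Finset.sum_add_distrib, Finset.sum_ite_eq,
        if_pos (Finset.mem_range.2 hu)]
    have hd1 : 1 ≤ deg u := Nat.le_add_right _ _
    have hle := hΨ σ''
    refine ⟨⟨hT', hR', ?_⟩, by omega⟩
    rw [hΨ']
    have : 620 * (l + 1) * (Ψ σ' + deg u) = 620 * (l + 1) * Ψ σ' + 600 * (l + 1) * deg u +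
      20 * ((l + 1) * deg u) := by ring
    have h1 : 1 * 1 ≤ (l + 1) * deg u := Nat.mul_le_mul (by omega) hd1
    change k ≤ 600 * (l + 1) * deg u at hk
    simp
    omega
  · simp only [BExpr.val_ltN, val_ld, NExpr.val_const, NExpr.val_reg, hA.n0] at hb
    intro frame
    refine post _ _ frame (fun v x hw => ?_) ?_
    · refine (hR.finish (fun _ => trivial) hs (fun a ha => h.src_lt _ (revArc_lt ha)) ?_ hw).2
      intro v hv hv'
      exact hb (root_min hT (j := N + v) (by omega) (by omega) (by omega)).1
    · have h1 := Nat.mul_le_mul_left (620 * (l + 1)) (hΨ σ')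
      have h2 : 1000 * (l + 1) * (N + 2 * E + 1) = 620 * (l + 1) * (N + 2 * E) +
        380 * (l * (N + 2 * E)) + 380 * (N + 2 * E) + 1000 * (l + 1) := by ring
      simp at hk1 ⊢
      omega

/-- The arcs that leave each vertex are listed in the columns 11 and 12. -/
def listArcs : Cmd := listRows (.reg 0) (.reg 1 + .reg 1)
  (.and (.not (.ltN (ld 0 (.reg 21)) (.reg 20))) (.not (.ltN (.reg 20) (ld 0 (.reg 21))))) 11 12

theorem wp_listArcs {S W : ℕ} [Machine S W] {σ : State} {Q : State → ℕ → Prop} (N E n L : ℕ)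
    (pt : ℕ → E2) (src : ℕ → ℕ) (hN : σ.nreg 0 = N) (hE : σ.nreg 1 = E) (hn : σ.nreg 2 = n)
    (hL : 2 * (N + E) < L) (hS : 32 * (n + L) ≤ S)
    (hsrc : ∀ a < 2 * E, σ.na 0 a = src a) (hlt : ∀ a < 2 * E, src a < N)
    (hpt : ∀ v < N, σ.ra 0 v = pt v 0 ∧ σ.ra 1 v = pt v 1)
    (post : ∀ σ' k, Frame listArcs σ σ' → ArcMemory N E n pt src σ' →
      k ≤ N * (2 * E * 100 + 100) + 100 → Q σ' k) : wp S W listArcs σ Q := by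
  have hB := Machine.big (S := S) (W := W)
  have hSW := Machine.le (S := S) (W := W)
  refine wp_listRows (fun u a => src a = u) N (2 * E) n L (by decide) (by decide) (by decide) hn hS
    (by omega) (by omega) ((rowStart_fibre_le _ _ _).trans_lt (by omega)) (fun σ' fr => ?_)
    (fun σ' fr => ?_) (fun σ' fr h1 h2 => ?_) (fun σ' k fr hR hk => ?_)
  · simp [(fr.nreg 0 rfl).trans hN]
  · simp [(fr.nreg 1 rfl).trans hE]; omega
  · have e0 : σ'.na 0 (σ'.nreg 21) = src (σ'.nreg 21) :=
      (fr.na 0 rfl rfl (by decide) _).trans (hsrc _ h2)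
    simp only [BExpr.safe_and, BExpr.safe_not, BExpr.safe_ltN, safe_ld, NExpr.safe_reg, NExpr.val_reg,
      BExpr.val_and, BExpr.val_not, BExpr.val_ltN, val_ld, e0, (fr.nreg 2 rfl).trans hn, true_and, and_true]
    exact ⟨⟨by omega, fun _ => by omega⟩, by omega⟩
  · refine post σ' k fr ⟨(fr.nreg 0 rfl).trans hN, (fr.nreg 2 rfl).trans hn, fun a ha => ?_, hlt,
      fun v hv => ?_, hR⟩ ?_
    · exact (fr.na 0 rfl rfl (by decide) _).trans (hsrc _ ha)
    · rw [fr.ra 0 rfl rfl (by decide), fr.ra 1 rfl rfl (by decide)]; exact hpt v hv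
    · simp at hk
      refine hk.trans ?_
      have : N * (2 * E * 56 + 3 + 1 + 40) ≤ N * (2 * E * 100 + 100) := Nat.mul_le_mul_left _ (by omega)
      omega

/-! ### The spanning ratio -/

/-- The walks of the graph, by the numbers of the vertices. -/
def Walks (E : ℕ) (pt : ℕ → E2) (src : ℕ → ℕ) (u v : ℕ) : Set ℝ :=
  {x | ArcWalk (2 * E) src (fun a => src (revArc a))
    (fun a => dist (pt (src a)) (pt (src (revArc a)))) u v x}

/-- The least `τ ≥ 1` such that the graph is a `τ`-spanner is computed in the real register 5. -/
def spanningRatio : Cmd := block [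
  .setR 5 (.ofNat (.const 1)),
  forN 23 (.reg 0) (block [
    dijkstra,
    forN 24 (.reg 0) (block [
      .setR 7 (distE (rld 0 (.reg 23)) (rld 1 (.reg 23)) (rld 0 (.reg 24)) (rld 1 (.reg 24))),
      .ite (.ltR (.reg 5 * .reg 7) (rld 9 (.reg 0 + .reg 24)))
        (.setR 5 (rld 9 (.reg 0 + .reg 24) / .reg 7)) .skip])])]

/-- The maximum of 1 and all quotients of graph distance and Euclidean distance, updated only when
the current value fails for a pair. Every quotient is at most each admissible `τ`, hence so is the
result. -/
theorem wp_spanningRatio {S W : ℕ} [Machine S W] {σ : State} {Q : State → ℕ → Prop} (N E n L l : ℕ)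
    (pt : ℕ → E2) (src : ℕ → ℕ) (τ : ℝ) (h : ArcMemory N E n pt src σ) (hτ1 : 1 ≤ τ)
    (hl : N < 2 ^ l) (hL : 2 * N < L) (hL' : 2 * E < L) (hS : 32 * (n + L) ≤ S)
    (hτ : ∀ u < N, ∀ v < N, ∃ x, IsLeast (Walks E pt src u v) x ∧ x ≤ τ * dist (pt u) (pt v))
    (post : ∀ σ' k, Frame spanningRatio σ σ' → 1 ≤ σ'.rreg 5 → σ'.rreg 5 ≤ τ →
      (∀ u < N, ∀ v < N, ∃ x, IsLeast (Walks E pt src u v) x ∧ x ≤ σ'.rreg 5 * dist (pt u) (pt v)) →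
      k ≤ N * (1200 * (l + 1) * (N + 2 * E + 1)) + 20 → Q σ' k) : wp S W spanningRatio σ Q := by
  have hB := Machine.big (S := S) (W := W)
  have hSW := Machine.le (S := S) (W := W)
  choose! g hg1 hg2 using hτ
  refine wp_frame ?_
  unfold spanningRatio
  simp only [wp_block_cons, wp_setR, RExpr.safe_ofNat, NExpr.safe_const, RExpr.val_ofNat,
    NExpr.val_const, Nat.cast_one]
  refine ⟨by omega, ?_⟩
  set σ₀ := σ.setR 5 1 with hσ₀
  have hA0 : ArcMemory N E n pt src σ₀ := ⟨h.n0, h.n2, h.src_eq, h.src_lt, h.pt_eq, h.rows⟩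
  refine wp_forN N (1000 * (l + 1) * (N + 2 * E + 1) + N * 170 + 20) (fun u σ' => 1 ≤ σ'.rreg 5 ∧ σ'.rreg 5 ≤ τ ∧
      ∀ u' < u, ∀ v < N, g u' v ≤ σ'.rreg 5 * dist (pt u') (pt v)) (by omega) rfl
    (fun _ σ' _ fr _ => by simp [(fr.nreg 0 rfl).trans hA0.n0]) ⟨by simp [hσ₀], by simpa [hσ₀], by simp⟩
    ?_ ?_
  · rintro u σ' hu fr e23 ⟨h1, h2, h3⟩
    have hA := hA0.frame fr ⟨⟨rfl, rfl⟩, ⟨rfl, rfl, rfl⟩, rfl, rfl⟩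
    rw [wp_block_cons]
    refine wp_mono (wp_dijkstra (Q := fun σ' k => (∀ v x, x ∈ Walks E pt src u v →
        IsLeast (Walks E pt src u v) (σ'.ra 9 (N + v))) ∧ k ≤ 1000 * (l + 1) * (N + 2 * E + 1))
      N E n L l u pt src hA hu e23 hl hL hL' hS (fun _ _ _ h1 h2 => ⟨h1, h2⟩)) ?_
    rintro σ₁ k₁ fr1 ⟨hd, hk1⟩
    have hA1 := hA.frame fr1 ⟨⟨rfl, rfl⟩, ⟨rfl, rfl, rfl⟩, rfl, rfl⟩
    have hd' : ∀ v < N, σ₁.ra 9 (N + v) = g u v := fun v hv =>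
      (hd v _ (hg1 u hu v hv).1).unique (hg1 u hu v hv)
    have e23' : σ₁.nreg 23 = u := (fr1.nreg 23 rfl).trans e23
    have e5 : σ₁.rreg 5 = σ'.rreg 5 := fr1.rreg 5 rfl
    rw [wp_block_cons]
    refine wp_forN N 150 (fun v σ₂ => 1 ≤ σ₂.rreg 5 ∧ σ₂.rreg 5 ≤ τ ∧
      (∀ u' < u, ∀ v < N, g u' v ≤ σ₂.rreg 5 * dist (pt u') (pt v)) ∧
      ∀ v' < v, g u v' ≤ σ₂.rreg 5 * dist (pt u) (pt v')) (by omega) rfl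
      (fun _ σ' _ fr _ => by simp [(fr.nreg 0 rfl).trans hA1.n0])
      ⟨by simpa [e5], by simpa [e5], by simpa [e5], by simp⟩ ?_ ?_
    · rintro v σ₂ hv fr2 e24 ⟨g1, g2, g3, g4⟩
      have hA2 := hA1.frame fr2 ⟨⟨rfl, rfl⟩, ⟨rfl, rfl, rfl⟩, rfl, rfl⟩
      have f23 : σ₂.nreg 23 = u := (fr2.nreg 23 rfl).trans e23'
      have f9 : σ₂.ra 9 (N + v) = g u v := (fr2.ra 9 rfl rfl (by decide) _).trans (hd' v hv)
      have hdist : Real.sqrt ((σ₂.ra 0 u - σ₂.ra 0 v) * (σ₂.ra 0 u - σ₂.ra 0 v) +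
          (σ₂.ra 1 u - σ₂.ra 1 v) * (σ₂.ra 1 u - σ₂.ra 1 v)) = dist (pt u) (pt v) := by
        rw [(hA2.pt_eq u hu).1, (hA2.pt_eq u hu).2, (hA2.pt_eq v hv).1, (hA2.pt_eq v hv).2, sqrt_eq_dist]
      simp only [wp_block_cons, wp_block_nil, wp_setR, wp_ite, wp_skip, safe_distE, val_distE, safe_rld,
        val_rld, NExpr.safe_reg, NExpr.safe_add, NExpr.val_reg, NExpr.val_add, BExpr.safe_ltR, BExpr.val_ltR,
        RExpr.safe_mul, RExpr.safe_div, RExpr.safe_reg, RExpr.val_mul, RExpr.val_div, RExpr.val_reg,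
        State.nreg_setR, State.rreg_setR, State.ra_setR, Nat.reduceEqDiff, if_true, if_false,
        hA2.n0, hA2.n2, e24, f23, f9, hdist, true_and, and_true]
      refine ⟨by omega, by omega, fun hb => ?_, fun hb => ?_⟩
      -- Coinciding points have graph distance at most `τ * 0`, so the test cannot hold for them;
      -- there is no division by zero.
      · have hpos : 0 < dist (pt u) (pt v) := by
          rcases (dist_nonneg (x := pt u) (y := pt v)).eq_or_lt with he | he
          · have := hg2 u hu v hv
            rw [← he] at this hb
            simp at this hb
            linarith
          · exact he
        have hlt : σ₂.rreg 5 < g u v / dist (pt u) (pt v) := (lt_div_iff₀ hpos).2 hb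
        refine ⟨⟨by omega, by omega⟩, ⟨by simp; linarith, ?_, fun u' hu' v' hv' => ?_, fun v' hv' => ?_⟩, by simp⟩
        · simpa using (div_le_iff₀ hpos).2 (hg2 u hu v hv)
        · refine (g3 u' hu' v' hv').trans ?_
          simpa using mul_le_mul_of_nonneg_right hlt.le dist_nonneg
        · by_cases hvv : v' = v
          · subst hvv
            simp [div_mul_cancel₀ _ hpos.ne']
          · refine (g4 v' (by omega)).trans ?_
            simpa using mul_le_mul_of_nonneg_right hlt.le dist_nonneg
      · refine ⟨⟨by simpa, by simpa, by simpa using g3, fun v' hv' => ?_⟩, by simp⟩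
        by_cases hvv : v' = v
        · subst hvv
          simpa using not_lt.1 hb
        · simpa using g4 v' (by omega)
    · rintro σ₂ k₂ fr2 _ ⟨g1, g2, g3, g4⟩ hk2
      rw [wp_block_nil]
      refine ⟨⟨by simpa, by simpa, fun u' hu' v hv => ?_⟩, ?_⟩
      · by_cases huu : u' = u
        · subst huu; simpa using g4 v hv
        · simpa using g3 u' (by omega) v hv
      · simp at hk2
        omega
  · rintro σ' k fr _ ⟨h1, h2, h3⟩ hk
    rw [wp_block_nil]
    intro frame
    refine post _ _ frame h1 h2 (fun u hu v hv => ⟨g u v, hg1 u hu v hv, h3 u hu v hv⟩) ?_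
    simp only [NExpr.cost_reg, RExpr.cost_ofNat, NExpr.cost_const] at hk ⊢
    have h1 : 1000 * (l + 1) * (N + 2 * E + 1) + N * 170 + 20 + 1 + 7 ≤ 1200 * (l + 1) * (N + 2 * E + 1) := by
      have : 1200 * (l + 1) * (N + 2 * E + 1) = 1000 * (l + 1) * (N + 2 * E + 1) +
        200 * (l * (N + 2 * E + 1)) + 200 * (N + 2 * E + 1) := by ring
      omega
    have h2 := Nat.mul_le_mul_left N h1
    omega

/-! ### Packing -/

/-- The constant 3 / 2 is a rational bound for the square root of 2. -/
theorem dist_le_of_coord {x y : E2} {a : ℝ} (h0 : |x 0 - y 0| ≤ a) (h1 : |x 1 - y 1| ≤ a) :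
    dist x y ≤ 3 / 2 * a := by
  rw [← sqrt_eq_dist]
  have ha : 0 ≤ a := (abs_nonneg _).trans h0
  refine Real.sqrt_le_iff.2 ⟨by positivity, ?_⟩
  have e0 := abs_mul_abs_self (x 0 - y 0)
  have e1 := abs_mul_abs_self (x 1 - y 1)
  nlinarith [mul_self_le_mul_self (abs_nonneg _) h0, mul_self_le_mul_self (abs_nonneg _) h1]

theorem abs_coord_le_dist (x y : E2) (i : Fin 2) : |x i - y i| ≤ dist x y := by
  rw [← Real.dist_eq]
  exact EuclideanSpace.dist_eq x y ▸ Real.abs_le_sqrt (by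
    have := Finset.single_le_sum (f := fun i => dist (x i) (y i) ^ 2) (s := Finset.univ)
      (fun _ _ => sq_nonneg _) (Finset.mem_univ i)
    simpa using this) |>.trans' (le_abs_self _)

/-- Cut the plane into cells of side `δ / 2`. Two points in one cell have distance at most `3 / 2 *
(δ / 2)`, less than `δ`, so each cell contains at most one point. In each direction a segment of
length `2 * D` meets at most `4 * D / δ + 2` cells. -/
theorem card_le_of_separated {A : Finset ℕ} {q : ℕ → E2} {c : E2} {D δ : ℝ} (hδ : 0 < δ)
    (hD : ∀ a ∈ A, dist (q a) c ≤ D) (hsep : ∀ a ∈ A, ∀ b ∈ A, a < b → δ ≤ dist (q a) (q b)) :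
    (A.card : ℝ) ≤ (4 * D / δ + 2) ^ 2 := by
  rcases A.eq_empty_or_nonempty with rfl | ⟨a₀, ha₀⟩
  · simp; positivity
  have hD0 : 0 ≤ D := dist_nonneg.trans (hD a₀ ha₀)
  have h2 : 0 < δ / 2 := by positivity
  let I : Fin 2 → Finset ℤ := fun i =>
    Finset.Icc ⌊(c i - D) / (δ / 2)⌋ ⌊(c i + D) / (δ / 2)⌋
  have hI : ∀ i, ((I i).card : ℝ) ≤ 4 * D / δ + 2 := by
    intro i
    have h3 : ⌊(c i - D) / (δ / 2)⌋ ≤ ⌊(c i + D) / (δ / 2)⌋ :=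
      Int.floor_le_floor (by gcongr; linarith)
    have h4 : ((I i).card : ℤ) = ⌊(c i + D) / (δ / 2)⌋ + 1 - ⌊(c i - D) / (δ / 2)⌋ := by
      rw [Int.card_Icc, Int.toNat_of_nonneg (by omega)]
    have h5 : ((I i).card : ℝ) = ⌊(c i + D) / (δ / 2)⌋ + 1 - ⌊(c i - D) / (δ / 2)⌋ := by
      exact_mod_cast h4
    have h6 := Int.floor_le ((c i + D) / (δ / 2))
    have h7 := Int.lt_floor_add_one ((c i - D) / (δ / 2))
    have h8 : (c i + D) / (δ / 2) - (c i - D) / (δ / 2) = 4 * D / δ := by field_simp; ring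
    rw [h5]
    linarith
  have hcard : A.card ≤ (I 0 ×ˢ I 1).card := by
    refine Finset.card_le_card_of_injOn (fun a => (⌊q a 0 / (δ / 2)⌋, ⌊q a 1 / (δ / 2)⌋)) ?_ ?_
    · intro a ha
      have key : ∀ i : Fin 2, ⌊q a i / (δ / 2)⌋ ∈ I i := by
        intro i
        have := abs_le.1 ((abs_coord_le_dist (q a) c i).trans (hD a ha))
        refine Finset.mem_Icc.2 ⟨Int.floor_le_floor ?_, Int.floor_le_floor ?_⟩ <;> gcongr <;> linarith
      exact Finset.mem_coe.2 (Finset.mem_product.2 ⟨key 0, key 1⟩)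
    · have main : ∀ a ∈ A, ∀ b ∈ A, a < b → (⌊q a 0 / (δ / 2)⌋, ⌊q a 1 / (δ / 2)⌋) ≠
          (⌊q b 0 / (δ / 2)⌋, ⌊q b 1 / (δ / 2)⌋) := by
        intro a ha b hb hlt he
        have key : ∀ i : Fin 2, ⌊q a i / (δ / 2)⌋ = ⌊q b i / (δ / 2)⌋ →
            |q a i - q b i| ≤ δ / 2 := by
          intro i hi
          have h3 := (Int.abs_sub_lt_one_of_floor_eq_floor hi).le
          rw [← sub_div, abs_div, abs_of_pos h2, div_le_one h2] at h3
          exact h3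
        obtain ⟨e0, e1⟩ := Prod.mk.inj he
        have := dist_le_of_coord (key 0 e0) (key 1 e1)
        have := hsep a ha b hb hlt
        linarith
      intro a ha b hb he
      rcases lt_trichotomy a b with h | h | h
      · exact absurd he (main a ha b hb h)
      · exact h
      · exact absurd he.symm (main b hb a ha h)
  have h0 := hI 0
  have h1 := hI 1
  calc (A.card : ℝ) ≤ (I 0).card * (I 1).card := by
        rw [Finset.card_product] at hcard
        exact_mod_cast hcard
    _ ≤ (4 * D / δ + 2) * (4 * D / δ + 2) := by gcongr
    _ = _ := by ring

/-! ### Neighbours -/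

/-- The relation of neighbouring points in a farthest-first order. -/
def Nbr (q : ℕ → E2) (lam : ℕ → ℝ) (u w : ℕ) : Prop :=
  w ≠ u ∧ dist (q w) (q u) ≤ 16 * lam (max u w)

theorem Nbr.symm {q : ℕ → E2} {lam : ℕ → ℝ} {u w : ℕ} (h : Nbr q lam u w) : Nbr q lam w u :=
  ⟨h.1.symm, by rw [dist_comm, max_comm]; exact h.2⟩

/-- The farthest-first order `q` with the positive radii `lam`. -/
structure Net (N : ℕ) (q : ℕ → E2) (lam : ℕ → ℝ) : Prop where
  pos : ∀ j, 1 ≤ j → j < N → 0 < lam j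
  sep : ∀ i j, i < j → j < N → lam j ≤ dist (q i) (q j)
  cover : ∀ j, 1 ≤ j → j < N → ∀ v < N, ∃ i < j, dist (q v) (q i) ≤ lam j

/-- The point `j` is within `lam i` of some point before `i`, and it is at least `lam j` away from
it. -/
theorem Net.antitone {N : ℕ} {q : ℕ → E2} {lam : ℕ → ℝ} (h : Net N q lam) {i j : ℕ} (hi : 1 ≤ i)
    (hij : i ≤ j) (hj : j < N) : lam j ≤ lam i := by
  obtain ⟨a, ha, hd⟩ := h.cover i hi (by omega) j hj
  exact (h.sep a j (by omega) hj).trans (by rwa [dist_comm])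

section

variable {N : ℕ} {q : ℕ → E2} {lam : ℕ → ℝ} (h : Net N q lam)
include h

open Classical in
/-- Every point has a bounded number of earlier neighbours. -/
theorem Net.card_earlier {w : ℕ} (hw : w < N) :
    ((Finset.range w).filter fun y => Nbr q lam y w).card ≤ 4356 := by
  rcases Nat.eq_zero_or_pos w with rfl | hw0
  · simp
  have hp := h.pos w hw0 hw
  have := card_le_of_separated (A := (Finset.range w).filter fun y => Nbr q lam y w) (q := q) (c := q w)
    (D := 16 * lam w) hp (fun a ha => ?_) (fun a ha b hb hab => ?_)
  -- Packing with ratio 16: the bound is 66 ^ 2 = 4356. The separation is `lam w`, because the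
  -- scales of earlier points are no smaller.
  · rw [show 4 * (16 * lam w) / lam w + 2 = 66 by field_simp; norm_num] at this
    norm_num at this
    exact_mod_cast this
  · obtain ⟨h1, h2⟩ := Finset.mem_filter.1 ha
    have := h2.2
    rwa [max_eq_right (Finset.mem_range.1 h1).le, dist_comm] at this
  · have hb' := Finset.mem_range.1 (Finset.mem_filter.1 hb).1
    exact (h.antitone (by omega) hb'.le hw).trans (h.sep a b hab (by omega))

open Classical in
-- A point may have many later neighbours. But a later neighbour of one point is an earlier
-- neighbour seen from the other end, so summing over the later end bounds these pairs as well.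
theorem Net.rowStart_nbr_le : rowStart (Nbr q lam) N N ≤ 8712 * N := by
  have hsplit : ∀ u ∈ Finset.range N, Nat.count (Nbr q lam u) N ≤
      ((Finset.range u).filter fun w => Nbr q lam u w).card +
      ((Finset.range N).filter fun w => u < w ∧ Nbr q lam u w).card := by
    intro u _
    rw [Nat.count_eq_card_filter_range, ← Finset.card_union_of_disjoint]
    · refine Finset.card_le_card fun w hw => ?_
      simp only [Finset.mem_union, Finset.mem_filter, Finset.mem_range] at hw ⊢
      have := hw.2.1
      rcases lt_or_gt_of_ne this with h1 | h1
      · exact Or.inl ⟨h1, hw.2⟩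
      · exact Or.inr ⟨hw.1, h1, hw.2⟩
    · rw [Finset.disjoint_left]
      intro w h1 h2
      simp only [Finset.mem_filter, Finset.mem_range] at h1 h2
      omega
  have hswap : ∑ u ∈ Finset.range N, ((Finset.range N).filter fun w => u < w ∧ Nbr q lam u w).card =
      ∑ w ∈ Finset.range N, ((Finset.range N).filter fun u => u < w ∧ Nbr q lam u w).card := by
    simp only [Finset.card_filter]
    exact Finset.sum_comm
  have h1 : ∀ u ∈ Finset.range N, ((Finset.range u).filter fun w => Nbr q lam u w).card ≤ 4356 := by
    intro u hu
    refine le_trans (Finset.card_le_card fun w hw => ?_) (h.card_earlier (Finset.mem_range.1 hu))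
    rw [Finset.mem_filter] at hw ⊢
    exact ⟨hw.1, hw.2.symm⟩
  have h2 : ∀ w ∈ Finset.range N,
      ((Finset.range N).filter fun u => u < w ∧ Nbr q lam u w).card ≤ 4356 := by
    intro w hw
    refine le_trans (Finset.card_le_card fun u hu => ?_) (h.card_earlier (Finset.mem_range.1 hw))
    simp only [Finset.mem_filter, Finset.mem_range] at hu ⊢
    exact hu.2
  calc rowStart (Nbr q lam) N N ≤ _ := Finset.sum_le_sum hsplit
    _ = _ := Finset.sum_add_distrib
    _ ≤ 4356 * N + 4356 * N := by
      rw [hswap]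
      have h3 := Finset.sum_le_sum h1
      have h4 := Finset.sum_le_sum h2
      simp only [Finset.sum_const, Finset.card_range, smul_eq_mul] at h3 h4
      omega
    _ = 8712 * N := by ring

end

/-! ### Levels and ancestors -/

/-- The first index `i ≥ 1` with `lam i ≤ ρ`. -/
structure IsLevel (N : ℕ) (lam : ℕ → ℝ) (ρ : ℝ) (i : ℕ) : Prop where
  one_le : 1 ≤ i
  le : i ≤ N
  lt : ∀ j, 1 ≤ j → j < i → ρ < lam j
  ge : ∀ j, i ≤ j → j < N → lam j ≤ ρ

/-- A smaller radius is reached later in the order. -/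
theorem IsLevel.mono {N : ℕ} {lam : ℕ → ℝ} {ρ ρ' : ℝ} {i i' : ℕ} (h : IsLevel N lam ρ i)
    (h' : IsLevel N lam ρ' i') (hρ : ρ' ≤ ρ) : i ≤ i' := by
  by_contra hlt
  have h1 := h'.ge i' le_rfl (by have := h.le; omega)
  have h2 := h.lt i' h'.one_le (by omega)
  linarith

/-- The first ancestor less than `i`. -/
def top (par : ℕ → ℕ) (i z : ℕ) : ℕ :=
  if i ≤ z ∧ par z < z then top par i (par z) else z
termination_by z

section

variable {par : ℕ → ℕ} {N i : ℕ}

theorem top_of_lt {z : ℕ} (h : z < i) : top par i z = z := by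
  rw [top, if_neg (by omega)]

theorem top_of_le {z : ℕ} (h : i ≤ z) (hlt : par z < z) : top par i z = top par i (par z) := by
  rw [top, if_pos ⟨h, hlt⟩]

theorem top_lt (hi : 1 ≤ i) (hpar : ∀ j < N, 1 ≤ j → par j < j) {z : ℕ} (hz : z < N) :
    top par i z < i := by
  induction z using Nat.strong_induction_on with
  | _ z ih =>
    rcases Nat.lt_or_ge z i with h | h
    · rwa [top_of_lt h]
    · have := hpar z hz (by omega)
      rw [top_of_le h this]
      exact ih _ this (by omega)

/-- Each step to the parent lowers the index by at least one until it is 0. -/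
theorem iterate_le_sub (h0 : par 0 = 0) (hpar : ∀ j < N, 1 ≤ j → par j < j) {z : ℕ} (hz : z < N)
    (m : ℕ) : par^[m] z ≤ z - m := by
  induction m with
  | zero => simp
  | succ m ih =>
    rw [Function.iterate_succ_apply']
    rcases Nat.eq_zero_or_pos (par^[m] z) with h | h
    · rw [h, h0]; omega
    · have := hpar _ (by omega) h
      omega

/-- A jump that does not pass below `i` does not pass the sought ancestor either. This justifies the
long jumps in `climb`. -/
theorem top_iterate (hi : 1 ≤ i) (h0 : par 0 = 0) (hpar : ∀ j < N, 1 ≤ j → par j < j) {z : ℕ}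
    (hz : z < N) (m : ℕ) (hm : i ≤ par^[m] z) : top par i (par^[m] z) = top par i z := by
  induction m with
  | zero => rfl
  | succ m ih =>
    rw [Function.iterate_succ_apply'] at hm ⊢
    have h1 := iterate_le_sub h0 hpar hz m
    have hpos : 1 ≤ par^[m] z := by
      by_contra hc
      have : par^[m] z = 0 := by omega
      rw [this, h0] at hm
      omega
    have h2 := hpar _ (by omega) hpos
    rw [← top_of_le (by omega) h2]
    exact ih (by omega)

end

/-! ### The answer to a query -/

/-- The ancestor `u` and its near neighbours before the level `i` of the radius `r`. -/
def IsRoot (q : ℕ → E2) (lam : ℕ → ℝ) (r : ℝ) (i u x : ℕ) : Prop :=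
  x = u ∨ (x < i ∧ Nbr q lam u x ∧ lam (max u x) ≤ 16 * r)

/-- The descendants of the roots before the level `i'`. -/
def InAnswer (q : ℕ → E2) (lam : ℕ → ℝ) (par : ℕ → ℕ) (r : ℝ) (i i' u z : ℕ) : Prop :=
  z < i' ∧ IsRoot q lam r i u (top par i z)

section

variable {N : ℕ} {q : ℕ → E2} {lam : ℕ → ℝ} {par : ℕ → ℕ} {r s : ℝ} {i i' : ℕ} {c : E2}

/-- Along the chain from `z` the scales at least double and stay at most `r` before the last step,
so the lengths `2 * lam` sum up geometrically to at most `4 * r`. The second bound, with `2 * lam z`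
subtracted, is what makes the induction work: the next step has scale at least `2 * lam z`, which
leaves room for the current one. -/
theorem dist_top (hP : Parents N q lam par) (hi : IsLevel N lam r i) (hr : 0 ≤ r) {z : ℕ}
    (hz : z < N) : dist (q z) (q (top par i z)) ≤ 4 * r ∧
      (i ≤ z → dist (q z) (q (top par i z)) ≤ 4 * r - 2 * lam z) := by
  have h1 := hi.one_le
  have key : i ≤ z → dist (q z) (q (top par i z)) ≤ 4 * r - 2 * lam z := by
    induction z using Nat.strong_induction_on with
    | _ z ih =>
      intro h
      have hlt := hP.lt z hz (by omega)
      have hd := hP.dist_le z hz (by omega)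
      have hl := hi.ge z h hz
      rw [top_of_le h hlt]
      have htri := dist_triangle (q z) (q (par z)) (q (top par i (par z)))
      rw [dist_comm (q z) (q (par z))] at htri
      rcases Nat.lt_or_ge (par z) i with h2 | h2
      · rw [top_of_lt h2] at htri ⊢
        simp only [dist_self] at htri
        linarith
      · have h3 := ih (par z) hlt (by omega) h2
        rcases hP.scale z hz (by omega) with h4 | h4
        · omega
        · linarith
  refine ⟨?_, key⟩
  rcases Nat.lt_or_ge z i with h | h
  · rw [top_of_lt h, dist_self]; linarith
  · rcases hP.scale z hz (by omega) with h4 | h4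
    · have h2 := hP.lt z hz (by omega)
      have h3 := hP.dist_le z hz (by omega)
      have h5 := hi.ge z h hz
      rw [top_of_le h h2, h4, top_of_lt (by omega), dist_comm, ← h4]
      linarith
    · have h3 := hP.dist_le z hz (by omega)
      have h6 : 0 ≤ lam z := by linarith [dist_nonneg (x := q (par z)) (y := q z)]
      linarith [key h]

/-- The scale of the later one of two points before `i` exceeds `r`, so the distance is below 16
times it. On the other hand the scale is at most the distance, hence at most `14 * r`, which the
cut-off `16 * r` of `IsRoot` admits. -/
theorem isRoot_of_dist_le (hN : Net N q lam) (hi : IsLevel N lam r i) (hr : 0 ≤ r) {u x : ℕ}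
    (hu : u < i) (hx : x < i) (hd : dist (q x) (q u) ≤ 14 * r) : IsRoot q lam r i u x := by
  by_cases hxu : x = u
  · exact Or.inl hxu
  have hm : 1 ≤ max u x ∧ max u x < i := by omega
  have h1 := hi.lt _ hm.1 hm.2
  refine Or.inr ⟨hx, ⟨hxu, by linarith⟩, ?_⟩
  have hiN := hi.le
  have : lam (max u x) ≤ dist (q x) (q u) := by
    rcases lt_or_gt_of_ne hxu with h | h
    · rw [max_eq_left h.le]; exact hN.sep x u h (by omega)
    · rw [max_eq_right h.le, dist_comm]; exact hN.sep u x h (by omega)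
  linarith

theorem IsRoot.lt {u x : ℕ} (h : IsRoot q lam r i u x) (hu : u < i) : x < i := by
  rcases h with rfl | h
  · exact hu
  · exact h.1

theorem IsRoot.dist_le {u x : ℕ} (h : IsRoot q lam r i u x) (hr : 0 ≤ r) :
    dist (q x) (q u) ≤ 256 * r := by
  rcases h with rfl | h
  · simpa using hr
  · linarith [h.2.1.2, h.2.2]

/-- Completeness. Let z be the point before `i'` that covers v. The distance between the ancestors
of z and of a is at most (4 + 1 + 3/2 + 3 + 4) r = 13.5 r, by way of z, v, the centre and a; so the
ancestor of z is a root. -/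
theorem exists_inAnswer (hN : Net N q lam) (hP : Parents N q lam par) (hi : IsLevel N lam r i)
    (hi' : IsLevel N lam s i') (hr : 0 ≤ r) (hs : 0 ≤ s) (hsr : s ≤ r) {a : ℕ} (ha : a < N)
    (hac : dist (q a) c ≤ 3 * r) {v : ℕ} (hv : v < N) (hvc : dist (q v) c ≤ 3 / 2 * r) :
    ∃ z, InAnswer q lam par r i i' (top par i a) z ∧ dist (q v) (q z) ≤ s := by
  obtain ⟨z, hz, hd⟩ : ∃ z < i', dist (q v) (q z) ≤ s := by
    rcases Nat.lt_or_ge i' N with h | h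
    · obtain ⟨z, hz, hd⟩ := hN.cover i' hi'.one_le h v hv
      exact ⟨z, hz, hd.trans (hi'.ge i' le_rfl h)⟩
    -- If the level is `N`, all points are before it and each one covers itself. This includes the
    -- case of radius 0.
    · exact ⟨v, by omega, by simpa using hs⟩
  have hzN : z < N := hz.trans_le hi'.le
  refine ⟨z, ⟨hz, isRoot_of_dist_le hN hi hr (top_lt hi.one_le hP.lt ha) (top_lt hi.one_le hP.lt hzN) ?_⟩, hd⟩
  have h1 := (dist_top hP hi hr hzN).1
  have h2 := (dist_top hP hi hr ha).1
  have t1 := dist_triangle (q (top par i z)) (q z) (q (top par i a))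
  have t2 := dist_triangle (q z) (q v) (q (top par i a))
  have t3 := dist_triangle (q v) c (q (top par i a))
  have t4 := dist_triangle c (q a) (q (top par i a))
  rw [dist_comm (q (top par i z)) (q z)] at t1
  rw [dist_comm (q z) (q v)] at t2
  rw [dist_comm c (q a)] at t4
  linarith

/-- The constant is 4 + 256 + 4 + 3, by way of the root above z, the point u and the point a. -/
theorem InAnswer.dist_le (hP : Parents N q lam par) (hi : IsLevel N lam r i)
    (hi' : IsLevel N lam s i') (hr : 0 ≤ r) {a : ℕ} (ha : a < N) (hac : dist (q a) c ≤ 3 * r) {z : ℕ}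
    (h : InAnswer q lam par r i i' (top par i a) z) : dist (q z) c ≤ 267 * r := by
  have h1 := (dist_top hP hi hr (h.1.trans_le hi'.le)).1
  have h2 := (dist_top hP hi hr ha).1
  have h3 := h.2.dist_le hr
  have t1 := dist_triangle (q z) (q (top par i z)) c
  have t2 := dist_triangle (q (top par i z)) (q (top par i a)) c
  have t3 := dist_triangle (q (top par i a)) (q a) c
  rw [dist_comm (q (top par i a)) (q a)] at t3
  linarith

open Classical in
/-- The number of entries of the list of neighbours that are read when `y` is processed. -/
noncomputable def scanLength (q : ℕ → E2) (lam : ℕ → ℝ) (i i' y : ℕ) : ℕ :=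
  ((Finset.range i').filter fun w => Nbr q lam y w ∧ (y < i → i ≤ w)).card

open Classical in
/-- The answer as a finite set. -/
noncomputable def answer (q : ℕ → E2) (lam : ℕ → ℝ) (par : ℕ → ℕ) (r : ℝ) (i i' u : ℕ) : Finset ℕ :=
  (Finset.range i').filter (InAnswer q lam par r i i' u)

theorem mem_answer {u z : ℕ} : z ∈ answer q lam par r i i' u ↔ InAnswer q lam par r i i' u z := by
  classical
  simp only [answer, Finset.mem_filter, Finset.mem_range]
  exact ⟨fun h => h.2, fun h => ⟨h.1, h⟩⟩

/-- Points before the level of `s` are at least `s` apart, since all their scales from index 1 on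
exceed `s`. -/
theorem card_level_le (hN : Net N q lam) (hi' : IsLevel N lam s i') (hs : 0 < s) {A : Finset ℕ} {D : ℝ}
    (hA : ∀ z ∈ A, z < i') (hD : ∀ z ∈ A, dist (q z) c ≤ D) : (A.card : ℝ) ≤ (4 * D / s + 2) ^ 2 := by
  refine card_le_of_separated hs hD fun a ha b hb hab => ?_
  have := hA b hb
  exact (hi'.lt b (by omega) this).le.trans (hN.sep a b hab (this.trans_le hi'.le))

theorem card_answer_le (hN : Net N q lam) (hP : Parents N q lam par) (hi : IsLevel N lam r i)
    (hi' : IsLevel N lam s i') (hs : 0 < s) (hr : 0 ≤ r) {a : ℕ} (ha : a < N)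
    (hac : dist (q a) c ≤ 3 * r) :
    ((answer q lam par r i i' (top par i a)).card : ℝ) ≤ (1068 * r / s + 2) ^ 2 := by
  have := card_level_le (D := 267 * r) hN hi' hs (fun z hz => (mem_answer.1 hz).1)
    (fun z hz => (mem_answer.1 hz).dist_le hP hi hi' hr ha hac)
  rwa [show 4 * (267 * r) = 1068 * r by ring] at this

open Classical in
-- Roots are more than `r` apart and within `256 * r` of `u`, where 256 = 16 * 16; the bound does
-- not depend on `ε`. This is what allows a logarithmic cost for each root.
theorem card_roots_le (hN : Net N q lam) (hi : IsLevel N lam r i) (hr : 0 < r) (u : ℕ) :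
    ((Finset.range i).filter (IsRoot q lam r i u)).card ≤ 1026 ^ 2 := by
  have := card_level_le (D := 256 * r) (c := q u) (A := (Finset.range i).filter (IsRoot q lam r i u))
    hN hi hr (fun z hz => Finset.mem_range.1 (Finset.mem_filter.1 hz).1)
    (fun z hz => (Finset.mem_filter.1 hz).2.dist_le hr.le)
  rw [show 4 * (256 * r) / r + 2 = 1026 by field_simp; norm_num] at this
  exact_mod_cast this

open Classical in
-- The entries read for y are earlier neighbours, of which there are at most 4356, or later
-- neighbours w. The latter have index at least `i`, hence scale at most `r`, and so lie within 267
-- r + 16 r = 283 r of the centre. Charge such an entry to w: it receives at most 4356 charges, as y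
-- is an earlier neighbour of w, and packing bounds the number of these w.
theorem sum_scanLength_le (hN : Net N q lam) (hP : Parents N q lam par) (hi : IsLevel N lam r i)
    (hi' : IsLevel N lam s i') (hs : 0 < s) (hr : 0 ≤ r) {a : ℕ} (ha : a < N)
    (hac : dist (q a) c ≤ 3 * r) :
    ((∑ y ∈ answer q lam par r i i' (top par i a), scanLength q lam i i' y : ℕ) : ℝ) ≤
      8712 * (1132 * r / s + 2) ^ 2 := by
  set A := answer q lam par r i i' (top par i a) with hA
  set B := (Finset.range i').filter fun w => i ≤ w ∧ dist (q w) c ≤ 283 * r with hB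
  have hAi : ∀ y ∈ A, y < i' := fun y hy => (mem_answer.1 hy).1
  have hi'N := hi'.le
  have h1 : ∀ y ∈ A, scanLength q lam i i' y ≤
      4356 + (B.filter fun w => y < w ∧ Nbr q lam y w).card := by
    intro y hy
    have hyN : y < N := (hAi y hy).trans_le hi'.le
    have hyd := (mem_answer.1 hy).dist_le hP hi hi' hr ha hac
    have he : ((Finset.range y).filter fun w => Nbr q lam y w).card ≤ 4356 := by
      refine le_trans (Finset.card_le_card fun w hw => ?_) (hN.card_earlier hyN)
      rw [Finset.mem_filter] at hw ⊢
      exact ⟨hw.1, hw.2.symm⟩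
    refine le_trans ?_ (Nat.add_le_add_right he _)
    rw [scanLength]
    refine le_trans (Finset.card_le_card (t := ((Finset.range y).filter fun w => Nbr q lam y w) ∪
      (B.filter fun w => y < w ∧ Nbr q lam y w)) fun w hw => ?_) (Finset.card_union_le _ _)
    simp only [hB, Finset.mem_union, Finset.mem_filter, Finset.mem_range] at hw ⊢
    obtain ⟨hw1, hw2, hw3⟩ := hw
    rcases lt_or_gt_of_ne hw2.1 with h | h
    · exact Or.inl ⟨h, hw2⟩
    · refine Or.inr ⟨⟨hw1, ?_, ?_⟩, h, hw2⟩
      · rcases Nat.lt_or_ge y i with h' | h'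
        · exact hw3 h'
        · omega
      -- For a root y before `i` the scan begins only at index `i`; for the other y it follows from
      -- y < w.
      · have hiw : i ≤ w := by
          rcases Nat.lt_or_ge y i with h' | h'
          · exact hw3 h'
          · omega
        have h4 := hi.ge w hiw (by omega)
        have h5 := hw2.2
        rw [max_eq_right h.le] at h5
        linarith [dist_triangle (q w) (q y) c]
  have h2 : ∑ y ∈ A, (B.filter fun w => y < w ∧ Nbr q lam y w).card ≤ B.card * 4356 := by
    have : ∑ y ∈ A, (B.filter fun w => y < w ∧ Nbr q lam y w).card =
        ∑ w ∈ B, (A.filter fun y => y < w ∧ Nbr q lam y w).card := by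
      simp only [Finset.card_filter]
      exact Finset.sum_comm
    rw [this, ← smul_eq_mul]
    refine Finset.sum_le_card_nsmul _ _ _ fun w hw => ?_
    have hwN : w < N := (Finset.mem_range.1 (Finset.mem_filter.1 hw).1).trans_le hi'.le
    refine le_trans (Finset.card_le_card fun y hy => ?_) (hN.card_earlier hwN)
    rw [Finset.mem_filter] at hy ⊢
    exact ⟨Finset.mem_range.2 hy.2.1, hy.2.2⟩
  have h3 : ∑ y ∈ A, scanLength q lam i i' y ≤ A.card * 4356 + B.card * 4356 := by
    refine (Finset.sum_le_sum h1).trans ?_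
    rw [Finset.sum_add_distrib, Finset.sum_const, smul_eq_mul]
    omega
  have h4 := card_answer_le hN hP hi hi' hs hr ha hac
  have h5 : (B.card : ℝ) ≤ (4 * (283 * r) / s + 2) ^ 2 := card_level_le hN hi' hs
    (fun z hz => Finset.mem_range.1 (Finset.mem_filter.1 hz).1) (fun z hz => (Finset.mem_filter.1 hz).2.2)
  have h6 : (1068 * r / s + 2) ^ 2 ≤ (1132 * r / s + 2) ^ 2 := by gcongr; norm_num
  rw [show 4 * (283 * r) = 1132 * r by ring] at h5
  calc ((∑ y ∈ A, scanLength q lam i i' y : ℕ) : ℝ) ≤ ((A.card * 4356 + B.card * 4356 : ℕ) : ℝ) := by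
        exact_mod_cast h3
    _ = A.card * 4356 + B.card * 4356 := by push_cast; ring
    _ ≤ 8712 * (1132 * r / s + 2) ^ 2 := by linarith

end

/-! ### The stored neighbour lists and the contents of the memory -/

/-- The neighbours of each point are listed in the columns 3 and 4. -/
def listNbrs : Cmd := listRows (.reg 0) (.reg 0)
  (.and (.not (.and (.not (.ltN (.reg 21) (.reg 20))) (.not (.ltN (.reg 20) (.reg 21)))))
    (.not (.ltR (.ofNat (.const 16) * rld 4 (.reg 21 + (.reg 20 - .reg 21)))
      (distE (rld 2 (.reg 21)) (rld 3 (.reg 21)) (rld 2 (.reg 20)) (rld 3 (.reg 20)))))) 3 4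

theorem wp_listNbrs {S W : ℕ} [Machine S W] {σ : State} {Q : State → ℕ → Prop} (N n L : ℕ)
    (q : ℕ → E2) (lam : ℕ → ℝ) (hN : σ.nreg 0 = N) (hn : σ.nreg 2 = n)
    (hL : 8712 * N + 1 < L) (hS : 32 * (n + L) ≤ S) (hnet : Net N q lam)
    (hq : ∀ j < N, σ.ra 2 j = q j 0 ∧ σ.ra 3 j = q j 1) (hlam : ∀ j < N, σ.ra 4 j = lam j)
    (post : ∀ σ' k, Frame listNbrs σ σ' → Rows (Nbr q lam) N N (σ'.na 3) (σ'.na 4) →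
      k ≤ N * (N * 200 + 100) + 100 → Q σ' k) : wp S W listNbrs σ Q := by
  have hB := Machine.big (S := S) (W := W)
  have hSW := Machine.le (S := S) (W := W)
  refine wp_listRows (Nbr q lam) N N n L (by decide) (by decide) (by decide) hn hS
    (by omega) (by omega) (hnet.rowStart_nbr_le.trans_lt (by omega)) (fun σ' fr => ?_)
    (fun σ' fr => ?_) (fun σ' fr h1 h2 => ?_) (fun σ' k fr hR hk => ?_)
  · simp [(fr.nreg 0 rfl).trans hN]
  · simp [(fr.nreg 0 rfl).trans hN]
  · set u := σ'.nreg 20 with hu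
    set w := σ'.nreg 21 with hw
    have r2 : ∀ j, σ'.ra 2 j = σ.ra 2 j := fr.ra 2 rfl rfl (by decide)
    have r3 : ∀ j, σ'.ra 3 j = σ.ra 3 j := fr.ra 3 rfl rfl (by decide)
    -- Truncated subtraction provides the maximum, which the machine does not have.
    have hm : w + (u - w) = max u w := by omega
    have r4 : σ'.ra 4 (max u w) = lam (max u w) :=
      (fr.ra 4 rfl rfl (by decide) _).trans (hlam _ (by omega))
    have hmN : max u w < N := by omega
    simp only [BExpr.safe_and, BExpr.safe_not, BExpr.safe_ltN, BExpr.safe_ltR, safe_rld, safe_distE,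
      RExpr.safe_mul, RExpr.safe_ofNat, NExpr.safe_const, NExpr.safe_reg, NExpr.safe_add, NExpr.safe_sub,
      NExpr.val_reg, NExpr.val_add, NExpr.val_sub, BExpr.val_and, BExpr.val_not, BExpr.val_ltN,
      BExpr.val_ltR, RExpr.val_mul, RExpr.val_ofNat, NExpr.val_const, val_rld, val_distE, ← hu, ← hw,
      (fr.nreg 2 rfl).trans hn, hm, r4, r2, r3, (hq u h1).1, (hq u h1).2, (hq w h2).1, (hq w h2).2,
      sqrt_eq_dist, true_and, and_true]
    refine ⟨⟨fun _ => trivial, fun _ => ⟨⟨by omega, by omega, by omega⟩, by omega⟩⟩, ?_⟩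
    rw [Nbr]
    push_cast
    constructor
    · rintro ⟨h3, h4⟩
      exact ⟨fun h => h3 ⟨by omega, by omega⟩, not_lt.1 h4⟩
    · rintro ⟨h3, h4⟩
      exact ⟨fun h => h3 (by omega), not_lt.2 h4⟩
  · refine post σ' k fr hR ?_
    simp at hk
    refine hk.trans ?_
    have : N * (N * 131 + 1 + 1 + 40) ≤ N * (N * 200 + 100) := Nat.mul_le_mul_left _ (by omega)
    omega

/-- The memory of the data structure. -/
structure Stored (N n l : ℕ) (q : ℕ → E2) (lam : ℕ → ℝ) (par perm : ℕ → ℕ) (sx : ℕ → ℕ)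
    (xinv : ℕ → ℕ) (xs ys : ℕ → ℝ) (σ : State) : Prop where
  n0 : σ.nreg 0 = N
  n2 : σ.nreg 2 = n
  n3 : σ.nreg 3 = l
  n4 : σ.nreg 4 = 2 ^ l
  perm_eq : ∀ j < N, σ.na 1 j = perm j
  jump : ∀ i ≤ l, ∀ v < N, σ.na 2 (i * N + v) = par^[2 ^ i] v
  nbrs : Rows (Nbr q lam) N N (σ.na 3) (σ.na 4)
  xinv_eq : ∀ p < N, σ.na 6 p = xinv p
  xs_eq : ∀ p < N, σ.ra 5 p = xs p
  ys_eq : ∀ p < N, σ.ra 6 p = ys p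
  table : WaveletTable sx N l (σ.na 10)
  lam_eq : ∀ j < N, σ.ra 4 j = lam j

/-- The side condition lists the registers and columns that hold the data structure; for each
subprogram of the query it holds by computation. -/
theorem Stored.frame {N n l : ℕ} {q : ℕ → E2} {lam : ℕ → ℝ} {par perm : ℕ → ℕ} {sx : ℕ → ℕ}
    {xinv : ℕ → ℕ} {xs ys : ℕ → ℝ} {σ σ' : State} {c : Cmd}
    (h : Stored N n l q lam par perm sx xinv xs ys σ) (hf : Frame c σ σ')
    (hc : (c.modN 0 = false ∧ c.modN 2 = false ∧ c.modN 3 = false ∧ c.modN 4 = false) ∧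
      (c.modNA 1 = false ∧ c.modNA 2 = false ∧ c.modNA 3 = false ∧ c.modNA 4 = false ∧
        c.modNA 6 = false ∧ c.modNA 10 = false) ∧
      c.modRA 4 = false ∧ c.modRA 5 = false ∧ c.modRA 6 = false) :
    Stored N n l q lam par perm sx xinv xs ys σ' := by
  obtain ⟨⟨h0, h2, h3, h4⟩, ⟨a1, a2, a3, a4, a6, a10⟩, r4, r5, r6⟩ := hc
  have e : ∀ j, c.modNA j = false → j < 32 → σ'.na j = σ.na j :=
    fun j hj hj' => funext (hf.na j hj h2 hj')
  have e' : ∀ j, c.modRA j = false → j < 32 → σ'.ra j = σ.ra j :=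
    fun j hj hj' => funext (hf.ra j hj h2 hj')
  refine ⟨(hf.nreg 0 h0).trans h.n0, (hf.nreg 2 h2).trans h.n2, (hf.nreg 3 h3).trans h.n3,
    (hf.nreg 4 h4).trans h.n4, ?_, ?_, ?_, ?_, ?_, ?_, ?_, ?_⟩
  · rw [e 1 a1 (by decide)]; exact h.perm_eq
  · rw [e 2 a2 (by decide)]; exact h.jump
  · rw [e 3 a3 (by decide), e 4 a4 (by decide)]; exact h.nbrs
  · rw [e 6 a6 (by decide)]; exact h.xinv_eq
  · rw [e' 5 r5 (by decide)]; exact h.xs_eq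
  · rw [e' 6 r6 (by decide)]; exact h.ys_eq
  · rw [e 10 a10 (by decide)]; exact h.table
  · rw [e' 4 r4 (by decide)]; exact h.lam_eq

/-- The geometric facts about the contents of the data structure. -/
structure Index (N l : ℕ) (q : ℕ → E2) (lam : ℕ → ℝ) (par perm xrk xinv yrk yinv : ℕ → ℕ)
    (xs ys : ℕ → ℝ) : Prop where
  pos : 0 < N
  lt_pow : N < 2 ^ l
  net : Net N q lam
  parents : Parents N q lam par
  perm_lt : ∀ j < N, perm j < N
  xrank : Ranking N (fun j => q j 0) xrk xinv xs
  yrank : Ranking N (fun j => q j 1) yrk yinv ys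

/-! ### Levels and a vertex near the query square -/

/-- Binary search with the given first index and key. -/
def search (acc : RExpr) (lo : ℕ) (key : RExpr) (dst : ℕ) : Cmd := block [
  .setN 10 (.const lo), .setN 11 (.reg 0), .setR 6 key, lowerBound acc, .setN dst (.reg 10)]

theorem wp_search {S W : ℕ} [Machine S W] {σ : State} {Q : State → ℕ → Prop} {acc key : RExpr} {lo dst : ℕ}
    (N l : ℕ) (f : ℕ → ℝ) (hN : σ.nreg 0 = N) (hlo : lo ≤ N) (hW : 2 * N ≤ W) (hl : N < 2 ^ l)
    (hf : ∀ i j, lo ≤ i → i ≤ j → j < N → f i ≤ f j)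
    (hkey : ∀ σ' : State, σ'.rreg = σ.rreg → key.Safe S W σ' ∧ key.val σ' = key.val σ)
    (hacc : ∀ σ' : State, σ'.nreg 2 = σ.nreg 2 → σ'.rmem = σ.rmem → σ'.nreg 12 < N →
      lo ≤ σ'.nreg 12 → acc.Safe S W σ' ∧ acc.val σ' = f (σ'.nreg 12))
    (post : ∀ σ' k p, Frame (search acc lo key dst) σ σ' → σ'.nreg dst = p → lo ≤ p → p ≤ N →
      (∀ q, lo ≤ q → q < p → f q < key.val σ) → (∀ q, p ≤ q → q < N → key.val σ ≤ f q) →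
      k ≤ (acc.cost + 20) * (l + 1) + key.cost + 20 → Q σ' k) :
    wp S W (search acc lo key dst) σ Q := by
  have hB := Machine.big (S := S) (W := W)
  refine wp_frame ?_
  unfold search
  simp only [wp_block_cons, wp_setN, wp_setR, NExpr.safe_const, NExpr.safe_reg, NExpr.val_const,
    NExpr.val_reg, State.nreg_setN, Nat.reduceEqDiff, if_true, if_false, hN, true_and]
  obtain ⟨k1, k2⟩ := hkey ((σ.setN 10 lo).setN 11 N) rfl
  refine ⟨by omega, k1, ?_⟩
  rw [k2]
  refine wp_lowerBound f lo N l (by simp) (by simp) hlo hW (by omega) hf (fun σ' fr h1 h2 => ?_) ?_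
  · refine hacc σ' ((fr.nreg 2 rfl).trans (by simp)) ?_ h2 h1
    funext a
    exact fr.rmem a rfl
  · intro σ' k p fr e10 h1 h2 h3 h4 hk
    rw [e10, wp_block_nil]
    intro frame
    refine post _ _ p frame (by simp) h1 h2 (by simpa using h3) (by simpa using h4) ?_
    simp
    omega

/-- Compute the levels (registers 50 and 51) of the radii and find the first point from the left in
the square with parallel axes that contains the query square. -/
def locate : Cmd := block [
  .setR 8 (.sqrt (.reg 2 * .reg 2 + .reg 3 * .reg 3)),
  .setR 9 (.reg 4 * .reg 8 / .reg 5),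
  search (.ofNat (.const 0) - rld 4 (.reg 12)) 1 (.ofNat (.const 0) - .reg 8) 50,
  search (.ofNat (.const 0) - rld 4 (.reg 12)) 1 (.ofNat (.const 0) - .reg 9) 51,
  search (rld 5 (.reg 12)) 0 (.reg 0 - .ofNat (.const 2) * .reg 8) 39,
  search (rld 6 (.reg 12)) 0 (.reg 1 - .ofNat (.const 2) * .reg 8) 41,
  search (rld 6 (.reg 12)) 0 (.reg 1 + .ofNat (.const 2) * .reg 8) 42,
  findLeast]

section

variable {S W : ℕ} [Machine S W] {σ : State} {Q : State → ℕ → Prop} {N n L l : ℕ} {q : ℕ → E2}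
  {lam : ℕ → ℝ} {par perm xrk xinv yrk yinv : ℕ → ℕ} {xs ys : ℕ → ℝ}

/-- Vertices with suitable second coordinate are an interval of positions in the order of that
coordinate. Among them the table yields the least position in the order of the first coordinate that
is not left of the window. Whether this vertex is too far to the right is left to the caller. Open
windows suffice, because the query square stays strictly inside. -/
theorem wp_locate (hI : Index N l q lam par perm xrk xinv yrk yinv xs ys)
    (hS : Stored N n l q lam par perm (fun y => xrk (yinv y)) xinv xs ys σ)
    (hL : 2 * ((l + 2) * 2 ^ l) + N < L) (hLS : 32 * (n + L) ≤ S)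
    (r s : ℝ) (hr : Real.sqrt (σ.rreg 2 * σ.rreg 2 + σ.rreg 3 * σ.rreg 3) = r) (hr0 : 0 < r)
    (hs : σ.rreg 4 * r / σ.rreg 5 = s)
    (post : ∀ σ' k i i', Frame locate σ σ' → σ'.nreg 50 = i → σ'.nreg 51 = i' → σ'.rreg 8 = r →
      IsLevel N lam r i → IsLevel N lam s i' →
      (σ'.nreg 43 = 0 ∧ (∀ j < N, ¬ (|q j 0 - σ.rreg 0| < 2 * r ∧ |q j 1 - σ.rreg 1| < 2 * r)) ∨
        σ'.nreg 43 = 1 ∧ σ'.nreg 31 < N ∧ σ.rreg 0 - 2 * r ≤ xs (σ'.nreg 31) ∧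
          |q (xinv (σ'.nreg 31)) 1 - σ.rreg 1| ≤ 2 * r ∧
          ∀ j < N, |q j 0 - σ.rreg 0| < 2 * r → |q j 1 - σ.rreg 1| < 2 * r → xs (σ'.nreg 31) ≤ q j 0) →
      k ≤ 1000 * (l + 1) → Q σ' k) : wp S W locate σ Q := by
  have hB := Machine.big (S := S) (W := W)
  have hSW := Machine.le (S := S) (W := W)
  have hN := hI.pos
  have hl2 : (l + 2) * 2 ^ l = l * 2 ^ l + 2 * 2 ^ l := by ring
  have hl := hI.lt_pow
  refine wp_frame ?_
  unfold locate
  simp only [wp_block_cons, wp_setR, RExpr.Safe, RExpr.safe_add, RExpr.safe_mul, RExpr.safe_reg, RExpr.safe_div,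
    RExpr.val_sqrt, RExpr.val_add, RExpr.val_mul, RExpr.val_div, RExpr.val_reg, State.rreg_setR,
    Nat.reduceEqDiff, if_true, if_false, hr, hs, true_and, and_true]
  set σ₀ := (σ.setR 8 r).setR 9 s with hσ₀
  have hS0 : Stored N n l q lam par perm (fun y => xrk (yinv y)) xinv xs ys σ₀ :=
    ⟨hS.n0, hS.n2, hS.n3, hS.n4, hS.perm_eq, hS.jump, hS.nbrs, hS.xinv_eq, hS.xs_eq, hS.ys_eq, hS.table, hS.lam_eq⟩
  have h08 : σ₀.rreg 8 = r := by simp [hσ₀]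
  have h09 : σ₀.rreg 9 = s := by simp [hσ₀]
  have h00 : σ₀.rreg 0 = σ.rreg 0 := by simp [hσ₀]
  have h01 : σ₀.rreg 1 = σ.rreg 1 := by simp [hσ₀]
  have acc4 : ∀ σ₁, Stored N n l q lam par perm (fun y => xrk (yinv y)) xinv xs ys σ₁ → ∀ σ' : State,
      σ'.nreg 2 = σ₁.nreg 2 → σ'.rmem = σ₁.rmem → σ'.nreg 12 < N → 1 ≤ σ'.nreg 12 →
      (RExpr.ofNat (.const 0) - rld 4 (.reg 12)).Safe S W σ' ∧
      (RExpr.ofNat (.const 0) - rld 4 (.reg 12)).val σ' = - lam (σ'.nreg 12) := by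
    intro σ₁ h σ' e2 em h12 _
    have : σ'.ra 4 (σ'.nreg 12) = lam (σ'.nreg 12) := by
      rw [← h.lam_eq _ h12, State.ra, State.ra, e2, em]
    simp [this, e2, h.n2]
    omega
  have accx : ∀ σ₁, Stored N n l q lam par perm (fun y => xrk (yinv y)) xinv xs ys σ₁ → ∀ σ' : State,
      σ'.nreg 2 = σ₁.nreg 2 → σ'.rmem = σ₁.rmem → σ'.nreg 12 < N → 0 ≤ σ'.nreg 12 →
      (rld 5 (.reg 12)).Safe S W σ' ∧ (rld 5 (.reg 12)).val σ' = xs (σ'.nreg 12) := by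
    intro σ₁ h σ' e2 em h12 _
    have : σ'.ra 5 (σ'.nreg 12) = xs (σ'.nreg 12) := by
      rw [← h.xs_eq _ h12, State.ra, State.ra, e2, em]
    simp [this, e2, h.n2]
    omega
  have accy : ∀ σ₁, Stored N n l q lam par perm (fun y => xrk (yinv y)) xinv xs ys σ₁ → ∀ σ' : State,
      σ'.nreg 2 = σ₁.nreg 2 → σ'.rmem = σ₁.rmem → σ'.nreg 12 < N → 0 ≤ σ'.nreg 12 →
      (rld 6 (.reg 12)).Safe S W σ' ∧ (rld 6 (.reg 12)).val σ' = ys (σ'.nreg 12) := by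
    intro σ₁ h σ' e2 em h12 _
    have : σ'.ra 6 (σ'.nreg 12) = ys (σ'.nreg 12) := by
      rw [← h.ys_eq _ h12, State.ra, State.ra, e2, em]
    simp [this, e2, h.n2]
    omega
  have mono4 : ∀ i j, 1 ≤ i → i ≤ j → j < N → - lam i ≤ - lam j := fun i j h1 h2 h3 =>
    neg_le_neg (hI.net.antitone h1 h2 h3)
  have monox : ∀ i j, 0 ≤ i → i ≤ j → j < N → xs i ≤ xs j := by
    intro i j _ h2 h3
    rw [hI.xrank.sorted_eq i (by omega), hI.xrank.sorted_eq j h3]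
    exact hI.xrank.mono i j h2 h3
  have monoy : ∀ i j, 0 ≤ i → i ≤ j → j < N → ys i ≤ ys j := by
    intro i j _ h2 h3
    rw [hI.yrank.sorted_eq i (by omega), hI.yrank.sorted_eq j h3]
    exact hI.yrank.mono i j h2 h3
  -- The scales decrease, so their negatives are searched. The search starts at index 1, as `lam 0`
  -- is meaningless.
  refine wp_search N l (fun j => - lam j) hS0.n0 (by omega) (by omega) hI.lt_pow mono4
    (fun σ' h => by simp [h]) (acc4 _ hS0) ?_
  intro σ₁ k₁ i fr1 e50 i1 i2 i3 i4 hk1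
  have hS1 := hS0.frame fr1 ⟨⟨rfl, rfl, rfl, rfl⟩, ⟨rfl, rfl, rfl, rfl, rfl, rfl⟩, rfl, rfl, rfl⟩
  refine wp_search N l (fun j => - lam j) hS1.n0 (by omega) (by omega) hI.lt_pow mono4
    (fun σ' h => by simp [h]) (acc4 _ hS1) ?_
  intro σ₂ k₂ i' fr2 e51 j1 j2 j3 j4 hk2
  have hS2 := hS1.frame fr2 ⟨⟨rfl, rfl, rfl, rfl⟩, ⟨rfl, rfl, rfl, rfl, rfl, rfl⟩, rfl, rfl, rfl⟩
  have hi : IsLevel N lam r i := by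
    simp [h08] at i3 i4
    exact ⟨i1, i2, i3, i4⟩
  have hi' : IsLevel N lam s i' := by
    have e9 : σ₁.rreg 9 = s := (fr1.rreg 9 rfl).trans h09
    simp [e9] at j3 j4
    exact ⟨j1, j2, j3, j4⟩
  have f08 : σ₂.rreg 8 = r := (fr2.rreg 8 rfl).trans ((fr1.rreg 8 rfl).trans h08)
  have f00 : σ₂.rreg 0 = σ.rreg 0 := (fr2.rreg 0 rfl).trans ((fr1.rreg 0 rfl).trans h00)
  have f01 : σ₂.rreg 1 = σ.rreg 1 := (fr2.rreg 1 rfl).trans ((fr1.rreg 1 rfl).trans h01)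
  refine wp_search N l xs hS2.n0 (by omega) (by omega) hI.lt_pow monox
    (fun σ' h => by simp [h]; omega) (accx _ hS2) ?_
  intro σ₃ k₃ x fr3 e39 x1 x2 x3 x4 hk3
  have hS3 := hS2.frame fr3 ⟨⟨rfl, rfl, rfl, rfl⟩, ⟨rfl, rfl, rfl, rfl, rfl, rfl⟩, rfl, rfl, rfl⟩
  have g08 : σ₃.rreg 8 = r := (fr3.rreg 8 rfl).trans f08
  have g01 : σ₃.rreg 1 = σ.rreg 1 := (fr3.rreg 1 rfl).trans f01
  refine wp_search N l ys hS3.n0 (by omega) (by omega) hI.lt_pow monoy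
    (fun σ' h => by simp [h]; omega) (accy _ hS3) ?_
  intro σ₄ k₄ a fr4 e41 a1 a2 a3 a4 hk4
  have hS4 := hS3.frame fr4 ⟨⟨rfl, rfl, rfl, rfl⟩, ⟨rfl, rfl, rfl, rfl, rfl, rfl⟩, rfl, rfl, rfl⟩
  have m08 : σ₄.rreg 8 = r := (fr4.rreg 8 rfl).trans g08
  have m01 : σ₄.rreg 1 = σ.rreg 1 := (fr4.rreg 1 rfl).trans g01
  refine wp_search N l ys hS4.n0 (by omega) (by omega) hI.lt_pow monoy
    (fun σ' h => by simp [h]; omega) (accy _ hS4) ?_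
  intro σ₅ k₅ b fr5 e42 b1 b2 b3 b4 hk5
  have hS5 := hS4.frame fr5 ⟨⟨rfl, rfl, rfl, rfl⟩, ⟨rfl, rfl, rfl, rfl, rfl, rfl⟩, rfl, rfl, rfl⟩
  simp [f08, f00] at x3 x4
  simp [g08, g01] at a3 a4
  simp [m08, m01] at b3 b4
  have hab : a ≤ b := by
    by_contra hlt
    have h1 := b4 b le_rfl (by omega)
    have h2 := a3 b (by omega)
    linarith
  have hyx : ∀ y < N, xrk (yinv y) < N := fun y hy => hI.xrank.rk_lt _ (hI.yrank.inv_lt _ hy)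
  refine wp_findLeast N n L l a b x (fun y => xrk (yinv y)) hS5.n2 hS5.n3 hS5.n4
    ((fr5.nreg 39 rfl).trans ((fr4.nreg 39 rfl).trans e39)) ((fr5.nreg 41 rfl).trans e41) e42 hab b2
    (by omega) hL hLS (fun y hy => (hyx y hy).trans hI.lt_pow) hS5.table ?_
  intro σ₆ k₆ fr6 hres hk6
  rw [wp_block_nil]
  intro frame
  -- Every point of the open window has its position by the second coordinate in `[a, b)` and its
  -- position by the first coordinate at or after `x`.
  have hwin : ∀ j < N, |q j 0 - σ.rreg 0| < 2 * r → |q j 1 - σ.rreg 1| < 2 * r →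
      a ≤ yrk j ∧ yrk j < b ∧ x ≤ xrk j := by
    intro j hj h0 h1
    rw [abs_lt] at h0 h1
    have ey : ys (yrk j) = q j 1 := by
      rw [hI.yrank.sorted_eq _ (hI.yrank.rk_lt j hj), hI.yrank.inv_rk j hj]
    have ex : xs (xrk j) = q j 0 := by
      rw [hI.xrank.sorted_eq _ (hI.xrank.rk_lt j hj), hI.xrank.inv_rk j hj]
    refine ⟨?_, ?_, ?_⟩
    · by_contra hc
      have := a3 (yrk j) (not_le.1 hc)
      linarith
    · by_contra hc
      have := b4 (yrk j) (not_lt.1 hc) (hI.yrank.rk_lt j hj)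
      linarith
    · by_contra hc
      have := x3 (xrk j) (not_le.1 hc)
      linarith
  refine post _ _ i i' frame ?_ ?_ ?_ hi hi' ?_ ?_
  · rw [fr6.nreg 50 rfl, fr5.nreg 50 rfl, fr4.nreg 50 rfl, fr3.nreg 50 rfl, fr2.nreg 50 rfl, e50]
  · rw [fr6.nreg 51 rfl, fr5.nreg 51 rfl, fr4.nreg 51 rfl, fr3.nreg 51 rfl, e51]
  · rw [fr6.rreg 8 rfl, fr5.rreg 8 rfl, m08]
  · rcases hres with ⟨h43, hno⟩ | ⟨h43, y, y1, y2, y3, y4, y5⟩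
    · refine Or.inl ⟨h43, fun j hj hc => ?_⟩
      obtain ⟨c1, c2, c3⟩ := hwin j hj hc.1 hc.2
      have := hno _ c1 c2
      rw [hI.yrank.inv_rk j hj] at this
      omega
    · have hXN : σ₆.nreg 31 < N := by
        rw [← y3]
        exact hyx y (by omega)
      have hinv : xinv (σ₆.nreg 31) = yinv y := by
        rw [← y3]
        exact hI.xrank.inv_rk _ (hI.yrank.inv_lt _ (by omega))
      refine Or.inr ⟨h43, hXN, by linarith [x4 _ y4 hXN], ?_, fun j hj h0 h1 => ?_⟩
      · have ey : q (xinv (σ₆.nreg 31)) 1 = ys y := by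
          rw [hinv, hI.yrank.sorted_eq y (by omega)]
        have h1 := a4 y y1 (by omega)
        have h2 := b3 y y2
        rw [ey, abs_le]
        constructor <;> linarith
      · obtain ⟨c1, c2, c3⟩ := hwin j hj h0 h1
        have := y5 _ c1 c2 (by rwa [hI.yrank.inv_rk j hj])
        rw [hI.yrank.inv_rk j hj] at this
        have ex : xs (xrk j) = q j 0 := by
          rw [hI.xrank.sorted_eq _ (hI.xrank.rk_lt j hj), hI.xrank.inv_rk j hj]
        rw [← ex]
        exact monox _ _ (Nat.zero_le _) this (hI.xrank.rk_lt j hj)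
  · simp [RExpr.cost] at hk1 hk2 hk3 hk4 hk5 ⊢
    omega

end

open Classical in
-- Within a row the positions are counts, which increase with the element. Each row is therefore
-- sorted by index and can be searched by bisection.
theorem Rows.lt_iff {C : ℕ → ℕ → Prop} {A M : ℕ} {start list : ℕ → ℕ} (h : Rows C A M start list)
    {u p p' : ℕ} (hu : u < A) (h1 : rowStart C M u ≤ p) (h2 : p < rowStart C M (u + 1))
    (h1' : rowStart C M u ≤ p') (h2' : p' < rowStart C M (u + 1)) : list p < list p' ↔ p < p' := by
  have key : ∀ {p p'}, rowStart C M u ≤ p → p < rowStart C M (u + 1) → rowStart C M u ≤ p' →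
      p' < rowStart C M (u + 1) → p < p' → list p < list p' := by
    intro p p' h1 h2 h1' h2' hpp
    obtain ⟨_, _, c⟩ := h.exists_eq hu h1 h2
    obtain ⟨_, _, c'⟩ := h.exists_eq hu h1' h2'
    by_contra hc
    have := Nat.count_monotone (C u) (not_lt.1 hc)
    omega
  refine ⟨fun hl => ?_, key h1 h2 h1' h2'⟩
  by_contra hc
  rcases (not_lt.1 hc).eq_or_lt with rfl | h3
  · omega
  · have := key h1' h2' h1 h2 h3
    omega

open Classical in
theorem Rows.exists_pos {C : ℕ → ℕ → Prop} {A M : ℕ} {start list : ℕ → ℕ} (h : Rows C A M start list)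
    {u w : ℕ} (hu : u < A) (hw : w < M) (hC : C u w) :
    ∃ p, rowStart C M u ≤ p ∧ p < rowStart C M (u + 1) ∧ list p = w := by
  refine ⟨_, Nat.le_add_right _ _, ?_, h.list_eq u hu w hw hC⟩
  rw [rowStart_succ]
  exact Nat.add_lt_add_left (Nat.count_strict_mono hC hw) _

theorem rowStart_le_succ (C : ℕ → ℕ → Prop) (M u : ℕ) :
    rowStart C M u ≤ rowStart C M (u + 1) ∧ rowStart C M (u + 1) ≤ rowStart C M u + M := by
  classical
  rw [rowStart_succ]
  have : Nat.count (C u) M ≤ M := Nat.count_le _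
  constructor
  · exact Nat.le_add_right _ _
  · convert Nat.add_le_add_left this _

theorem rowStart_mono (C : ℕ → ℕ → Prop) (M : ℕ) {u v : ℕ} (h : u ≤ v) :
    rowStart C M u ≤ rowStart C M v := Finset.sum_le_sum_of_subset (Finset.range_mono h)

/-! ### From the located vertex to the roots -/

/-- Replace the number in register 52 by its first ancestor less than register 50. -/
def climb : Cmd := block [
  .setN 53 (.reg 3),
  .loop (.ltN (.const 0) (.reg 53)) (block [
    .setN 53 (.reg 53 - .const 1),
    .setN 54 (ld 2 (.reg 53 * .reg 0 + .reg 52)),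
    .ite (.ltN (.reg 54) (.reg 50)) .skip (.setN 52 (.reg 54))]),
  .ite (.ltN (.reg 52) (.reg 50)) .skip (.setN 52 (ld 2 (.reg 52)))]

/-- Start the queue in column 14, whose length is in register 55, with the roots. -/
def enqueueRoots : Cmd := block [
  st 14 (.const 0) (.reg 52),
  .setN 55 (.const 1),
  .setN 10 (ld 3 (.reg 52)),
  .setN 11 (ld 3 (.reg 52 + .const 1)),
  .setN 56 (.reg 10),
  .setR 6 (.ofNat (.reg 50)),
  lowerBound (.ofNat (ld 4 (.reg 12))),
  .loop (.and (.ltN (.reg 56) (.reg 10)) (.not (.ltR (.ofNat (.const 16) * .reg 8)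
      (rld 4 (ld 4 (.reg 10 - .const 1) + (.reg 52 - ld 4 (.reg 10 - .const 1)))))))
    (block [
      st 14 (.reg 55) (ld 4 (.reg 10 - .const 1)),
      .setN 55 (.reg 55 + .const 1),
      .setN 10 (.reg 10 - .const 1)])]

section

variable {S W : ℕ} [Machine S W] {σ : State} {Q : State → ℕ → Prop} {N n L l : ℕ} {q : ℕ → E2}
  {lam : ℕ → ℝ} {par perm xrk xinv yrk yinv : ℕ → ℕ} {xs ys : ℕ → ℝ}

/-- The invariant says that a jump by `2 ^ k` falls below `i`. A jump by half of this is made only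
if it stays at or above `i`, and then the other half falls below. At `k = 0` the parent is the first
one below, unless the point itself already is. -/
theorem wp_climb (hI : Index N l q lam par perm xrk xinv yrk yinv xs ys)
    (hS : Stored N n l q lam par perm (fun y => xrk (yinv y)) xinv xs ys σ)
    (hL : (l + 1) * N + l < L) (hLS : 32 * (n + L) ≤ S) (a i : ℕ) (ha : a < N) (hi : 1 ≤ i)
    (h52 : σ.nreg 52 = a) (h50 : σ.nreg 50 = i)
    (post : ∀ σ' k, Frame climb σ σ' → σ'.nreg 52 = top par i a → k ≤ 100 * (l + 1) → Q σ' k) :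
    wp S W climb σ Q := by
  have hB := Machine.big (S := S) (W := W)
  have hSW := Machine.le (S := S) (W := W)
  have h0 := hI.parents.zero
  have hlt := hI.parents.lt
  have hN := hI.pos
  refine wp_frame ?_
  unfold climb
  simp only [wp_block_cons, wp_setN, NExpr.safe_reg, NExpr.val_reg, hS.n3, true_and]
  refine wp_loop (fun σ' t => ∃ k b, σ'.nreg 53 = k ∧ k ≤ l ∧ σ'.nreg 52 = b ∧ b < N ∧
      top par i b = top par i a ∧ par^[2 ^ k] b < i ∧ t + 50 * k ≤ 50 * l) (fun σ' => σ'.nreg 53)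
    ⟨l, a, by simp, le_rfl, by simp [h52], ha, rfl, ?_, by simp⟩ ?_
  -- Since `2 ^ l` exceeds `N`, the longest jump ends at 0.
  · have := iterate_le_sub h0 hlt ha (2 ^ l)
    have := hI.lt_pow
    omega
  · rintro σ' t fr ⟨k, b, e53, hk, e52, hb, htop, hkb, ht⟩
    have e0 : σ'.nreg 0 = N := (fr.nreg 0 rfl).trans (by simp [hS.n0])
    have e2 : σ'.nreg 2 = n := (fr.nreg 2 rfl).trans (by simp [hS.n2])
    have e50 : σ'.nreg 50 = i := (fr.nreg 50 rfl).trans (by simp [h50])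
    have hj : ∀ k ≤ l, ∀ v < N, σ'.na 2 (k * N + v) = par^[2 ^ k] v := by
      intro k hk v hv
      rw [fr.na 2 rfl rfl (by decide)]
      simpa using hS.jump k hk v hv
    refine ⟨by simp, fun hc => ?_, fun hc => ?_⟩
    · simp only [BExpr.val_ltN, NExpr.val_const, NExpr.val_reg, e53] at hc
      obtain ⟨k, rfl⟩ : ∃ k', k = k' + 1 := ⟨k - 1, by omega⟩
      have hkN : k * N ≤ l * N := Nat.mul_le_mul_right _ (by omega)
      have hlN : (l + 1) * N = l * N + N := by ring
      have hjk := hj k (by omega) b hb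
      have hbk := ((iterate_le_sub h0 hlt hb (2 ^ k)).trans (Nat.sub_le _ _)).trans_lt hb
      simp only [wp_block_cons, wp_block_nil, wp_setN, wp_ite, wp_skip, NExpr.safe_reg, NExpr.safe_const,
        NExpr.safe_sub, NExpr.safe_add, NExpr.safe_mul, safe_ld, val_ld, NExpr.val_reg, NExpr.val_const,
        NExpr.val_sub, NExpr.val_add, NExpr.val_mul, State.nreg_setN, State.na_setN, ne_eq,
        not_false_eq_true, Nat.reduceEqDiff, if_true, if_false, BExpr.safe_ltN, BExpr.val_ltN, e53, e0,
        e2, e50, e52, Nat.add_sub_cancel, hjk, true_and, and_true]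
      refine ⟨by omega, by omega, fun hlt' => ?_, fun hge => ?_⟩
      · exact ⟨⟨k, b, by simp, by omega, by simp [e52], hb, htop, hlt', by simp; omega⟩, by simp [e53]⟩
      · refine ⟨⟨k, par^[2 ^ k] b, by simp, by omega, by simp, by omega, ?_, ?_, by simp; omega⟩, by simp [e53]⟩
        · rw [top_iterate hi h0 hlt hb _ (not_lt.1 hge), htop]
        · rwa [← Function.iterate_add_apply, ← two_mul, ← pow_succ']
    · simp only [BExpr.val_ltN, NExpr.val_const, NExpr.val_reg, e53] at hc
      obtain rfl : k = 0 := by omega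
      have hj0 := hj 0 (by omega) b hb
      simp only [pow_zero, Function.iterate_one, zero_mul, zero_add] at hj0 hkb
      have hlN : (l + 1) * N = l * N + N := by ring
      simp only [wp_block_nil, wp_setN, wp_ite, wp_skip, NExpr.safe_reg, safe_ld, val_ld,
        NExpr.val_reg, BExpr.safe_ltN, BExpr.val_ltN, e0, e2, e50, e52, hj0, true_and, and_true]
      refine ⟨fun hlt' => ?_, fun hge => ⟨by omega, ?_⟩⟩
      · refine fun frame => post _ _ frame ?_ ?_
        · rw [e52, ← htop, top_of_lt hlt']
        · simp; omega
      · refine fun frame => post _ _ frame ?_ ?_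
        · rw [← htop, top_of_le (by omega) (hlt b hb (by omega)), top_of_lt hkb]
          simp
        · simp; omega

/-- In the sorted list of `u`, the neighbours before `i` end at the position found by bisection.
Their scales decrease with the index, so those that satisfy the cut-off `16 * r` stand at the end of
this part and are read backwards until the first failure. Only roots are read, plus one failing
test. -/
theorem wp_enqueueRoots (hI : Index N l q lam par perm xrk xinv yrk yinv xs ys)
    (hS : Stored N n l q lam par perm (fun y => xrk (yinv y)) xinv xs ys σ)
    (hL : 8712 * N + 1 < L) (hLS : 32 * (n + L) ≤ S) (u i : ℕ) (r : ℝ) (hi : IsLevel N lam r i)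
    (hu : u < i) (h52 : σ.nreg 52 = u) (h50 : σ.nreg 50 = i) (h8 : σ.rreg 8 = r)
    (post : ∀ σ' k m, Frame enqueueRoots σ σ' → σ'.nreg 55 = m →
      (∀ a < m, ∀ b < m, σ'.na 14 a = σ'.na 14 b → a = b) →
      (∀ x, IsRoot q lam r i u x ↔ ∃ a < m, σ'.na 14 a = x) → k ≤ 100 * (l + m + 1) → Q σ' k) :
    wp S W enqueueRoots σ Q := by
  have hB := Machine.big (S := S) (W := W)
  have hSW := Machine.le (S := S) (W := W)
  have huN : u < N := hu.trans_le hi.le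
  have htot := hI.net.rowStart_nbr_le
  have hmono := rowStart_mono (Nbr q lam) N (show u + 1 ≤ N from huN)
  obtain ⟨hrow, hrow'⟩ := rowStart_le_succ (Nbr q lam) N u
  have hst := hS.nbrs.start_eq u huN.le
  have hst' := hS.nbrs.start_eq (u + 1) huN
  have hex := fun p h1 h2 => hS.nbrs.exists_eq (u := u) (p := p) huN h1 h2
  have hltiff := fun p p' h1 h2 h1' h2' => hS.nbrs.lt_iff (u := u) (p := p) (p' := p') huN h1 h2 h1' h2'
  set s₀ := rowStart (Nbr q lam) N u with hs₀
  set s₁ := rowStart (Nbr q lam) N (u + 1) with hs₁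
  refine wp_frame ?_
  unfold enqueueRoots
  simp only [wp_block_cons, wp_st, wp_setN, wp_setR, NExpr.safe_reg, NExpr.safe_const, NExpr.safe_add,
    RExpr.safe_ofNat, RExpr.val_ofNat, NExpr.val_reg, NExpr.val_const, NExpr.val_add, safe_ld, val_ld,
    State.nreg_setN, State.nreg_setNA, State.na_setN, State.na_setNA, ne_eq, not_false_eq_true,
    Nat.reduceEqDiff, Nat.reduceLT, false_and, if_true, if_false, hS.n2, h52, h50, hst, hst',
    true_and, and_true]
  refine ⟨by omega, by omega, by omega, by omega, by omega, ?_⟩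
  set σ₀ := (((((σ.setNA 14 0 u).setN 55 1).setN 10 s₀).setN 11 s₁).setN 56 s₀).setR 6 (i : ℝ) with hσ₀
  refine wp_lowerBound (fun p => (σ.na 4 p : ℝ)) s₀ s₁ l (by simp [hσ₀]) (by simp [hσ₀]) hrow (by omega)
    (by have := hI.lt_pow; omega) (fun p p' h1 h2 h3 => ?_) (fun σ' fr h1 h2 => ?_) ?_
  · rcases h2.eq_or_lt with rfl | h2
    · exact le_rfl
    · exact_mod_cast ((hltiff p p' h1 (by omega) (by omega) h3).2 h2).le
  · have : ∀ p, σ'.na 4 p = σ.na 4 p := fun p => (fr.na 4 rfl rfl (by decide) p).trans (by simp [hσ₀])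
    have e2 : σ'.nreg 2 = n := (fr.nreg 2 rfl).trans (by simp [hσ₀, hS.n2])
    simp [this, e2]
    omega
  intro σ₁ k₁ p₀ fr1 e10 hp1 hp2 hp3 hp4 hk1
  have hp3' : ∀ p, s₀ ≤ p → p < p₀ → σ.na 4 p < i := by
    intro p h1 h2
    have := hp3 p h1 h2
    simp [hσ₀] at this
    exact this
  have hp4' : ∀ p, p₀ ≤ p → p < s₁ → i ≤ σ.na 4 p := by
    intro p h1 h2
    have := hp4 p h1 h2
    simp [hσ₀] at this
    exact this
  have hmax : ∀ w, w + (u - w) = max u w := fun w => by omega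
  refine wp_loop (fun σ' t => ∃ p, σ'.nreg 10 = p ∧ s₀ ≤ p ∧ p ≤ p₀ ∧ σ'.nreg 55 = 1 + (p₀ - p) ∧
      σ'.na 14 0 = u ∧ (∀ j < p₀ - p, σ'.na 14 (1 + j) = σ.na 4 (p₀ - 1 - j)) ∧
      (∀ p', p ≤ p' → p' < p₀ → lam (max u (σ.na 4 p')) ≤ 16 * r) ∧ t ≤ 80 * (p₀ - p))
    (fun σ' => σ'.nreg 10) ?_ ?_
  · refine ⟨p₀, e10, hp1, le_rfl, ?_, ?_, by omega, by omega, by simp⟩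
    · rw [fr1.nreg 55 rfl]; simp [hσ₀]
    · rw [fr1.na 14 rfl rfl (by decide)]; simp [hσ₀]
  rintro σ' t fr ⟨p, f10, f1, f2, f55, f0, fj, flam, ft⟩
  have e2 : σ'.nreg 2 = n := by rw [fr.nreg 2 rfl, fr1.nreg 2 rfl]; simp [hσ₀, hS.n2]
  have e56 : σ'.nreg 56 = s₀ := by rw [fr.nreg 56 rfl, fr1.nreg 56 rfl]; simp [hσ₀]
  have e52 : σ'.nreg 52 = u := by rw [fr.nreg 52 rfl, fr1.nreg 52 rfl]; simp [hσ₀, h52]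
  have e8 : σ'.rreg 8 = r := by rw [fr.rreg 8 rfl, fr1.rreg 8 rfl]; simp [hσ₀, h8]
  have a4 : ∀ p, σ'.na 4 p = σ.na 4 p := fun p => by
    rw [fr.na 4 rfl rfl (by decide), fr1.na 4 rfl rfl (by decide)]; simp [hσ₀]
  have r4 : ∀ j < N, σ'.ra 4 j = lam j := fun j hj => by
    rw [fr.ra 4 rfl rfl (by decide), fr1.ra 4 rfl rfl (by decide)]; simpa [hσ₀] using hS.lam_eq j hj
  have hval : s₀ < p → σ.na 4 (p - 1) < N ∧ max u (σ.na 4 (p - 1)) < N := by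
    intro hsp
    have := (hex (p - 1) (by omega) (by omega)).1
    omega
  simp only [BExpr.safe_and, BExpr.safe_ltN, BExpr.safe_not, BExpr.safe_ltR, BExpr.val_and,
    BExpr.val_ltN, BExpr.val_not, BExpr.val_ltR, RExpr.safe_mul, RExpr.safe_ofNat, RExpr.safe_reg,
    RExpr.val_mul, RExpr.val_ofNat, RExpr.val_reg, safe_rld, val_rld, safe_ld, val_ld, NExpr.safe_add,
    NExpr.safe_sub, NExpr.safe_const, NExpr.safe_reg, NExpr.val_add, NExpr.val_sub, NExpr.val_const,
    NExpr.val_reg, e2, e56, e52, e8, f10, a4, hmax, true_and, and_true]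
  refine ⟨fun hsp => ⟨by omega, ⟨⟨⟨by omega, by omega⟩, ⟨by omega, by omega⟩, by have := hval hsp; omega⟩,
    by have := hval hsp; omega⟩⟩, fun hc => ?_, fun hc => ?_⟩
  · obtain ⟨hsp, hc2⟩ := hc
    obtain ⟨hw1, hw2⟩ := hval hsp
    rw [r4 _ hw2, not_lt] at hc2
    simp only [wp_block_cons, wp_block_nil, wp_st, wp_setN, safe_ld, val_ld, NExpr.safe_add,
      NExpr.safe_sub, NExpr.safe_const, NExpr.safe_reg, NExpr.val_add, NExpr.val_sub, NExpr.val_const,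
      NExpr.val_reg, State.nreg_setN, State.nreg_setNA, Nat.reduceEqDiff, if_true, if_false,
      e2, f10, f55, a4, true_and, and_true]
    refine ⟨by omega, ⟨by omega, by omega⟩, ⟨by omega, by omega⟩, by omega,
      ⟨p - 1, by simp, by omega, by omega, by omega, ?_, fun j hj => ?_, fun p' h1 h2 => ?_, ?_⟩, ?_⟩
    · have : 0 ≠ 1 + (p₀ - p) := by omega
      simp [f0, this]
    · by_cases hjp : j = p₀ - p
      · subst hjp
        simp
        congr 1; omega
      · simp
        rw [if_neg (by omega)]
        exact fj j (by omega)
    · by_cases hpp : p' = p - 1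
      · subst hpp; exact_mod_cast hc2
      · exact flam p' (by omega) h2
    · simp; omega
    · omega
  · rw [wp_block_nil]
    intro frame
    have hg : ∀ a < 1 + (p₀ - p), σ'.na 14 a = if a = 0 then u else σ.na 4 (p₀ - a) := by
      intro a ha
      by_cases ha0 : a = 0
      · simp [ha0, f0]
      · rw [if_neg ha0]
        have := fj (a - 1) (by omega)
        rw [show 1 + (a - 1) = a by omega, show p₀ - 1 - (a - 1) = p₀ - a by omega] at this
        exact this
    have hne : ∀ p', s₀ ≤ p' → p' < s₁ → σ.na 4 p' ≠ u := fun p' h1 h2 => (hex p' h1 h2).2.1.1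
    -- No duplicates: `u` is not its own neighbour, and a row is strictly increasing.
    refine post _ _ (1 + (p₀ - p)) frame f55 (fun a ha b hb hab => ?_) (fun x => ⟨fun hx => ?_, ?_⟩) ?_
    · rw [hg a ha, hg b hb] at hab
      split at hab <;> split at hab
      · omega
      · exact absurd hab.symm (hne _ (by omega) (by omega))
      · exact absurd hab (hne _ (by omega) (by omega))
      · have h1 := hltiff (p₀ - a) (p₀ - b) (by omega) (by omega) (by omega) (by omega)
        have h2 := hltiff (p₀ - b) (p₀ - a) (by omega) (by omega) (by omega) (by omega)
        omega
    · rcases hx with rfl | ⟨hx1, hx2, hx3⟩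
      · exact ⟨0, by omega, f0⟩
      · obtain ⟨px, g1, g2, g3⟩ := hS.nbrs.exists_pos huN (hx1.trans_le hi.le) hx2
        have hpx : px < p₀ := by
          by_contra hcon
          have := hp4' px (by omega) g2
          omega
        by_cases hpp : p ≤ px
        · refine ⟨p₀ - px, by omega, ?_⟩
          rw [hg _ (by omega), if_neg (by omega), show p₀ - (p₀ - px) = px by omega, g3]
        -- A root further to the left has a smaller index, hence a scale no smaller than the one
        -- that failed the test.
        · exfalso
          obtain ⟨hw1, hw2⟩ := hval (by omega)
          have hiN := hi.le
          refine hc ⟨by omega, not_lt.2 ?_⟩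
          rw [r4 _ hw2]
          have hle : x ≤ σ.na 4 (p - 1) := by
            rw [← g3]
            have := hltiff (p - 1) px (by omega) (by omega) g1 g2
            omega
          have hxu := hx2.1
          have := hI.net.antitone (i := max u x) (j := max u (σ.na 4 (p - 1))) (by omega) (by omega) hw2
          push_cast
          linarith
    · rintro ⟨a, ha, rfl⟩
      rw [hg a ha]
      split
      · exact Or.inl rfl
      · have h1 := hex (p₀ - a) (by omega) (by omega)
        exact Or.inr ⟨hp3' _ (by omega) (by omega), h1.2.1, flam _ (by omega) (by omega)⟩
    · simp at hk1 ⊢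
      omega

end

/-! ### Traversal of the trees below the roots -/

/-- The queue `g 0, ..., g (m - 1)` of the search for the answer, when the points `g b` with `b < h`
are processed and the descendants less than `e` of the point `g h` are in the queue. -/
structure Queue (q : ℕ → E2) (lam : ℕ → ℝ) (par : ℕ → ℕ) (r : ℝ) (i i' u h e m : ℕ) (g : ℕ → ℕ) :
    Prop where
  inj : ∀ a < m, ∀ b < m, g a = g b → a = b
  mem : ∀ a < m, InAnswer q lam par r i i' u (g a)
  origin : ∀ a < m, g a < i ∨ (i ≤ g a ∧ ∃ b < m, (b < h ∨ b = h ∧ g a < e) ∧ g b = par (g a))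
  root : ∀ x, IsRoot q lam r i u x → ∃ a < m, g a = x
  closed : ∀ b < m, ∀ w, (b < h ∨ b = h ∧ w < e) → i ≤ w → w < i' → par w = g b → ∃ a < m, g a = w

namespace Queue

variable {N : ℕ} {q : ℕ → E2} {lam : ℕ → ℝ} {par : ℕ → ℕ} {r s : ℝ} {i i' u h e e' m : ℕ} {g g' : ℕ → ℕ}

theorem congr (hQ : Queue q lam par r i i' u h e m g) (hg : ∀ a < m, g' a = g a) :
    Queue q lam par r i i' u h e m g' := by
  refine ⟨fun a ha b hb hab => ?_, fun a ha => ?_, fun a ha => ?_, fun x hx => ?_,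
    fun b hb w h1 h2 h3 h4 => ?_⟩
  · rw [hg a ha, hg b hb] at hab; exact hQ.inj a ha b hb hab
  · rw [hg a ha]; exact hQ.mem a ha
  · rw [hg a ha]
    refine (hQ.origin a ha).imp_right ?_
    rintro ⟨h1, b, hb, h2, h3⟩
    exact ⟨h1, b, hb, h2, by rw [hg b hb, h3]⟩
  · obtain ⟨a, ha, h1⟩ := hQ.root x hx
    exact ⟨a, ha, by rw [hg a ha, h1]⟩
  · rw [hg b hb] at h4
    obtain ⟨a, ha, h5⟩ := hQ.closed b hb w h1 h2 h3 h4
    exact ⟨a, ha, by rw [hg a ha, h5]⟩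

/-- Neighbours that are not children of the head may be passed over. -/
theorem mono (hQ : Queue q lam par r i i' u h e m g) (hee : e ≤ e')
    (hno : h < m → ∀ w, e ≤ w → w < e' → i ≤ w → w < i' → par w ≠ g h) :
    Queue q lam par r i i' u h e' m g := by
  refine ⟨hQ.inj, hQ.mem, fun a ha => ?_, hQ.root, fun b hb w h1 h2 h3 h4 => ?_⟩
  · refine (hQ.origin a ha).imp_right ?_
    rintro ⟨h1, b, hb, h2, h3⟩
    exact ⟨h1, b, hb, h2.imp_right fun h => ⟨h.1, h.2.trans_le hee⟩, h3⟩
  · refine hQ.closed b hb w (h1.imp_right ?_) h2 h3 h4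
    rintro ⟨rfl, h5⟩
    refine ⟨rfl, ?_⟩
    by_contra hc
    exact hno hb w (not_lt.1 hc) h5 h2 h3 h4

/-- Once the children of the head below `i'` are in the queue, the head counts as processed. -/
theorem next (hQ : Queue q lam par r i i' u h i' m g) : Queue q lam par r i i' u (h + 1) 0 m g := by
  refine ⟨hQ.inj, hQ.mem, fun a ha => ?_, hQ.root, fun b hb w h1 h2 h3 h4 => ?_⟩
  · refine (hQ.origin a ha).imp_right ?_
    rintro ⟨h1, b, hb, h2, h3⟩
    exact ⟨h1, b, hb, Or.inl (by omega), h3⟩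
  · exact hQ.closed b hb w (by omega) h2 h3 h4

/-- A root lies before `i` and is its own first ancestor before `i`, so it belongs to the answer. -/
theorem init (hu : u < i) (hi' : i ≤ i')
    (hinj : ∀ a < m, ∀ b < m, g a = g b → a = b)
    (hroot : ∀ x, IsRoot q lam r i u x ↔ ∃ a < m, g a = x) : Queue q lam par r i i' u 0 0 m g := by
  have hlt : ∀ a < m, g a < i := fun a ha => ((hroot _).2 ⟨a, ha, rfl⟩).lt hu
  refine ⟨hinj, fun a ha => ⟨(hlt a ha).trans_le hi', ?_⟩, fun a ha => Or.inl (hlt a ha),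
    fun x hx => (hroot x).1 hx, fun b hb w h1 => by omega⟩
  rw [top_of_lt (hlt a ha)]
  exact (hroot _).2 ⟨a, ha, rfl⟩

/-- Append the descendant `w` of `g h`. -/
theorem push (hQ : Queue q lam par r i i' u h e m g) (hhm : h < m) {w : ℕ} (hew : e ≤ w) (hiw : i ≤ w)
    (hwi : w < i') (hpw : par w = g h) (hpar : par w < w)
    (hno : ∀ w', e ≤ w' → w' < w → i ≤ w' → w' < i' → par w' ≠ g h) :
    Queue q lam par r i i' u h (w + 1) (m + 1) (Function.update g m w) := by
  -- An entry equal to `w` would have been appended as a child of `par w`, which is the head `g h`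
  -- and occurs in the queue only there. But only children below `e` have been appended for the
  -- head.
  have hnew : ∀ a < m, g a ≠ w := by
    intro a ha haw
    rcases hQ.origin a ha with h1 | ⟨h1, b, hb, h2, h3⟩
    · omega
    · rw [haw, hpw] at h3
      have := hQ.inj b hb h hhm h3
      omega
  have hg : ∀ a, a ≠ m → Function.update g m w a = g a := fun a ha => Function.update_of_ne ha _ _
  refine ⟨fun a ha b hb hab => ?_, fun a ha => ?_, fun a ha => ?_, fun x hx => ?_,
    fun b hb x h1 h2 h3 h4 => ?_⟩
  · by_cases ham : a = m <;> by_cases hbm : b = m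
    · omega
    · subst ham
      rw [hg b hbm, Function.update_self] at hab
      exact absurd hab.symm (hnew b (by omega))
    · subst hbm
      rw [hg a ham, Function.update_self] at hab
      exact absurd hab (hnew a (by omega))
    · rw [hg a ham, hg b hbm] at hab
      exact hQ.inj a (by omega) b (by omega) hab
  · by_cases ham : a = m
    · subst ham
      rw [Function.update_self]
      refine ⟨hwi, ?_⟩
      rw [top_of_le hiw hpar, hpw]
      exact (hQ.mem h hhm).2
    · rw [hg a ham]; exact hQ.mem a (by omega)
  · by_cases ham : a = m
    · subst ham
      rw [Function.update_self]
      exact Or.inr ⟨hiw, h, by omega, Or.inr ⟨rfl, by omega⟩, by rw [hg h (by omega), hpw]⟩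
    · rw [hg a ham]
      refine (hQ.origin a (by omega)).imp_right ?_
      rintro ⟨h1, b, hb, h2, h3⟩
      exact ⟨h1, b, by omega, by omega, by rw [hg b (by omega), h3]⟩
  · obtain ⟨a, ha, h1⟩ := hQ.root x hx
    exact ⟨a, by omega, by rw [hg a (by omega), h1]⟩
  · by_cases hxw : x = w
    · exact ⟨m, by omega, by rw [Function.update_self, hxw]⟩
    · by_cases hbm : b = m
      · omega
      · rw [hg b hbm] at h4
        have hbx : b < h ∨ b = h ∧ x < e := by
          rcases h1 with h1 | ⟨rfl, h5⟩
          · exact Or.inl h1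
          · refine Or.inr ⟨rfl, ?_⟩
            by_contra hc
            exact hno x (not_lt.1 hc) (by omega) h2 h3 h4
        obtain ⟨a, ha, h5⟩ := hQ.closed b (by omega) x hbx h2 h3 h4
        exact ⟨a, by omega, by rw [hg a (by omega), h5]⟩

/-- When the whole queue is processed, it contains the answer. -/
theorem complete (hQ : Queue q lam par r i i' u m 0 m g) (hP : Parents N q lam par) (hi : 1 ≤ i)
    (hi' : i' ≤ N) {z : ℕ} : InAnswer q lam par r i i' u z ↔ ∃ a < m, g a = z := by
  constructor
  · intro hz
    -- Either z is a root, or its parent has the same first ancestor before `i` and a smaller index.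
    -- Then the parent is in the queue, and its children have been appended.
    induction z using Nat.strong_induction_on with
    | _ z ih =>
      rcases Nat.lt_or_ge z i with h1 | h1
      · have := hz.2
        rw [top_of_lt h1] at this
        exact hQ.root z this
      · have hlt := hP.lt z (hz.1.trans_le hi') (by omega)
        have h2 := hz.2
        rw [top_of_le h1 hlt] at h2
        obtain ⟨b, hb, hbz⟩ := ih _ hlt ⟨hlt.trans hz.1, h2⟩
        exact hQ.closed b hb z (Or.inl hb) h1 hz.1 hbz.symm
  · rintro ⟨a, ha, rfl⟩
    exact hQ.mem a ha

/-- The entries are distinct indices below `N`; so the queue fits into its column and the traversal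
terminates. -/
theorem length_le (hQ : Queue q lam par r i i' u h e m g) (hi' : i' ≤ N) : m ≤ N := by
  have := Finset.card_le_card_of_injOn (s := Finset.range m) (t := Finset.range N) g
    (fun a ha => Finset.mem_coe.2 (Finset.mem_range.2
      ((hQ.mem a (Finset.mem_range.1 (Finset.mem_coe.1 ha))).1.trans_le hi')))
    (fun a ha b hb hab => hQ.inj a (Finset.mem_range.1 (Finset.mem_coe.1 ha)) b
      (Finset.mem_range.1 (Finset.mem_coe.1 hb)) hab)
  simpa using this

end Queue

/-- Read the list of neighbours between the registers 10 and 59 up to the level in register 51, and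
append the children of the point in register 58 to the queue. -/
def scan : Cmd := .loop (.and (.ltN (.reg 10) (.reg 59)) (.ltN (ld 4 (.reg 10)) (.reg 51))) (block [
  .setN 60 (ld 4 (.reg 10)),
  .ite (.and (.not (.ltN (ld 2 (.reg 60)) (.reg 58))) (.not (.ltN (.reg 58) (ld 2 (.reg 60)))))
    (block [st 14 (.reg 55) (.reg 60), .setN 55 (.reg 55 + .const 1)]) .skip,
  .setN 10 (.reg 10 + .const 1)])

section

variable {S W : ℕ} [Machine S W] {σ : State} {Q : State → ℕ → Prop} {N n L l : ℕ} {q : ℕ → E2}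
  {lam : ℕ → ℝ} {par perm xrk xinv yrk yinv : ℕ → ℕ} {xs ys : ℕ → ℝ}

/-- The children of `y` are among its neighbours. The list is sorted, so the children from `i` on
and below `i'` are met in increasing order, and reading stops at the first entry that is not below
`i'`. -/
theorem wp_scan (hI : Index N l q lam par perm xrk xinv yrk yinv xs ys)
    (hS : Stored N n l q lam par perm (fun y => xrk (yinv y)) xinv xs ys σ)
    (hL : 8712 * N + 1 < L) (hLS : 32 * (n + L) ≤ S) (u i i' h m y p₀ : ℕ) (r s : ℝ)
    (hi : IsLevel N lam r i) (hi' : IsLevel N lam s i')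
    (hhm : h < m) (h58 : σ.nreg 58 = y) (h51 : σ.nreg 51 = i') (h55 : σ.nreg 55 = m) (h10 : σ.nreg 10 = p₀)
    (h59 : σ.nreg 59 = rowStart (Nbr q lam) N (y + 1)) (hy : σ.na 14 h = y)
    (hp : rowStart (Nbr q lam) N y ≤ p₀) (hp' : p₀ ≤ rowStart (Nbr q lam) N (y + 1))
    (hlow : ∀ p, rowStart (Nbr q lam) N y ≤ p → p < p₀ → y < i ∧ σ.na 4 p < i)
    (hhigh : y < i → ∀ p, p₀ ≤ p → p < rowStart (Nbr q lam) N (y + 1) → i ≤ σ.na 4 p)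
    (hQ : Queue q lam par r i i' u h 0 m (σ.na 14))
    (post : ∀ σ' k m', Frame scan σ σ' → σ'.nreg 55 = m' → m ≤ m' →
      Queue q lam par r i i' u h i' m' (σ'.na 14) → (∀ a < m, σ'.na 14 a = σ.na 14 a) →
      k ≤ 100 * scanLength q lam i i' y + 50 → Q σ' k) : wp S W scan σ Q := by
  classical
  have hB := Machine.big (S := S) (W := W)
  have hSW := Machine.le (S := S) (W := W)
  have hyN : y < N := by
    have := (hQ.mem h hhm).1
    have := hi'.le
    omega
  have hi1 := hi.one_le
  have hiN' := hi'.le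
  have htot := hI.net.rowStart_nbr_le
  have hmono := rowStart_mono (Nbr q lam) N (show y + 1 ≤ N from hyN)
  have hex := fun p h1 h2 => hS.nbrs.exists_eq (u := y) (p := p) hyN h1 h2
  have hltiff := fun p p' h1 h2 h1' h2' => hS.nbrs.lt_iff (u := y) (p := p) (p' := p') hyN h1 h2 h1' h2'
  set s₀ := rowStart (Nbr q lam) N y with hs₀
  set s₁ := rowStart (Nbr q lam) N (y + 1) with hs₁
  -- A child lies within `2 * lam w`, well within the radius `16 * lam w` of neighbourhood. It is
  -- not in the part of the list that is skipped, as that part consists of indices before `i`.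
  have hchild : ∀ w, i ≤ w → w < i' → par w = y → ∃ p, p₀ ≤ p ∧ p < s₁ ∧ σ.na 4 p = w := by
    intro w h1 h2 h3
    have hlt := hI.parents.lt w (by omega) (by omega)
    have hd := hI.parents.dist_le w (by omega) (by omega)
    have hpos := hI.net.pos w (by omega) (by omega)
    rw [h3] at hd hlt
    obtain ⟨p, g1, g2, g3⟩ := hS.nbrs.exists_pos hyN (show w < N by omega)
      (show Nbr q lam y w from ⟨hlt.ne', by rw [max_eq_right hlt.le, dist_comm]; linarith⟩)
    refine ⟨p, ?_, g2, g3⟩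
    by_contra hc
    have := (hlow p g1 (by omega)).2
    omega
  have hpar2 : ∀ w < N, par w < N := by
    intro w hw
    rcases Nat.eq_zero_or_pos w with rfl | h1
    · rw [hI.parents.zero]; exact hw
    · exact (hI.parents.lt w hw h1).trans hw
  -- The entries read are distinct elements of the set that `scanLength` counts.
  have hlen : ∀ p, p₀ ≤ p → p ≤ s₁ → (∀ p', p₀ ≤ p' → p' < p → σ.na 4 p' < i') →
      p - p₀ ≤ scanLength q lam i i' y := by
    intro p h1 h2 h3
    rw [← Nat.card_Ico]
    refine Finset.card_le_card_of_injOn (σ.na 4) (fun p' hp' => ?_) (fun a ha b hb hab => ?_)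
    · have := Finset.mem_Ico.1 (Finset.mem_coe.1 hp')
      refine Finset.mem_coe.2 (Finset.mem_filter.2 ⟨Finset.mem_range.2 (h3 p' this.1 this.2),
        (hex p' (by omega) (by omega)).2.1, fun hyi => hhigh hyi p' this.1 (by omega)⟩)
    · have h4 := Finset.mem_Ico.1 (Finset.mem_coe.1 ha)
      have h5 := Finset.mem_Ico.1 (Finset.mem_coe.1 hb)
      have h6 := hltiff a b (by omega) (by omega) (by omega) (by omega)
      have h7 := hltiff b a (by omega) (by omega) (by omega) (by omega)
      omega
  refine wp_loop (fun σ' t => ∃ p e m', σ'.nreg 10 = p ∧ p₀ ≤ p ∧ p ≤ s₁ ∧ σ'.nreg 55 = m' ∧ m ≤ m' ∧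
      (∀ p', p₀ ≤ p' → p' < p → σ.na 4 p' < e ∧ σ.na 4 p' < i') ∧
      (∀ p', p ≤ p' → p' < s₁ → e ≤ σ.na 4 p') ∧
      Queue q lam par r i i' u h e m' (σ'.na 14) ∧ (∀ a < m, σ'.na 14 a = σ.na 14 a) ∧
      t ≤ 90 * (p - p₀)) (fun σ' => s₁ - σ'.nreg 10)
    ⟨p₀, 0, m, h10, le_rfl, hp', h55, le_rfl, by omega, by simp, hQ, fun _ _ => rfl, by simp⟩ ?_
  rintro σ' t fr ⟨p, e, m', e10, f1, f2, e55, f3, f4, f5, hQ', f6, ft⟩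
  have e2 : σ'.nreg 2 = n := (fr.nreg 2 rfl).trans hS.n2
  have e51 : σ'.nreg 51 = i' := (fr.nreg 51 rfl).trans h51
  have e58 : σ'.nreg 58 = y := (fr.nreg 58 rfl).trans h58
  have e59 : σ'.nreg 59 = s₁ := (fr.nreg 59 rfl).trans h59
  have a4 : ∀ p, σ'.na 4 p = σ.na 4 p := fr.na 4 rfl rfl (by decide)
  have a2 : ∀ w < N, σ'.na 2 w = par w := fun w hw => by
    have := hS.jump 0 (Nat.zero_le _) w hw
    rw [fr.na 2 rfl rfl (by decide)]
    simpa using this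
  have ey : σ'.na 14 h = y := (f6 h hhm).trans hy
  have hmN := hQ'.length_le hi'.le
  simp only [BExpr.safe_and, BExpr.safe_ltN, BExpr.val_and, BExpr.val_ltN, NExpr.safe_reg, NExpr.val_reg,
    safe_ld, val_ld, e2, e10, e51, e59, a4, true_and, and_true]
  refine ⟨fun hps => by omega, fun hc => ?_, fun hc => ?_⟩
  · obtain ⟨hps, hwi⟩ := hc
    obtain ⟨hw1, hw2, -⟩ := hex p (by omega) hps
    set w := σ.na 4 p with hw
    have hew := f5 p le_rfl hps
    have hno : ∀ w', e ≤ w' → w' < w → i ≤ w' → w' < i' → par w' ≠ σ'.na 14 h := by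
      intro w' h1 h2 h3 h4 h5
      obtain ⟨p', g1, g2, g3⟩ := hchild w' h3 h4 (h5.trans ey)
      rcases Nat.lt_or_ge p' p with h6 | h6
      · have := (f4 p' g1 h6).1; omega
      · have := hltiff p' p (by omega) g2 (by omega) hps
        omega
    have hP4 : ∀ p', p₀ ≤ p' → p' < p + 1 → σ.na 4 p' < w + 1 ∧ σ.na 4 p' < i' := by
      intro p' h1 h2
      by_cases hpp : p' = p
      · subst hpp; omega
      · have := f4 p' h1 (by omega); omega
    have hP5 : ∀ p', p + 1 ≤ p' → p' < s₁ → w + 1 ≤ σ.na 4 p' := by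
      intro p' h1 h2
      exact (hltiff p p' (by omega) hps (by omega) h2).2 (by omega)
    simp only [wp_block_cons, wp_block_nil, wp_setN, wp_ite, wp_skip, wp_st, BExpr.safe_and,
      BExpr.safe_not, BExpr.safe_ltN, BExpr.val_and, BExpr.val_not, BExpr.val_ltN, safe_ld, val_ld,
      NExpr.safe_reg, NExpr.safe_add, NExpr.safe_const, NExpr.val_reg, NExpr.val_add, NExpr.val_const,
      State.nreg_setN, State.nreg_setNA, State.na_setN, ne_eq, not_false_eq_true, Nat.reduceEqDiff,
      if_true, if_false, e2, e10, e55, e58, a4, ← hw, a2 w hw1, true_and, and_true]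
    refine ⟨by omega, ⟨by omega, fun _ => by omega⟩, fun hpw => ?_, fun hpw => ?_⟩
    · have hpw' : par w = y := by omega
      -- For a root the scan begins at `i`. For any other `y` a child has a larger index than `y`,
      -- hence is beyond `i` as well.
      have hiw : i ≤ w := by
        rcases Nat.lt_or_ge y i with h1 | h1
        · exact hhigh h1 p f1 hps
        · rcases Nat.eq_zero_or_pos w with h2 | h2
          · rw [h2, hI.parents.zero] at hpw'; omega
          · have := hI.parents.lt w hw1 h2
            omega
      refine ⟨by omega, by omega, by omega, ⟨p + 1, w + 1, m' + 1, by simp, by omega, by omega, by simp,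
        by omega, hP4, hP5, ?_, fun a ha => ?_, ?_⟩, by omega⟩
      · refine (hQ'.push (by omega) hew hiw hwi (hpw'.trans ey.symm)
          (hI.parents.lt w hw1 (by omega)) hno).congr fun a ha => ?_
        simp only [Function.update_apply, State.na_setN', State.na_setNA, hw]
        simp
      · have : a ≠ m' := by omega
        simp [this, f6 a ha]
      · simp; omega
    · refine ⟨by omega, ⟨p + 1, w + 1, m', by simp, by omega, by omega, by simp [e55],
        by omega, hP4, hP5, ?_, fun a ha => ?_, ?_⟩, by omega⟩
      · refine (hQ'.mono (e' := w + 1) (by omega) fun _ w' h1 h2 h3 h4 h5 => ?_).congr fun a ha => ?_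
        · by_cases hww : w' = w
          · rw [hww, ey] at h5; omega
          · exact hno w' h1 (by omega) h3 h4 h5
        · simp
      · simp [f6 a ha]
      · simp; omega
  · refine post _ _ m' fr e55 f3 ?_ f6 ?_
    · have hno : ∀ w, e ≤ w → i ≤ w → w < i' → par w ≠ σ'.na 14 h := by
        intro w h1 h3 h4 h5
        obtain ⟨p', g1, g2, g3⟩ := hchild w h3 h4 (h5.trans ey)
        rcases Nat.lt_or_ge p' p with h6 | h6
        · have := (f4 p' g1 h6).1; omega
        · have h7 : ¬ σ.na 4 p < i' := fun h7 => hc ⟨by omega, h7⟩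
          have := hltiff p' p (by omega) g2 (by omega) (by omega)
          omega
      -- It is not recorded that `e` is at most `i'`, hence the maximum. All entries are below `i'`,
      -- so it can be lowered to `i'` afterwards.
      have hQ2 := hQ'.mono (e' := max e i') (le_max_left _ _) fun _ w h1 _ h3 h4 => hno w h1 h3 h4
      refine ⟨hQ2.inj, hQ2.mem, fun a ha => ?_, hQ2.root, fun b hb w h1 h2 h3 h4 => ?_⟩
      · refine (hQ2.origin a ha).imp_right ?_
        rintro ⟨h1, b, hb, h2, h3⟩
        have := (hQ2.mem a ha).1
        exact ⟨h1, b, hb, by omega, h3⟩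
      · exact hQ2.closed b hb w (by omega) h2 h3 h4
    · have := hlen p f1 f2 fun p' h1 h2 => (f4 p' h1 h2).2
      simp
      omega

end

/-- Take a point from the queue, return it and find the first neighbour that is to be read. -/
def beginScan : Cmd := block [
  .setN 58 (ld 14 (.reg 57)),
  .emit (ld 1 (.reg 58)),
  .setN 10 (ld 3 (.reg 58)),
  .setN 59 (ld 3 (.reg 58 + .const 1)),
  .ite (.ltN (.reg 58) (.reg 50)) (block [
    .setN 11 (.reg 59),
    .setR 6 (.ofNat (.reg 50)),
    lowerBound (.ofNat (ld 4 (.reg 12)))]) .skip]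

/-- Process the queue. -/
def processQueue : Cmd := block [
  .setN 57 (.const 0),
  .loop (.ltN (.reg 57) (.reg 55)) (block [beginScan, scan, .setN 57 (.reg 57 + .const 1)])]

section

variable {S W : ℕ} [Machine S W] {σ : State} {Q : State → ℕ → Prop} {N n L l : ℕ} {q : ℕ → E2}
  {lam : ℕ → ℝ} {par perm xrk xinv yrk yinv : ℕ → ℕ} {xs ys : ℕ → ℝ}

/-- For `y < i` the list may contain many neighbours below `i`, whose number is not bounded by the
size of the answer; bisection skips them. Only these points cost a logarithm. -/
theorem wp_beginScan (hI : Index N l q lam par perm xrk xinv yrk yinv xs ys)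
    (hS : Stored N n l q lam par perm (fun y => xrk (yinv y)) xinv xs ys σ)
    (hL : 8712 * N + 1 < L) (hLS : 32 * (n + L) ≤ S) (i h y : ℕ) (hyN : y < N) (hhN : h < N)
    (h50 : σ.nreg 50 = i) (h57 : σ.nreg 57 = h) (hy : σ.na 14 h = y)
    (post : ∀ σ' k p₀, Frame beginScan σ σ' → σ'.nreg 58 = y → σ'.nreg 10 = p₀ →
      σ'.nreg 59 = rowStart (Nbr q lam) N (y + 1) → rowStart (Nbr q lam) N y ≤ p₀ →
      p₀ ≤ rowStart (Nbr q lam) N (y + 1) →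
      (∀ p, rowStart (Nbr q lam) N y ≤ p → p < p₀ → y < i ∧ σ.na 4 p < i) →
      (y < i → ∀ p, p₀ ≤ p → p < rowStart (Nbr q lam) N (y + 1) → i ≤ σ.na 4 p) →
      σ'.out = σ.out ++ [perm y] → k ≤ 100 + (if y < i then 100 * (l + 1) else 0) → Q σ' k) :
    wp S W beginScan σ Q := by
  have hB := Machine.big (S := S) (W := W)
  have hSW := Machine.le (S := S) (W := W)
  have htot := hI.net.rowStart_nbr_le
  have hmono := rowStart_mono (Nbr q lam) N (show y + 1 ≤ N from hyN)
  obtain ⟨hrow, hrow'⟩ := rowStart_le_succ (Nbr q lam) N y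
  have hst := hS.nbrs.start_eq y hyN.le
  have hst' := hS.nbrs.start_eq (y + 1) hyN
  have hltiff := fun p p' h1 h2 h1' h2' => hS.nbrs.lt_iff (u := y) (p := p) (p' := p') hyN h1 h2 h1' h2'
  have hperm := hS.perm_eq y hyN
  set s₀ := rowStart (Nbr q lam) N y with hs₀
  set s₁ := rowStart (Nbr q lam) N (y + 1) with hs₁
  refine wp_frame ?_
  unfold beginScan
  simp only [wp_block_cons, wp_block_nil, wp_emit, wp_setN, wp_setR, wp_ite, wp_skip, BExpr.safe_ltN,
    BExpr.val_ltN, NExpr.safe_reg, NExpr.safe_const, NExpr.safe_add,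
    RExpr.safe_ofNat, RExpr.val_ofNat, NExpr.val_reg, NExpr.val_const, NExpr.val_add, safe_ld, val_ld,
    State.nreg_setN, State.nreg_push, State.na_setN, State.na_push, ne_eq, not_false_eq_true,
    Nat.reduceEqDiff, if_true, if_false, hS.n2, h50, h57, hy, hst, hst', hperm,
    true_and, and_true]
  refine ⟨by omega, by omega, by omega, by omega, fun hyi => ?_, fun hyi => ?_⟩
  · set σ₀ := (((((σ.setN 58 y).push (perm y)).setN 10 s₀).setN 59 s₁).setN 11 s₁).setR 6 (i : ℝ) with hσ₀
    refine wp_lowerBound (fun p => (σ.na 4 p : ℝ)) s₀ s₁ l (by simp [hσ₀]) (by simp [hσ₀]) hrow (by omega)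
      (by have := hI.lt_pow; omega) (fun p p' h1 h2 h3 => ?_) (fun σ' fr h1 h2 => ?_) ?_
    · rcases h2.eq_or_lt with rfl | h2
      · exact le_rfl
      · exact_mod_cast ((hltiff p p' h1 (by omega) (by omega) h3).2 h2).le
    · have : ∀ p, σ'.na 4 p = σ.na 4 p := fun p => (fr.na 4 rfl rfl (by decide) p).trans (by simp [hσ₀])
      have e2 : σ'.nreg 2 = n := (fr.nreg 2 rfl).trans (by simp [hσ₀, hS.n2])
      simp [this, e2]
      omega
    intro σ₁ k₁ p₀ fr1 e10 hp1 hp2 hp3 hp4 hk1 frame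
    refine post _ _ p₀ frame ?_ e10 ?_ hp1 hp2 (fun p h1 h2 => ⟨hyi, ?_⟩) (fun _ p h1 h2 => ?_) ?_ ?_
    · rw [fr1.nreg 58 rfl]; simp [hσ₀]
    · rw [fr1.nreg 59 rfl]; simp [hσ₀]
    · have := hp3 p h1 h2
      simp [hσ₀] at this
      exact this
    · have := hp4 p h1 h2
      simp [hσ₀] at this
      exact this
    · rw [fr1.out rfl]; simp [hσ₀]
    · rw [if_pos hyi]
      simp at hk1 ⊢
      omega
  · intro frame
    refine post _ _ s₀ frame (by simp) (by simp) (by simp) le_rfl hrow (fun p h1 h2 => by omega)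
      (fun h => absurd h hyi) (by simp) ?_
    simp [hyi]

open Classical in
-- The distinct entries of the final queue are exactly the answer, so the time is a sum over the
-- answer. The number of points still to be processed is bounded by `N`.
theorem wp_processQueue (hI : Index N l q lam par perm xrk xinv yrk yinv xs ys)
    (hS : Stored N n l q lam par perm (fun y => xrk (yinv y)) xinv xs ys σ)
    (hL : 8712 * N + 1 < L) (hLS : 32 * (n + L) ≤ S) (u i i' m : ℕ) (r s : ℝ)
    (hi : IsLevel N lam r i) (hi' : IsLevel N lam s i') (hii : i ≤ i') (hu : u < i)
    (h50 : σ.nreg 50 = i) (h51 : σ.nreg 51 = i') (h55 : σ.nreg 55 = m)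
    (hinj : ∀ a < m, ∀ b < m, σ.na 14 a = σ.na 14 b → a = b)
    (hroot : ∀ x, IsRoot q lam r i u x ↔ ∃ a < m, σ.na 14 a = x) (hout : σ.out = [])
    (post : ∀ σ' k, Frame processQueue σ σ' →
      (∀ a, a ∈ σ'.out ↔ ∃ y ∈ answer q lam par r i i' u, perm y = a) →
      k ≤ ∑ y ∈ answer q lam par r i i' u,
        (100 * scanLength q lam i i' y + 200 + (if y < i then 100 * (l + 1) else 0)) + 20 → Q σ' k) :
    wp S W processQueue σ Q := by
  have hB := Machine.big (S := S) (W := W)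
  have hSW := Machine.le (S := S) (W := W)
  have hiN' := hi'.le
  refine wp_frame ?_
  unfold processQueue
  simp only [wp_block_cons, wp_setN, NExpr.safe_const, NExpr.val_const]
  refine ⟨by omega, ?_⟩
  set cst := fun y => 100 * scanLength q lam i i' y + 200 + (if y < i then 100 * (l + 1) else 0) with hcst
  refine wp_loop (fun σ' t => ∃ h m', σ'.nreg 57 = h ∧ σ'.nreg 55 = m' ∧ h ≤ m' ∧
      Queue q lam par r i i' u h 0 m' (σ'.na 14) ∧
      (∀ a, a ∈ σ'.out ↔ ∃ b < h, perm (σ'.na 14 b) = a) ∧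
      t ≤ ∑ b ∈ Finset.range h, cst (σ'.na 14 b)) (fun σ' => N - σ'.nreg 57)
    ⟨0, m, by simp, by simp [h55], Nat.zero_le _, Queue.init hu hii (by simpa using hinj)
      (by simpa using hroot), by simp [hout], by simp⟩ ?_
  rintro σ₁ t fr ⟨h, m', e57, e55, hhm, hQ, ho, ht⟩
  have hS1 : Stored N n l q lam par perm (fun y => xrk (yinv y)) xinv xs ys (σ.setN 57 0) :=
    ⟨by simp [hS.n0], by simp [hS.n2], by simp [hS.n3], by simp [hS.n4], by simpa using hS.perm_eq,
      by simpa using hS.jump, by simpa [State.na_setN'] using hS.nbrs, by simpa using hS.xinv_eq,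
      by simpa using hS.xs_eq, by simpa using hS.ys_eq, by simpa [State.na_setN'] using hS.table,
      by simpa using hS.lam_eq⟩
  have hS2 := hS1.frame fr ⟨⟨rfl, rfl, rfl, rfl⟩, ⟨rfl, rfl, rfl, rfl, rfl, rfl⟩, rfl, rfl, rfl⟩
  have e50 : σ₁.nreg 50 = i := (fr.nreg 50 rfl).trans (by simp [h50])
  have e51 : σ₁.nreg 51 = i' := (fr.nreg 51 rfl).trans (by simp [h51])
  have hmN := hQ.length_le hiN'
  refine ⟨by simp, fun hc => ?_, fun hc => ?_⟩
  · simp only [BExpr.val_ltN, NExpr.val_reg, e57, e55] at hc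
    have hyN : σ₁.na 14 h < N := (hQ.mem h hc).1.trans_le hiN'
    simp only [wp_block_cons]
    refine wp_beginScan hI hS2 hL hLS i h (σ₁.na 14 h) hyN (by omega) e50 e57 rfl ?_
    intro σ₂ k₂ p₀ fr2 f58 f10 f59 hp hp' hlow hhigh hout2 hk2
    have hS3 := hS2.frame fr2 ⟨⟨rfl, rfl, rfl, rfl⟩, ⟨rfl, rfl, rfl, rfl, rfl, rfl⟩, rfl, rfl, rfl⟩
    have a4 : ∀ p, σ₂.na 4 p = σ₁.na 4 p := fr2.na 4 rfl rfl (by decide)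
    have a14 : ∀ p, σ₂.na 14 p = σ₁.na 14 p := fr2.na 14 rfl rfl (by decide)
    refine wp_scan hI hS3 hL hLS u i i' h m' (σ₁.na 14 h) p₀ r s hi hi' hc f58
      ((fr2.nreg 51 rfl).trans e51) ((fr2.nreg 55 rfl).trans e55) f10 f59 (a14 h) hp hp'
      (by simpa only [a4] using hlow) (by simpa only [a4] using hhigh) (hQ.congr fun a _ => a14 a) ?_
    intro σ₃ k₃ m₃ fr3 g55 hm3 hQ3 g14 hk3
    have e57' : σ₃.nreg 57 = h := (fr3.nreg 57 rfl).trans ((fr2.nreg 57 rfl).trans e57)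
    have b14 : ∀ a < m', σ₃.na 14 a = σ₁.na 14 a := fun a ha => (g14 a ha).trans (a14 a)
    simp only [wp_setN, wp_block_nil, NExpr.safe_add, NExpr.safe_reg, NExpr.safe_const, NExpr.val_add,
      NExpr.val_reg, NExpr.val_const, e57', true_and]
    refine ⟨⟨by omega, by omega⟩, ⟨h + 1, m₃, by simp, by simp [g55], by omega, ?_, fun a => ?_, ?_⟩, by simp [e57]; omega⟩
    · exact hQ3.next.congr fun a _ => by simp
    · have : σ₃.out = σ₁.out ++ [perm (σ₁.na 14 h)] := (fr3.out rfl).trans hout2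
      simp only [State.out_setN, this, List.mem_append, List.mem_singleton, ho]
      constructor
      · rintro (⟨b, hb, h1⟩ | h1)
        · exact ⟨b, by omega, by simp [b14 b (by omega), h1]⟩
        · exact ⟨h, by omega, by simp [b14 h hc, h1]⟩
      · rintro ⟨b, hb, h1⟩
        simp [b14 b (by omega)] at h1
        by_cases hbh : b = h
        · exact Or.inr (by rw [← h1, hbh])
        · exact Or.inl ⟨b, by omega, h1⟩
    · rw [Finset.sum_range_succ, Finset.sum_congr rfl (g := fun b => cst (σ₁.na 14 b)) fun b hb => by
        have := Finset.mem_range.1 hb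
        simp [b14 b (by omega)]]
      have : ((σ₃.setN 57 (h + 1)).na 14 h) = σ₁.na 14 h := by simp [b14 h hc]
      rw [this]
      simp only [hcst] at ht ⊢
      simp
      omega
  · simp only [BExpr.val_ltN, NExpr.val_reg, e57, e55] at hc
    obtain rfl : h = m' := by omega
    have hcomp := fun z => hQ.complete hI.parents hi.one_le hiN' (z := z)
    have himg : answer q lam par r i i' u = (Finset.range h).image (σ₁.na 14) := by
      ext z
      rw [mem_answer, hcomp, Finset.mem_image]
      simp only [Finset.mem_range]
    rw [wp_block_nil]
    intro frame
    refine post _ _ frame (fun a => ?_) ?_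
    · rw [ho]
      constructor
      · rintro ⟨b, hb, h1⟩
        exact ⟨_, mem_answer.2 (hQ.mem b hb), h1⟩
      · rintro ⟨y, hy, h1⟩
        obtain ⟨b, hb, rfl⟩ := (hcomp y).1 (mem_answer.1 hy)
        exact ⟨b, hb, h1⟩
    · rw [himg, Finset.sum_image fun a ha b hb hab => hQ.inj a (Finset.mem_range.1 (Finset.mem_coe.1 ha)) b
        (Finset.mem_range.1 (Finset.mem_coe.1 hb)) hab]
      refine le_trans ?_ (Nat.add_le_add_right ht 20)
      simp
      omega

end

/-! ### The complete query -/

/-- Return the points of the answer of the square whose centre is in the real registers 0 and 1, and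
whose half-side vector is in the real registers 2 and 3. -/
def answerQuery : Cmd := block [
  locate,
  .ite (.and (.ltN (.const 0) (.reg 43))
      (.not (.ltR (.reg 0 + .ofNat (.const 2) * .reg 8) (rld 5 (.reg 31)))))
    (block [.setN 52 (ld 6 (.reg 31)), climb, enqueueRoots, processQueue]) .skip]

theorem sum_add_ite_le {A : Finset ℕ} {i C D R : ℕ} {f : ℕ → ℕ}
    (hR : (A.filter (· < i)).card ≤ R) :
    ∑ y ∈ A, (C * f y + 200 + (if y < i then D else 0)) ≤ C * ∑ y ∈ A, f y + 200 * A.card + D * R := by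
  have h : ∑ y ∈ A, (if y < i then D else 0) ≤ D * R := by
    rw [← Finset.sum_filter, Finset.sum_const, smul_eq_mul, mul_comm]
    exact Nat.mul_le_mul_left _ hR
  rw [Finset.sum_add_distrib, Finset.sum_add_distrib, ← Finset.mul_sum, Finset.sum_const, smul_eq_mul]
  omega

section

variable {S W : ℕ} [Machine S W] {σ : State} {Q : State → ℕ → Prop} {N n L l : ℕ} {q : ℕ → E2}
  {lam : ℕ → ℝ} {par perm xrk xinv yrk yinv : ℕ → ℕ} {xs ys : ℕ → ℝ}

/-- Points at distance at most `3 / 2 * r` are strictly inside the window of half-side `2 * r`, so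
an empty window justifies the empty answer. Otherwise the located vertex is within `3 * r` of the
centre, and the geometric lemmas apply. The bounds on size and time need a positive radius `ε * r /
τ`; correctness does not. -/
theorem wp_answerQuery (hI : Index N l q lam par perm xrk xinv yrk yinv xs ys)
    (hS : Stored N n l q lam par perm (fun y => xrk (yinv y)) xinv xs ys σ)
    (hL1 : (l + 1) * N + l < L) (hL2 : 8712 * N + 1 < L) (hL3 : 2 * ((l + 2) * 2 ^ l) + N < L)
    (hLS : 32 * (n + L) ≤ S) (c : E2) (r ε τ : ℝ) (hr0 : 0 < r) (hε0 : 0 ≤ ε) (hε1 : ε ≤ 1) (hτ : 1 ≤ τ)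
    (hr : Real.sqrt (σ.rreg 2 * σ.rreg 2 + σ.rreg 3 * σ.rreg 3) = r) (h0 : σ.rreg 0 = c 0)
    (h1 : σ.rreg 1 = c 1) (h4 : σ.rreg 4 = ε) (h5 : σ.rreg 5 = τ) (hout : σ.out = [])
    (post : ∀ σ' (k : ℕ) (A : Finset ℕ), Frame answerQuery σ σ' → (∀ y ∈ A, y < N) →
      (∀ a, a ∈ σ'.out ↔ ∃ y ∈ A, perm y = a) →
      (∀ v < N, dist (q v) c ≤ 3 / 2 * r → ∃ z ∈ A, dist (q v) (q z) ≤ ε * r / τ) →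
      (0 < ε → (A.card : ℝ) ≤ (1068 * (τ / ε) + 2) ^ 2 ∧
        (k : ℝ) ≤ 10 ^ 9 * (l + 1) + 10 ^ 13 * (τ / ε) ^ 2) → Q σ' k) :
    wp S W answerQuery σ Q := by
  classical
  have hB := Machine.big (S := S) (W := W)
  have hSW := Machine.le (S := S) (W := W)
  have hτ0 : 0 < τ := by linarith
  refine wp_frame ?_
  unfold answerQuery
  simp only [wp_block_cons]
  refine wp_locate hI hS hL3 hLS r (ε * r / τ) hr hr0 (by rw [h4, h5]) ?_
  intro σ₁ k₁ i i' fr1 e50 e51 e8 hi hi' hfind hk1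
  have hS1 := hS.frame fr1 ⟨⟨rfl, rfl, rfl, rfl⟩, ⟨rfl, rfl, rfl, rfl, rfl, rfl⟩, rfl, rfl, rfl⟩
  have hs0 : 0 ≤ ε * r / τ := by positivity
  -- Here `ε ≤ 1 ≤ τ` is used; it puts the level of the roots before the level of the answer.
  have hsr : ε * r / τ ≤ r := by
    rw [div_le_iff₀ hτ0]
    nlinarith
  have hii : i ≤ i' := hi.mono hi' hsr
  have e0 : σ₁.rreg 0 = c 0 := (fr1.rreg 0 rfl).trans h0
  have o1 : σ₁.out = [] := (fr1.out rfl).trans hout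
  have hwin : ∀ v, dist (q v) c ≤ 3 / 2 * r → |q v 0 - c 0| < 2 * r ∧ |q v 1 - c 1| < 2 * r :=
    fun v hv => ⟨by linarith [abs_coord_le_dist (q v) c 0], by linarith [abs_coord_le_dist (q v) c 1]⟩
  simp only [wp_block_nil, wp_ite, BExpr.safe_and, BExpr.safe_ltN, BExpr.safe_not, BExpr.safe_ltR,
    BExpr.val_and, BExpr.val_ltN, BExpr.val_not, BExpr.val_ltR, RExpr.safe_add, RExpr.safe_mul,
    RExpr.safe_ofNat, RExpr.safe_reg, RExpr.val_add, RExpr.val_mul, RExpr.val_ofNat, RExpr.val_reg,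
    safe_rld, val_rld, NExpr.safe_const, NExpr.safe_reg, NExpr.val_const, NExpr.val_reg, hS1.n2, e0, e8,
    true_and, and_true, wp_skip]
  have hX : 0 < σ₁.nreg 43 → σ₁.nreg 31 < N := fun h => by omega
  refine ⟨⟨by omega, fun h => ⟨by omega, by have := hX h; omega⟩⟩, fun hc => ?_, fun hc => ?_⟩
  · obtain ⟨hc1, hc2⟩ := hc
    rcases hfind with ⟨h43, -⟩ | ⟨-, hXN, hx1, hy1, hmin⟩
    · omega
    rw [hS1.xs_eq _ hXN, not_lt] at hc2
    push_cast at hc2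
    set X := σ₁.nreg 31 with hXdef
    set a := xinv X with ha
    have haN : a < N := hI.xrank.inv_lt X hXN
    have hxa : xs X = q a 0 := hI.xrank.sorted_eq X hXN
    have hac : dist (q a) c ≤ 3 * r := by
      have := dist_le_of_coord (x := q a) (y := c) (a := 2 * r)
        (abs_le.2 ⟨by linarith, by linarith⟩) (by rw [← h1]; exact hy1)
      linarith
    have hxi := hS1.xinv_eq X hXN
    simp only [wp_block_cons, wp_setN, safe_ld, val_ld, NExpr.safe_reg, NExpr.val_reg, hS1.n2, ← hXdef, hxi,
      ← ha, true_and]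
    refine ⟨by omega, ?_⟩
    have hS2 : Stored N n l q lam par perm (fun y => xrk (yinv y)) xinv xs ys (σ₁.setN 52 a) :=
      ⟨by simp [hS1.n0], by simp [hS1.n2], by simp [hS1.n3], by simp [hS1.n4], by simpa using hS1.perm_eq,
        by simpa using hS1.jump, by simpa [State.na_setN'] using hS1.nbrs, by simpa using hS1.xinv_eq,
        by simpa using hS1.xs_eq, by simpa using hS1.ys_eq, by simpa [State.na_setN'] using hS1.table,
        by simpa using hS1.lam_eq⟩
    refine wp_climb hI hS2 hL1 hLS a i haN hi.one_le (by simp) (by simp [e50]) ?_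
    intro σ₃ k₃ fr3 e52 hk3
    have hS3 := hS2.frame fr3 ⟨⟨rfl, rfl, rfl, rfl⟩, ⟨rfl, rfl, rfl, rfl, rfl, rfl⟩, rfl, rfl, rfl⟩
    set u := top par i a with hu
    have hui : u < i := top_lt hi.one_le hI.parents.lt haN
    have g50 : σ₃.nreg 50 = i := (fr3.nreg 50 rfl).trans (by simp [e50])
    have g51 : σ₃.nreg 51 = i' := (fr3.nreg 51 rfl).trans (by simp [e51])
    refine wp_enqueueRoots hI hS3 hL2 hLS u i r hi hui e52 g50
      ((fr3.rreg 8 rfl).trans (by simp [e8])) ?_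
    intro σ₄ k₄ m fr4 e55 hinj hroot hk4
    have hS4 := hS3.frame fr4 ⟨⟨rfl, rfl, rfl, rfl⟩, ⟨rfl, rfl, rfl, rfl, rfl, rfl⟩, rfl, rfl, rfl⟩
    refine wp_processQueue hI hS4 hL2 hLS u i i' m r (ε * r / τ) hi hi' hii hui
      ((fr4.nreg 50 rfl).trans g50) ((fr4.nreg 51 rfl).trans g51) e55 hinj hroot
      (by rw [fr4.out rfl, fr3.out rfl]; simp [o1]) ?_
    intro σ₅ k₅ fr5 ho hk5
    rw [wp_block_nil]
    intro frame
    refine post _ _ (answer q lam par r i i' u) frame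
      (fun y hy => (mem_answer.1 hy).1.trans_le hi'.le) ho (fun v hv hd => ?_) (fun hε => ?_)
    · obtain ⟨z, hz, hzd⟩ := exists_inAnswer hI.net hI.parents hi hi' hr0.le hs0 hsr haN hac hv hd
      exact ⟨z, mem_answer.2 hz, hzd⟩
    · have hspos : 0 < ε * r / τ := by positivity
      have hρ : r / (ε * r / τ) = τ / ε := by field_simp
      have hρ1 : 1 ≤ τ / ε := by
        rw [le_div_iff₀ hε]; linarith
      have hcard := card_answer_le hI.net hI.parents hi hi' hspos hr0.le haN hac
      have hsum := sum_scanLength_le hI.net hI.parents hi hi' hspos hr0.le haN hac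
      rw [mul_div_assoc, hρ] at hcard hsum
      refine ⟨hcard, ?_⟩
      set A := answer q lam par r i i' u with hA
      have hroots := card_roots_le hI.net hi hr0 u
      have hm : m ≤ 1026 ^ 2 := by
        refine le_trans ?_ hroots
        rw [← Finset.card_range m]
        refine Finset.card_le_card_of_injOn (σ₄.na 14) (fun b hb => ?_) (fun b hb b' hb' hbb =>
          hinj b (Finset.mem_range.1 (Finset.mem_coe.1 hb)) b' (Finset.mem_range.1 (Finset.mem_coe.1 hb')) hbb)
        have := (hroot _).2 ⟨b, Finset.mem_range.1 (Finset.mem_coe.1 hb), rfl⟩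
        exact Finset.mem_coe.2 (Finset.mem_filter.2 ⟨Finset.mem_range.2 (this.lt hui), this⟩)
      -- An answer before `i` is its own first ancestor there, hence a root. This bounds the number
      -- of bisections.
      have hAi : (A.filter (· < i)).card ≤ 1026 ^ 2 := by
        refine le_trans (Finset.card_le_card fun y hy => ?_) hroots
        rw [Finset.mem_filter] at hy
        have h1 := (mem_answer.1 hy.1).2
        rw [top_of_lt hy.2] at h1
        exact Finset.mem_filter.2 ⟨Finset.mem_range.2 hy.2, h1⟩
      have hk5' := hk5.trans (Nat.add_le_add_right (sum_add_ite_le hAi) 20)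
      have hk : k₁ + (k₃ + (k₄ + k₅)) + 100 ≤ 3 * 10 ^ 8 * (l + 1) +
          (100 * ∑ y ∈ A, scanLength q lam i i' y + 200 * A.card) := by
        omega
      have hkR : ((k₁ + (k₃ + (k₄ + k₅)) + 100 : ℕ) : ℝ) ≤ 3 * 10 ^ 8 * (l + 1) +
          (100 * (∑ y ∈ A, scanLength q lam i i' y : ℕ) + 200 * A.card) := by exact_mod_cast hk
      set ρ := τ / ε with hρdef
      -- The ratio `ρ` is at least 1, which absorbs the additive constants.
      have b1 : (1132 * ρ + 2) ^ 2 ≤ (1134 * ρ) ^ 2 := by gcongr; linarith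
      have b2 : (1068 * ρ + 2) ^ 2 ≤ (1134 * ρ) ^ 2 := by gcongr; linarith
      refine le_trans (Nat.cast_le.2 (?_ : _ ≤ k₁ + (k₃ + (k₄ + k₅)) + 100)) (hkR.trans ?_)
      · simp
        omega
      · have : (0 : ℝ) ≤ l := Nat.cast_nonneg l
        nlinarith [sq_nonneg ρ]
  · intro frame
    refine post _ _ ∅ frame (by simp) (by simp [o1]) (fun v hv hd => ?_) (fun hε => ⟨by simp; positivity, ?_⟩)
    · exfalso
      obtain ⟨w1, w2⟩ := hwin v hd
      rcases hfind with ⟨-, hno⟩ | ⟨h43, hXN, hx1, hy1, hmin⟩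
      · exact hno v hv (by rw [h0, h1]; exact ⟨w1, w2⟩)
      · refine hc ⟨by omega, not_lt.2 ?_⟩
        rw [hS1.xs_eq _ hXN]
        have h3 := hmin v hv (by rw [h0]; exact w1) (by rw [h1]; exact w2)
        have := (abs_lt.1 w1).2
        push_cast
        linarith
    · have hk : k₁ + 100 ≤ 10 ^ 9 * (l + 1) := by omega
      have hkR : ((k₁ + 100 : ℕ) : ℝ) ≤ 10 ^ 9 * (l + 1) := by exact_mod_cast hk
      refine le_trans (Nat.cast_le.2 (?_ : _ ≤ k₁ + 100)) (hkR.trans ?_)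
      · simp
      · have : 0 ≤ (τ / ε) ^ 2 := sq_nonneg _
        linarith

end

/-! ### The complete preprocessing -/

theorem Greedy.net {N : ℕ} {pt : ℕ → E2} {perm : ℕ → ℕ} {lam : ℕ → ℝ} (h : Greedy N N pt perm lam)
    (hinj : ∀ u < N, ∀ v < N, pt u = pt v → u = v) : Net N (fun j => pt (perm j)) lam :=
  ⟨fun _ h1 hj => h.lam_pos hinj hj h1, fun i j hij hj => h.sep j hj i hij,
    fun j h1 hj v hv => h.cover j hj h1 (perm v) (h.lt v hv)⟩

/-- Later points have positive distance from earlier ones, so the order repeats no vertex and by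
counting contains all of them. -/
theorem Greedy.exists_eq {N : ℕ} {pt : ℕ → E2} {perm : ℕ → ℕ} {lam : ℕ → ℝ} (h : Greedy N N pt perm lam)
    (hinj : ∀ u < N, ∀ v < N, pt u = pt v → u = v) {v : ℕ} (hv : v < N) : ∃ j < N, perm j = v := by
  have key : ∀ i j, i < j → j < N → perm i ≠ perm j := by
    intro i j hij hj heq
    have h1 := h.sep j hj i hij
    rw [heq, dist_self] at h1
    have := h.lam_pos hinj hj (by omega)
    linarith
  let f : Fin N → Fin N := fun j => ⟨perm j, h.lt j j.2⟩
  have hf : Function.Injective f := by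
    intro i j hij
    have h1 : perm i = perm j := congrArg Fin.val hij
    rcases lt_trichotomy (i : ℕ) j with h2 | h2 | h2
    · exact absurd h1 (key _ _ h2 j.2)
    · exact Fin.ext h2
    · exact absurd h1.symm (key _ _ h2 i.2)
  obtain ⟨j, hj⟩ := Finite.injective_iff_surjective.1 hf ⟨v, hv⟩
  exact ⟨j, j.2, congrArg Fin.val hj⟩

/-- Every term is at most a multiple of `n * n` or of `l * (n * n)`. Once the products have become
atoms, the claim is linear. -/
theorem preprocess_time_le {N E k1 k2 k3 k4 k5 k6 k7 k8 k9 k10 k11 k12 : ℕ} (l : ℕ) (hpos : 0 < N)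
    (hk1 : k1 ≤ 100 * (N + E) + 100) (hk2 : k2 ≤ 20 * l + 20) (hk3 : k3 ≤ N * (N * 200 + 200) + 20)
    (hk4 : k4 ≤ N * (N * 200 + 50) + 20) (hk5 : k5 ≤ l * (N * 100 + 50) + 20)
    (hk6 : k6 ≤ N * (N * 200 + 100) + 20) (hk7 : k7 ≤ N * (N * 200 + 100) + 20) (hk8 : k8 ≤ N * 50 + 20)
    (hk9 : k9 ≤ l * (N * (N * 100 + 200) + 50) + 20) (hk10 : k10 ≤ N * (N * 200 + 100) + 100)
    (hk11 : k11 ≤ N * (2 * E * 100 + 100) + 100)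
    (hk12 : k12 ≤ N * (1200 * (l + 1) * (N + 2 * E + 1)) + 20) :
    k1 + k2 + k3 + k4 + k5 + k6 + k7 + k8 + k9 + k10 + k11 + k12 + 100 ≤
      10 ^ 4 * (l + 1) * ((N + E) * (N + E)) := by
  set n := N + E with hn
  have q1 : N ≤ n := by omega
  have q2 : n ≤ n * n := Nat.le_mul_self n
  have q3 : N * N ≤ n * n := Nat.mul_le_mul q1 q1
  have q4 : N * E ≤ n * n := Nat.mul_le_mul q1 (by omega)
  have q5 : l * N ≤ l * (n * n) := Nat.mul_le_mul_left _ (by omega)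
  have q6 : l * (N * N) ≤ l * (n * n) := Nat.mul_le_mul_left _ (by omega)
  have q7 : l * (N * E) ≤ l * (n * n) := Nat.mul_le_mul_left _ (by omega)
  have q8 : l ≤ l * (n * n) := Nat.le_mul_of_pos_right _ (by omega)
  have q9 : 1 ≤ n * n := by omega
  have q10 : E ≤ n * n := by omega
  generalize n * n = M at *
  have x3 : N * (N * 200 + 200) = 200 * (N * N) + 200 * N := by ring
  have x4 : N * (N * 200 + 50) = 200 * (N * N) + 50 * N := by ring
  have x5 : l * (N * 100 + 50) = 100 * (l * N) + 50 * l := by ring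
  have x6 : N * (N * 200 + 100) = 200 * (N * N) + 100 * N := by ring
  have x9 : l * (N * (N * 100 + 200) + 50) = 100 * (l * (N * N)) + 200 * (l * N) + 50 * l := by ring
  have x11 : N * (2 * E * 100 + 100) = 200 * (N * E) + 100 * N := by ring
  have x12 : N * (1200 * (l + 1) * (N + 2 * E + 1)) = 1200 * (l * (N * N)) + 2400 * (l * (N * E)) +
      1200 * (l * N) + 1200 * (N * N) + 2400 * (N * E) + 1200 * N := by ring
  have x13 : 10 ^ 4 * (l + 1) * M = 10 ^ 4 * (l * M) + 10 ^ 4 * M := by ring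
  rw [x3] at hk3; rw [x4] at hk4; rw [x5] at hk5; rw [x6] at hk6 hk7 hk10; rw [x9] at hk9
  rw [x11] at hk11; rw [x12] at hk12; rw [x13]
  clear_value n
  omega

/-- The preprocessing. -/
def preprocess : Cmd := block [copyInput, bitLength, greedy, parents, jumps, rank 2 5 6 5,
  rank 3 7 8 6, compose, wavelet, listNbrs, listArcs, spanningRatio]

section

variable {S W : ℕ} [Machine S W] {σ : State} {Q : State → ℕ → Prop}

/-- Composition of the stages. Each one writes only its own columns, registers and scratch space, so
the results of the earlier stages are still present at the end. -/
theorem wp_preprocess (N E L : ℕ) (pt : ℕ → E2) (src : ℕ → ℕ) (ε τ : ℝ) (hpos : 0 < N)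
    (hN : σ.nreg 0 = N) (hE : σ.nreg 1 = E) (hε : σ.rreg 0 = ε)
    (hsrc : ∀ a < 2 * E, σ.nmem a = src a) (hzero : ∀ a, 2 * E ≤ a → σ.nmem a = 0)
    (hlt : ∀ a < 2 * E, src a < N)
    (hpt : ∀ v < N, σ.rmem (2 * v) = pt v 0 ∧ σ.rmem (2 * v + 1) = pt v 1)
    (hinj : ∀ u < N, ∀ v < N, pt u = pt v → u = v) (hτ1 : 1 ≤ τ)
    (hτ : ∀ u < N, ∀ v < N, ∃ x, IsLeast (Walks E pt src u v) x ∧ x ≤ τ * dist (pt u) (pt v))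
    (hL1 : 2 * (N + E) < L) (hL2 : 8712 * N + 1 < L)
    (hL3 : ∀ l, 2 ^ l ≤ 2 * N → (l + 1) * N + l < L ∧ 2 * ((l + 2) * 2 ^ l) + N < L)
    (hLS : 32 * (N + E + L) ≤ S)
    (post : ∀ σ' k l q lam par perm xrk xinv yrk yinv xs ys,
      Index N l q lam par perm xrk xinv yrk yinv xs ys →
      Stored N (N + E) l q lam par perm (fun y => xrk (yinv y)) xinv xs ys σ' → 2 ^ l ≤ 2 * N →
      σ'.rreg 4 = ε → 1 ≤ σ'.rreg 5 → σ'.rreg 5 ≤ τ →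
      (∀ u < N, ∀ v < N, ∃ x, IsLeast (Walks E pt src u v) x ∧ x ≤ σ'.rreg 5 * dist (pt u) (pt v)) →
      (∀ j < N, q j = pt (perm j)) → (∀ v < N, ∃ j < N, perm j = v) →
      k ≤ 10 ^ 4 * (l + 1) * ((N + E) * (N + E)) → Q σ' k) : wp S W preprocess σ Q := by
  have hB := Machine.big (S := S) (W := W)
  have hSW := Machine.le (S := S) (W := W)
  have hNL : N < L := by omega
  have hWN : 2 * N ≤ W := by omega
  have hLN : 2 * N < L := by omega
  have hLE : 2 * E < L := by omega
  unfold preprocess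
  simp only [wp_block_cons]
  refine wp_copyInput N E L hN hE hL1 hLS ?_
  intro σ1 k1 fr1 n2_1 r4_1 hna0 hra0 hk1
  have n0_1 : σ1.nreg 0 = N := (fr1.nreg 0 rfl).trans hN
  have n1_1 : σ1.nreg 1 = E := (fr1.nreg 1 rfl).trans hE
  rw [hε] at r4_1
  -- The cells of column 10 lie beyond the input, where the memory is zero, and copying does not
  -- touch this column. The wavelet table relies on it.
  have z_1 : ∀ i, σ1.na 10 i = 0 := by
    intro i
    rw [State.na, fr1.nmem _ (by rw [Nat.add_comm, Nat.add_mul_mod_self_left]; rfl)]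
    exact hzero _ (by omega)
  refine wp_bitLength N n0_1 hpos hWN ?_
  intro σ2 k2 l fr2 n3_2 n4_2 hl hl2 hk2
  -- After each stage, the contents that later stages need are traced back to the state in which
  -- they were produced; the frames make every such equation a computation.
  have n0_2 : σ2.nreg 0 = _ := (fr2.nreg 0 rfl).trans n0_1
  have n1_2 : σ2.nreg 1 = _ := (fr2.nreg 1 rfl).trans n1_1
  have n2_2 : σ2.nreg 2 = _ := (fr2.nreg 2 rfl).trans n2_1
  have r4_2 : σ2.rreg 4 = _ := (fr2.rreg 4 rfl).trans r4_1
  have na0_2 : σ2.na 0 = _ := funext (fr2.na 0 rfl rfl (by decide))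
  have na10_2 : σ2.na 10 = _ := funext (fr2.na 10 rfl rfl (by decide))
  have ra0_2 : σ2.ra 0 = _ := funext (fr2.ra 0 rfl rfl (by decide))
  have ra1_2 : σ2.ra 1 = _ := funext (fr2.ra 1 rfl rfl (by decide))
  obtain ⟨hL4, hL5⟩ := hL3 l hl2
  have hra0' : ∀ v < N, σ2.ra 0 v = pt v 0 ∧ σ2.ra 1 v = pt v 1 := fun v hv => by
    rw [ra0_2, ra1_2, (hra0 v hv).1, (hra0 v hv).2]; exact hpt v hv
  refine wp_greedy N (N + E) L pt n0_2 n2_2 hpos hNL hLS hra0' ?_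
  intro σ3 k3 fr3 hG hq3 hk3
  have n0_3 : σ3.nreg 0 = _ := (fr3.nreg 0 rfl).trans n0_2
  have n1_3 : σ3.nreg 1 = _ := (fr3.nreg 1 rfl).trans n1_2
  have n2_3 : σ3.nreg 2 = _ := (fr3.nreg 2 rfl).trans n2_2
  have r4_3 : σ3.rreg 4 = _ := (fr3.rreg 4 rfl).trans r4_2
  have n3_3 : σ3.nreg 3 = _ := (fr3.nreg 3 rfl).trans n3_2
  have n4_3 : σ3.nreg 4 = _ := (fr3.nreg 4 rfl).trans n4_2
  have na0_3 : σ3.na 0 = _ := (funext (fr3.na 0 rfl rfl (by decide))).trans na0_2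
  have na10_3 : σ3.na 10 = _ := (funext (fr3.na 10 rfl rfl (by decide))).trans na10_2
  have ra0_3 : σ3.ra 0 = _ := (funext (fr3.ra 0 rfl rfl (by decide))).trans ra0_2
  have ra1_3 : σ3.ra 1 = _ := (funext (fr3.ra 1 rfl rfl (by decide))).trans ra1_2
  set perm := σ3.na 1 with hperm
  set lam := σ3.ra 4 with hlam
  set q : ℕ → E2 := fun j => pt (perm j) with hq
  refine wp_parents N (N + E) L q lam n0_3 hpos n2_3 hNL hLS hq3 (fun _ _ => rfl)
    (fun j hj h1 => hG.exists_parent hinj hj h1) ?_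
  intro σ4 k4 fr4 hP hk4
  have n0_4 : σ4.nreg 0 = _ := (fr4.nreg 0 rfl).trans n0_3
  have n1_4 : σ4.nreg 1 = _ := (fr4.nreg 1 rfl).trans n1_3
  have n2_4 : σ4.nreg 2 = _ := (fr4.nreg 2 rfl).trans n2_3
  have r4_4 : σ4.rreg 4 = _ := (fr4.rreg 4 rfl).trans r4_3
  have n3_4 : σ4.nreg 3 = _ := (fr4.nreg 3 rfl).trans n3_3
  have n4_4 : σ4.nreg 4 = _ := (fr4.nreg 4 rfl).trans n4_3
  have na0_4 : σ4.na 0 = _ := (funext (fr4.na 0 rfl rfl (by decide))).trans na0_3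
  have na1_4 : σ4.na 1 = _ := funext (fr4.na 1 rfl rfl (by decide))
  have na10_4 : σ4.na 10 = _ := (funext (fr4.na 10 rfl rfl (by decide))).trans na10_3
  have ra0_4 : σ4.ra 0 = _ := (funext (fr4.ra 0 rfl rfl (by decide))).trans ra0_3
  have ra1_4 : σ4.ra 1 = _ := (funext (fr4.ra 1 rfl rfl (by decide))).trans ra1_3
  have ra2_4 : σ4.ra 2 = _ := funext (fr4.ra 2 rfl rfl (by decide))
  have ra3_4 : σ4.ra 3 = _ := funext (fr4.ra 3 rfl rfl (by decide))
  have ra4_4 : σ4.ra 4 = _ := funext (fr4.ra 4 rfl rfl (by decide))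
  set par := σ4.na 2 with hpar
  refine wp_jumps N (N + E) L l par n0_4 n2_4 n3_4 hL4 hLS (fun v hv => by
    rcases Nat.eq_zero_or_pos v with rfl | h
    · rw [hP.zero]; exact hv
    · exact (hP.lt v hv h).trans hv) (fun _ _ => rfl) ?_
  intro σ5 k5 fr5 hJ hk5
  have n0_5 : σ5.nreg 0 = _ := (fr5.nreg 0 rfl).trans n0_4
  have n1_5 : σ5.nreg 1 = _ := (fr5.nreg 1 rfl).trans n1_4
  have n2_5 : σ5.nreg 2 = _ := (fr5.nreg 2 rfl).trans n2_4
  have r4_5 : σ5.rreg 4 = _ := (fr5.rreg 4 rfl).trans r4_4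
  have n3_5 : σ5.nreg 3 = _ := (fr5.nreg 3 rfl).trans n3_4
  have n4_5 : σ5.nreg 4 = _ := (fr5.nreg 4 rfl).trans n4_4
  have na0_5 : σ5.na 0 = _ := (funext (fr5.na 0 rfl rfl (by decide))).trans na0_4
  have na1_5 : σ5.na 1 = _ := (funext (fr5.na 1 rfl rfl (by decide))).trans na1_4
  have na10_5 : σ5.na 10 = _ := (funext (fr5.na 10 rfl rfl (by decide))).trans na10_4
  have ra0_5 : σ5.ra 0 = _ := (funext (fr5.ra 0 rfl rfl (by decide))).trans ra0_4
  have ra1_5 : σ5.ra 1 = _ := (funext (fr5.ra 1 rfl rfl (by decide))).trans ra1_4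
  have ra2_5 : σ5.ra 2 = _ := (funext (fr5.ra 2 rfl rfl (by decide))).trans ra2_4
  have ra3_5 : σ5.ra 3 = _ := (funext (fr5.ra 3 rfl rfl (by decide))).trans ra3_4
  have ra4_5 : σ5.ra 4 = _ := (funext (fr5.ra 4 rfl rfl (by decide))).trans ra4_4
  refine wp_rank N (N + E) L (fun j => q j 0) (by decide) (by decide) (by decide) (by decide) (by decide) (by rfl)
    n0_5 n2_5 hNL hLS (fun j hj => by rw [ra2_5]; exact (hq3 j hj).1) ?_
  intro σ6 k6 fr6 hX hk6
  have n0_6 : σ6.nreg 0 = _ := (fr6.nreg 0 rfl).trans n0_5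
  have n1_6 : σ6.nreg 1 = _ := (fr6.nreg 1 rfl).trans n1_5
  have n2_6 : σ6.nreg 2 = _ := (fr6.nreg 2 rfl).trans n2_5
  have r4_6 : σ6.rreg 4 = _ := (fr6.rreg 4 rfl).trans r4_5
  have n3_6 : σ6.nreg 3 = _ := (fr6.nreg 3 rfl).trans n3_5
  have n4_6 : σ6.nreg 4 = _ := (fr6.nreg 4 rfl).trans n4_5
  have na0_6 : σ6.na 0 = _ := (funext (fr6.na 0 rfl rfl (by decide))).trans na0_5
  have na1_6 : σ6.na 1 = _ := (funext (fr6.na 1 rfl rfl (by decide))).trans na1_5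
  have na2_6 : σ6.na 2 = _ := funext (fr6.na 2 rfl rfl (by decide))
  have na10_6 : σ6.na 10 = _ := (funext (fr6.na 10 rfl rfl (by decide))).trans na10_5
  have ra0_6 : σ6.ra 0 = _ := (funext (fr6.ra 0 rfl rfl (by decide))).trans ra0_5
  have ra1_6 : σ6.ra 1 = _ := (funext (fr6.ra 1 rfl rfl (by decide))).trans ra1_5
  have ra2_6 : σ6.ra 2 = _ := (funext (fr6.ra 2 rfl rfl (by decide))).trans ra2_5
  have ra3_6 : σ6.ra 3 = _ := (funext (fr6.ra 3 rfl rfl (by decide))).trans ra3_5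
  have ra4_6 : σ6.ra 4 = _ := (funext (fr6.ra 4 rfl rfl (by decide))).trans ra4_5
  set xrk := σ6.na 5 with hxrk
  set xinv := σ6.na 6 with hxinv
  set xs := σ6.ra 5 with hxs
  refine wp_rank N (N + E) L (fun j => q j 1) (by decide) (by decide) (by decide) (by decide) (by decide) (by rfl)
    n0_6 n2_6 hNL hLS (fun j hj => by rw [ra3_6]; exact (hq3 j hj).2) ?_
  intro σ7 k7 fr7 hY hk7
  have n0_7 : σ7.nreg 0 = _ := (fr7.nreg 0 rfl).trans n0_6
  have n1_7 : σ7.nreg 1 = _ := (fr7.nreg 1 rfl).trans n1_6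
  have n2_7 : σ7.nreg 2 = _ := (fr7.nreg 2 rfl).trans n2_6
  have r4_7 : σ7.rreg 4 = _ := (fr7.rreg 4 rfl).trans r4_6
  have n3_7 : σ7.nreg 3 = _ := (fr7.nreg 3 rfl).trans n3_6
  have n4_7 : σ7.nreg 4 = _ := (fr7.nreg 4 rfl).trans n4_6
  have na0_7 : σ7.na 0 = _ := (funext (fr7.na 0 rfl rfl (by decide))).trans na0_6
  have na1_7 : σ7.na 1 = _ := (funext (fr7.na 1 rfl rfl (by decide))).trans na1_6
  have na2_7 : σ7.na 2 = _ := (funext (fr7.na 2 rfl rfl (by decide))).trans na2_6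
  have na10_7 : σ7.na 10 = _ := (funext (fr7.na 10 rfl rfl (by decide))).trans na10_6
  have ra0_7 : σ7.ra 0 = _ := (funext (fr7.ra 0 rfl rfl (by decide))).trans ra0_6
  have ra1_7 : σ7.ra 1 = _ := (funext (fr7.ra 1 rfl rfl (by decide))).trans ra1_6
  have ra2_7 : σ7.ra 2 = _ := (funext (fr7.ra 2 rfl rfl (by decide))).trans ra2_6
  have ra3_7 : σ7.ra 3 = _ := (funext (fr7.ra 3 rfl rfl (by decide))).trans ra3_6
  have ra4_7 : σ7.ra 4 = _ := (funext (fr7.ra 4 rfl rfl (by decide))).trans ra4_6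
  have na5_7 : σ7.na 5 = _ := funext (fr7.na 5 rfl rfl (by decide))
  have na6_7 : σ7.na 6 = _ := funext (fr7.na 6 rfl rfl (by decide))
  have ra5_7 : σ7.ra 5 = _ := funext (fr7.ra 5 rfl rfl (by decide))
  set yrk := σ7.na 7 with hyrk
  set yinv := σ7.na 8 with hyinv
  set ys := σ7.ra 6 with hys
  refine wp_compose N (N + E) L n0_7 n2_7 hNL hLS hY.inv_lt ?_
  intro σ8 k8 fr8 hC hk8
  have n0_8 : σ8.nreg 0 = _ := (fr8.nreg 0 rfl).trans n0_7
  have n1_8 : σ8.nreg 1 = _ := (fr8.nreg 1 rfl).trans n1_7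
  have n2_8 : σ8.nreg 2 = _ := (fr8.nreg 2 rfl).trans n2_7
  have r4_8 : σ8.rreg 4 = _ := (fr8.rreg 4 rfl).trans r4_7
  have n3_8 : σ8.nreg 3 = _ := (fr8.nreg 3 rfl).trans n3_7
  have n4_8 : σ8.nreg 4 = _ := (fr8.nreg 4 rfl).trans n4_7
  have na0_8 : σ8.na 0 = _ := (funext (fr8.na 0 rfl rfl (by decide))).trans na0_7
  have na1_8 : σ8.na 1 = _ := (funext (fr8.na 1 rfl rfl (by decide))).trans na1_7
  have na2_8 : σ8.na 2 = _ := (funext (fr8.na 2 rfl rfl (by decide))).trans na2_7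
  have na10_8 : σ8.na 10 = _ := (funext (fr8.na 10 rfl rfl (by decide))).trans na10_7
  have ra0_8 : σ8.ra 0 = _ := (funext (fr8.ra 0 rfl rfl (by decide))).trans ra0_7
  have ra1_8 : σ8.ra 1 = _ := (funext (fr8.ra 1 rfl rfl (by decide))).trans ra1_7
  have ra2_8 : σ8.ra 2 = _ := (funext (fr8.ra 2 rfl rfl (by decide))).trans ra2_7
  have ra3_8 : σ8.ra 3 = _ := (funext (fr8.ra 3 rfl rfl (by decide))).trans ra3_7
  have ra4_8 : σ8.ra 4 = _ := (funext (fr8.ra 4 rfl rfl (by decide))).trans ra4_7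
  have na5_8 : σ8.na 5 = _ := (funext (fr8.na 5 rfl rfl (by decide))).trans na5_7
  have na6_8 : σ8.na 6 = _ := (funext (fr8.na 6 rfl rfl (by decide))).trans na6_7
  have ra5_8 : σ8.ra 5 = _ := (funext (fr8.ra 5 rfl rfl (by decide))).trans ra5_7
  have ra6_8 : σ8.ra 6 = _ := funext (fr8.ra 6 rfl rfl (by decide))
  refine wp_wavelet N (N + E) L l (fun y => xrk (yinv y)) n0_8 n2_8 n3_8 n4_8 hL5 hLS
    (fun y hy => by rw [hC y hy, na5_7])
    (fun y hy => (hX.rk_lt _ (hY.inv_lt y hy)).trans hl) (fun y hy y' hy' h => by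
      have h1 := congrArg xinv h
      simp only [hX.inv_rk _ (hY.inv_lt y hy), hX.inv_rk _ (hY.inv_lt y' hy')] at h1
      rw [← hY.rk_inv y hy, h1, hY.rk_inv y' hy'])
    (fun i => by rw [na10_8]; exact z_1 i) ?_
  intro σ9 k9 fr9 hT hk9
  have n0_9 : σ9.nreg 0 = _ := (fr9.nreg 0 rfl).trans n0_8
  have n1_9 : σ9.nreg 1 = _ := (fr9.nreg 1 rfl).trans n1_8
  have n2_9 : σ9.nreg 2 = _ := (fr9.nreg 2 rfl).trans n2_8
  have r4_9 : σ9.rreg 4 = _ := (fr9.rreg 4 rfl).trans r4_8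
  have n3_9 : σ9.nreg 3 = _ := (fr9.nreg 3 rfl).trans n3_8
  have n4_9 : σ9.nreg 4 = _ := (fr9.nreg 4 rfl).trans n4_8
  have na0_9 : σ9.na 0 = _ := (funext (fr9.na 0 rfl rfl (by decide))).trans na0_8
  have na1_9 : σ9.na 1 = _ := (funext (fr9.na 1 rfl rfl (by decide))).trans na1_8
  have na2_9 : σ9.na 2 = _ := (funext (fr9.na 2 rfl rfl (by decide))).trans na2_8
  have ra0_9 : σ9.ra 0 = _ := (funext (fr9.ra 0 rfl rfl (by decide))).trans ra0_8
  have ra1_9 : σ9.ra 1 = _ := (funext (fr9.ra 1 rfl rfl (by decide))).trans ra1_8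
  have ra2_9 : σ9.ra 2 = _ := (funext (fr9.ra 2 rfl rfl (by decide))).trans ra2_8
  have ra3_9 : σ9.ra 3 = _ := (funext (fr9.ra 3 rfl rfl (by decide))).trans ra3_8
  have ra4_9 : σ9.ra 4 = _ := (funext (fr9.ra 4 rfl rfl (by decide))).trans ra4_8
  have na5_9 : σ9.na 5 = _ := (funext (fr9.na 5 rfl rfl (by decide))).trans na5_8
  have na6_9 : σ9.na 6 = _ := (funext (fr9.na 6 rfl rfl (by decide))).trans na6_8
  have ra5_9 : σ9.ra 5 = _ := (funext (fr9.ra 5 rfl rfl (by decide))).trans ra5_8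
  have ra6_9 : σ9.ra 6 = _ := (funext (fr9.ra 6 rfl rfl (by decide))).trans ra6_8
  refine wp_listNbrs N (N + E) L q lam n0_9 n2_9 hL2 hLS (hG.net hinj)
    (fun j hj => by rw [ra2_9, ra3_9]; exact hq3 j hj) (fun j hj => by rw [ra4_9]) ?_
  intro σ10 k10 fr10 hNb hk10
  have n0_10 : σ10.nreg 0 = _ := (fr10.nreg 0 rfl).trans n0_9
  have n1_10 : σ10.nreg 1 = _ := (fr10.nreg 1 rfl).trans n1_9
  have n2_10 : σ10.nreg 2 = _ := (fr10.nreg 2 rfl).trans n2_9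
  have r4_10 : σ10.rreg 4 = _ := (fr10.rreg 4 rfl).trans r4_9
  have n3_10 : σ10.nreg 3 = _ := (fr10.nreg 3 rfl).trans n3_9
  have n4_10 : σ10.nreg 4 = _ := (fr10.nreg 4 rfl).trans n4_9
  have na0_10 : σ10.na 0 = _ := (funext (fr10.na 0 rfl rfl (by decide))).trans na0_9
  have na1_10 : σ10.na 1 = _ := (funext (fr10.na 1 rfl rfl (by decide))).trans na1_9
  have na2_10 : σ10.na 2 = _ := (funext (fr10.na 2 rfl rfl (by decide))).trans na2_9
  have na10_10 : σ10.na 10 = _ := funext (fr10.na 10 rfl rfl (by decide))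
  have ra0_10 : σ10.ra 0 = _ := (funext (fr10.ra 0 rfl rfl (by decide))).trans ra0_9
  have ra1_10 : σ10.ra 1 = _ := (funext (fr10.ra 1 rfl rfl (by decide))).trans ra1_9
  have ra2_10 : σ10.ra 2 = _ := (funext (fr10.ra 2 rfl rfl (by decide))).trans ra2_9
  have ra3_10 : σ10.ra 3 = _ := (funext (fr10.ra 3 rfl rfl (by decide))).trans ra3_9
  have ra4_10 : σ10.ra 4 = _ := (funext (fr10.ra 4 rfl rfl (by decide))).trans ra4_9
  have na5_10 : σ10.na 5 = _ := (funext (fr10.na 5 rfl rfl (by decide))).trans na5_9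
  have na6_10 : σ10.na 6 = _ := (funext (fr10.na 6 rfl rfl (by decide))).trans na6_9
  have ra5_10 : σ10.ra 5 = _ := (funext (fr10.ra 5 rfl rfl (by decide))).trans ra5_9
  have ra6_10 : σ10.ra 6 = _ := (funext (fr10.ra 6 rfl rfl (by decide))).trans ra6_9
  refine wp_listArcs N E (N + E) L pt src n0_10 n1_10 n2_10 hL1 hLS
    (fun a ha => by rw [na0_10, hna0 a ha]; exact hsrc a ha) hlt
    (fun v hv => by rw [ra0_10, ra1_10, (hra0 v hv).1, (hra0 v hv).2]; exact hpt v hv) ?_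
  intro σ11 k11 fr11 hA hk11
  have n0_11 : σ11.nreg 0 = _ := (fr11.nreg 0 rfl).trans n0_10
  have n1_11 : σ11.nreg 1 = _ := (fr11.nreg 1 rfl).trans n1_10
  have n2_11 : σ11.nreg 2 = _ := (fr11.nreg 2 rfl).trans n2_10
  have r4_11 : σ11.rreg 4 = _ := (fr11.rreg 4 rfl).trans r4_10
  have n3_11 : σ11.nreg 3 = _ := (fr11.nreg 3 rfl).trans n3_10
  have n4_11 : σ11.nreg 4 = _ := (fr11.nreg 4 rfl).trans n4_10
  have na0_11 : σ11.na 0 = _ := (funext (fr11.na 0 rfl rfl (by decide))).trans na0_10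
  have na1_11 : σ11.na 1 = _ := (funext (fr11.na 1 rfl rfl (by decide))).trans na1_10
  have na2_11 : σ11.na 2 = _ := (funext (fr11.na 2 rfl rfl (by decide))).trans na2_10
  have na10_11 : σ11.na 10 = _ := (funext (fr11.na 10 rfl rfl (by decide))).trans na10_10
  have ra0_11 : σ11.ra 0 = _ := (funext (fr11.ra 0 rfl rfl (by decide))).trans ra0_10
  have ra1_11 : σ11.ra 1 = _ := (funext (fr11.ra 1 rfl rfl (by decide))).trans ra1_10
  have ra2_11 : σ11.ra 2 = _ := (funext (fr11.ra 2 rfl rfl (by decide))).trans ra2_10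
  have ra3_11 : σ11.ra 3 = _ := (funext (fr11.ra 3 rfl rfl (by decide))).trans ra3_10
  have ra4_11 : σ11.ra 4 = _ := (funext (fr11.ra 4 rfl rfl (by decide))).trans ra4_10
  have na5_11 : σ11.na 5 = _ := (funext (fr11.na 5 rfl rfl (by decide))).trans na5_10
  have na6_11 : σ11.na 6 = _ := (funext (fr11.na 6 rfl rfl (by decide))).trans na6_10
  have ra5_11 : σ11.ra 5 = _ := (funext (fr11.ra 5 rfl rfl (by decide))).trans ra5_10
  have ra6_11 : σ11.ra 6 = _ := (funext (fr11.ra 6 rfl rfl (by decide))).trans ra6_10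
  have na3_11 : σ11.na 3 = _ := funext (fr11.na 3 rfl rfl (by decide))
  have na4_11 : σ11.na 4 = _ := funext (fr11.na 4 rfl rfl (by decide))
  refine wp_spanningRatio N E (N + E) L l pt src τ hA hτ1 hl hLN hLE hLS hτ ?_
  intro σ12 k12 fr12 h5 h5' hW hk12
  have n0_12 : σ12.nreg 0 = _ := (fr12.nreg 0 rfl).trans n0_11
  have n1_12 : σ12.nreg 1 = _ := (fr12.nreg 1 rfl).trans n1_11
  have n2_12 : σ12.nreg 2 = _ := (fr12.nreg 2 rfl).trans n2_11
  have r4_12 : σ12.rreg 4 = _ := (fr12.rreg 4 rfl).trans r4_11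
  have n3_12 : σ12.nreg 3 = _ := (fr12.nreg 3 rfl).trans n3_11
  have n4_12 : σ12.nreg 4 = _ := (fr12.nreg 4 rfl).trans n4_11
  have na0_12 : σ12.na 0 = _ := (funext (fr12.na 0 rfl rfl (by decide))).trans na0_11
  have na1_12 : σ12.na 1 = _ := (funext (fr12.na 1 rfl rfl (by decide))).trans na1_11
  have na2_12 : σ12.na 2 = _ := (funext (fr12.na 2 rfl rfl (by decide))).trans na2_11
  have na10_12 : σ12.na 10 = _ := (funext (fr12.na 10 rfl rfl (by decide))).trans na10_11
  have ra0_12 : σ12.ra 0 = _ := (funext (fr12.ra 0 rfl rfl (by decide))).trans ra0_11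
  have ra1_12 : σ12.ra 1 = _ := (funext (fr12.ra 1 rfl rfl (by decide))).trans ra1_11
  have ra2_12 : σ12.ra 2 = _ := (funext (fr12.ra 2 rfl rfl (by decide))).trans ra2_11
  have ra3_12 : σ12.ra 3 = _ := (funext (fr12.ra 3 rfl rfl (by decide))).trans ra3_11
  have ra4_12 : σ12.ra 4 = _ := (funext (fr12.ra 4 rfl rfl (by decide))).trans ra4_11
  have na5_12 : σ12.na 5 = _ := (funext (fr12.na 5 rfl rfl (by decide))).trans na5_11
  have na6_12 : σ12.na 6 = _ := (funext (fr12.na 6 rfl rfl (by decide))).trans na6_11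
  have ra5_12 : σ12.ra 5 = _ := (funext (fr12.ra 5 rfl rfl (by decide))).trans ra5_11
  have ra6_12 : σ12.ra 6 = _ := (funext (fr12.ra 6 rfl rfl (by decide))).trans ra6_11
  have na3_12 : σ12.na 3 = _ := (funext (fr12.na 3 rfl rfl (by decide))).trans na3_11
  have na4_12 : σ12.na 4 = _ := (funext (fr12.na 4 rfl rfl (by decide))).trans na4_11
  rw [wp_block_nil]
  refine post _ _ l q lam par perm xrk xinv yrk yinv xs ys
    ⟨hpos, hl, hG.net hinj, hP, hG.lt, hX, hY⟩
    ⟨n0_12, n2_12, n3_12, n4_12, fun j _ => by rw [na1_12], fun i hi v hv => ?_, ?_,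
      fun p _ => by rw [na6_12], fun p _ => by rw [ra5_12], fun p _ => by rw [ra6_12], ?_,
      fun j _ => by rw [ra4_12]⟩ hl2 r4_12 h5 h5' hW (fun _ _ => rfl) (fun v hv => hG.exists_eq hinj hv) ?_
  · rw [na2_12]; exact hJ i hi v hv
  · rw [na3_12, na4_12]; exact hNb
  · rw [na10_12]; exact hT
  · refine le_trans ?_ (preprocess_time_le l hpos hk1 hk2 hk3 hk4 hk5 hk6 hk7 hk8 hk9 hk10 hk11 hk12)
    clear * -
    omega

end

end RealRAM

/-! ### Walks of the graph and walks along the arcs of the input -/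

namespace GeometricGraph

variable {P : GeometricGraph}

theorem walkLength_nil (u : Fin P.numVertices) : P.walkLength (.nil : P.graph.Walk u u) = 0 := by
  simp [walkLength]

theorem walkLength_cons {u v w : Fin P.numVertices} (h : P.graph.Adj u v) (p : P.graph.Walk v w) :
    P.walkLength (.cons h p) = dist (P.pos u) (P.pos v) + P.walkLength p := by
  simp [walkLength]

theorem walkLength_concat {u v w : Fin P.numVertices} (p : P.graph.Walk u v) (h : P.graph.Adj v w) :
    P.walkLength (p.concat h) = P.walkLength p + dist (P.pos v) (P.pos w) := by
  simp [walkLength, SimpleGraph.Walk.darts_concat]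

/-- The path that remains after removing cycles uses a subset of the darts of the walk, each at most
once, and lengths are nonnegative. -/
theorem walkLength_bypass_le {u v : Fin P.numVertices} (p : P.graph.Walk u v) :
    P.walkLength p.bypass ≤ P.walkLength p := by
  have h := List.subperm_of_subset (p.bypass_isPath.isTrail.edges_nodup.of_map _) p.darts_bypass_subset_darts
  obtain ⟨l, hl, hs⟩ := h
  rw [walkLength, walkLength, ← (hl.map _).sum_eq]
  refine (hs.map _).sum_le_sum fun x hx => ?_
  obtain ⟨d, -, rfl⟩ := List.mem_map.1 hx
  exact dist_nonneg

/-- The infimum in the definition of the distance is attained: only paths matter, and there are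
finitely many. -/
theorem exists_isLeast_walkLength {u v : Fin P.numVertices} (p : P.graph.Walk u v) :
    ∃ x, IsLeast (Set.range (P.walkLength : P.graph.Walk u v → ℝ)) x := by
  classical
  have hfin : {p : P.graph.Walk u v | p.IsPath}.Finite := by
    refine (Set.toFinite {p : P.graph.Walk u v | p.IsPath ∧ p.length < Fintype.card (Fin P.numVertices)}).subset
      fun p hp => ⟨hp, hp.length_lt⟩
  obtain ⟨p₀, -, hp₀⟩ := Set.exists_min_image _ P.walkLength hfin ⟨p.bypass, p.bypass_isPath⟩
  refine ⟨P.walkLength p₀, ⟨p₀, rfl⟩, ?_⟩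
  rintro _ ⟨w, rfl⟩
  exact (hp₀ w.bypass w.bypass_isPath).trans (walkLength_bypass_le w)

theorem graphDist_eq_of_isLeast {u v : Fin P.numVertices} {x : ℝ}
    (h : IsLeast (Set.range (P.walkLength : P.graph.Walk u v → ℝ)) x) :
    P.graphDist u v = ENNReal.ofReal x := by
  obtain ⟨⟨w, rfl⟩, hx⟩ := h
  exact le_antisymm (iInf_le _ w) (le_iInf fun w' => ENNReal.ofReal_le_ofReal (hx ⟨w', rfl⟩))

/-- The spanner inequality bounds the distance by a finite number, while the infimum over no walks
is infinite. -/
theorem IsSpanner.exists_walk {t : ℝ} (h : P.IsSpanner t) (u v : Fin P.numVertices) :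
    Nonempty (P.graph.Walk u v) := by
  by_contra hc
  rw [not_nonempty_iff] at hc
  have := h u v
  rw [graphDist, iInf_of_empty, top_le_iff] at this
  exact ENNReal.ofReal_ne_top this

theorem IsEdgeList.length_eq {es : List (Fin P.numVertices × Fin P.numVertices)}
    (h : P.IsEdgeList es) : es.length = P.graph.edgeSet.ncard := by
  classical
  have : P.graph.edgeSet = ((es.map fun e => s(e.1, e.2)).toFinset : Set _) := by
    ext e
    rw [List.coe_toFinset]
    exact (h.2 e).symm
  rw [this, Set.ncard_coe_finset, List.toFinset_card_of_nodup h.1, List.length_map]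

end GeometricGraph

namespace RealRAM

variable {P : GeometricGraph} {es : List (Fin P.numVertices × Fin P.numVertices)} {ε : ℝ}

/-- The vertices as a sequence of points. -/
noncomputable def points (P : GeometricGraph) (v : ℕ) : E2 :=
  if h : v < P.numVertices then P.pos ⟨v, h⟩ else 0

theorem points_eq (v : Fin P.numVertices) : points P v = P.pos v := by simp [points]

theorem points_eq' {v : ℕ} (h : v < P.numVertices) : points P v = P.pos ⟨v, h⟩ := by simp [points, h]

theorem nmem_buildInput_even {j : ℕ} (hj : j < es.length) :
    (buildInput P es ε).nmem (2 * j) = (es[j].1 : ℕ) := by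
  have h1 : 2 * j / 2 = j := by omega
  simp [buildInput, h1, hj]

theorem nmem_buildInput_odd {j : ℕ} (hj : j < es.length) :
    (buildInput P es ε).nmem (2 * j + 1) = (es[j].2 : ℕ) := by
  have h1 : (2 * j + 1) / 2 = j := by omega
  have h2 : (2 * j + 1) % 2 = 1 := by omega
  simp [buildInput, h1, h2, hj]

theorem nmem_buildInput_of_le {a : ℕ} (ha : 2 * es.length ≤ a) : (buildInput P es ε).nmem a = 0 := by
  have : ¬ a / 2 < es.length := by omega
  simp [buildInput, this]

theorem rmem_buildInput {v : ℕ} (hv : v < P.numVertices) :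
    (buildInput P es ε).rmem (2 * v) = points P v 0 ∧
      (buildInput P es ε).rmem (2 * v + 1) = points P v 1 := by
  have h1 : (2 * v + 1) / 2 = v := by omega
  have h2 : (2 * v + 1) % 2 = 1 := by omega
  have h3 : 2 * v / 2 = v := by omega
  simp [buildInput, points, h1, h2, h3, hv]

theorem arc_cases {a : ℕ} (ha : a < 2 * es.length) : ∃ j, ∃ hj : j < es.length,
    (buildInput P es ε).nmem a = (es[j].1 : ℕ) ∧ (buildInput P es ε).nmem (revArc a) = (es[j].2 : ℕ) ∨
    (buildInput P es ε).nmem a = (es[j].2 : ℕ) ∧ (buildInput P es ε).nmem (revArc a) = (es[j].1 : ℕ) := by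
  refine ⟨a / 2, by omega, ?_⟩
  rcases Nat.even_or_odd' a with ⟨j, rfl | rfl⟩
  · have h1 : revArc (2 * j) = 2 * j + 1 := by unfold revArc; omega
    have h2 : 2 * j / 2 = j := by omega
    left
    rw [h1]
    simp only [h2]
    exact ⟨nmem_buildInput_even (by omega), nmem_buildInput_odd (by omega)⟩
  · have h1 : revArc (2 * j + 1) = 2 * j := by unfold revArc; omega
    have h2 : (2 * j + 1) / 2 = j := by omega
    right
    rw [h1]
    simp only [h2]
    exact ⟨nmem_buildInput_odd (by omega), nmem_buildInput_even (by omega)⟩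

theorem arc_lt {a : ℕ} (ha : a < 2 * es.length) : (buildInput P es ε).nmem a < P.numVertices := by
  obtain ⟨j, hj, ⟨h, -⟩ | ⟨h, -⟩⟩ := arc_cases (ε := ε) ha <;> rw [h] <;> exact Fin.isLt _

theorem arc_adj (h : P.IsEdgeList es) {a : ℕ} (ha : a < 2 * es.length) {u v : Fin P.numVertices}
    (hu : (buildInput P es ε).nmem a = u) (hv : (buildInput P es ε).nmem (revArc a) = v) :
    P.graph.Adj u v := by
  obtain ⟨j, hj, hc⟩ := arc_cases (ε := ε) ha
  have hadj : P.graph.Adj es[j].1 es[j].2 := by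
    rw [← SimpleGraph.mem_edgeSet, ← h.2]
    exact List.mem_map.2 ⟨es[j], List.getElem_mem hj, rfl⟩
  rcases hc with ⟨h1, h2⟩ | ⟨h1, h2⟩
  · rwa [Fin.ext (hu.symm.trans h1), Fin.ext (hv.symm.trans h2)]
  · rw [Fin.ext (hu.symm.trans h1), Fin.ext (hv.symm.trans h2)]; exact hadj.symm

theorem exists_arc (h : P.IsEdgeList es) {u v : Fin P.numVertices} (huv : P.graph.Adj u v) :
    ∃ a < 2 * es.length, (buildInput P es ε).nmem a = u ∧ (buildInput P es ε).nmem (revArc a) = v := by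
  rw [← SimpleGraph.mem_edgeSet, ← h.2, List.mem_map] at huv
  obtain ⟨e, he, heq⟩ := huv
  obtain ⟨j, hj, rfl⟩ := List.getElem_of_mem he
  have h1 : revArc (2 * j + 1) = 2 * j := by unfold revArc; omega
  have h2 : revArc (2 * j) = 2 * j + 1 := by unfold revArc; omega
  rcases Sym2.eq_iff.1 heq with ⟨h3, h4⟩ | ⟨h3, h4⟩
  · exact ⟨2 * j, by omega, by rw [nmem_buildInput_even hj, h3], by rw [h2, nmem_buildInput_odd hj, h4]⟩
  · exact ⟨2 * j + 1, by omega, by rw [nmem_buildInput_odd hj, h4], by rw [h1, nmem_buildInput_even hj, h3]⟩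

theorem exists_walk_of_arcWalk (h : P.IsEdgeList es) {u : Fin P.numVertices} {v : ℕ} {x : ℝ}
    (hw : x ∈ Walks es.length (points P) (buildInput P es ε).nmem u v) :
    ∃ hv : v < P.numVertices, ∃ w : P.graph.Walk u ⟨v, hv⟩, P.walkLength w = x := by
  have hw' : ArcWalk _ _ _ _ _ _ _ := hw
  induction hw' with
  | nil => exact ⟨u.2, .nil, GeometricGraph.walkLength_nil u⟩
  | @snoc u' a x hw' ha hu ih =>
    obtain ⟨hv, w, rfl⟩ := ih hw'
    have ht : (buildInput P es ε).nmem (revArc a) < P.numVertices := arc_lt (revArc_lt ha)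
    refine ⟨ht, w.concat (arc_adj h ha hu rfl), ?_⟩
    rw [GeometricGraph.walkLength_concat, hu, points_eq' hv, points_eq' ht]

theorem arcWalk_of_walk (h : P.IsEdgeList es) {u v : Fin P.numVertices} (w : P.graph.Walk u v)
    {s : ℕ} {y : ℝ} (hs : y ∈ Walks es.length (points P) (buildInput P es ε).nmem s u) :
    y + P.walkLength w ∈ Walks es.length (points P) (buildInput P es ε).nmem s v := by
  induction w generalizing y with
  | nil => simpa [GeometricGraph.walkLength_nil] using hs
  | cons hadj p ih =>
    obtain ⟨a, ha, h1, h2⟩ := exists_arc (ε := ε) h hadj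
    have := ArcWalk.snoc hs ha h1
    simp only [h1, h2, points_eq] at this
    rw [GeometricGraph.walkLength_cons, ← add_assoc]
    exact ih this

/-- Each edge is listed once in an arbitrary orientation, and its two arcs provide both directions.
So walks in the graph and walks along arcs have the same lengths. -/
theorem walks_eq_range (h : P.IsEdgeList es) (u v : Fin P.numVertices) :
    Walks es.length (points P) (buildInput P es ε).nmem u v =
      Set.range (P.walkLength : P.graph.Walk u v → ℝ) := by
  ext x
  constructor
  · intro hx
    obtain ⟨hv, w, hw⟩ := exists_walk_of_arcWalk h hx
    exact ⟨w, hw⟩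
  · rintro ⟨w, rfl⟩
    simpa using arcWalk_of_walk (ε := ε) h w (ArcWalk.nil (s := (u : ℕ)))

theorem exists_isLeast_walks (h : P.IsEdgeList es) {t : ℝ} (ht : 0 ≤ t) (hP : P.IsSpanner t) {u v : ℕ}
    (hu : u < P.numVertices) (hv : v < P.numVertices) :
    ∃ x, IsLeast (Walks es.length (points P) (buildInput P es ε).nmem u v) x ∧
      x ≤ t * dist (points P u) (points P v) := by
  obtain ⟨w⟩ := hP.exists_walk ⟨u, hu⟩ ⟨v, hv⟩
  obtain ⟨x, hx⟩ := P.exists_isLeast_walkLength w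
  refine ⟨x, ?_, ?_⟩
  · rw [← walks_eq_range (ε := ε) h] at hx
    exact hx
  · have := hP ⟨u, hu⟩ ⟨v, hv⟩
    rw [P.graphDist_eq_of_isLeast hx, ENNReal.ofReal_le_ofReal_iff (by positivity)] at this
    rwa [points_eq' hu, points_eq' hv]

theorem graphDist_le (h : P.IsEdgeList es) {u v : Fin P.numVertices} {x y : ℝ}
    (hx : IsLeast (Walks es.length (points P) (buildInput P es ε).nmem u v) x) (hxy : x ≤ y) :
    P.graphDist u v ≤ ENNReal.ofReal y := by
  rw [walks_eq_range h] at hx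
  rw [P.graphDist_eq_of_isLeast hx]
  exact ENNReal.ofReal_le_ofReal hxy

/-- The squared distance is `(a ^ 2 + b ^ 2) * r ^ 2`, at most `2 * r ^ 2`. Only this disc around
the centre is used afterwards, so the orientation of the square plays no role. -/
theorem dist_centre_le (s : PlaneSquare) {x : E2} (hx : x ∈ s.region) :
    dist x s.centre ≤ 3 / 2 * s.r := by
  obtain ⟨a, b, ha, hb, h0, h1⟩ := hx
  have hr : s.r ^ 2 = s.half 0 ^ 2 + s.half 1 ^ 2 := by
    rw [PlaneSquare.r, EuclideanSpace.norm_sq_eq, Fin.sum_univ_two, Real.norm_eq_abs, Real.norm_eq_abs,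
      sq_abs, sq_abs]
  have hr0 : 0 ≤ s.r := norm_nonneg _
  have ha2 : a ^ 2 ≤ 1 := by rw [← sq_abs]; nlinarith [abs_nonneg a]
  have hb2 : b ^ 2 ≤ 1 := by rw [← sq_abs]; nlinarith [abs_nonneg b]
  rw [← sqrt_eq_dist]
  refine Real.sqrt_le_iff.2 ⟨by positivity, ?_⟩
  have e0 : x 0 - s.centre 0 = a * s.half 0 - b * s.half 1 := by rw [h0]; ring
  have e1 : x 1 - s.centre 1 = a * s.half 1 + b * s.half 0 := by rw [h1]; ring
  rw [e0, e1]
  have : (a * s.half 0 - b * s.half 1) * (a * s.half 0 - b * s.half 1) +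
      (a * s.half 1 + b * s.half 0) * (a * s.half 1 + b * s.half 0) = (a ^ 2 + b ^ 2) * s.r ^ 2 := by
    rw [hr]; ring
  rw [this]
  nlinarith [sq_nonneg s.r]

theorem sqrt_half (s : PlaneSquare) :
    Real.sqrt (s.half 0 * s.half 0 + s.half 1 * s.half 1) = s.r := by
  have := sqrt_eq_dist s.half 0
  simpa [PlaneSquare.r] using this

/-! ### The resources -/

/-- Both the logarithm of `n` to base 2 and 1 are at most `log (n + 1) / log 2`, and `2 / log 2 <
4`. Using `n + 1` keeps the bound positive for `n = 1`. -/
theorem log_two_add_one_le {n : ℕ} (hn : 1 ≤ n) : (Nat.log 2 n + 1 : ℝ) ≤ 4 * Real.log (n + 1) := by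
  have h2 := Real.log_two_gt_d9
  have hn' : (1 : ℝ) ≤ n := by exact_mod_cast hn
  have h1 : Real.log 2 ≤ Real.log (n + 1) := Real.log_le_log (by norm_num) (by linarith)
  have h3 : (Nat.log 2 n : ℝ) * Real.log 2 ≤ Real.log (n + 1) := by
    rw [← Real.log_pow]
    refine Real.log_le_log (by positivity) ?_
    have : ((2 ^ Nat.log 2 n : ℕ) : ℝ) ≤ n := by exact_mod_cast Nat.pow_log_le_self 2 (by omega)
    push_cast at this
    linarith
  have h4 : (0 : ℝ) ≤ Nat.log 2 n := Nat.cast_nonneg _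
  nlinarith

/-- The number of cells of a column that the programs use. -/
def columnSize (n : ℕ) : ℕ := 10 ^ 4 * (n * (Nat.log 2 n + 1))

theorem columnSize_le_memorySize {n K : ℕ} (hn : 1 ≤ n) (hK : 10 ^ 13 ≤ K) :
    32 * (n + columnSize n) ≤ memorySize K n := by
  refine Nat.le_floor ?_
  have h1 := log_two_add_one_le hn
  have hn' : (1 : ℝ) ≤ n := by exact_mod_cast hn
  have hK' : (10 ^ 13 : ℝ) ≤ K := by exact_mod_cast hK
  have hm : (0 : ℝ) ≤ Nat.log 2 n := Nat.cast_nonneg _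
  have hlog : 0 ≤ Real.log (n + 1) := Real.log_nonneg (by linarith)
  have h2 : (n : ℝ) * (Nat.log 2 n + 1) ≤ n * (4 * Real.log (n + 1)) := by gcongr
  have h3 : (10 ^ 13 : ℝ) * (n * Real.log (n + 1)) ≤ K * (n * Real.log (n + 1)) := by gcongr
  have h4 : (n : ℝ) ≤ n * (Nat.log 2 n + 1) := by nlinarith
  have h5 : 0 ≤ n * Real.log (n + 1) := by positivity
  unfold columnSize
  push_cast
  nlinarith

/-- The two largest tables in a column are that of the jumps, with `l + 1` rows, and the wavelet
table with its `l + 1` levels; `l` exceeds the logarithm of `n` by at most 1. -/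
theorem columnSize_gt {n N l : ℕ} (hn : 1 ≤ n) (hN : N ≤ n) (hl : 2 ^ l ≤ 2 * N) :
    (l + 1) * N + l < columnSize n ∧ 2 * ((l + 2) * 2 ^ l) + N < columnSize n ∧
      l + 1 ≤ 2 * (Nat.log 2 n + 1) := by
  set m := Nat.log 2 n with hm
  have hlm : l ≤ m + 1 := by
    rcases Nat.eq_zero_or_pos l with rfl | h
    · omega
    · obtain ⟨l, rfl⟩ : ∃ j, l = j + 1 := ⟨l - 1, by omega⟩
      rw [pow_succ] at hl
      have := (Nat.le_log_iff_pow_le (b := 2) (by omega) (show n ≠ 0 by omega)).2 (show 2 ^ l ≤ n by omega)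
      omega
  have h1 : (l + 1) * N ≤ (m + 2) * n := Nat.mul_le_mul (by omega) hN
  have h2 : (l + 2) * 2 ^ l ≤ (m + 3) * (2 * n) := Nat.mul_le_mul (by omega) (by omega)
  have h3 : m ≤ n * m := Nat.le_mul_of_pos_left _ hn
  have e1 : (m + 2) * n = n * m + 2 * n := by ring
  have e2 : (m + 3) * (2 * n) = 2 * (n * m) + 6 * n := by ring
  have e3 : columnSize n = 10 ^ 4 * (n * m + n) := by rw [columnSize, ← hm]; ring
  rw [e1] at h1
  rw [e2] at h2
  rw [e3]
  omega

/-- The memory has at most `K * n ^ 2` cells, since the logarithm is at most `n`, and `(n + 1) ^ K`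
is larger. Thus integers of O(log n) bits address the whole memory. -/
theorem machine {n K : ℕ} (hn : 1 ≤ n) (hK : 10 ^ 13 ≤ K) :
    Machine (memorySize K n) (wordBound K n) := by
  have key : K * n ^ 2 ≤ wordBound K n := by
    obtain ⟨j, rfl⟩ : ∃ j, K = j + 3 := ⟨K - 3, by omega⟩
    have h1 : j + 1 ≤ (n + 1) ^ j := Nat.lt_pow_self (by omega)
    have h2 : 2 * n ^ 2 ≤ (n + 1) ^ 3 := by
      have : (n + 1) ^ 3 = 2 * n ^ 2 + (n ^ 3 + n ^ 2 + 3 * n + 1) := by ring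
      omega
    calc (j + 3) * n ^ 2 ≤ ((j + 1) * 2) * n ^ 2 := Nat.mul_le_mul_right _ (by omega)
      _ = (j + 1) * (2 * n ^ 2) := by ring
      _ ≤ (n + 1) ^ j * (n + 1) ^ 3 := Nat.mul_le_mul h1 h2
      _ = wordBound (j + 3) n := by rw [wordBound, pow_add]
  refine ⟨le_trans ?_ key, ?_⟩
  · refine Nat.floor_le_of_le ?_
    have h1 : Real.log (n + 1) ≤ n := by
      have := Real.log_le_sub_one_of_pos (show (0 : ℝ) < n + 1 by positivity)
      linarith
    push_cast
    calc (K : ℝ) * n * Real.log (n + 1) ≤ K * n * n := by gcongr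
      _ = K * n ^ 2 := by ring
  · have : K * 1 ≤ K * n ^ 2 := Nat.mul_le_mul_left _ (Nat.one_le_pow _ _ hn)
    omega

/-! ### The data structure -/

/-- The state `σ` holds the data structure. -/
def Holds (P : GeometricGraph) (es : List (Fin P.numVertices × Fin P.numVertices)) (t ε : ℝ)
    (σ : State) : Prop :=
  ∃ l q lam par perm xrk xinv yrk yinv xs ys,
    Index P.numVertices l q lam par perm xrk xinv yrk yinv xs ys ∧
    Stored P.numVertices (P.numVertices + es.length) l q lam par perm (fun y => xrk (yinv y)) xinv xs ys σ ∧
    2 ^ l ≤ 2 * P.numVertices ∧ σ.rreg 4 = ε ∧ 1 ≤ σ.rreg 5 ∧ σ.rreg 5 ≤ t ∧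
    (∀ u < P.numVertices, ∀ v < P.numVertices,
      ∃ x, IsLeast (Walks es.length (points P) (buildInput P es ε).nmem u v) x ∧
        x ≤ σ.rreg 5 * dist (points P u) (points P v)) ∧
    (∀ j < P.numVertices, q j = points P (perm j)) ∧ ∀ v < P.numVertices, ∃ j < P.numVertices, perm j = v

variable {P : GeometricGraph} {es : List (Fin P.numVertices × Fin P.numVertices)} {t ε : ℝ} {σ : State}

theorem Holds.queryInput (h : Holds P es t ε σ) (s : PlaneSquare) : Holds P es t ε (queryInput σ s) := by
  obtain ⟨l, q, lam, par, perm, xrk, xinv, yrk, yinv, xs, ys, hI, hS, h1⟩ := h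
  exact ⟨l, q, lam, par, perm, xrk, xinv, yrk, yinv, xs, ys, hI,
    ⟨hS.n0, hS.n2, hS.n3, hS.n4, hS.perm_eq, hS.jump, hS.nbrs, hS.xinv_eq, hS.xs_eq, hS.ys_eq, hS.table,
      hS.lam_eq⟩, h1⟩

/-- The query program changes none of the stored columns and registers, in particular not `ε` and
the spanning ratio in the real registers 4 and 5. -/
theorem Holds.frame {σ' : State} (h : Holds P es t ε σ) (hf : Frame answerQuery σ σ') :
    Holds P es t ε σ' := by
  obtain ⟨l, q, lam, par, perm, xrk, xinv, yrk, yinv, xs, ys, hI, hS, h1⟩ := h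
  refine ⟨l, q, lam, par, perm, xrk, xinv, yrk, yinv, xs, ys, hI,
    hS.frame hf ⟨⟨rfl, rfl, rfl, rfl⟩, ⟨rfl, rfl, rfl, rfl, rfl, rfl⟩, rfl, rfl, rfl⟩, ?_⟩
  rwa [hf.rreg 4 rfl, hf.rreg 5 rfl]

section

variable {K : ℕ}

theorem exists_preprocess (hK : 10 ^ 13 ≤ K) (hN : 0 < P.numVertices) (hes : P.IsEdgeList es)
    (ht : 1 ≤ t) (hP : P.IsSpanner t) :
    ∃ σ k, Exec (memorySize K P.complexity) (wordBound K P.complexity) preprocess (buildInput P es ε) σ k ∧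
      Holds P es t ε σ ∧ (k : ℝ) ≤ K * (P.complexity : ℝ) ^ 2 * Real.log (P.complexity + 1) := by
  have hn : P.complexity = P.numVertices + es.length := by rw [GeometricGraph.complexity, hes.length_eq]
  have hn1 : 1 ≤ P.complexity := by omega
  have := machine hn1 hK
  have hcol : 10 ^ 4 * P.complexity ≤ columnSize P.complexity :=
    Nat.mul_le_mul_left _ (Nat.le_mul_of_pos_right _ (by omega))
  refine wp_preprocess P.numVertices es.length (columnSize P.complexity) (points P)
    (buildInput P es ε).nmem ε t hN rfl rfl rfl (fun _ _ => rfl) (fun a ha => nmem_buildInput_of_le ha)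
    (fun a ha => arc_lt ha) (fun v hv => rmem_buildInput hv) (fun u hu v hv huv => ?_) ht
    (fun u hu v hv => exists_isLeast_walks hes (by linarith) hP hu hv) (by omega) (by omega)
    (fun l hl => ?_) (by rw [← hn]; exact columnSize_le_memorySize hn1 hK) ?_
  · rw [points_eq' hu, points_eq' hv] at huv
    exact congrArg Fin.val (P.pos_injective huv)
  · have := columnSize_gt hn1 (by omega) hl
    exact ⟨this.1, this.2.1⟩
  · intro σ' k l q lam par perm xrk xinv yrk yinv xs ys hI hS hl h4 h5 h5' hW hq hperm hk
    refine ⟨⟨l, q, lam, par, perm, xrk, xinv, yrk, yinv, xs, ys, hI, hS, hl, h4, h5, h5', hW, hq, hperm⟩, ?_⟩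
    have h1 := log_two_add_one_le hn1
    have h2 := (columnSize_gt hn1 (by omega) hl).2.2
    have h3 : k ≤ 10 ^ 4 * (2 * (Nat.log 2 P.complexity + 1)) * (P.complexity * P.complexity) := by
      rw [← hn] at hk
      exact hk.trans (Nat.mul_le_mul_right _ (Nat.mul_le_mul_left _ h2))
    have h4 : (k : ℝ) ≤ 10 ^ 4 * (2 * (Nat.log 2 P.complexity + 1)) * (P.complexity * P.complexity) := by
      exact_mod_cast h3
    have hK' : (10 ^ 13 : ℝ) ≤ K := by exact_mod_cast hK
    have hlog : 0 ≤ Real.log (P.complexity + 1) := Real.log_nonneg (by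
      have : (0 : ℝ) ≤ P.complexity := Nat.cast_nonneg _
      linarith)
    calc (k : ℝ) ≤ 10 ^ 4 * (2 * (4 * Real.log (P.complexity + 1))) * (P.complexity * P.complexity) :=
          h4.trans (by gcongr)
      _ = 8 * 10 ^ 4 * (P.complexity : ℝ) ^ 2 * Real.log (P.complexity + 1) := by ring
      _ ≤ K * (P.complexity : ℝ) ^ 2 * Real.log (P.complexity + 1) := by
          gcongr
          linarith

/-- Translation from positions in the farthest-first order to vertices, and from Euclidean to graph
distances: multiplication by the computed ratio `τ` turns `ε * r / τ` into `ε * r`. As `τ ≤ t`, the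
bounds in terms of `τ / ε` imply those in terms of `t / ε`. -/
theorem exists_answerQuery (hK : 10 ^ 13 ≤ K) (hes : P.IsEdgeList es) (hε0 : 0 ≤ ε) (hε1 : ε ≤ 1)
    (h : Holds P es t ε σ) (s : PlaneSquare) :
    ∃ (σ' : State) (k : ℕ) (T : Finset (Fin P.numVertices)),
      Exec (memorySize K P.complexity) (wordBound K P.complexity) answerQuery (queryInput σ s) σ' k ∧
      Returns σ' T ∧
      (∀ v : Fin P.numVertices, P.pos v ∈ s.region →
        ∃ z ∈ T, P.graphDist v z ≤ ENNReal.ofReal (ε * s.r)) ∧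
      (0 < ε → (T.card : ℝ) ≤ K * (t / ε) ^ 2 ∧
        (k : ℝ) ≤ K * (Real.log (P.complexity + 1) + (t / ε) ^ 2)) := by
  classical
  obtain ⟨l, q, lam, par, perm, xrk, xinv, yrk, yinv, xs, ys, hI, hS, hl, h4, h5, h5', hW, hq, hperm⟩ :=
    h.queryInput s
  have hN := hI.pos
  have hn : P.complexity = P.numVertices + es.length := by rw [GeometricGraph.complexity, hes.length_eq]
  have hn1 : 1 ≤ P.complexity := by omega
  have := machine hn1 hK
  have hcol : 10 ^ 4 * P.complexity ≤ columnSize P.complexity :=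
    Nat.mul_le_mul_left _ (Nat.le_mul_of_pos_right _ (by omega))
  obtain ⟨hL1, hL3, hl'⟩ := columnSize_gt hn1 (by omega) hl
  have hr0 : 0 < s.r := norm_pos_iff.2 s.half_ne_zero
  set τ := (RealRAM.queryInput σ s).rreg 5 with hτ
  have hwp := wp_answerQuery (S := memorySize K P.complexity) (W := wordBound K P.complexity)
    (Q := fun σ' k => ∃ A : Finset ℕ, (∀ y ∈ A, y < P.numVertices) ∧
      (∀ a, a ∈ σ'.out ↔ ∃ y ∈ A, perm y = a) ∧
      (∀ v < P.numVertices, dist (q v) s.centre ≤ 3 / 2 * s.r → ∃ z ∈ A, dist (q v) (q z) ≤ ε * s.r / τ) ∧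
      (0 < ε → (A.card : ℝ) ≤ (1068 * (τ / ε) + 2) ^ 2 ∧
        (k : ℝ) ≤ 10 ^ 9 * (l + 1) + 10 ^ 13 * (τ / ε) ^ 2))
    hI hS hL1 (by omega) hL3 (by rw [← hn]; exact columnSize_le_memorySize hn1 hK) s.centre s.r ε τ hr0
    hε0 hε1 h5 (sqrt_half s) rfl rfl h4 rfl rfl (fun _ _ A _ h1 h2 h3 h4 => ⟨A, h1, h2, h3, h4⟩)
  obtain ⟨σ', k, hex, A, hA, hout, hcov, hcost⟩ := hwp
  refine ⟨σ', k, Finset.univ.filter fun z : Fin P.numVertices => ∃ y ∈ A, perm y = z, hex,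
    fun a => ?_, fun v hv => ?_, fun hε => ?_⟩
  · rw [hout]
    constructor
    · rintro ⟨y, hy, rfl⟩
      exact ⟨⟨perm y, hI.perm_lt y (hA y hy)⟩, by simpa using ⟨y, hy, rfl⟩, rfl⟩
    · rintro ⟨z, hz, rfl⟩
      simpa using hz
  · obtain ⟨j, hj, hjv⟩ := hperm v v.2
    have hqj : q j = P.pos v := by rw [hq j hj, hjv, points_eq]
    obtain ⟨z, hz, hd⟩ := hcov j hj (by rw [hqj]; exact dist_centre_le s hv)
    have hzN := hA z hz
    refine ⟨⟨perm z, hI.perm_lt z hzN⟩, by simpa using ⟨z, hz, rfl⟩, ?_⟩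
    obtain ⟨x, hx, hxd⟩ := hW v v.2 (perm z) (hI.perm_lt z hzN)
    refine graphDist_le hes hx (hxd.trans ?_)
    have hτ0 : 0 < τ := by linarith
    rw [← hjv, ← hq j hj, ← hq z hzN]
    calc τ * dist (q j) (q z) ≤ τ * (ε * s.r / τ) := by gcongr
      _ = ε * s.r := by field_simp
  · obtain ⟨c1, c2⟩ := hcost hε
    have hK' : (10 ^ 13 : ℝ) ≤ K := by exact_mod_cast hK
    have hρ : 1 ≤ τ / ε := by rw [le_div_iff₀ hε]; linarith
    have hρt : τ / ε ≤ t / ε := by gcongr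
    have hsq : (τ / ε) ^ 2 ≤ (t / ε) ^ 2 := by gcongr
    have hK2 : (10 ^ 13 : ℝ) * (t / ε) ^ 2 ≤ K * (t / ε) ^ 2 := by gcongr
    constructor
    -- The returned vertices are the images of `A` under `perm`, so there are at most as many.
    · have hcard : (Finset.univ.filter fun z : Fin P.numVertices => ∃ y ∈ A, perm y = z).card ≤ A.card := by
        rw [← Finset.card_map Fin.valEmbedding]
        refine (Finset.card_le_card fun a ha => ?_).trans (Finset.card_image_le (s := A) (f := perm))
        simp only [Finset.mem_map, Finset.mem_filter, Finset.mem_univ, true_and, Fin.valEmbedding_apply] at ha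
        obtain ⟨z, ⟨y, hy, hyz⟩, rfl⟩ := ha
        exact Finset.mem_image.2 ⟨y, hy, hyz⟩
      refine (Nat.cast_le.2 hcard).trans (c1.trans ?_)
      have : (1068 * (τ / ε) + 2) ^ 2 ≤ (1070 * (τ / ε)) ^ 2 := by gcongr; linarith
      nlinarith [sq_nonneg (t / ε)]
    · have h1 := log_two_add_one_le hn1
      have h2 : (l + 1 : ℝ) ≤ 2 * (Nat.log 2 P.complexity + 1) := by exact_mod_cast hl'
      have hlog : 0 ≤ Real.log (P.complexity + 1) := Real.log_nonneg (by
        have : (0 : ℝ) ≤ P.complexity := Nat.cast_nonneg _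
        linarith)
      have hK3 : (10 ^ 13 : ℝ) * Real.log (P.complexity + 1) ≤ K * Real.log (P.complexity + 1) := by gcongr
      linarith

/-- Since the machine is deterministic, any state after the preprocessing is the one constructed in
`exists_preprocess`; queries preserve the invariant by their frame. -/
theorem Reachable.holds (hK : 10 ^ 13 ≤ K) (hN : 0 < P.numVertices) (hes : P.IsEdgeList es)
    (ht : 1 ≤ t) (hP : P.IsSpanner t)
    (h : Reachable (memorySize K P.complexity) (wordBound K P.complexity) preprocess answerQuery
      (buildInput P es ε) σ) : Holds P es t ε σ := by
  induction h with
  | built h =>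
    obtain ⟨σ', k, hex, hh, -⟩ := exists_preprocess (ε := ε) hK hN hes ht hP
    rwa [(h.unique hex).1]
  | queried q _ h ih => exact (ih.queryInput q).frame h.frame

end

end RealRAM

theorem mainTheorem6 :
    ∃ (build query : RealRAM.Cmd) (K : ℕ),
      ∀ (P : GeometricGraph) (es : List (Fin P.numVertices × Fin P.numVertices)) (t ε : ℝ),
        0 < P.numVertices → P.IsEdgeList es → 1 ≤ t → P.IsSpanner t → 0 ≤ ε → ε ≤ 1 →
        (∃ (σ : RealRAM.State) (k : ℕ),
          RealRAM.Exec (RealRAM.memorySize K P.complexity) (RealRAM.wordBound K P.complexity)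
            build (RealRAM.buildInput P es ε) σ k ∧
          (k : ℝ) ≤ K * (P.complexity : ℝ) ^ 2 * Real.log (P.complexity + 1)) ∧
        ∀ σ : RealRAM.State,
          RealRAM.Reachable (RealRAM.memorySize K P.complexity)
            (RealRAM.wordBound K P.complexity) build query (RealRAM.buildInput P es ε) σ →
          ∀ q : PlaneSquare,
            ∃ (σ' : RealRAM.State) (k : ℕ) (T : Finset (Fin P.numVertices)),
              RealRAM.Exec (RealRAM.memorySize K P.complexity)
                (RealRAM.wordBound K P.complexity) query (RealRAM.queryInput σ q) σ' k ∧
              RealRAM.Returns σ' T ∧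
              (∀ v : Fin P.numVertices, P.pos v ∈ q.region →
                ∃ z ∈ T, P.graphDist v z ≤ ENNReal.ofReal (ε * q.r)) ∧
              (0 < ε →
                (T.card : ℝ) ≤ K * (t / ε) ^ 2 ∧
                (k : ℝ) ≤ K * (Real.log (P.complexity + 1) + (t / ε) ^ 2)) := by
  -- The constant 10 ^ 13 comes from the time bound of a query. It is hidden behind an inequality,
  -- so that powers with exponent `K` are never evaluated.
  obtain ⟨K, hK⟩ : ∃ K : ℕ, 10 ^ 13 ≤ K := ⟨_, le_rfl⟩
  refine ⟨RealRAM.preprocess, RealRAM.answerQuery, K, fun P es t ε hN hes ht hP hε0 hε1 => ⟨?_, fun σ hσ q => ?_⟩⟩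
  · obtain ⟨σ, k, hex, -, hk⟩ := RealRAM.exists_preprocess (ε := ε) hK hN hes ht hP
    exact ⟨σ, k, hex, hk⟩
  · exact RealRAM.exists_answerQuery hK hes hε0 hε1 (hσ.holds hK hN hes ht hP) q
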